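/- **Setting.** For $L,\epsilon>0$ let $\Omega=(0,L)\times(0,\infty)$, $Y=\sqrt\epsilon\,y$, $\Delta_\epsilon=\partial_{yy}+\epsilon\partial_{xx}$. Let $c_0>0$, $M\in\mathbb R$, and let $\chi$ be a fixed smooth cut-off with $\chi=1$ on $(-\infty,1]$, $\chi=0$ on $[2,\infty)$. A function $h$ has *weighted bound $M$ from order $m_0$* if $(1+y)^k|\partial_x^i\partial_y^jh|\le M$ on $\overline\Omega$ for $m_0\le i+j\le3$, $k\le 3$. *Approximate solution.* The following layers are smooth on $\overline\Omega$. (i) $[u_e^0,v_e^0,P_e^0](x,Y)$ solves the stationary Euler equations in $\Omega$ with $v_e^0|_{Y=0}=v_e^0|_{Y\to\infty}=0$ and $c_0\le u_e^0\le M$; $v^0_e$ has weighted bound $M$ from order $0$ and $u_e^0$ from order $1$. The flow need not be a shear flow. (ii) $[u_p^0,v_p^0](x,y)$ has weighted bound $M$ from order $0$, is divergence free, and satisfies, with $u^0:=u_e^0(x,0)+u_p^0$ and $v^0:=y\,v^0_{eY}(x,0)+v_p^0+v_e^1(x,0)$, the Prandtl system $u^0u^0_{px}+u^0_{ex}(x,0)u_p^0+v^0u^0_{py}-u^0_{pyy}=0$,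 $u^0|_{y=0}=u_b$ (a constant), $v_p^0|_{y=0}=-v_e^1(x,0)$, and $u^0(0,y)\ge c_0$. (iii) $[u_e^1,v_e^1,P_e^1](x,Y)$ solves the Euler equations linearized at $[u_e^0,v_e^0]$, and $u_e^1,v_e^1$ have weighted bound $M$ from order $0$. (iv) $[u_p,v_p](x,y)$ is divergence free, $u_p$ has weighted bound $M$ from order $0$, and $u^0u_{px}+u^0_xu_p+v^0u_{py}+u^0_yv_p-u_{pyy}+F=0$, $u_p|_{y=0}=-u_e^1(x,0)$, $v_p|_{y=0}=0$, where $$F=v_p^0\{u^0_{eY}+\sqrt\epsilon u^1_{eY}\}+\tfrac1{\sqrt\epsilon}\big[\tfrac{v_e^0}{\sqrt\epsilon}-yv^0_{eY}(x,0)\big]u^0_{py}+yv^1_{eY}(x,0)u^0_{py}+\tfrac1{\sqrt\epsilon}\big[\{u_e^0-u_e^0(x,0)\}u^0_{px}+\{u^0_{ex}-u^0_{ex}(x,0)\}u^0_p\big]+u_p^0u^1_{ex}+u_e^1u^0_{px}.$$ Here Euler layers without explicit argument are evaluated at $(x,\sqrt\epsilon y)$. Put $u_p^1=\chi(\sqrt\epsilon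 y)u_p+\sqrt\epsilon\chi'(\sqrt\epsilon y)\int_0^yu_p$, $v_p^1=\chi(\sqrt\epsilon y)v_p$, and $$u_s=u_e^0+u_p^0+\sqrt\epsilon u_e^1+\sqrt\epsilon u_p^1,\qquad v_s=\tfrac{v_e^0}{\sqrt\epsilon}+v_p^0+v_e^1+\sqrt\epsilon v_p^1 .$$ *Linearized system.* Let $f,g\in L^2(\Omega)$, $a_L\in L^2(0,\infty)$, and let $b_L\in C^1(0,\infty)$ with $b_L,b_L'\in L^2(0,\infty)$. Consider $$-\Delta_\epsilon u+u_su_x+u_{sx}u+v_su_y+u_{sy}v+P_x=f,\quad -\Delta_\epsilon v+u_sv_x+v_{sx}u+v_sv_y+v_{sy}v+\tfrac{P_y}\epsilon=g,\quad u_x+v_y=0,$$ $$[u,v]|_{x=0}=[u,v]|_{y=0}=[u,v]|_{y\to\infty}=0,\qquad P-2\epsilon u_x|_{x=L}=a_L,\qquad u_y+\epsilon v_x|_{x=L}=b_L .$$ The space $\mathcal X$ consists of the $[u,v]$ in the closure, in the norm $\|u_y,\sqrt\epsilon v_y,\epsilon v_x\|_{L^2}$, of the smooth divergence free fields supported away from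 $x=0$ and compactly in $y\in(0,\infty)$, for which $\{u_y,u_x,u_{yy},u_{xy},u_{xx}\}y$, $v_y$, $v_x$ are in $L^2(\Omega)$, $u,v\in L^\infty$, and $\{u_y,u_x\}y$, $u_x$ are in $L^2(x=L)$. A solution $[u,v,P]\in\mathcal X$ is a strong solution: the equations hold a.e. with weak derivatives, the conditions at $x=L$ hold in the sense of traces, $[u,v]$ is $H^2$ and $P$ is $H^1$ on bounded parts of $\Omega$ away from the corners $(0,0)$, $(L,0)$, and $[u,v]$ is $H^{3/2}$ and $P$ is $H^{1/2}$ on bounded parts of $\Omega$. **Proposition (Positivity Estimate).** There are $L_0,\epsilon_0,C,K>0$, depending only on $c_0$, $M$ and $\chi$, such that the following holds for all $0<L<L_0$, $0<\epsilon<\epsilon_0$, all layers as above, all $\delta$ with $|v_e^0(x,Y)|\le\delta Y$ on $\Omega$ (in particular $\delta=\|v_e^0/Y\|_{L^\infty}$), and all data $f,g,a_L,b_L$ as above. Every solution $[u,v,P]\in\mathcal X$ of the linearized system satisfies, with $\beta=v/u_s$ (which has weak derivatives $\beta_x,\beta_y\in L^2(\Omega)$), $$\|\beta_y,\sqrt\epsilon\beta_x\|_{L^2}^2+\int_{x=L}\frac{\epsilon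 v_y^2}{u_s}\le C\Big(\|u_y\|_{L^2}^2+\delta\,\|u_y y,\sqrt\epsilon v_y y\|_{L^2}^2+\big\|b_L,\partial_yb_L,\tfrac{a_L}{\sqrt\epsilon}\big\|_{L^2(x=L)}^2\Big)+K\,\mathcal R_2,$$ where $\mathcal R_2=-\int_\Omega f\beta_y+\int_\Omega\epsilon g\beta_x$. The same right-hand side also bounds $\|v_y,\sqrt\epsilon v_x\|_{L^2}^2$. -/

import Mathlib

open MeasureTheory Set Filter Topology
open scoped ContDiff ENNReal

noncomputable section

namespace BoundaryLayer

/-! ### Domain and classical partial derivatives -/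

/-- The open domain `Ω = (0, L) × (0, ∞)`. -/
def Om (L : ℝ) : Set (ℝ × ℝ) := Ioo 0 L ×ˢ Ioi 0

/-- Its closure `[0, L] × [0, ∞)`. -/
def OmBar (L : ℝ) : Set (ℝ × ℝ) := Icc 0 L ×ˢ Ici 0

/-- Partial derivative in `x`, one-sided at `x = 0` and `x = L`. -/
def dX (L : ℝ) (h : ℝ × ℝ → ℝ) (p : ℝ × ℝ) : ℝ :=
  derivWithin (fun s => h (s, p.2)) (Icc 0 L) p.1

/-- Partial derivative in the second variable, one-sided at `0`. -/
def dY (h : ℝ × ℝ → ℝ) (p : ℝ × ℝ) : ℝ :=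
  derivWithin (fun t => h (p.1, t)) (Ici 0) p.2

/-- `h` is smooth up to the boundary. -/
def Smooth (L : ℝ) (h : ℝ × ℝ → ℝ) : Prop := ContDiffOn ℝ ∞ h (OmBar L)

/-- All partial derivatives of `h` of order `m₀ ≤ |α| ≤ 3`, weighted by `(1 + y) ^ k` with `k ≤ 3`,
are bounded by `M`. -/
def WeightedBound (L M : ℝ) (m₀ : ℕ) (h : ℝ × ℝ → ℝ) : Prop :=
  ∀ i j k : ℕ, m₀ ≤ i + j → i + j ≤ 3 → k ≤ 3 → ∀ p ∈ OmBar L,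
    (1 + p.2) ^ k * |((dX L)^[i] (dY^[j] h)) p| ≤ M

/-! ### The layers of the approximate solution

Euler layers are functions of `(x, Y)`, Prandtl layers are functions of `(x, y)`, and
`Y = √ε y`. -/

/-- The layers: the leading Euler flow `[ue0, ve0, Pe0]`, the leading Prandtl layer `[up0, vp0]`,
the first Euler corrector `[ue1, ve1, Pe1]`, and the first Prandtl corrector `[up1, vp1]` before it
is cut off. -/
structure Layers where
  ue0 : ℝ × ℝ → ℝ
  ve0 : ℝ × ℝ → ℝ
  Pe0 : ℝ × ℝ → ℝ
  up0 : ℝ × ℝ → ℝ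
  vp0 : ℝ × ℝ → ℝ
  ue1 : ℝ × ℝ → ℝ
  ve1 : ℝ × ℝ → ℝ
  Pe1 : ℝ × ℝ → ℝ
  up1 : ℝ × ℝ → ℝ
  vp1 : ℝ × ℝ → ℝ

/-- `[ue0, ve0, Pe0]` is a (possibly non-shear) Euler flow without penetration at `Y = 0, ∞`, with
`c₀ ≤ ue0 ≤ M` and with weighted derivatives bounded by `M`. -/
structure IsEulerFlow (L c₀ M : ℝ) (A : Layers) : Prop where
  smooth_u : Smooth L A.ue0
  smooth_v : Smooth L A.ve0
  smooth_P : Smooth L A.Pe0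
  momentum_x : ∀ p ∈ Om L,
    A.ue0 p * dX L A.ue0 p + A.ve0 p * dY A.ue0 p + dX L A.Pe0 p = 0
  momentum_y : ∀ p ∈ Om L,
    A.ue0 p * dX L A.ve0 p + A.ve0 p * dY A.ve0 p + dY A.Pe0 p = 0
  divFree : ∀ p ∈ Om L, dX L A.ue0 p + dY A.ve0 p = 0
  wall : ∀ x ∈ Icc 0 L, A.ve0 (x, 0) = 0
  infinity : ∀ x ∈ Icc 0 L, Tendsto (fun Y => A.ve0 (x, Y)) atTop (𝓝 0)
  lower : ∀ p ∈ OmBar L, c₀ ≤ A.ue0 p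
  upper : ∀ p ∈ OmBar L, A.ue0 p ≤ M
  bound_v : WeightedBound L M 0 A.ve0
  bound_u : WeightedBound L M 1 A.ue0

/-- `[up0, vp0]` is a smooth, decaying solution of the leading order Prandtl system with wall
velocity `ub`. The pressure of the layer does not depend on `y` and hence vanishes. The tangential
velocity of the inflow is bounded below by `c₀`. -/
structure IsPrandtlLayer (L ub c₀ M : ℝ) (A : Layers) : Prop where
  smooth_u : Smooth L A.up0
  smooth_v : Smooth L A.vp0
  momentum : ∀ p ∈ Om L,
    (A.ue0 (p.1, 0) + A.up0 p) * dX L A.up0 p + dX L A.ue0 (p.1, 0) * A.up0 p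
      + (p.2 * dY A.ve0 (p.1, 0) + A.vp0 p + A.ve1 (p.1, 0)) * dY A.up0 p
      - dY (dY A.up0) p = 0
  divFree : ∀ p ∈ Om L, dX L A.up0 p + dY A.vp0 p = 0
  wall_u : ∀ x ∈ Icc 0 L, A.ue0 (x, 0) + A.up0 (x, 0) = ub
  wall_v : ∀ x ∈ Icc 0 L, A.vp0 (x, 0) = - A.ve1 (x, 0)
  inflow : ∀ y, 0 ≤ y → c₀ ≤ A.ue0 (0, 0) + A.up0 (0, y)
  bound_u : WeightedBound L M 0 A.up0
  bound_v : WeightedBound L M 0 A.vp0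

/-- `[ue1, ve1, Pe1]` is a smooth, decaying solution of the Euler equations linearized at
`[ue0, ve0]`. (It is matched to the Prandtl layer through `IsPrandtlLayer.wall_v`; its values at
`x = 0` and `x = L` are prescribed data and therefore arbitrary here.) -/
structure IsEulerCorrector (L M : ℝ) (A : Layers) : Prop where
  smooth_u : Smooth L A.ue1
  smooth_v : Smooth L A.ve1
  smooth_P : Smooth L A.Pe1
  momentum_x : ∀ p ∈ Om L,
    A.ue0 p * dX L A.ue1 p + dX L A.ue0 p * A.ue1 p + A.ve0 p * dY A.ue1 p
      + A.ve1 p * dY A.ue0 p + dX L A.Pe1 p = 0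
  momentum_y : ∀ p ∈ Om L,
    A.ue0 p * dX L A.ve1 p + A.ue1 p * dX L A.ve0 p + A.ve0 p * dY A.ve1 p
      + dY A.ve0 p * A.ve1 p + dY A.Pe1 p = 0
  divFree : ∀ p ∈ Om L, dX L A.ue1 p + dY A.ve1 p = 0
  bound_u : WeightedBound L M 0 A.ue1
  bound_v : WeightedBound L M 0 A.ve1

/-- The terms of order `√ε` which the leading layers leave in the tangential momentum equation and
which the first Prandtl corrector has to cancel. -/
def Layers.source (A : Layers) (L ε : ℝ) (p : ℝ × ℝ) : ℝ :=
  let x := p.1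
  let y := p.2
  let q : ℝ × ℝ := (x, √ε * y)
  A.vp0 p * (dY A.ue0 q + √ε * dY A.ue1 q)
    + 1 / √ε * (A.ve0 q / √ε - y * dY A.ve0 (x, 0)) * dY A.up0 p
    + y * dY A.ve1 (x, 0) * dY A.up0 p
    + 1 / √ε * ((A.ue0 q - A.ue0 (x, 0)) * dX L A.up0 p
        + (dX L A.ue0 q - dX L A.ue0 (x, 0)) * A.up0 p)
    + A.up0 p * dX L A.ue1 q + A.ue1 q * dX L A.up0 p

/-- `[up1, vp1]` is a smooth solution, with decaying `up1`, of the Prandtl equations linearized at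
the leading order layer, with source `-A.source`; the layer pressure again vanishes. -/
structure IsPrandtlCorrector (L ε M : ℝ) (A : Layers) : Prop where
  smooth_u : Smooth L A.up1
  smooth_v : Smooth L A.vp1
  momentum : ∀ p ∈ Om L,
    (A.ue0 (p.1, 0) + A.up0 p) * dX L A.up1 p
      + (dX L A.ue0 (p.1, 0) + dX L A.up0 p) * A.up1 p
      + (p.2 * dY A.ve0 (p.1, 0) + A.vp0 p + A.ve1 (p.1, 0)) * dY A.up1 p
      + dY A.up0 p * A.vp1 p - dY (dY A.up1) p + A.source L ε p = 0
  divFree : ∀ p ∈ Om L, dX L A.up1 p + dY A.vp1 p = 0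
  wall_u : ∀ x ∈ Icc 0 L, A.up1 (x, 0) = - A.ue1 (x, 0)
  wall_v : ∀ x ∈ Icc 0 L, A.vp1 (x, 0) = 0
  bound_u : WeightedBound L M 0 A.up1

/-- `A` is a family of layers with viscosity `ε`, wall velocity `ub`, lower bound `c₀` and
bound `M`. -/
structure IsLayers (L ε ub c₀ M : ℝ) (A : Layers) : Prop where
  euler : IsEulerFlow L c₀ M A
  prandtl : IsPrandtlLayer L ub c₀ M A
  eulerCorrector : IsEulerCorrector L M A
  prandtlCorrector : IsPrandtlCorrector L ε M A

/-- A smooth cut-off function on `[0, ∞)`. -/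
def IsCutoff (χ : ℝ → ℝ) : Prop :=
  ContDiff ℝ ∞ χ ∧ (∀ t, t ≤ 1 → χ t = 1) ∧ (∀ t, 2 ≤ t → χ t = 0)

/-- The first Prandtl corrector, cut off at `y ~ 1 / √ε` so that it stays divergence free. -/
def Layers.up1Cut (A : Layers) (χ : ℝ → ℝ) (ε : ℝ) (p : ℝ × ℝ) : ℝ :=
  χ (√ε * p.2) * A.up1 p + √ε * deriv χ (√ε * p.2) * ∫ s in (0 : ℝ)..p.2, A.up1 (p.1, s)

/-- See `Layers.up1Cut`. -/
def Layers.vp1Cut (A : Layers) (χ : ℝ → ℝ) (ε : ℝ) (p : ℝ × ℝ) : ℝ :=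
  χ (√ε * p.2) * A.vp1 p

/-- `u_s = u_e⁰ + u_p⁰ + √ε u_e¹ + √ε u_p¹` in the variables `(x, y)`. -/
def Layers.us (A : Layers) (χ : ℝ → ℝ) (ε : ℝ) (p : ℝ × ℝ) : ℝ :=
  A.ue0 (p.1, √ε * p.2) + A.up0 p + √ε * A.ue1 (p.1, √ε * p.2) + √ε * A.up1Cut χ ε p

/-- `v_s = v_e⁰ / √ε + v_p⁰ + v_e¹ + √ε v_p¹` in the variables `(x, y)`. -/
def Layers.vs (A : Layers) (χ : ℝ → ℝ) (ε : ℝ) (p : ℝ × ℝ) : ℝ :=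
  A.ve0 (p.1, √ε * p.2) / √ε + A.vp0 p + A.ve1 (p.1, √ε * p.2) + √ε * A.vp1Cut χ ε p

/-! ### Weak derivatives, traces, local regularity -/

/-- `g` is the weak partial derivative of `h` in `Ω` in the direction `e`. -/
def WeakPartial (L : ℝ) (e : ℝ × ℝ) (h g : ℝ × ℝ → ℝ) : Prop :=
  LocallyIntegrableOn h (Om L) ∧ LocallyIntegrableOn g (Om L) ∧
    ∀ ψ : ℝ × ℝ → ℝ, ContDiff ℝ ∞ ψ → HasCompactSupport ψ → tsupport ψ ⊆ Om L →
      ∫ p in Om L, h p * fderiv ℝ ψ p e = - ∫ p in Om L, g p * ψ p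

/-- `t` is the trace on `{x = L, y > 0}` of the function `h`, whose weak derivative in `x` is `hx`;
the trace is characterized by Green's formula. -/
def HasTrace (L : ℝ) (h hx : ℝ × ℝ → ℝ) (t : ℝ → ℝ) : Prop :=
  LocallyIntegrableOn t (Ioi 0) ∧
    ∀ ψ : ℝ × ℝ → ℝ, ContDiff ℝ ∞ ψ → HasCompactSupport ψ → tsupport ψ ⊆ Ioi 0 ×ˢ Ioi 0 →
      ∫ p in Om L, (h p * fderiv ℝ ψ p (1, 0) + hx p * ψ p) = ∫ y in Ioi 0, t y * ψ (L, y)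

/-- Square integrability on `Ω ∩ K` for all compact `K` which avoid the two corners of `Ω`. -/
def LocSqIntegrable (L : ℝ) (h : ℝ × ℝ → ℝ) : Prop :=
  ∀ K : Set (ℝ × ℝ), IsCompact K → ((0 : ℝ), (0 : ℝ)) ∉ K → (L, (0 : ℝ)) ∉ K →
    MemLp h 2 (volume.restrict (K ∩ Om L))

/-- `h` belongs to `H^{1/2}((0, L) × (0, R))` for all `R` (Gagliardo seminorm). -/
def LocHalfSobolev (L : ℝ) (h : ℝ × ℝ → ℝ) : Prop :=
  ∀ R : ℝ, 0 < R → MemLp h 2 (volume.restrict (Ioo 0 L ×ˢ Ioo 0 R)) ∧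
    ∫⁻ p in Ioo 0 L ×ˢ Ioo 0 R, ∫⁻ q in Ioo 0 L ×ˢ Ioo 0 R,
      ENNReal.ofReal ((h p - h q) ^ 2 / dist p q ^ 3) < ⊤

/-! ### Remainders and the linearized system -/

/-- A triple `[u, v, P]` together with its weak derivatives. -/
structure Remainder where
  u : ℝ × ℝ → ℝ
  ux : ℝ × ℝ → ℝ
  uy : ℝ × ℝ → ℝ
  uxx : ℝ × ℝ → ℝ
  uxy : ℝ × ℝ → ℝ
  uyy : ℝ × ℝ → ℝ
  v : ℝ × ℝ → ℝ
  vx : ℝ × ℝ → ℝ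
  vy : ℝ × ℝ → ℝ
  vxx : ℝ × ℝ → ℝ
  vxy : ℝ × ℝ → ℝ
  vyy : ℝ × ℝ → ℝ
  P : ℝ × ℝ → ℝ
  Px : ℝ × ℝ → ℝ
  Py : ℝ × ℝ → ℝ

/-- The components of `S` are the weak derivatives which their names indicate. -/
structure Remainder.IsJet (L : ℝ) (S : Remainder) : Prop where
  ux : WeakPartial L (1, 0) S.u S.ux
  uy : WeakPartial L (0, 1) S.u S.uy
  uxx : WeakPartial L (1, 0) S.ux S.uxx
  uxy : WeakPartial L (1, 0) S.uy S.uxy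
  uyy : WeakPartial L (0, 1) S.uy S.uyy
  vx : WeakPartial L (1, 0) S.v S.vx
  vy : WeakPartial L (0, 1) S.v S.vy
  vxx : WeakPartial L (1, 0) S.vx S.vxx
  vxy : WeakPartial L (1, 0) S.vy S.vxy
  vyy : WeakPartial L (0, 1) S.vy S.vyy
  Px : WeakPartial L (1, 0) S.P S.Px
  Py : WeakPartial L (0, 1) S.P S.Py

/-- The space `C_{0,S}` of smooth divergence free fields, supported away from `x = 0` and compactly
in `y ∈ (0, ∞)`. -/
def IsTestField (L : ℝ) (φ ϕ : ℝ × ℝ → ℝ) : Prop :=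
  ContDiff ℝ ∞ φ ∧ ContDiff ℝ ∞ ϕ ∧
    (∃ r a b : ℝ, 0 < r ∧ 0 < a ∧
      ∀ p : ℝ × ℝ, (p.1 < r ∨ p.2 < a ∨ b < p.2) → φ p = 0 ∧ ϕ p = 0) ∧
    ∀ p ∈ Om L, fderiv ℝ φ p (1, 0) + fderiv ℝ ϕ p (0, 1) = 0

/-- `[u, v]` lies in the closure `𝒳₀` of `C_{0,S}` in the norm `‖u_y, √ε v_y, ε v_x‖_{L²}`. As test
fields vanish at `x = 0`, convergence in this norm implies convergence in `L²`. Membership expresses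
`[u, v] = 0` on `{x = 0}`, on `{y = 0}` and as `y → ∞` in the sense of traces. -/
def Remainder.MemX0 (L : ℝ) (S : Remainder) : Prop :=
  ∃ φ ϕ : ℕ → ℝ × ℝ → ℝ, (∀ n, IsTestField L (φ n) (ϕ n)) ∧
    Tendsto (fun n => eLpNorm (fun p => S.u p - φ n p) 2 (volume.restrict (Om L)))
      atTop (𝓝 0) ∧
    Tendsto (fun n => eLpNorm (fun p => S.v p - ϕ n p) 2 (volume.restrict (Om L)))
      atTop (𝓝 0) ∧
    Tendsto (fun n => eLpNorm (fun p => S.uy p - fderiv ℝ (φ n) p (0, 1)) 2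
      (volume.restrict (Om L))) atTop (𝓝 0) ∧
    Tendsto (fun n => eLpNorm (fun p => S.vy p - fderiv ℝ (ϕ n) p (0, 1)) 2
      (volume.restrict (Om L))) atTop (𝓝 0) ∧
    Tendsto (fun n => eLpNorm (fun p => S.vx p - fderiv ℝ (ϕ n) p (1, 0)) 2
      (volume.restrict (Om L))) atTop (𝓝 0)

/-- `[u, v] ∈ 𝒳`: membership in `𝒳₀` and finiteness of every term of the norm of `𝒳`. (The positive
powers of `ε` in the norm do not influence finiteness.) -/
structure Remainder.MemX (L : ℝ) (S : Remainder) : Prop where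
  memX0 : S.MemX0 L
  uy_y : MemLp (fun p => S.uy p * p.2) 2 (volume.restrict (Om L))
  ux_y : MemLp (fun p => S.ux p * p.2) 2 (volume.restrict (Om L))
  vy : MemLp S.vy 2 (volume.restrict (Om L))
  vx : MemLp S.vx 2 (volume.restrict (Om L))
  uyy_y : MemLp (fun p => S.uyy p * p.2) 2 (volume.restrict (Om L))
  uxy_y : MemLp (fun p => S.uxy p * p.2) 2 (volume.restrict (Om L))
  uxx_y : MemLp (fun p => S.uxx p * p.2) 2 (volume.restrict (Om L))
  u_bdd : MemLp S.u ⊤ (volume.restrict (Om L))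
  v_bdd : MemLp S.v ⊤ (volume.restrict (Om L))
  uy_trace : ∃ t : ℝ → ℝ, HasTrace L S.uy S.uxy t ∧
    MemLp (fun y => t y * y) 2 (volume.restrict (Ioi 0))
  ux_trace : ∃ t : ℝ → ℝ, HasTrace L S.ux S.uxx t ∧
    MemLp (fun y => t y * y) 2 (volume.restrict (Ioi 0)) ∧
    MemLp t 2 (volume.restrict (Ioi 0))

/-- The local regularity of strong solutions: `[u, v]` is `H²` and `P` is `H¹` up to the boundary
away from the two corners, and `[u, v]` is `H^{3/2}` and `P` is `H^{1/2}` up to the corners. -/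
structure Remainder.IsStrong (L : ℝ) (S : Remainder) : Prop where
  uxx : LocSqIntegrable L S.uxx
  uxy : LocSqIntegrable L S.uxy
  uyy : LocSqIntegrable L S.uyy
  vxx : LocSqIntegrable L S.vxx
  vxy : LocSqIntegrable L S.vxy
  vyy : LocSqIntegrable L S.vyy
  Px : LocSqIntegrable L S.Px
  Py : LocSqIntegrable L S.Py
  ux_half : LocHalfSobolev L S.ux
  uy_half : LocHalfSobolev L S.uy
  vx_half : LocHalfSobolev L S.vx
  vy_half : LocHalfSobolev L S.vy
  P_half : LocHalfSobolev L S.P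

/-- `[u, v, P] ∈ 𝒳` is a strong solution of the system linearized at `[us, vs]`,

* `-Δ_ε u + us u_x + us_x u + vs u_y + us_y v + P_x = f`,
* `-Δ_ε v + us v_x + vs_x u + vs v_y + vs_y v + P_y / ε = g`,
* `u_x + v_y = 0`,

where `Δ_ε = ∂_yy + ε ∂_xx`, with `[u, v] = 0` at `x = 0`, at `y = 0` and as `y → ∞` (contained in
`MemX0`), and with the stress-free conditions `P - 2 ε u_x = aL` and `u_y + ε v_x = bL` at
`x = L`. -/
structure Remainder.IsSolution (L ε : ℝ) (us vs f g : ℝ × ℝ → ℝ) (aL bL : ℝ → ℝ)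
    (S : Remainder) : Prop where
  jet : S.IsJet L
  memX : S.MemX L
  strong : S.IsStrong L
  momentum_x : ∀ᵐ p ∂(volume.restrict (Om L)),
    -(S.uyy p + ε * S.uxx p)
      + (us p * S.ux p + dX L us p * S.u p + vs p * S.uy p + dY us p * S.v p)
      + S.Px p = f p
  momentum_y : ∀ᵐ p ∂(volume.restrict (Om L)),
    -(S.vyy p + ε * S.vxx p)
      + (us p * S.vx p + dX L vs p * S.u p + vs p * S.vy p + dY vs p * S.v p)
      + S.Py p / ε = g p
  divFree : ∀ᵐ p ∂(volume.restrict (Om L)), S.ux p + S.vy p = 0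
  stress_normal : HasTrace L (fun p => S.P p - 2 * ε * S.ux p)
    (fun p => S.Px p - 2 * ε * S.uxx p) aL
  stress_tangential : HasTrace L (fun p => S.uy p + ε * S.vx p)
    (fun p => S.uxy p + ε * S.vxx p) bL

end BoundaryLayer

end

open BoundaryLayer

noncomputable section

namespace BoundaryLayer

/-! The momentum equations are tested with $-\beta_y$ and $\epsilon\beta_x$, where $\beta=v/u_s$.
Since $u_x=-v_y$, the critical convection terms are $u_su_x+u_{sy}v=-u_s^2\beta_y$ and
$u_sv_x=u_s^2\beta_x+u_{sx}v$. They produce $u_s^2(\beta_y^2+\epsilon\beta_x^2)$, which is coercive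
because $u_s\ge c_0/2$. Everything else has to be a boundary term of good sign, a datum, or a term
that can be absorbed.

Pressure and viscosity are handled by one pointwise identity, `flux_divergence`. For the weight
$w=1/u_s$ and the tangential stress $B=u_y+\epsilon v_x$ there is a flux (`fluxX`, `fluxY`) whose
divergence is the tested equation up to `fluxLow`, a sum of products of two factors among the first
derivatives of the solution, $v$ and the data. On the wall the flux vanishes, because $v,v_x,v_y$
do. At $x=0$ its horizontal component is $-\frac12wB^2\le0$. At $x=L$ the stress conditions turn it
into $2\epsilon wv_y^2$ plus terms with $a_L$, $b_L$ and the trace of $v$. In the flux $u_y$ is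
multiplied by $B-b_L$, so that the trace of $u_y$ at $x=L$, over which there is no control, drops
out; the price is a term with $b_L'$. The result is `energy_le`.

The terms of lower order are estimated pointwise by Young's inequality with a parameter $\theta$
(`low_order_le`). Quantities bounded by $\beta_y,\sqrt\epsilon\beta_x$ receive the factor $\theta$;
among them is $v/y$, by Hardy's inequality, and this is why $y$-derivatives of $u_s$ must decay. The
remaining factors receive $\theta^{-1}$: they are data, $u_y$, or the functions $u$ and
$\sqrt\epsilon v$, for which Poincaré's inequality in $x$ gains $L^2$. With $L,\epsilon\le\theta^2$
and $\theta$ small the former are absorbed (`positivity_of_background`). The Euler part of $v_s$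
grows like $\min(\delta,M)\,y$ and is responsible for the weighted norm; its square is at most
$M\delta y^2$.

Two points need care. First, the solution is only $H^{3/2}$ at the corners, so the divergence
theorem is applied with cut-offs that vanish on squares of side comparable to $2^{-n}$ and have
gradient of size $2^n$. The error tends to zero since $2^n\int h^2\to0$ over such squares for every
$h\in H^{1/2}$ (`corner_decay`); for large $y$ integrability of the flux suffices (`outflow_le`).
Second, boundary conditions are encoded by closure and by Green's formula. They are converted into
absolute continuity with end values on almost every line (`lineAC_of_green`,
`Remainder.IsSolution.lines`), after which all integrations by parts take place on lines.

Finally, `exists_isBackground` verifies that the approximate solution satisfies the bounds used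
above, uniformly in $\epsilon$. The normal component of the first Prandtl corrector is not assumed
bounded; its bound follows from the divergence condition and the decay of the tangential component.
-/

/-! ### Absolutely continuous functions on an interval, up to null sets -/

/-- `H` agrees almost everywhere on `(α, γ)` with an absolutely continuous function with derivative
`H'` and boundary values `p` and `q`. -/
structure LineAC (α γ : ℝ) (H H' : ℝ → ℝ) (p q : ℝ) : Prop where
  int : IntervalIntegrable H' volume α γ
  eq : ∀ᵐ s ∂(volume.restrict (Ioo α γ)), H s = p + ∫ t in α..s, H' t
  fin : q = p + ∫ t in α..γ, H' t

namespace LineAC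

variable {α γ : ℝ} {H H' K K' : ℝ → ℝ} {p q r s : ℝ}

theorem integral_eq (h : LineAC α γ H H' p q) : ∫ t in α..γ, H' t = q - p := by
  rw [h.fin]; ring

theorem congr (h : LineAC α γ H H' p q) {H₁ H₁' : ℝ → ℝ} (hle : α ≤ γ)
    (e : ∀ᵐ s ∂(volume.restrict (Ioo α γ)), H₁ s = H s)
    (e' : ∀ᵐ s ∂(volume.restrict (Ioo α γ)), H₁' s = H' s) : LineAC α γ H₁ H₁' p q := by
  have e₂ : H' =ᵐ[volume.restrict (Ioc α γ)] H₁' := by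
    rw [← Measure.restrict_congr_set Ioo_ae_eq_Ioc]
    filter_upwards [e'] with x hx using hx.symm
  have e₃ : ∀ x ∈ Icc α γ, ∫ t in α..x, H' t = ∫ t in α..x, H₁' t := by
    intro x hx
    rw [intervalIntegral.integral_of_le hx.1, intervalIntegral.integral_of_le hx.1]
    exact integral_congr_ae (ae_restrict_of_ae_restrict_of_subset (Ioc_subset_Ioc_right hx.2) e₂)
  refine ⟨h.int.congr_ae (by rwa [uIoc_of_le hle]), ?_, ?_⟩
  · filter_upwards [e, h.eq, ae_restrict_mem measurableSet_Ioo] with x h1 h2 h3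
    rw [h1, h2, e₃ x (Ioo_subset_Icc_self h3)]
  · rw [← e₃ γ ⟨hle, le_rfl⟩, h.fin]

theorem add (h : LineAC α γ H H' p q) (k : LineAC α γ K K' r s) (hle : α ≤ γ) :
    LineAC α γ (fun x => H x + K x) (fun x => H' x + K' x) (p + r) (q + s) := by
  have e : ∀ x ∈ Icc α γ, ∫ t in α..x, (H' t + K' t)
      = (∫ t in α..x, H' t) + ∫ t in α..x, K' t := by
    intro x hx
    have hs : uIcc α x ⊆ uIcc α γ := by
      rw [uIcc_of_le hx.1, uIcc_of_le hle]; exact Icc_subset_Icc_right hx.2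
    exact intervalIntegral.integral_add (h.int.mono_set hs) (k.int.mono_set hs)
  refine ⟨h.int.add k.int, ?_, ?_⟩
  · filter_upwards [h.eq, k.eq, ae_restrict_mem measurableSet_Ioo] with x h1 h2 h3
    rw [h1, h2, e x (Ioo_subset_Icc_self h3)]; ring
  · rw [e γ ⟨hle, le_rfl⟩, h.fin, k.fin]; ring

theorem const_mul (h : LineAC α γ H H' p q) (c : ℝ) :
    LineAC α γ (fun x => c * H x) (fun x => c * H' x) (c * p) (c * q) := by
  refine ⟨h.int.const_mul c, ?_, ?_⟩
  · filter_upwards [h.eq] with x h1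
    rw [h1, intervalIntegral.integral_const_mul]; ring
  · rw [intervalIntegral.integral_const_mul, h.fin]; ring

theorem sub (h : LineAC α γ H H' p q) (k : LineAC α γ K K' r s) (hle : α ≤ γ) :
    LineAC α γ (fun x => H x - K x) (fun x => H' x - K' x) (p - r) (q - s) := by
  simpa [sub_eq_add_neg] using h.add (k.const_mul (-1)) hle

theorem const (c : ℝ) : LineAC α γ (fun _ => c) (fun _ => 0) c c :=
  ⟨intervalIntegrable_const, by simp, by simp⟩

/-- The absolutely continuous representative. -/
theorem ac (h : LineAC α γ H H' p q) :
    AbsolutelyContinuousOnInterval (fun x => p + ∫ t in α..x, H' t) α γ := by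
  have h1 := h.int.absolutelyContinuousOnInterval_intervalIntegral (c := α) left_mem_uIcc
  have h2 : AbsolutelyContinuousOnInterval (fun _ : ℝ => p) α γ :=
    (LipschitzWith.const p).lipschitzOnWith.absolutelyContinuousOnInterval
  exact h2.add h1

/-- The absolutely continuous representatives satisfy the product rule on every $[\alpha,x]$ by
integration by parts. It passes to $H$ and $K$ because these differ from their representatives on a
null set only. -/
theorem mul (h : LineAC α γ H H' p q) (k : LineAC α γ K K' r s) (hle : α ≤ γ) :
    LineAC α γ (fun x => H x * K x) (fun x => H' x * K x + H x * K' x) (p * r) (q * s) := by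
  set h₀ : ℝ → ℝ := fun x => p + ∫ t in α..x, H' t with hh₀
  set k₀ : ℝ → ℝ := fun x => r + ∫ t in α..x, K' t with hk₀
  have key : LineAC α γ (fun x => h₀ x * k₀ x) (fun x => H' x * k₀ x + h₀ x * K' x)
      (p * r) (q * s) := by
    have dh : ∀ᵐ x, x ∈ uIcc α γ → HasDerivAt h₀ (H' x) x := by
      filter_upwards [h.int.ae_hasDerivAt_integral] with x hx hm
      exact (hx hm α left_mem_uIcc).const_add p
    have dk : ∀ᵐ x, x ∈ uIcc α γ → HasDerivAt k₀ (K' x) x := by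
      filter_upwards [k.int.ae_hasDerivAt_integral] with x hx hm
      exact (hx hm α left_mem_uIcc).const_add r
    have e : ∀ x ∈ Icc α γ, ∫ t in α..x, (H' t * k₀ t + h₀ t * K' t) = h₀ x * k₀ x - p * r := by
      intro x hx
      have hs : uIcc α x ⊆ uIcc α γ := by
        rw [uIcc_of_le hx.1, uIcc_of_le hle]; exact Icc_subset_Icc_right hx.2
      have := (h.ac.mono hs).integral_deriv_mul_eq_sub (k.ac.mono hs)
      have e0 : h₀ α * k₀ α = p * r := by simp [hh₀, hk₀]
      rw [← e0, ← this]
      refine intervalIntegral.integral_congr_ae ?_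
      filter_upwards [dh, dk] with y h1 h2 hy
      have hy' := hs (uIoc_subset_uIcc hy)
      rw [(h1 hy').deriv, (h2 hy').deriv]
    refine ⟨(h.int.mul_continuousOn k.ac.continuousOn).add
      (k.int.continuousOn_mul h.ac.continuousOn), ?_, ?_⟩
    · filter_upwards [ae_restrict_mem measurableSet_Ioo] with x hx
      rw [e x (Ioo_subset_Icc_self hx)]; ring
    · rw [e γ ⟨hle, le_rfl⟩, h.fin, k.fin]; ring
  refine key.congr hle ?_ ?_
  · filter_upwards [h.eq, k.eq] with x h1 h2; rw [h1, h2]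
  · filter_upwards [h.eq, k.eq] with x h1 h2; rw [h1, h2]

/-- A function which is continuous on `[α, γ]` and differentiable on `(α, γ)` with integrable
derivative. -/
theorem of_hasDerivAt (hle : α ≤ γ) (hc : ContinuousOn H (Icc α γ))
    (hd : ∀ x ∈ Ioo α γ, HasDerivAt H (H' x) x) (hi : IntervalIntegrable H' volume α γ) :
    LineAC α γ H H' (H α) (H γ) := by
  have e : ∀ x ∈ Icc α γ, ∫ t in α..x, H' t = H x - H α := by
    intro x hx
    refine intervalIntegral.integral_eq_sub_of_hasDerivAt_of_le hx.1
      (hc.mono (Icc_subset_Icc_right hx.2)) (fun y hy => hd y ⟨hy.1, hy.2.trans_le hx.2⟩)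
      (hi.mono_set ?_)
    rw [uIcc_of_le hx.1, uIcc_of_le hle]; exact Icc_subset_Icc_right hx.2
  refine ⟨hi, ?_, ?_⟩
  · filter_upwards [ae_restrict_mem measurableSet_Ioo] with x hx
    rw [e x (Ioo_subset_Icc_self hx)]; ring
  · rw [e γ ⟨hle, le_rfl⟩]; ring

/-- Boundary values are determined by the function. -/
theorem unique (h : LineAC α γ H H' p q) (k : LineAC α γ H H' r s) (hlt : α < γ) :
    p = r ∧ q = s := by
  have hne : NeZero (volume.restrict (Ioo α γ)) := ⟨by
    rw [Ne, Measure.restrict_eq_zero]; simp [hlt]⟩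
  obtain ⟨x, h1, h2⟩ := (k.eq.and h.eq).exists
  have : p = r := by linarith
  exact ⟨this, by rw [h.fin, k.fin, this]⟩

/-- An absolutely continuous function vanishing at the left end is bounded by the `L²` norm of its
derivative. -/
theorem sq_le (h : LineAC α γ H H' 0 q) (hlt : α ≤ γ)
    (h2 : IntegrableOn (fun t => H' t ^ 2) (Ioo α γ)) :
    (∀ᵐ s ∂(volume.restrict (Ioo α γ)), H s ^ 2 ≤ (s - α) * ∫ t in Ioo α s, H' t ^ 2) ∧
      q ^ 2 ≤ (γ - α) * ∫ t in Ioo α γ, H' t ^ 2 := by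
  have key : ∀ x ∈ Icc α γ, (∫ t in α..x, H' t) ^ 2 ≤ (x - α) * ∫ t in Ioo α x, H' t ^ 2 := by
    intro x hx
    rw [intervalIntegral.integral_of_le hx.1, integral_Ioc_eq_integral_Ioo]
    have hs : Ioo α x ⊆ Ioo α γ := Ioo_subset_Ioo_right hx.2
    have h1 : IntegrableOn H' (Ioo α x) :=
      ((intervalIntegrable_iff_integrableOn_Ioo_of_le hlt).1 h.int).mono_set hs
    have h2' := h2.mono_set hs
    set m := ∫ t in Ioo α x, H' t
    set S := ∫ t in Ioo α x, H' t ^ 2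
    rcases hx.1.eq_or_lt with h0 | h0
    · simp [m, h0]
    have hd : 0 < x - α := by linarith
    -- Expanding this square gives the Cauchy–Schwarz inequality $m^2\le(x-\alpha)\int H'^2$.
    have : 0 ≤ ∫ t in Ioo α x, ((x - α) * H' t - m) ^ 2 := integral_nonneg fun _ => sq_nonneg _
    have e : ∫ t in Ioo α x, ((x - α) * H' t - m) ^ 2
        = (x - α) ^ 2 * S - 2 * (x - α) * m * m + (x - α) * m ^ 2 := by
      have : (fun t => ((x - α) * H' t - m) ^ 2)
          = fun t => (x - α) ^ 2 * H' t ^ 2 - 2 * (x - α) * m * H' t + m ^ 2 := by ext; ring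
      rw [this, integral_add, integral_sub, integral_const_mul, integral_const_mul]
      · simp only [integral_const, MeasurableSet.univ, measureReal_restrict_apply, univ_inter,
          Real.volume_real_Ioo_of_le hx.1, smul_eq_mul]
        rfl
      · exact h2'.const_mul _
      · exact h1.const_mul _
      · exact (h2'.const_mul _).sub (h1.const_mul _)
      · exact integrableOn_const (by simp)
    rw [e] at this
    have h3 : 0 ≤ (x - α) * ((x - α) * S - m ^ 2) := by nlinarith
    nlinarith [nonneg_of_mul_nonneg_right h3 hd]
  refine ⟨?_, ?_⟩
  · filter_upwards [h.eq, ae_restrict_mem measurableSet_Ioo] with x h1 h3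
    rw [h1, zero_add]; exact key x (Ioo_subset_Icc_self h3)
  · rw [h.fin, zero_add]; exact key γ ⟨hlt, le_rfl⟩

end LineAC

/-! ### Green's formula and absolute continuity on lines -/

/-- The primitive `-∫_s^∞ φ(t, z) dt` of a test function is smooth. -/
theorem contDiff_primitive {φ : ℝ × ℝ → ℝ} (hφ : ContDiff ℝ ∞ φ) (hc : HasCompactSupport φ)
    {γ : ℝ} (hγ : ∀ p : ℝ × ℝ, γ ≤ p.1 → φ p = 0) :
    ContDiff ℝ ∞ (fun p : ℝ × ℝ => -∫ t in p.1..γ, φ (t, p.2)) := by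
  -- Convolution of $\varphi(\cdot,z)$ with this indicator is $\int_s^\infty\varphi(t,z)\,dt$.
  -- Smoothness in both variables is therefore that of a convolution with a parameter.
  set f : ℝ → ℝ := (Iic (0 : ℝ)).indicator (fun _ => 1)
  have hf : LocallyIntegrable f volume :=
    (locallyIntegrable_const (1 : ℝ)).indicator measurableSet_Iic
  have h := contDiffOn_convolution_right_with_param (𝕜 := ℝ) (μ := volume) (n := ⊤) (f := f)
    (ContinuousLinearMap.mul ℝ ℝ) (g := fun z x : ℝ => φ (x, z)) (s := univ)
    (k := Prod.fst '' tsupport φ) isOpen_univ (hc.image continuous_fst)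
    (fun z x _ hx => by
      by_contra hne
      exact hx ⟨(x, z), subset_tsupport _ hne, rfl⟩) hf
    (by
      have : (↿fun z x : ℝ => φ (x, z)) = fun p : ℝ × ℝ => φ (p.2, p.1) := rfl
      rw [this]
      exact (hφ.comp (contDiff_snd.prodMk contDiff_fst)).contDiffOn)
  have h' := (contDiffOn_univ.1 (by simpa using h)).comp
    (contDiff_snd.prodMk contDiff_fst : ContDiff ℝ ∞ fun p : ℝ × ℝ => (p.2, p.1))
  convert h'.neg using 1
  ext p
  symm
  simp only [Function.comp, convolution, ContinuousLinearMap.mul_apply']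
  congr 1
  have hcont : Continuous fun t => φ (t, p.2) :=
    hφ.continuous.comp (Continuous.prodMk_left p.2)
  have hcs : HasCompactSupport fun t => φ (t, p.2) := by
    refine HasCompactSupport.intro (hc.image continuous_fst) fun x hx => ?_
    by_contra hne
    exact hx ⟨(x, p.2), subset_tsupport _ hne, rfl⟩
  have hint : Integrable fun t => φ (t, p.2) := hcont.integrable_of_hasCompactSupport hcs
  rw [← integral_sub_left_eq_self (fun t => f t * φ (p.1 - t, p.2)) volume p.1]
  have e : (fun x => f (p.1 - x) * φ (p.1 - (p.1 - x), p.2))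
      = (Ici p.1).indicator (fun t => φ (t, p.2)) := by
    ext x
    by_cases hx : p.1 ≤ x <;> simp [f, indicator, hx]
  rw [e, integral_indicator measurableSet_Ici, integral_Ici_eq_integral_Ioi,
    ← intervalIntegral.integral_Ioi_sub_Ioi' hint.integrableOn hint.integrableOn]
  have : ∫ t in Ioi γ, φ (t, p.2) = 0 :=
    setIntegral_eq_zero_of_forall_eq_zero fun t ht => hγ _ (le_of_lt ht)
  rw [this, sub_zero]

/-- A smooth function which is `0` for `t ≤ c` and `1` for `d ≤ t`. -/
theorem exists_smooth_step {c d : ℝ} (h : c < d) : ∃ ξ : ℝ → ℝ, ContDiff ℝ ∞ ξ ∧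
    (∀ t, t ≤ c → ξ t = 0) ∧ (∀ t, d ≤ t → ξ t = 1) ∧ (∀ t, 0 ≤ ξ t ∧ ξ t ≤ 1) := by
  have hd : 0 < d - c := sub_pos.2 h
  refine ⟨fun t => Real.smoothTransition ((t - c) / (d - c)), ?_, ?_, ?_, ?_⟩
  · exact Real.smoothTransition.contDiff.comp (by fun_prop)
  · intro t ht
    exact Real.smoothTransition.zero_of_nonpos (div_nonpos_of_nonpos_of_nonneg (by linarith) hd.le)
  · intro t ht
    exact Real.smoothTransition.one_of_one_le ((one_le_div hd).2 (by linarith))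
  · exact fun t => ⟨Real.smoothTransition.nonneg _, Real.smoothTransition.le_one _⟩

theorem fderiv_apply_fst {ψ : ℝ × ℝ → ℝ} {p : ℝ × ℝ} (h : DifferentiableAt ℝ ψ p) {d : ℝ}
    (hd : HasDerivAt (fun s => ψ (s, p.2)) d p.1) : fderiv ℝ ψ p (1, 0) = d := by
  have h1 : HasDerivAt (fun s : ℝ => (s, p.2)) ((1 : ℝ), (0 : ℝ)) p.1 :=
    (hasDerivAt_id p.1).prodMk (hasDerivAt_const p.1 p.2)
  exact (h.hasFDerivAt.comp_hasDerivAt p.1 h1).unique hd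

theorem hasDerivAt_fst {ψ : ℝ × ℝ → ℝ} (h : Differentiable ℝ ψ) (p : ℝ × ℝ) :
    HasDerivAt (fun s => ψ (s, p.2)) (fderiv ℝ ψ p (1, 0)) p.1 := by
  have h1 : HasDerivAt (fun s : ℝ => (s, p.2)) ((1 : ℝ), (0 : ℝ)) p.1 :=
    (hasDerivAt_id p.1).prodMk (hasDerivAt_const p.1 p.2)
  exact (h p).hasFDerivAt.comp_hasDerivAt p.1 h1

theorem hasDerivAt_snd {ψ : ℝ × ℝ → ℝ} (h : Differentiable ℝ ψ) (p : ℝ × ℝ) :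
    HasDerivAt (fun s => ψ (p.1, s)) (fderiv ℝ ψ p (0, 1)) p.2 := by
  have h1 : HasDerivAt (fun s : ℝ => (p.1, s)) ((0 : ℝ), (1 : ℝ)) p.2 :=
    (hasDerivAt_const p.2 p.1).prodMk (hasDerivAt_id p.2)
  exact (h p).hasFDerivAt.comp_hasDerivAt p.2 h1

theorem continuous_fderiv_apply {ψ : ℝ × ℝ → ℝ} (h : ContDiff ℝ ∞ ψ) (e : ℝ × ℝ) :
    Continuous fun p => fderiv ℝ ψ p e :=
  (h.continuous_fderiv (by simp)).clm_apply continuous_const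

/-- A bounded continuous function times an integrable function. -/
theorem IntegrableOn.mul_test {X : Type*} [TopologicalSpace X] [MeasurableSpace X]
    [OpensMeasurableSpace X] {μ : Measure X} {s : Set X} {h ψ : X → ℝ}
    (hh : IntegrableOn h s μ) (hψ : Continuous ψ) (hc : HasCompactSupport ψ) :
    IntegrableOn (fun p => h p * ψ p) s μ := by
  obtain ⟨C, hC⟩ := hc.exists_bound_of_continuous hψ
  exact Integrable.mul_bdd (c := C) hh hψ.aestronglyMeasurable (ae_of_all _ hC)

theorem hasCompactSupport_fderiv_apply {ψ : ℝ × ℝ → ℝ} (hc : HasCompactSupport ψ) (e : ℝ × ℝ) :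
    HasCompactSupport fun p => fderiv ℝ ψ p e :=
  hc.fderiv_apply ℝ e

/-- If Green's formula without boundary terms holds for all test functions which vanish near
`s = γ`, then `F` is absolutely continuous on almost every line, with derivative `G`, and vanishes
at `s = α`. -/
theorem lineAC_of_green {α γ : ℝ} (hlt : α < γ) {J : Set ℝ} (hJ : IsOpen J) {F G : ℝ × ℝ → ℝ}
    (hF : IntegrableOn F (Ioo α γ ×ˢ J)) (hG : IntegrableOn G (Ioo α γ ×ˢ J))
    (hgreen : ∀ ψ : ℝ × ℝ → ℝ, ContDiff ℝ ∞ ψ → HasCompactSupport ψ → tsupport ψ ⊆ Iio γ ×ˢ J →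
      ∫ p in Ioo α γ ×ˢ J, (F p * fderiv ℝ ψ p (1, 0) + G p * ψ p) = 0) :
    ∀ᵐ z ∂(volume.restrict J),
      LineAC α γ (fun s => F (s, z)) (fun s => G (s, z)) 0 (∫ s in α..γ, G (s, z)) := by
  set D : Set (ℝ × ℝ) := Ioo α γ ×ˢ J with hD
  have hDo : IsOpen D := isOpen_Ioo.prod hJ
  have hvol : (volume : Measure (ℝ × ℝ)).restrict D
      = (volume.restrict (Ioo α γ)).prod (volume.restrict J) := by
    rw [Measure.prod_restrict]; rfl
  have hG' : Integrable G ((volume.restrict (Ioo α γ)).prod (volume.restrict J)) := by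
    rw [← hvol]; exact hG
  have hGline : ∀ᵐ z ∂(volume.restrict J), IntegrableOn (fun s => G (s, z)) (Ioo α γ) :=
    hG'.prod_left_ae
  -- The candidate for $F$ is the primitive of $G$. Writing it as an integral over a fixed interval
  -- makes its joint measurability a case of Fubini's theorem.
  set I : ℝ × ℝ → ℝ := fun p => ∫ t in Ioo α γ, (if t < p.1 then G (t, p.2) else 0) with hI
  have hIeq : ∀ s ∈ Ioo α γ, ∀ z, I (s, z) = ∫ t in α..s, G (t, z) := by
    intro s hs z
    have : (fun t => if t < s then G (t, z) else 0) = (Iio s).indicator (fun t => G (t, z)) := by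
      ext t; simp [indicator]
    simp only [hI]
    rw [this, setIntegral_indicator measurableSet_Iio, intervalIntegral.integral_of_le hs.1.le,
      integral_Ioc_eq_integral_Ioo]
    congr 2
    ext t
    simp only [mem_inter_iff, mem_Ioo, mem_Iio]
    exact ⟨fun h => ⟨h.1.1, h.2⟩, fun h => ⟨⟨h.1, h.2.trans hs.2⟩, h.2⟩⟩
  have hImeas : AEStronglyMeasurable I (volume.restrict D) := by
    have h1 : AEStronglyMeasurable (fun q : (ℝ × ℝ) × ℝ => G (q.2, q.1.2))
        ((volume.restrict D).prod (volume.restrict (Ioo α γ))) := by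
      have hqm : Measure.QuasiMeasurePreserving (fun q : (ℝ × ℝ) × ℝ => (q.2, q.1.2))
          ((volume.restrict D).prod (volume.restrict (Ioo α γ)))
          ((volume.restrict (Ioo α γ)).prod (volume.restrict J)) := by
        rw [hvol]
        have a1 := (measurePreserving_prodAssoc (volume.restrict (Ioo α γ)) (volume.restrict J)
          (volume.restrict (Ioo α γ))).quasiMeasurePreserving
        have a2 := Measure.quasiMeasurePreserving_snd (μ := volume.restrict (Ioo α γ))
          (ν := (volume.restrict J).prod (volume.restrict (Ioo α γ)))
        exact (Measure.measurePreserving_swap.quasiMeasurePreserving).comp (a2.comp a1)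
      exact hG'.1.comp_quasiMeasurePreserving hqm
    have h2 : AEStronglyMeasurable (fun q : (ℝ × ℝ) × ℝ => if q.2 < q.1.1 then G (q.2, q.1.2) else 0)
        ((volume.restrict D).prod (volume.restrict (Ioo α γ))) := by
      have := h1.indicator (s := {q : (ℝ × ℝ) × ℝ | q.2 < q.1.1})
        (measurableSet_lt measurable_snd (measurable_fst.comp measurable_fst))
      refine this.congr (ae_of_all _ fun q => ?_)
      simp [indicator]
    exact h2.integral_prod_right'
  have hN : Integrable (fun z => ∫ t in Ioo α γ, ‖G (t, z)‖) (volume.restrict J) :=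
    hG'.norm.integral_prod_right
  have hIint : IntegrableOn I D := by
    have hb : Integrable (fun p : ℝ × ℝ => ∫ t in Ioo α γ, ‖G (t, p.2)‖) (volume.restrict D) := by
      rw [hvol]
      exact hN.comp_snd _
    refine hb.mono' hImeas ?_
    have : ∀ᵐ p ∂(volume.restrict D), IntegrableOn (fun s => G (s, p.2)) (Ioo α γ) := by
      rw [hvol]
      exact Measure.quasiMeasurePreserving_snd.ae hGline
    filter_upwards [this] with p hp
    refine norm_integral_le_of_norm_le hp.norm (ae_of_all _ fun t => ?_)
    split_ifs <;> simp
  have key : ∀ φ : ℝ × ℝ → ℝ, ContDiff ℝ ∞ φ → HasCompactSupport φ → tsupport φ ⊆ D →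
      ∫ p, φ p • (F p - I p) ∂(volume.restrict D) = 0 := by
    intro φ hφ hc hs
    have hz : ∀ p : ℝ × ℝ, γ ≤ p.1 → φ p = 0 := fun p hp => by
      by_contra hne
      exact absurd (hs (subset_tsupport _ hne)).1.2 (not_lt.2 hp)
    -- The test function should have $s$-derivative $\varphi$. The primitive $\Phi$ does not vanish
    -- far to the left, so it is multiplied by a step which equals one for $s\ge\alpha$ and hence
    -- changes nothing in the domain.
    obtain ⟨ξ, hξ, hξ0, hξ1, -⟩ := exists_smooth_step (show α - 1 < α by linarith)
    set Φ : ℝ × ℝ → ℝ := fun p => -∫ t in p.1..γ, φ (t, p.2)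
    have hΦ : ContDiff ℝ ∞ Φ := contDiff_primitive hφ hc hz
    set ψ : ℝ × ℝ → ℝ := fun p => ξ p.1 * Φ p
    have hψ : ContDiff ℝ ∞ ψ := (hξ.comp contDiff_fst).mul hΦ
    have hΦ0 : ∀ p : ℝ × ℝ, (p.2 ∉ Prod.snd '' tsupport φ) → Φ p = 0 := by
      intro p hp
      have : ∀ t, φ (t, p.2) = 0 := fun t => by
        by_contra hne
        exact hp ⟨(t, p.2), subset_tsupport _ hne, rfl⟩
      simp [Φ, this]
    -- The compact support of $\varphi$ leaves a gap before $\gamma$. This makes $\psi$ vanish near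
    -- $s=\gamma$, as `hgreen` requires.
    obtain ⟨m, hmγ, hm⟩ : ∃ m < γ, ∀ p : ℝ × ℝ, m < p.1 → φ p = 0 := by
      rcases (tsupport φ).eq_empty_or_nonempty with he | hne
      · refine ⟨γ - 1, by linarith, fun p _ => image_eq_zero_of_notMem_tsupport (by simp [he])⟩
      · obtain ⟨x, hx, hmax⟩ := (show IsCompact (tsupport φ) from hc).exists_isMaxOn hne
          continuous_fst.continuousOn
        refine ⟨x.1, (hs hx).1.2, fun p hp => ?_⟩
        by_contra h0
        exact absurd (hmax (subset_tsupport _ h0)) (not_le.2 hp)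
    have hΦm : ∀ p : ℝ × ℝ, m < p.1 → Φ p = 0 := by
      intro p hp
      simp only [Φ, neg_eq_zero]
      rcases le_total p.1 γ with h | h
      · refine (intervalIntegral.integral_congr (g := fun _ => (0 : ℝ)) fun t ht => ?_).trans
          (by simp)
        rw [uIcc_of_le h] at ht
        exact hm _ (hp.trans_le ht.1)
      · refine (intervalIntegral.integral_congr (g := fun _ => (0 : ℝ)) fun t ht => ?_).trans
          (by simp)
        rw [uIcc_of_ge h] at ht
        exact hz _ ht.1
    have hKc : IsCompact (Icc (α - 1) m ×ˢ (Prod.snd '' tsupport φ)) :=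
      isCompact_Icc.prod ((show IsCompact (tsupport φ) from hc).image continuous_snd)
    have hψK : ∀ p, p ∉ Icc (α - 1) m ×ˢ (Prod.snd '' tsupport φ) → ψ p = 0 := by
      intro p hp
      simp only [mem_prod, mem_Icc, not_and_or, not_le] at hp
      rcases hp with (h | h) | h
      · simp [ψ, hξ0 _ h.le]
      · simp [ψ, hΦm _ h]
      · simp [ψ, hΦ0 _ h]
    have hψc : HasCompactSupport ψ := HasCompactSupport.intro hKc hψK
    have hψs : tsupport ψ ⊆ Iio γ ×ˢ J := by
      refine (closure_minimal (fun p hp => ?_) hKc.isClosed).trans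
        (prod_mono (fun x hx => hx.2.trans_lt hmγ) ?_)
      · by_contra h
        exact hp (hψK p h)
      · rintro _ ⟨p, hp, rfl⟩
        exact (hs hp).2
    have hΦd : ∀ p : ℝ × ℝ, HasDerivAt (fun s => Φ (s, p.2)) (φ p) p.1 := by
      intro p
      have hcont : Continuous fun t => φ (t, p.2) := hφ.continuous.comp (Continuous.prodMk_left p.2)
      have := (intervalIntegral.integral_hasDerivAt_left (hcont.intervalIntegrable p.1 γ)
        (hcont.stronglyMeasurableAtFilter _ _) hcont.continuousAt).neg
      rw [neg_neg] at this
      exact this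
    have hψΦ : ∀ p : ℝ × ℝ, p ∈ D → ψ p = Φ p := fun p hp => by
      simp [ψ, hξ1 _ hp.1.1.le]
    have hψd : ∀ p ∈ D, fderiv ℝ ψ p (1, 0) = φ p := by
      intro p hp
      refine fderiv_apply_fst (hψ.differentiable (by simp) p) ?_
      refine (hΦd p).congr_of_eventuallyEq ?_
      filter_upwards [Ioi_mem_nhds hp.1.1] with s hs'
      simp [ψ, hξ1 s (le_of_lt hs')]
    have g1 := hgreen ψ hψ hψc hψs
    have iF : IntegrableOn (fun p => F p * φ p) D := IntegrableOn.mul_test hF hφ.continuous hc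
    have iI : IntegrableOn (fun p => I p * φ p) D := IntegrableOn.mul_test hIint hφ.continuous hc
    have iG : IntegrableOn (fun p => G p * ψ p) D := IntegrableOn.mul_test hG hψ.continuous hψc
    have g2 : ∫ p in D, (F p * φ p + G p * ψ p) = 0 := by
      rw [← g1]
      exact setIntegral_congr_fun hDo.measurableSet fun p hp => by simp only [hψd p hp]
    -- The primitive satisfies the same formula: on each line $I$ vanishes at $\alpha$ and $\Phi$
    -- vanishes at $\gamma$. Subtraction leaves $\int\varphi(F-I)=0$ for all $\varphi$.
    have g3 : ∫ p in D, (I p * φ p + G p * ψ p) = 0 := by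
      have hi : Integrable (fun p => I p * φ p + G p * ψ p)
          ((volume.restrict (Ioo α γ)).prod (volume.restrict J)) := by
        rw [← hvol]; exact iI.add iG
      rw [hvol, integral_prod_symm _ hi]
      refine integral_eq_zero_of_ae ?_
      filter_upwards [hGline, ae_restrict_mem hJ.measurableSet] with z hz hzJ
      have c1 : LineAC α γ (fun s => ∫ t in α..s, G (t, z)) (fun s => G (s, z)) 0
          (∫ t in α..γ, G (t, z)) :=
        ⟨(intervalIntegrable_iff_integrableOn_Ioo_of_le hlt.le).2 hz, by simp, by simp⟩
      have hcont : Continuous fun t => φ (t, z) := hφ.continuous.comp (Continuous.prodMk_left z)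
      have c2 := LineAC.of_hasDerivAt (H := fun s => Φ (s, z)) (H' := fun s => φ (s, z)) hlt.le
        (hΦ.continuous.comp (Continuous.prodMk_left z)).continuousOn
        (fun x _ => hΦd (x, z)) (hcont.intervalIntegrable _ _)
      have c3 := (c1.mul c2 hlt.le).integral_eq
      have c4 : Φ (γ, z) = 0 := hΦm _ hmγ
      rw [c4, mul_zero, zero_mul, sub_zero, intervalIntegral.integral_of_le hlt.le,
        integral_Ioc_eq_integral_Ioo] at c3
      rw [Pi.zero_apply, ← c3]
      refine setIntegral_congr_fun measurableSet_Ioo fun s hs' => ?_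
      simp only [hIeq s hs' z, hψΦ (s, z) ⟨hs', hzJ⟩]
      ring
    have : ∀ p, φ p • (F p - I p) = (F p * φ p + G p * ψ p) - (I p * φ p + G p * ψ p) := by
      intro p; simp only [smul_eq_mul]; ring
    simp_rw [this]
    have e := integral_sub (iF.add iG) (iI.add iG)
    simp only [Pi.add_apply] at e
    rw [e, g2, g3, sub_zero]
  have hloc : LocallyIntegrableOn (fun p => F p - I p) D (volume.restrict D) :=
    (hF.sub hIint).integrable.locallyIntegrable.locallyIntegrableOn D
  have hae := hDo.ae_eq_zero_of_integral_contDiff_smul_eq_zero hloc key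
  have hae' : ∀ᵐ p ∂((volume.restrict (Ioo α γ)).prod (volume.restrict J)), F p = I p := by
    rw [← hvol]
    filter_upwards [hae, ae_restrict_mem hDo.measurableSet] with p hp hm
    exact sub_eq_zero.1 (hp hm)
  have hsw : ∀ᵐ q ∂((volume.restrict J).prod (volume.restrict (Ioo α γ))),
      F (q.2, q.1) = I (q.2, q.1) :=
    Measure.measurePreserving_swap.quasiMeasurePreserving.ae hae'
  filter_upwards [Measure.ae_ae_of_ae_prod hsw, hGline] with z hz hGz
  refine ⟨(intervalIntegrable_iff_integrableOn_Ioo_of_le hlt.le).2 hGz, ?_, by simp⟩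
  filter_upwards [hz, ae_restrict_mem measurableSet_Ioo] with s hs hm
  rw [hs, hIeq s hm z, zero_add]

theorem measurableSet_Om (L : ℝ) : MeasurableSet (Om L) := measurableSet_Ioo.prod measurableSet_Ioi

theorem isOpen_Om (L : ℝ) : IsOpen (Om L) := isOpen_Ioo.prod isOpen_Ioi

theorem volume_restrict_Om (L : ℝ) : (volume : Measure (ℝ × ℝ)).restrict (Om L)
    = (volume.restrict (Ioo 0 L)).prod (volume.restrict (Ioi 0)) := by
  rw [Measure.prod_restrict]; rfl

/-! ### Reflection of lines and exchange of the two variables -/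

theorem LineAC.comp_neg {α γ : ℝ} {H H' : ℝ → ℝ} {p q : ℝ} (hle : α ≤ γ)
    (h : LineAC (-γ) (-α) H H' p q) :
    LineAC α γ (fun s => H (-s)) (fun s => -H' (-s)) q p := by
  have hi : IntervalIntegrable (fun s => -H' (-s)) volume α γ := by
    have := ((IntervalIntegrable.iff_comp_neg (by simp)).1 h.int).symm.neg
    simp only [neg_neg] at this
    exact this
  refine ⟨hi, ?_, ?_⟩
  · have h1 : ∀ᵐ s ∂(volume.restrict (Ioo α γ)), H (-s) = p + ∫ t in (-γ)..(-s), H' t := by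
      have hmp : MeasurePreserving (fun x : ℝ => -x) (volume.restrict (Ioo α γ))
          (volume.restrict (Ioo (-γ) (-α))) := by
        have := (Measure.measurePreserving_neg (volume : Measure ℝ)).restrict_preimage
          (s := Ioo (-γ) (-α)) measurableSet_Ioo
        simpa using this
      exact hmp.quasiMeasurePreserving.ae h.eq
    filter_upwards [h1, ae_restrict_mem measurableSet_Ioo] with s hs hm
    rw [hs, h.fin, intervalIntegral.integral_neg, intervalIntegral.integral_comp_neg]
    have s1 : uIcc (-γ) (-s) ⊆ uIcc (-γ) (-α) := by
      rw [uIcc_of_le (by linarith [hm.2]), uIcc_of_le (by linarith)]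
      exact Icc_subset_Icc_right (by linarith [hm.1])
    have s2 : uIcc (-s) (-α) ⊆ uIcc (-γ) (-α) := by
      rw [uIcc_of_le (by linarith [hm.1]), uIcc_of_le (by linarith)]
      exact Icc_subset_Icc_left (by linarith [hm.2])
    rw [← intervalIntegral.integral_add_adjacent_intervals (h.int.mono_set s1) (h.int.mono_set s2)]
    ring
  · rw [h.fin, intervalIntegral.integral_neg, intervalIntegral.integral_comp_neg]; ring

/-- The version of `lineAC_of_green` for functions which vanish at the right end. -/
theorem lineAC_of_green_right {α γ : ℝ} (hlt : α < γ) {J : Set ℝ} (hJ : IsOpen J)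
    {F G : ℝ × ℝ → ℝ}
    (hF : IntegrableOn F (Ioo α γ ×ˢ J)) (hG : IntegrableOn G (Ioo α γ ×ˢ J))
    (hgreen : ∀ ψ : ℝ × ℝ → ℝ, ContDiff ℝ ∞ ψ → HasCompactSupport ψ → tsupport ψ ⊆ Ioi α ×ˢ J →
      ∫ p in Ioo α γ ×ˢ J, (F p * fderiv ℝ ψ p (1, 0) + G p * ψ p) = 0) :
    ∀ᵐ z ∂(volume.restrict J), ∃ p,
      LineAC α γ (fun s => F (s, z)) (fun s => G (s, z)) p 0 := by
  set r : (ℝ × ℝ) ≃L[ℝ] ℝ × ℝ :=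
    (ContinuousLinearEquiv.neg ℝ : ℝ ≃L[ℝ] ℝ).prodCongr (ContinuousLinearEquiv.refl ℝ ℝ) with hr
  have hrp : ∀ p : ℝ × ℝ, r p = (-p.1, p.2) := fun p => rfl
  have hmp : MeasurePreserving r volume volume :=
    (Measure.measurePreserving_neg (volume : Measure ℝ)).prod (MeasurePreserving.id volume)
  have hme : MeasurableEmbedding r := r.toHomeomorph.measurableEmbedding
  have hpre : ∀ I : Set ℝ, r ⁻¹' (I ×ˢ J) = (-I) ×ˢ J := by
    intro I; ext p; simp [hrp]
  have hpre' : r ⁻¹' (Ioo α γ ×ˢ J) = Ioo (-γ) (-α) ×ˢ J := by rw [hpre]; simp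
  have hF' : IntegrableOn (F ∘ r) (Ioo (-γ) (-α) ×ˢ J) := by
    rw [← hpre']; exact (hmp.integrableOn_comp_preimage hme).2 hF
  have hG' : IntegrableOn (fun p => -G (r p)) (Ioo (-γ) (-α) ×ˢ J) := by
    rw [← hpre']; exact ((hmp.integrableOn_comp_preimage hme).2 hG).neg
  have key := lineAC_of_green (show -γ < -α by linarith) hJ hF' hG' ?_
  · filter_upwards [key] with z hz
    have := LineAC.comp_neg hlt.le hz
    simp only [hrp, Function.comp, neg_neg] at this
    exact ⟨_, this⟩
  · intro ψ hψ hc hs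
    have hinv : ∀ p, r (r p) = p := fun p => by simp [hrp]
    have hc' : HasCompactSupport (ψ ∘ r) := hc.comp_homeomorph r.toHomeomorph
    have hts : tsupport (ψ ∘ r) = r ⁻¹' tsupport ψ := by
      exact (tsupport_comp_eq_preimage ψ r.toHomeomorph)
    have hs' : tsupport (ψ ∘ r) ⊆ Ioi α ×ˢ J := by
      rw [hts]
      intro p hp
      have := hs hp
      simp only [hrp, mem_prod, mem_Iio, mem_Ioi] at this ⊢
      exact ⟨by linarith [this.1], this.2⟩
    have g := hgreen (ψ ∘ r) (hψ.comp r.contDiff) hc' hs'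
    have hd : ∀ p, fderiv ℝ (ψ ∘ r) p (1, 0) = -fderiv ℝ ψ (r p) (1, 0) := by
      intro p
      rw [r.comp_right_fderiv]
      have : r (1, 0) = -((1 : ℝ), (0 : ℝ)) := by simp [hrp]
      simp only [ContinuousLinearMap.comp_apply, ContinuousLinearEquiv.coe_coe, this, map_neg]
    rw [← hpre']
    have e := hmp.setIntegral_preimage_emb hme
      (fun p => F p * fderiv ℝ ψ (r p) (1, 0) + -G p * ψ (r p)) (Ioo α γ ×ˢ J)
    simp only [hinv] at e
    simp only [Function.comp]
    refine (e.trans ?_).trans (neg_eq_zero.2 g)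
    rw [← integral_neg]
    refine integral_congr_ae (ae_of_all _ fun p => ?_)
    simp only [hd, Function.comp]; ring

theorem integral_green_swap (I J : Set ℝ) (F G ψ : ℝ × ℝ → ℝ) :
    ∫ p in I ×ˢ J, (F p.swap * fderiv ℝ ψ p (1, 0) + G p.swap * ψ p)
      = ∫ p in J ×ˢ I, (F p * fderiv ℝ (ψ ∘ Prod.swap) p (0, 1) + G p * (ψ ∘ Prod.swap) p) := by
  set r : (ℝ × ℝ) ≃L[ℝ] ℝ × ℝ := ContinuousLinearEquiv.prodComm ℝ ℝ ℝ with hr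
  have hmp : MeasurePreserving r volume volume := Measure.measurePreserving_swap
  have hpre' : r ⁻¹' (J ×ˢ I) = I ×ˢ J := by
    ext p; simp only [hr, mem_preimage, mem_prod, ContinuousLinearEquiv.prodComm_apply,
      Prod.fst_swap, Prod.snd_swap]; tauto
  have hd : ∀ p, fderiv ℝ (ψ ∘ Prod.swap) p (0, 1) = fderiv ℝ ψ p.swap (1, 0) := by
    intro p
    change fderiv ℝ (ψ ∘ r) p (0, 1) = _
    rw [r.comp_right_fderiv]
    rfl
  rw [← hpre']
  have e := hmp.setIntegral_preimage_emb r.toHomeomorph.measurableEmbedding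
    (fun p => F p * fderiv ℝ ψ p.swap (1, 0) + G p * ψ p.swap) (J ×ˢ I)
  simp only [hd, Function.comp]
  refine Eq.trans ?_ e
  simp [hr]

theorem tsupport_comp_swap_subset {ψ : ℝ × ℝ → ℝ} {I J : Set ℝ} (hs : tsupport ψ ⊆ I ×ˢ J) :
    tsupport (ψ ∘ Prod.swap) ⊆ J ×ˢ I := by
  have : tsupport (ψ ∘ Prod.swap) = Prod.swap ⁻¹' tsupport ψ :=
    tsupport_comp_eq_preimage ψ (Homeomorph.prodComm ℝ ℝ)
  rw [this]
  exact fun p hp => (hs hp).symm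

theorem integrableOn_comp_swap {F : ℝ × ℝ → ℝ} {I J : Set ℝ} (hF : IntegrableOn F (J ×ˢ I)) :
    IntegrableOn (fun p => F p.swap) (I ×ˢ J) := by
  have hpre' : Prod.swap ⁻¹' (J ×ˢ I) = I ×ˢ J := by
    ext p; simp only [mem_preimage, mem_prod, Prod.fst_swap, Prod.snd_swap]; tauto
  have hmp : MeasurePreserving (Prod.swap : ℝ × ℝ → ℝ × ℝ) volume volume :=
    Measure.measurePreserving_swap
  rw [← hpre']
  exact (hmp.integrableOn_comp_preimage (Homeomorph.prodComm ℝ ℝ).measurableEmbedding).2 hF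

/-- The version of `lineAC_of_green` for lines in the second variable. -/
theorem lineAC_of_green_snd {α γ : ℝ} (hlt : α < γ) {J : Set ℝ} (hJ : IsOpen J)
    {F G : ℝ × ℝ → ℝ}
    (hF : IntegrableOn F (J ×ˢ Ioo α γ)) (hG : IntegrableOn G (J ×ˢ Ioo α γ))
    (hgreen : ∀ ψ : ℝ × ℝ → ℝ, ContDiff ℝ ∞ ψ → HasCompactSupport ψ → tsupport ψ ⊆ J ×ˢ Iio γ →
      ∫ p in J ×ˢ Ioo α γ, (F p * fderiv ℝ ψ p (0, 1) + G p * ψ p) = 0) :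
    ∀ᵐ z ∂(volume.restrict J),
      LineAC α γ (fun s => F (z, s)) (fun s => G (z, s)) 0 (∫ s in α..γ, G (z, s)) := by
  refine lineAC_of_green hlt hJ (integrableOn_comp_swap hF) (integrableOn_comp_swap hG) ?_
  intro ψ hψ hc hs
  rw [integral_green_swap]
  exact hgreen (ψ ∘ Prod.swap) (hψ.comp (contDiff_snd.prodMk contDiff_fst))
    (hc.comp_homeomorph (Homeomorph.prodComm ℝ ℝ)) (tsupport_comp_swap_subset hs)

/-- The version of `lineAC_of_green_right` for lines in the second variable. -/
theorem lineAC_of_green_snd_right {α γ : ℝ} (hlt : α < γ) {J : Set ℝ} (hJ : IsOpen J)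
    {F G : ℝ × ℝ → ℝ}
    (hF : IntegrableOn F (J ×ˢ Ioo α γ)) (hG : IntegrableOn G (J ×ˢ Ioo α γ))
    (hgreen : ∀ ψ : ℝ × ℝ → ℝ, ContDiff ℝ ∞ ψ → HasCompactSupport ψ → tsupport ψ ⊆ J ×ˢ Ioi α →
      ∫ p in J ×ˢ Ioo α γ, (F p * fderiv ℝ ψ p (0, 1) + G p * ψ p) = 0) :
    ∀ᵐ z ∂(volume.restrict J), ∃ p,
      LineAC α γ (fun s => F (z, s)) (fun s => G (z, s)) p 0 := by
  refine lineAC_of_green_right hlt hJ (integrableOn_comp_swap hF) (integrableOn_comp_swap hG) ?_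
  intro ψ hψ hc hs
  rw [integral_green_swap]
  exact hgreen (ψ ∘ Prod.swap) (hψ.comp (contDiff_snd.prodMk contDiff_fst))
    (hc.comp_homeomorph (Homeomorph.prodComm ℝ ℝ)) (tsupport_comp_swap_subset hs)

/-- Null sets of `(0, b)` can be detected on the compactly contained intervals. -/
theorem ae_Ioo_of_forall {b : ℝ} {P : ℝ → Prop}
    (h : ∀ c d, 0 < c → d < b → ∀ᵐ x ∂(volume.restrict (Ioo c d)), P x) :
    ∀ᵐ x ∂(volume.restrict (Ioo 0 b)), P x := by
  have : Ioo (0 : ℝ) b = ⋃ n : ℕ, Ioo (1 / ((n : ℝ) + 1)) (b - 1 / ((n : ℝ) + 1)) := by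
    ext x
    simp only [mem_iUnion, mem_Ioo]
    constructor
    · rintro ⟨h1, h2⟩
      obtain ⟨n, hn⟩ := exists_nat_one_div_lt (lt_min h1 (sub_pos.2 h2))
      exact ⟨n, hn.trans_le (min_le_left _ _), by linarith [hn.trans_le (min_le_right _ _)]⟩
    · rintro ⟨n, h1, h2⟩
      have : (0 : ℝ) < 1 / ((n : ℝ) + 1) := by positivity
      exact ⟨this.trans h1, by linarith⟩
  rw [this, ae_restrict_iUnion_iff]
  intro n
  have : (0 : ℝ) < 1 / ((n : ℝ) + 1) := by positivity
  exact h _ _ this (by linarith)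

theorem ae_Ioi_of_forall {P : ℝ → Prop}
    (h : ∀ c d, 0 < c → c < d → ∀ᵐ x ∂(volume.restrict (Ioo c d)), P x) :
    ∀ᵐ x ∂(volume.restrict (Ioi 0)), P x := by
  have : Ioi (0 : ℝ) = ⋃ n : ℕ, Ioo (1 / ((n : ℝ) + 2)) ((n : ℝ) + 2) := by
    ext x
    simp only [mem_iUnion, mem_Ioo, mem_Ioi]
    constructor
    · intro h1
      obtain ⟨n, hn⟩ := exists_nat_one_div_lt h1
      obtain ⟨m, hm⟩ := exists_nat_gt x
      refine ⟨max n m, lt_of_le_of_lt ?_ hn, ?_⟩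
      · apply one_div_le_one_div_of_le (by positivity)
        have : (n : ℝ) ≤ (max n m : ℕ) := by exact_mod_cast le_max_left _ _
        linarith
      · have : (m : ℝ) ≤ (max n m : ℕ) := by exact_mod_cast le_max_right _ _
        linarith
    · rintro ⟨n, h1, h2⟩
      have : (0 : ℝ) < 1 / ((n : ℝ) + 2) := by positivity
      exact this.trans h1
  rw [this, ae_restrict_iUnion_iff]
  intro n
  have h0 : (0 : ℝ) ≤ n := n.cast_nonneg
  refine h _ _ (by positivity) ?_
  rw [div_lt_iff₀ (by positivity)]
  nlinarith

/-! ### Local integrability away from the corners -/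

/-- Integrability on `Ω ∩ K` for all compact `K` which avoid the two corners of `Ω`. -/
def LocInt (L : ℝ) (h : ℝ × ℝ → ℝ) : Prop :=
  ∀ K : Set (ℝ × ℝ), IsCompact K → ((0 : ℝ), (0 : ℝ)) ∉ K → (L, (0 : ℝ)) ∉ K →
    IntegrableOn h (K ∩ Om L)

theorem volume_inter_Om_lt_top {L : ℝ} {K : Set (ℝ × ℝ)} (hK : IsCompact K) :
    volume (K ∩ Om L) < ⊤ :=
  (measure_mono inter_subset_left).trans_lt hK.measure_lt_top

theorem LocSqIntegrable.locInt {L : ℝ} {h : ℝ × ℝ → ℝ} (H : LocSqIntegrable L h) :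
    LocInt L h := fun K hK h0 hL => by
  have : IsFiniteMeasure (volume.restrict (K ∩ Om L)) :=
    ⟨by simpa using volume_inter_Om_lt_top hK⟩
  exact (H K hK h0 hL).integrable (by norm_num)

theorem LocSqIntegrable.mul {L : ℝ} {h k : ℝ × ℝ → ℝ} (H : LocSqIntegrable L h)
    (G : LocSqIntegrable L k) : LocInt L (fun p => h p * k p) :=
  fun K hK h0 hL => (H K hK h0 hL).integrable_mul (G K hK h0 hL)

theorem MemLp.locSq {L : ℝ} {h : ℝ × ℝ → ℝ} (H : MemLp h 2 (volume.restrict (Om L))) :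
    LocSqIntegrable L h :=
  fun _ _ _ _ => H.mono_measure (Measure.restrict_mono inter_subset_right le_rfl)

theorem LocHalfSobolev.locSq {L : ℝ} {h : ℝ × ℝ → ℝ} (H : LocHalfSobolev L h) :
    LocSqIntegrable L h := fun K hK _ _ => by
  obtain ⟨R, hR⟩ := (hK.image continuous_snd).bddAbove
  refine (H (max R 0 + 1) (by positivity)).1.mono_measure (Measure.restrict_mono ?_ le_rfl)
  rintro p ⟨hp, hp'⟩
  exact ⟨hp'.1, hp'.2, ((hR ⟨p, hp, rfl⟩).trans (le_max_left _ _)).trans_lt (lt_add_one _)⟩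

theorem LocSqIntegrable.add {L : ℝ} {h k : ℝ × ℝ → ℝ} (H : LocSqIntegrable L h)
    (G : LocSqIntegrable L k) : LocSqIntegrable L (fun p => h p + k p) :=
  fun K hK h0 hL => (H K hK h0 hL).add (G K hK h0 hL)

theorem LocSqIntegrable.sub {L : ℝ} {h k : ℝ × ℝ → ℝ} (H : LocSqIntegrable L h)
    (G : LocSqIntegrable L k) : LocSqIntegrable L (fun p => h p - k p) :=
  fun K hK h0 hL => (H K hK h0 hL).sub (G K hK h0 hL)

theorem LocSqIntegrable.const_mul {L : ℝ} {h : ℝ × ℝ → ℝ} (H : LocSqIntegrable L h) (c : ℝ) :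
    LocSqIntegrable L (fun p => c * h p) :=
  fun K hK h0 hL => (H K hK h0 hL).const_mul c

theorem LocInt.add {L : ℝ} {h k : ℝ × ℝ → ℝ} (H : LocInt L h) (G : LocInt L k) :
    LocInt L (fun p => h p + k p) := fun K hK h0 hL => (H K hK h0 hL).add (G K hK h0 hL)

theorem LocInt.sub {L : ℝ} {h k : ℝ × ℝ → ℝ} (H : LocInt L h) (G : LocInt L k) :
    LocInt L (fun p => h p - k p) := fun K hK h0 hL => (H K hK h0 hL).sub (G K hK h0 hL)

theorem LocInt.const_mul {L : ℝ} {h : ℝ × ℝ → ℝ} (H : LocInt L h) (c : ℝ) :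
    LocInt L (fun p => c * h p) := fun K hK h0 hL => (H K hK h0 hL).const_mul c

theorem LocInt.integrableOn_strip {L : ℝ} {h : ℝ × ℝ → ℝ} (H : LocInt L h) {c d : ℝ}
    (hc : 0 < c) : IntegrableOn h (Ioo 0 L ×ˢ Ioo c d) := by
  refine (H (Icc 0 L ×ˢ Icc c d) (isCompact_Icc.prod isCompact_Icc)
    (fun h => absurd h.2.1 (not_le.2 hc)) (fun h => absurd h.2.1 (not_le.2 hc))).mono_set ?_
  rintro p ⟨hx, hy⟩
  exact ⟨⟨Ioo_subset_Icc_self hx, Ioo_subset_Icc_self hy⟩, hx, hc.trans hy.1⟩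

theorem LocInt.integrableOn_column {L : ℝ} {h : ℝ × ℝ → ℝ} (H : LocInt L h) {c d R : ℝ}
    (hc : 0 < c) (hd : d < L) : IntegrableOn h (Ioo c d ×ˢ Ioo 0 R) := by
  refine (H (Icc c d ×ˢ Icc 0 R) (isCompact_Icc.prod isCompact_Icc)
    (fun h => absurd h.1.1 (not_le.2 hc)) (fun h => absurd h.1.2 (not_le.2 hd))).mono_set ?_
  rintro p ⟨hx, hy⟩
  exact ⟨⟨Ioo_subset_Icc_self hx, Ioo_subset_Icc_self hy⟩,
    ⟨hc.trans hx.1, hx.2.trans hd⟩, hy.1⟩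

/-! ### Absolute continuity of the solution on lines -/

theorem setIntegral_Om_eq {L : ℝ} {D : Set (ℝ × ℝ)} {g : ℝ × ℝ → ℝ} (hD : D ⊆ Om L)
    (h : ∀ p ∈ Om L, p ∉ D → g p = 0) : ∫ p in D, g p = ∫ p in Om L, g p :=
  (setIntegral_eq_of_subset_of_forall_sdiff_eq_zero (measurableSet_Om L) hD
    fun p hp => h p hp.1 hp.2).symm

theorem test_eq_zero {ψ : ℝ × ℝ → ℝ} {U : Set (ℝ × ℝ)} (hs : tsupport ψ ⊆ U) {p : ℝ × ℝ}
    (hp : p ∉ U) (e : ℝ × ℝ) : ψ p = 0 ∧ fderiv ℝ ψ p e = 0 := by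
  have h1 : p ∉ tsupport ψ := fun h => hp (hs h)
  refine ⟨image_eq_zero_of_notMem_tsupport h1, ?_⟩
  have : fderiv ℝ ψ p = 0 := by
    by_contra h
    exact h1 (support_fderiv_subset ℝ h)
  simp [this]

/-- The integrand of Green's formula. -/
def greenForm (e : ℝ × ℝ) (h he ψ : ℝ × ℝ → ℝ) (p : ℝ × ℝ) : ℝ :=
  h p * fderiv ℝ ψ p e + he p * ψ p

theorem greenForm_eq_zero {ψ h he : ℝ × ℝ → ℝ} {U : Set (ℝ × ℝ)} (hs : tsupport ψ ⊆ U)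
    {p : ℝ × ℝ} (hp : p ∉ U) (e : ℝ × ℝ) : greenForm e h he ψ p = 0 := by
  simp [greenForm, test_eq_zero hs hp e]

/-- Strips $c<y<d$ with $c>0$ stay away from both corners, so that the local integrability applies
on them, and countably many strips exhaust $\Omega$. -/
theorem lineAC_x_of_green {L : ℝ} (hL : 0 < L) {h hx : ℝ × ℝ → ℝ} (ih : LocInt L h)
    (ihx : LocInt L hx)
    (g : ∀ ψ : ℝ × ℝ → ℝ, ContDiff ℝ ∞ ψ → HasCompactSupport ψ → tsupport ψ ⊆ Iio L ×ˢ Ioi 0 →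
      ∫ p in Om L, greenForm (1, 0) h hx ψ p = 0) :
    ∀ᵐ y ∂(volume.restrict (Ioi 0)), LineAC 0 L (fun x => h (x, y)) (fun x => hx (x, y)) 0
      (∫ x in (0 : ℝ)..L, hx (x, y)) := by
  refine ae_Ioi_of_forall fun c d hc _ => ?_
  refine lineAC_of_green hL isOpen_Ioo (ih.integrableOn_strip hc) (ihx.integrableOn_strip hc) ?_
  intro ψ hψ hψc hs
  refine Eq.trans ?_ (g ψ hψ hψc (hs.trans (prod_mono subset_rfl fun y hy => hc.trans hy.1)))
  refine setIntegral_Om_eq (prod_mono subset_rfl fun y hy => hc.trans hy.1) fun p hp hp' => ?_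
  exact greenForm_eq_zero hs (fun h => hp' ⟨hp.1, h.2⟩) _

theorem lineAC_y_of_green {L : ℝ} {R : ℝ} (hR : 0 < R) {h hy : ℝ × ℝ → ℝ} (ih : LocInt L h)
    (ihy : LocInt L hy)
    (g : ∀ ψ : ℝ × ℝ → ℝ, ContDiff ℝ ∞ ψ → HasCompactSupport ψ → tsupport ψ ⊆ Ioo 0 L ×ˢ univ →
      ∫ p in Om L, greenForm (0, 1) h hy ψ p = 0) :
    ∀ᵐ x ∂(volume.restrict (Ioo 0 L)), LineAC 0 R (fun y => h (x, y)) (fun y => hy (x, y)) 0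
      (∫ y in (0 : ℝ)..R, hy (x, y)) := by
  refine ae_Ioo_of_forall fun c d hc hd => ?_
  refine lineAC_of_green_snd hR isOpen_Ioo (ih.integrableOn_column hc hd)
    (ihy.integrableOn_column hc hd) ?_
  intro ψ hψ hψc hs
  have hsub : Ioo c d ⊆ Ioo 0 L := Ioo_subset_Ioo hc.le hd.le
  refine Eq.trans ?_ (g ψ hψ hψc (hs.trans (prod_mono hsub (subset_univ _))))
  refine setIntegral_Om_eq (prod_mono hsub fun y hy => hy.1) fun p hp hp' => ?_
  exact greenForm_eq_zero hs (fun h => hp' ⟨h.1, hp.2, h.2⟩) _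

theorem LocInt.mul_test {L : ℝ} {k Φ : ℝ × ℝ → ℝ} {T : Set (ℝ × ℝ)} (hk : LocInt L k)
    (hT : IsCompact T) (h0 : ((0 : ℝ), (0 : ℝ)) ∉ T) (hL : (L, (0 : ℝ)) ∉ T)
    (hΦ : Continuous Φ) (hΦc : HasCompactSupport Φ) (hz : ∀ p, p ∉ T → Φ p = 0) :
    IntegrableOn (fun p => k p * Φ p) (Om L) := by
  have := IntegrableOn.mul_test (hk T hT h0 hL) hΦ hΦc
  refine this.of_forall_sdiff_eq_zero (measurableSet_Om L) fun p hp => ?_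
  rw [hz p fun h => hp.2 ⟨h, hp.1⟩, mul_zero]

theorem LocInt.integrableOn_greenForm {L : ℝ} {h he ψ : ℝ × ℝ → ℝ} (hh : LocInt L h)
    (hhe : LocInt L he) (hψ : ContDiff ℝ ∞ ψ) (hψc : HasCompactSupport ψ)
    (h0 : ((0 : ℝ), (0 : ℝ)) ∉ tsupport ψ) (hL : (L, (0 : ℝ)) ∉ tsupport ψ) (e : ℝ × ℝ) :
    IntegrableOn (fun p => h p * fderiv ℝ ψ p e) (Om L) ∧
      IntegrableOn (fun p => he p * ψ p) (Om L) :=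
  ⟨hh.mul_test hψc h0 hL (continuous_fderiv_apply hψ e) (hasCompactSupport_fderiv_apply hψc e)
      (fun _ hp => (test_eq_zero subset_rfl hp e).2),
    hhe.mul_test hψc h0 hL hψ.continuous hψc (fun _ hp => (test_eq_zero subset_rfl hp e).1)⟩

/-- The trace does not depend on $x$, so subtracting it from $h$ leaves the derivative unchanged and
removes the boundary term from Green's formula. Then `lineAC_of_green_right` applies to the
difference. -/
theorem HasTrace.lineAC {L : ℝ} (hL : 0 < L) {h hx : ℝ × ℝ → ℝ} {t : ℝ → ℝ}
    (H : HasTrace L h hx t) (ih : LocInt L h) (ihx : LocInt L hx) :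
    ∀ᵐ y ∂(volume.restrict (Ioi 0)), ∃ p,
      LineAC 0 L (fun x => h (x, y)) (fun x => hx (x, y)) p (t y) := by
  refine ae_Ioi_of_forall fun c d hc _ => ?_
  have hcd : Ioo c d ⊆ Ioi (0 : ℝ) := fun y hy => hc.trans hy.1
  have hts : IntegrableOn t (Ioo c d) :=
    (H.1.integrableOn_compact_subset (fun y hy => hc.trans_le hy.1) isCompact_Icc).mono_set
      Ioo_subset_Icc_self
  have hvol : (volume : Measure (ℝ × ℝ)).restrict (Ioo 0 L ×ˢ Ioo c d)
      = (volume.restrict (Ioo 0 L)).prod (volume.restrict (Ioo c d)) := by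
    rw [Measure.prod_restrict]; rfl
  have ht : IntegrableOn (fun p : ℝ × ℝ => t p.2) (Ioo 0 L ×ˢ Ioo c d) := by
    rw [IntegrableOn, hvol]; exact hts.integrable.comp_snd _
  have key := lineAC_of_green_right hL isOpen_Ioo ((ih.integrableOn_strip hc).sub ht)
    (ihx.integrableOn_strip hc) ?_
  · filter_upwards [key] with y ⟨p, hp⟩
    have := hp.add (LineAC.const (t y)) hL.le
    simp only [Pi.sub_apply, sub_add_cancel, add_zero, zero_add] at this
    exact ⟨_, this⟩
  · intro ψ hψ hψc hs
    have hs' : tsupport ψ ⊆ Ioi 0 ×ˢ Ioi 0 := hs.trans (prod_mono subset_rfl hcd)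
    have g1 : ∫ p in Ioo 0 L ×ˢ Ioo c d, greenForm (1, 0) h hx ψ p
        = ∫ y in Ioi 0, t y * ψ (L, y) := by
      refine Eq.trans ?_ (H.2 ψ hψ hψc hs')
      refine setIntegral_Om_eq (prod_mono subset_rfl hcd) fun p hp hp' => ?_
      exact greenForm_eq_zero hs (fun h => hp' ⟨hp.1, h.2⟩) _
    have g2 : ∫ y in Ioi 0, t y * ψ (L, y) = ∫ y in Ioo c d, t y * ψ (L, y) := by
      refine setIntegral_eq_of_subset_of_forall_sdiff_eq_zero measurableSet_Ioi hcd fun y hy => ?_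
      rw [(test_eq_zero hs (fun h => hy.2 h.2) (0 : ℝ × ℝ)).1, mul_zero]
    have hψd := continuous_fderiv_apply hψ (1, 0)
    have hψdc := hasCompactSupport_fderiv_apply hψc (1, 0)
    have i1 : IntegrableOn (greenForm (1, 0) h hx ψ) (Ioo 0 L ×ˢ Ioo c d) :=
      (IntegrableOn.mul_test (ih.integrableOn_strip hc) hψd hψdc).add
        (IntegrableOn.mul_test (ihx.integrableOn_strip hc) hψ.continuous hψc)
    have i2 : IntegrableOn (fun p : ℝ × ℝ => t p.2 * fderiv ℝ ψ p (1, 0))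
        (Ioo 0 L ×ˢ Ioo c d) := IntegrableOn.mul_test ht hψd hψdc
    have g3 : ∫ p in Ioo 0 L ×ˢ Ioo c d, t p.2 * fderiv ℝ ψ p (1, 0)
        = ∫ y in Ioo c d, t y * ψ (L, y) := by
      have i2' := i2.integrable
      rw [hvol] at i2' ⊢
      rw [integral_prod_symm _ i2']
      refine integral_congr_ae (ae_of_all _ fun y => ?_)
      simp only
      rw [integral_const_mul, ← integral_Ioc_eq_integral_Ioo,
        ← intervalIntegral.integral_of_le hL.le,
        intervalIntegral.integral_eq_sub_of_hasDerivAt (f := fun x => ψ (x, y))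
          (fun x _ => hasDerivAt_fst (hψ.differentiable (by simp)) (x, y))
          ((hψd.comp (Continuous.prodMk_left y)).intervalIntegrable _ _),
        (test_eq_zero hs (p := (0, y)) (fun h => lt_irrefl (0 : ℝ) h.1) (0 : ℝ × ℝ)).1, sub_zero]
    have : ∀ p : ℝ × ℝ, (h - fun p : ℝ × ℝ => t p.2) p * fderiv ℝ ψ p (1, 0) + hx p * ψ p
        = greenForm (1, 0) h hx ψ p - t p.2 * fderiv ℝ ψ p (1, 0) := by
      intro p; simp only [greenForm, Pi.sub_apply]; ring
    simp_rw [this]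
    rw [integral_sub i1 i2, g1, g2, g3, sub_self]

/-- No end value is prescribed here. Multiplication by a cut-off which is one below $R$ and zero
above $R+1$ creates a zero end value at $R+1$, and the product coincides with $h$ on $(0,R)$. -/
theorem WeakPartial.lineAC_y {L R : ℝ} (hR : 0 < R) {h hy : ℝ × ℝ → ℝ}
    (H : WeakPartial L (0, 1) h hy) (ih : LocInt L h) (ihy : LocInt L hy) :
    ∀ᵐ x ∂(volume.restrict (Ioo 0 L)), ∃ p q,
      LineAC 0 R (fun y => h (x, y)) (fun y => hy (x, y)) p q := by
  obtain ⟨ξ, hξ, hξ0, hξ1, hξb⟩ := exists_smooth_step (show R < R + 1 by linarith)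
  have hξd : Continuous (deriv ξ) := hξ.continuous_deriv (by simp)
  refine ae_Ioo_of_forall fun c d hc hd => ?_
  have hsub : Ioo c d ⊆ Ioo 0 L := Ioo_subset_Ioo hc.le hd.le
  have hbd : ∀ {k g : ℝ × ℝ → ℝ}, LocInt L k → Continuous g →
      IntegrableOn (fun p => g p * k p) (Ioo c d ×ˢ Ioo 0 (R + 1)) := by
    intro k g hk hg
    obtain ⟨C, hC⟩ := ((isCompact_Icc (a := c) (b := d)).prod
      (isCompact_Icc (a := (0 : ℝ)) (b := R + 1))).exists_bound_of_continuousOn hg.continuousOn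
    refine Integrable.bdd_mul (c := C) (hk.integrableOn_column hc hd) hg.aestronglyMeasurable ?_
    filter_upwards [ae_restrict_mem (measurableSet_Ioo.prod measurableSet_Ioo)] with p hp
    exact hC p ⟨Ioo_subset_Icc_self hp.1, Ioo_subset_Icc_self hp.2⟩
  have key := lineAC_of_green_snd_right (F := fun p => (1 - ξ p.2) * h p)
    (G := fun p => (1 - ξ p.2) * hy p + (-deriv ξ p.2) * h p)
    (show (0 : ℝ) < R + 1 by linarith) (isOpen_Ioo (a := c) (b := d))
    (hbd ih (by fun_prop)) ((hbd ihy (by fun_prop)).add (hbd ih (by fun_prop))) ?_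
  · filter_upwards [key] with x ⟨p, hp⟩
    refine ⟨p, _, ?_, ?_, rfl⟩
    · have h1 := hp.int.mono_set (c := 0) (d := R) (by
        rw [uIcc_of_le hR.le, uIcc_of_le (by linarith)]; exact Icc_subset_Icc_right (by linarith))
      refine h1.congr fun y hy' => ?_
      rw [uIoc_of_le hR.le] at hy'
      have h0 : ξ y = 0 := hξ0 _ hy'.2
      have h0' : deriv ξ y = 0 := by
        have : IsMinOn ξ univ y := fun z _ => by simp [h0, (hξb z).1]
        exact (this.isLocalMin univ_mem).deriv_eq_zero
      simp [h0, h0']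
    · have hsubR : Ioo 0 R ⊆ Ioo 0 (R + 1) := Ioo_subset_Ioo_right (by linarith)
      filter_upwards [ae_restrict_of_ae_restrict_of_subset hsubR hp.eq,
        ae_restrict_mem measurableSet_Ioo] with y hy1 hy2
      rw [hξ0 _ hy2.2.le, sub_zero, one_mul] at hy1
      rw [hy1]
      congr 1
      refine intervalIntegral.integral_congr fun z hz => ?_
      rw [uIcc_of_le hy2.1.le] at hz
      have h0 : ξ z = 0 := hξ0 _ (hz.2.trans hy2.2.le)
      have h0' : deriv ξ z = 0 := by
        have : IsMinOn ξ univ z := fun z _ => by simp [h0, (hξb z).1]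
        exact (this.isLocalMin univ_mem).deriv_eq_zero
      simp [h0, h0']
  · intro ψ hψ hψc hs
    set Ψ : ℝ × ℝ → ℝ := fun p => (1 - ξ p.2) * ψ p with hΨ
    have hθ : ContDiff ℝ ∞ (fun p : ℝ × ℝ => 1 - ξ p.2) :=
      contDiff_const.sub (hξ.comp contDiff_snd)
    have hΨs : ContDiff ℝ ∞ Ψ := hθ.mul hψ
    have hts : tsupport Ψ ⊆ tsupport ψ := tsupport_mul_subset_right
    have g := H.2.2 Ψ hΨs hψc.mul_left (hts.trans (hs.trans (prod_mono hsub subset_rfl)))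
    have hΨd : ∀ p, fderiv ℝ Ψ p (0, 1)
        = (1 - ξ p.2) * fderiv ℝ ψ p (0, 1) - deriv ξ p.2 * ψ p := by
      intro p
      refine (hasDerivAt_snd (hΨs.differentiable (by simp)) p).unique ?_
      have h1 : HasDerivAt (fun y => 1 - ξ y) (-deriv ξ p.2) p.2 :=
        ((hξ.differentiable (by simp) p.2).hasDerivAt).const_sub 1
      have := h1.mul (hasDerivAt_snd (hψ.differentiable (by simp)) p)
      rw [neg_mul, neg_add_eq_sub] at this
      exact this
    obtain ⟨i1, i2⟩ := ih.integrableOn_greenForm ihy hΨs hψc.mul_left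
      (fun h => lt_irrefl (0 : ℝ) (hs (hts h)).2) (fun h => lt_irrefl (0 : ℝ) (hs (hts h)).2) (0, 1)
    have hΨa : ∀ p, Ψ p = (1 - ξ p.2) * ψ p := fun _ => rfl
    rw [eq_neg_iff_add_eq_zero, ← integral_add i1 i2] at g
    refine Eq.trans ?_ g
    have hsub' : Ioo c d ×ˢ Ioo 0 (R + 1) ⊆ Om L := prod_mono hsub fun y hy => hy.1
    refine Eq.trans ?_ (setIntegral_Om_eq (D := Ioo c d ×ˢ Ioo 0 (R + 1)) hsub' fun p hp hp' => ?_)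
    · refine integral_congr_ae (ae_of_all _ fun p => ?_)
      simp only [hΨd, hΨa]; ring
    · by_cases hq : p.1 ∈ Ioo c d
      · have : R + 1 ≤ p.2 := by
          by_contra hlt
          exact hp' ⟨hq, hp.2, not_le.1 hlt⟩
        have hξe : 1 - ξ p.2 = 0 := by rw [hξ1 _ this, sub_self]
        have h0' : deriv ξ p.2 = 0 := by
          have : IsMaxOn ξ univ p.2 := fun z _ => by simp [hξ1 _ this, (hξb z).2]
          exact (this.isLocalMax univ_mem).deriv_eq_zero
        simp only [hΨd, hΨa, hξe, h0']; ring
      · have := test_eq_zero hs (p := p) (fun h => hq h.1) (0, 1)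
        simp only [hΨd, hΨa, this]; ring

/-! ### Green's formula up to the boundary -/

theorem tendsto_integral_mul_of_eLpNorm {X : Type*} [MeasurableSpace X] {μ : Measure X}
    {h g : X → ℝ} {φ : ℕ → X → ℝ} (hh : MemLp h 2 μ) (hφ : ∀ n, AEStronglyMeasurable (φ n) μ)
    (hg : MemLp g 2 μ) (H : Tendsto (fun n => eLpNorm (fun p => h p - φ n p) 2 μ) atTop (𝓝 0)) :
    Tendsto (fun n => ∫ p, φ n p * g p ∂μ) atTop (𝓝 (∫ p, h p * g p ∂μ)) := by
  have hb : ∀ n, eLpNorm ((fun p => φ n p * g p) - fun p => h p * g p) 1 μ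
      ≤ eLpNorm g 2 μ * eLpNorm (fun p => h p - φ n p) 2 μ := by
    intro n
    have h1 := eLpNorm_smul_le_mul_eLpNorm (p := 2) (q := 2) (r := 1)
      (hh.1.sub (hφ n)) hg.1
    refine le_trans (le_of_eq ?_) h1
    rw [← eLpNorm_neg]
    congr 1
    ext p
    simp only [Pi.neg_apply, Pi.sub_apply, Pi.smul_apply', smul_eq_mul]; ring
  have hlim : Tendsto (fun n => eLpNorm g 2 μ * eLpNorm (fun p => h p - φ n p) 2 μ) atTop (𝓝 0) := by
    have := ENNReal.Tendsto.const_mul H (a := eLpNorm g 2 μ) (Or.inr hg.2.ne)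
    simpa using this
  refine tendsto_integral_of_L1' _ (hh.1.mul hg.1) ?_
    (tendsto_of_tendsto_of_tendsto_of_le_of_le tendsto_const_nhds hlim (fun _ => zero_le) hb)
  have hfin := H.eventually (gt_mem_nhds (show (0 : ℝ≥0∞) < ⊤ by simp))
  filter_upwards [hfin] with n hn
  have h1 : MemLp (fun p => h p - φ n p) 2 μ := ⟨hh.1.sub (hφ n), hn⟩
  have h2 : MemLp (φ n) 2 μ := by
    have := hh.sub h1
    refine (memLp_congr_ae (ae_of_all _ fun p => ?_)).1 this
    simp
  exact h2.integrable_mul hg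

theorem memLp_of_eLpNorm_sub {X : Type*} [MeasurableSpace X] {μ : Measure X}
    {h : X → ℝ} {φ : ℕ → X → ℝ} (hh : AEStronglyMeasurable h μ) (hφ : ∀ n, MemLp (φ n) 2 μ)
    (H : Tendsto (fun n => eLpNorm (fun p => h p - φ n p) 2 μ) atTop (𝓝 0)) : MemLp h 2 μ := by
  obtain ⟨n, hn⟩ := (H.eventually (gt_mem_nhds (show (0 : ℝ≥0∞) < ⊤ by simp))).exists
  have h1 : MemLp (fun p => h p - φ n p) 2 μ := ⟨hh.sub (hφ n).1, hn⟩
  have := h1.add (hφ n)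
  refine (memLp_congr_ae (ae_of_all _ fun p => ?_)).1 this
  simp

/-- A component of a test field. -/
structure IsTestFn (φ : ℝ × ℝ → ℝ) : Prop where
  smooth : ContDiff ℝ ∞ φ
  supp : ∃ r a b : ℝ, 0 < r ∧ 0 < a ∧ ∀ p : ℝ × ℝ, (p.1 < r ∨ p.2 < a ∨ b < p.2) → φ p = 0

theorem IsTestFn.memLp {L : ℝ} {φ : ℝ × ℝ → ℝ} (h : IsTestFn φ) (e : ℝ × ℝ) :
    MemLp φ 2 (volume.restrict (Om L)) ∧
      MemLp (fun p => fderiv ℝ φ p e) 2 (volume.restrict (Om L)) := by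
  obtain ⟨r, a, b, -, -, hz⟩ := h.supp
  have key : ∀ ψ : ℝ × ℝ → ℝ, Continuous ψ → (∀ p : ℝ × ℝ, b < p.2 → ψ p = 0) →
      MemLp ψ 2 (volume.restrict (Om L)) := by
    intro ψ hψ hb
    set K : Set (ℝ × ℝ) := Icc 0 L ×ˢ Icc 0 b
    have hK : IsCompact K := isCompact_Icc.prod isCompact_Icc
    obtain ⟨C, hC⟩ := hK.exists_bound_of_continuousOn hψ.continuousOn
    have hi : MemLp (K.indicator fun _ => C) 2 (volume.restrict (Om L)) :=
      memLp_indicator_const 2 hK.measurableSet C (Or.inr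
        ((Measure.restrict_apply_le _ _).trans_lt hK.measure_lt_top).ne)
    refine hi.mono hψ.aestronglyMeasurable ?_
    filter_upwards [ae_restrict_mem (measurableSet_Om L)] with p hp
    by_cases hpb : b < p.2
    · simp [hb p hpb]
    · have hpK : p ∈ K := ⟨Ioo_subset_Icc_self hp.1, le_of_lt hp.2, not_lt.1 hpb⟩
      rw [indicator_of_mem hpK]
      exact (hC p hpK).trans (le_abs_self C)
  refine ⟨key _ h.smooth.continuous fun p hp => hz p (Or.inr (Or.inr hp)),
    key _ (continuous_fderiv_apply h.smooth e) fun p hp => ?_⟩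
  have : φ =ᶠ[𝓝 p] fun _ => 0 := by
    filter_upwards [(isOpen_lt continuous_const continuous_snd).mem_nhds hp] with q hq
    exact hz q (Or.inr (Or.inr hq))
  rw [this.fderiv_eq]; simp

/-- Green's formula for limits of test functions; the test function need not vanish at `x = 0`
and at `y = 0`. -/
theorem green_of_approx {L : ℝ} {h g : ℝ × ℝ → ℝ} {e : ℝ × ℝ} {φ : ℕ → ℝ × ℝ → ℝ}
    (hφ : ∀ n, IsTestFn (φ n)) (hh : MemLp h 2 (volume.restrict (Om L)))
    (hg : MemLp g 2 (volume.restrict (Om L)))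
    (H1 : Tendsto (fun n => eLpNorm (fun p => h p - φ n p) 2 (volume.restrict (Om L)))
      atTop (𝓝 0))
    (H2 : Tendsto (fun n => eLpNorm (fun p => g p - fderiv ℝ (φ n) p e) 2
      (volume.restrict (Om L))) atTop (𝓝 0))
    {ψ : ℝ × ℝ → ℝ} (hψ : ContDiff ℝ ∞ ψ) (hψc : HasCompactSupport ψ)
    (hs : tsupport ψ ⊆ Iio L ×ˢ univ) : ∫ p in Om L, greenForm e h g ψ p = 0 := by
  have hψe := continuous_fderiv_apply hψ e
  have hψec := hasCompactSupport_fderiv_apply hψc e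
  have m1 : MemLp (fun p => fderiv ℝ ψ p e) 2 (volume.restrict (Om L)) :=
    (hψe.memLp_of_hasCompactSupport hψec).restrict _
  have m2 : MemLp ψ 2 (volume.restrict (Om L)) :=
    (hψ.continuous.memLp_of_hasCompactSupport hψc).restrict _
  have t1 := tendsto_integral_mul_of_eLpNorm hh (fun n => ((hφ n).memLp e).1.1) m1 H1
  have t2 := tendsto_integral_mul_of_eLpNorm hg (fun n => ((hφ n).memLp e).2.1) m2 H2
  have t3 := t1.add t2
  have hz : ∀ n, (∫ p in Om L, φ n p * fderiv ℝ ψ p e)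
      + ∫ p in Om L, fderiv ℝ (φ n) p e * ψ p = 0 := by
    intro n
    obtain ⟨r, a, b, hr, ha, hz⟩ := (hφ n).supp
    have hd := (hφ n).smooth
    have hde := continuous_fderiv_apply hd e
    -- Outside $\Omega$ one factor always vanishes: the test field to the left of $x=L$, and $\psi$
    -- beyond. The formula over $\Omega$ is therefore the one over the whole plane.
    have z1 : ∀ p, p ∉ Om L → φ n p = 0 ∧ fderiv ℝ (φ n) p e = 0 ∨ ψ p = 0 ∧ fderiv ℝ ψ p e = 0 := by
      intro p hp
      by_cases h1 : p.1 < L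
      · left
        have h2 : p.1 < r ∨ p.2 < a := by
          by_contra hcon
          push Not at hcon
          exact hp ⟨⟨hr.trans_le hcon.1, h1⟩, ha.trans_le hcon.2⟩
        have : φ n =ᶠ[𝓝 p] fun _ => 0 := by
          rcases h2 with h2 | h2
          · filter_upwards [(isOpen_lt continuous_fst continuous_const).mem_nhds h2] with q hq
            exact hz q (Or.inl hq)
          · filter_upwards [(isOpen_lt continuous_snd continuous_const).mem_nhds h2] with q hq
            exact hz q (Or.inr (Or.inl hq))
        exact ⟨this.eq_of_nhds, by rw [this.fderiv_eq]; simp⟩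
      · right
        exact test_eq_zero hs (fun h => h1 h.1) e
    have hi1 := (hd.continuous.mul hψe).integrable_of_hasCompactSupport (μ := volume) hψec.mul_left
    have hi2 := (hde.mul hψ.continuous).integrable_of_hasCompactSupport (μ := volume) hψc.mul_left
    have hi3 := (hd.continuous.mul hψ.continuous).integrable_of_hasCompactSupport
      (μ := volume) hψc.mul_left
    have := integral_mul_fderiv_eq_neg_fderiv_mul_of_integrable (μ := volume) hi2 hi1 hi3
      (fun x _ => hd.differentiable (by simp) x) (fun x _ => hψ.differentiable (by simp) x)
    rw [setIntegral_eq_integral_of_forall_compl_eq_zero, setIntegral_eq_integral_of_forall_compl_eq_zero,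
      this, neg_add_cancel]
    · intro p hp
      rcases z1 p hp with h | h <;> simp [h]
    · intro p hp
      rcases z1 p hp with h | h <;> simp [h]
  simp only [hz] at t3
  have := tendsto_nhds_unique t3 tendsto_const_nhds
  simp only [greenForm]
  have i1 := (hh.integrable_mul m1)
  have i2 := (hg.integrable_mul m2)
  exact (integral_add i1 i2).trans this

/-- A weak derivative can be tested with functions which do not vanish near a part of the boundary,
as soon as there are cut-off functions whose derivative in the direction `e` vanishes. -/
theorem WeakPartial.green_of_cutoff {L : ℝ} {e : ℝ × ℝ} {h he : ℝ × ℝ → ℝ}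
    (H : WeakPartial L e h he) (ih : LocInt L h) (ihe : LocInt L he)
    {ψ : ℝ × ℝ → ℝ} (hψ : ContDiff ℝ ∞ ψ) (hψc : HasCompactSupport ψ)
    (h0 : ((0 : ℝ), (0 : ℝ)) ∉ tsupport ψ) (hL : (L, (0 : ℝ)) ∉ tsupport ψ)
    {θ : ℕ → ℝ × ℝ → ℝ} (hθ : ∀ n, ContDiff ℝ ∞ (θ n)) (hθe : ∀ n p, fderiv ℝ (θ n) p e = 0)
    (hθb : ∀ n p, |θ n p| ≤ 1) (hθ1 : ∀ p ∈ Om L, ∀ᶠ n in atTop, θ n p = 1)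
    (hθs : ∀ n, tsupport (θ n) ∩ tsupport ψ ⊆ Om L) :
    ∫ p in Om L, greenForm e h he ψ p = 0 := by
  obtain ⟨i1, i2⟩ := ih.integrableOn_greenForm ihe hψ hψc h0 hL e
  have i3 : Integrable (greenForm e h he ψ) (volume.restrict (Om L)) := i1.add i2
  have hz : ∀ n, ∫ p in Om L, θ n p * greenForm e h he ψ p = 0 := by
    intro n
    have hΨ : ContDiff ℝ ∞ (fun p => θ n p * ψ p) := (hθ n).mul hψ
    have hts : tsupport (fun p => θ n p * ψ p) ⊆ Om L :=
      (subset_inter tsupport_mul_subset_left tsupport_mul_subset_right).trans (hθs n)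
    have g := H.2.2 _ hΨ hψc.mul_left hts
    have hts' : tsupport (fun p => θ n p * ψ p) ⊆ tsupport ψ := tsupport_mul_subset_right
    obtain ⟨j1, j2⟩ := ih.integrableOn_greenForm ihe hΨ hψc.mul_left (fun h => h0 (hts' h))
      (fun h => hL (hts' h)) e
    rw [eq_neg_iff_add_eq_zero, ← integral_add j1 j2] at g
    rw [← g]
    refine integral_congr_ae (ae_of_all _ fun p => ?_)
    have hd : fderiv ℝ (fun p => θ n p * ψ p) p e = θ n p * fderiv ℝ ψ p e := by
      rw [fderiv_fun_mul ((hθ n).differentiable (by simp) p) (hψ.differentiable (by simp) p)]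
      simp [hθe]
    simp only [greenForm, hd]; ring
  -- The cut-offs are constant in the direction $e$, so no derivative of them appears and dominated
  -- convergence suffices.
  have t : Tendsto (fun n => ∫ p in Om L, θ n p * greenForm e h he ψ p) atTop
      (𝓝 (∫ p in Om L, greenForm e h he ψ p)) := by
    refine tendsto_integral_of_dominated_convergence (fun p => ‖greenForm e h he ψ p‖)
      (fun n => ((hθ n).continuous.aestronglyMeasurable).mul i3.1) i3.norm
      (fun n => ae_of_all _ fun p => ?_) ?_
    · rw [norm_mul]
      exact mul_le_of_le_one_left (norm_nonneg _) (hθb n p)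
    · filter_upwards [ae_restrict_mem (measurableSet_Om L)] with p hp
      refine tendsto_const_nhds.congr' ?_
      filter_upwards [hθ1 p hp] with n hn
      rw [hn, one_mul]
  simp only [hz] at t
  exact (tendsto_nhds_unique t tendsto_const_nhds)

theorem exists_step_seq : ∃ ξ : ℕ → ℝ → ℝ, (∀ n, ContDiff ℝ ∞ (ξ n)) ∧
    (∀ n t, |ξ n t| ≤ 1) ∧ (∀ t, 0 < t → ∀ᶠ n in atTop, ξ n t = 1) ∧
    (∀ n, ∃ c > 0, ∀ t, t ≤ c → ξ n t = 0) := by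
  obtain ⟨ξ, hξ, hξ0, hξ1, hξb⟩ := exists_smooth_step (show (1 : ℝ) < 2 by norm_num)
  refine ⟨fun n t => ξ ((n + 1) * t), fun n => hξ.comp (by fun_prop), fun n t => ?_,
    fun t ht => ?_, fun n => ⟨1 / (n + 1), by positivity, fun t ht => hξ0 _ ?_⟩⟩
  · rw [abs_of_nonneg (hξb _).1]; exact (hξb _).2
  · obtain ⟨m, hm⟩ := exists_nat_gt (2 / t)
    filter_upwards [eventually_ge_atTop m] with n hn
    refine hξ1 _ ?_
    rw [div_lt_iff₀ ht] at hm
    have : (m : ℝ) ≤ n := by exact_mod_cast hn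
    nlinarith
  · have : (0 : ℝ) < n + 1 := by positivity
    rw [le_div_iff₀ this] at ht
    linarith

/-- Test functions for `x`-derivatives need not vanish at `y = 0`. -/
theorem WeakPartial.green_bottom {L : ℝ} {h hx : ℝ × ℝ → ℝ}
    (H : WeakPartial L (1, 0) h hx) (ih : LocInt L h) (ihx : LocInt L hx)
    {ψ : ℝ × ℝ → ℝ} (hψ : ContDiff ℝ ∞ ψ) (hψc : HasCompactSupport ψ)
    (hs : tsupport ψ ⊆ Ioo 0 L ×ˢ univ) : ∫ p in Om L, greenForm (1, 0) h hx ψ p = 0 := by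
  obtain ⟨ξ, hξ, hξb, hξ1, hξ0⟩ := exists_step_seq
  refine H.green_of_cutoff ih ihx hψ hψc (fun h => lt_irrefl (0 : ℝ) (hs h).1.1)
    (fun h => lt_irrefl L (hs h).1.2) (θ := fun n p => ξ n p.2)
    (fun n => (hξ n).comp contDiff_snd) (fun n p => ?_) (fun n p => hξb n _)
    (fun p hp => hξ1 _ hp.2) (fun n => ?_)
  · exact fderiv_apply_fst (((hξ n).comp contDiff_snd).differentiable (by simp) p)
      (hasDerivAt_const p.1 (ξ n p.2))
  · obtain ⟨c, hc, h0⟩ := hξ0 n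
    rintro p ⟨hp1, hp2⟩
    refine ⟨(hs hp2).1, hc.trans_le ?_⟩
    refine closure_minimal (t := {p : ℝ × ℝ | c ≤ p.2}) (fun q hq => ?_)
      (isClosed_le continuous_const continuous_snd) hp1
    by_contra hlt
    exact hq (h0 _ (le_of_lt (not_le.1 hlt)))

/-- Test functions for `y`-derivatives need not vanish at `x = 0`. -/
theorem WeakPartial.green_left {L : ℝ} {h hy : ℝ × ℝ → ℝ}
    (H : WeakPartial L (0, 1) h hy) (ih : LocInt L h) (ihy : LocInt L hy)
    {ψ : ℝ × ℝ → ℝ} (hψ : ContDiff ℝ ∞ ψ) (hψc : HasCompactSupport ψ)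
    (hs : tsupport ψ ⊆ Iio L ×ˢ Ioi 0) : ∫ p in Om L, greenForm (0, 1) h hy ψ p = 0 := by
  obtain ⟨ξ, hξ, hξb, hξ1, hξ0⟩ := exists_step_seq
  refine H.green_of_cutoff ih ihy hψ hψc (fun h => lt_irrefl (0 : ℝ) (hs h).2)
    (fun h => lt_irrefl (0 : ℝ) (hs h).2) (θ := fun n p => ξ n p.1)
    (fun n => (hξ n).comp contDiff_fst) (fun n p => ?_) (fun n p => hξb n _)
    (fun p hp => hξ1 _ hp.1.1) (fun n => ?_)
  · have hd := ((hξ n).comp (contDiff_fst (E := ℝ) (F := ℝ))).differentiable (by simp)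
    exact (hasDerivAt_snd hd p).unique (hasDerivAt_const p.2 (ξ n p.1))
  · obtain ⟨c, hc, h0⟩ := hξ0 n
    rintro p ⟨hp1, hp2⟩
    refine ⟨⟨hc.trans_le ?_, (hs hp2).1⟩, (hs hp2).2⟩
    refine closure_minimal (t := {p : ℝ × ℝ | c ≤ p.1}) (fun q hq => ?_)
      (isClosed_le continuous_const continuous_fst) hp1
    by_contra hlt
    exact hq (h0 _ (le_of_lt (not_le.1 hlt)))

theorem fderiv_fderiv_comm {ψ : ℝ × ℝ → ℝ} (hψ : ContDiff ℝ ∞ ψ) (p e e' : ℝ × ℝ) :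
    fderiv ℝ (fun q => fderiv ℝ ψ q e) p e' = fderiv ℝ (fun q => fderiv ℝ ψ q e') p e := by
  have hd : DifferentiableAt ℝ (fderiv ℝ ψ) p :=
    (hψ.fderiv_right (m := ∞) (by simp)).differentiable (by simp) p
  have h := (hψ.contDiffAt (x := p)).isSymmSndFDerivAt (by
    rw [minSmoothness_of_isRCLikeNormedField]; exact WithTop.coe_le_coe.2 (le_top (a := (2 : ℕ∞))))
  rw [fderiv_clm_apply hd (differentiableAt_const _), fderiv_clm_apply hd (differentiableAt_const _)]
  simpa using h e' e

/-- If Green's formula holds for `u` in both directions, then the mixed derivatives of `u` satisfy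
the same formulas. -/
theorem green_mixed {L : ℝ} {u ux uy w : ℝ × ℝ → ℝ} {e e' : ℝ × ℝ}
    (iu : LocInt L u) (iux : LocInt L ux) (iuy : LocInt L uy) (iw : LocInt L w)
    {ψ : ℝ × ℝ → ℝ} (hψ : ContDiff ℝ ∞ ψ) (hψc : HasCompactSupport ψ)
    (h0 : ((0 : ℝ), (0 : ℝ)) ∉ tsupport ψ) (hL : (L, (0 : ℝ)) ∉ tsupport ψ)
    (g1 : ∫ p in Om L, greenForm e u ux (fun p => fderiv ℝ ψ p e') p = 0)
    (g2 : ∫ p in Om L, greenForm e' u uy (fun p => fderiv ℝ ψ p e) p = 0)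
    (g3 : ∫ p in Om L, greenForm e' ux w ψ p = 0) :
    ∫ p in Om L, greenForm e uy w ψ p = 0 := by
  have sm : ∀ a : ℝ × ℝ, ContDiff ℝ ∞ (fun p => fderiv ℝ ψ p a) := fun a =>
    (hψ.fderiv_right (m := ∞) (by simp)).clm_apply contDiff_const
  have ts : ∀ a : ℝ × ℝ, tsupport (fun p => fderiv ℝ ψ p a) ⊆ tsupport ψ := fun a =>
    tsupport_fderiv_apply_subset ℝ a
  obtain ⟨a1, a2⟩ := iu.integrableOn_greenForm iux (sm e') (hasCompactSupport_fderiv_apply hψc e')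
    (fun h => h0 (ts _ h)) (fun h => hL (ts _ h)) e
  obtain ⟨b1, b2⟩ := iu.integrableOn_greenForm iuy (sm e) (hasCompactSupport_fderiv_apply hψc e)
    (fun h => h0 (ts _ h)) (fun h => hL (ts _ h)) e'
  obtain ⟨c1, c2⟩ := iux.integrableOn_greenForm iw hψ hψc h0 hL e'
  obtain ⟨d1, d2⟩ := iuy.integrableOn_greenForm iw hψ hψc h0 hL e
  simp only [greenForm] at *
  rw [integral_add a1 a2] at g1
  rw [integral_add b1 b2] at g2
  rw [integral_add c1 c2] at g3
  rw [integral_add d1 d2]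
  -- Second derivatives of $\psi$ commute, so the first two formulas give $\int
  -- u_x\,\partial_{e'}\psi=\int u_y\,\partial_e\psi$. The third formula then becomes the claim.
  have : ∫ p in Om L, u p * fderiv ℝ (fun q => fderiv ℝ ψ q e') p e
      = ∫ p in Om L, u p * fderiv ℝ (fun q => fderiv ℝ ψ q e) p e' :=
    integral_congr_ae (ae_of_all _ fun p => by simp only [fderiv_fderiv_comm hψ p e' e])
  linarith

theorem WeakPartial.green {L : ℝ} {e : ℝ × ℝ} {h he : ℝ × ℝ → ℝ} (H : WeakPartial L e h he)
    (ih : LocInt L h) (ihe : LocInt L he) {ψ : ℝ × ℝ → ℝ} (hψ : ContDiff ℝ ∞ ψ)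
    (hψc : HasCompactSupport ψ) (hs : tsupport ψ ⊆ Om L) :
    ∫ p in Om L, greenForm e h he ψ p = 0 := by
  obtain ⟨i1, i2⟩ := ih.integrableOn_greenForm ihe hψ hψc (fun h => lt_irrefl (0 : ℝ) (hs h).2)
    (fun h => lt_irrefl (0 : ℝ) (hs h).2) e
  have := H.2.2 ψ hψ hψc hs
  rw [eq_neg_iff_add_eq_zero, ← integral_add i1 i2] at this
  exact this

/-- The mixed weak derivative does not depend on the order. -/
theorem WeakPartial.mixed {L : ℝ} {u ux uy w : ℝ × ℝ → ℝ} {e e' : ℝ × ℝ}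
    (Hx : WeakPartial L e u ux) (Hy : WeakPartial L e' u uy) (H : WeakPartial L e uy w)
    (iu : LocInt L u) (iux : LocInt L ux) (iuy : LocInt L uy) (iw : LocInt L w) :
    WeakPartial L e' ux w := by
  refine ⟨Hx.2.1, H.2.1, fun ψ hψ hψc hs => ?_⟩
  have n0 : ((0 : ℝ), (0 : ℝ)) ∉ tsupport ψ := fun h => lt_irrefl (0 : ℝ) (hs h).2
  have nL : (L, (0 : ℝ)) ∉ tsupport ψ := fun h => lt_irrefl (0 : ℝ) (hs h).2
  have sm : ∀ a : ℝ × ℝ, ContDiff ℝ ∞ (fun p => fderiv ℝ ψ p a) := fun a =>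
    (hψ.fderiv_right (m := ∞) (by simp)).clm_apply contDiff_const
  have ts : ∀ a : ℝ × ℝ, tsupport (fun p => fderiv ℝ ψ p a) ⊆ Om L := fun a =>
    (tsupport_fderiv_apply_subset ℝ a).trans hs
  have := green_mixed iu iuy iux iw hψ hψc n0 nL
    (Hy.green iu iuy (sm e) (hasCompactSupport_fderiv_apply hψc e) (ts e))
    (Hx.green iu iux (sm e') (hasCompactSupport_fderiv_apply hψc e') (ts e'))
    (H.green iuy iw hψ hψc hs)
  obtain ⟨i1, i2⟩ := iux.integrableOn_greenForm iw hψ hψc n0 nL e'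
  rw [eq_neg_iff_add_eq_zero, ← integral_add i1 i2]
  exact this

/-- Weak derivatives are unique. -/
theorem WeakPartial.ae_add_eq_zero {L : ℝ} {e : ℝ × ℝ} {h he k ke : ℝ × ℝ → ℝ}
    (H : WeakPartial L e h he) (K : WeakPartial L e k ke)
    (ih : LocInt L h) (ihe : LocInt L he) (ik : LocInt L k) (ike : LocInt L ke)
    (hk : ∀ᵐ p ∂(volume.restrict (Om L)), h p + k p = 0) :
    ∀ᵐ p ∂(volume.restrict (Om L)), he p + ke p = 0 := by
  have hl : LocallyIntegrableOn (fun p => he p + ke p) (Om L) := H.2.1.add K.2.1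
  rw [ae_restrict_iff' (measurableSet_Om L)]
  refine (isOpen_Om L).ae_eq_zero_of_integral_contDiff_smul_eq_zero hl fun ψ hψ hψc hs => ?_
  have n0 : ((0 : ℝ), (0 : ℝ)) ∉ tsupport ψ := fun h => lt_irrefl (0 : ℝ) (hs h).2
  have nL : (L, (0 : ℝ)) ∉ tsupport ψ := fun h => lt_irrefl (0 : ℝ) (hs h).2
  have g1 := H.green ih ihe hψ hψc hs
  have g2 := K.green ik ike hψ hψc hs
  obtain ⟨i1, i2⟩ := ih.integrableOn_greenForm ihe hψ hψc n0 nL e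
  obtain ⟨j1, j2⟩ := ik.integrableOn_greenForm ike hψ hψc n0 nL e
  simp only [greenForm] at g1 g2
  rw [integral_add i1 i2] at g1
  rw [integral_add j1 j2] at g2
  have e1 : (∫ p in Om L, h p * fderiv ℝ ψ p e) + ∫ p in Om L, k p * fderiv ℝ ψ p e = 0 := by
    rw [← integral_add i1 j1]
    refine integral_eq_zero_of_ae ?_
    filter_upwards [hk] with p hp
    rw [← add_mul, hp, zero_mul, Pi.zero_apply]
  have e2 : ∫ p, ψ p • (he p + ke p) = (∫ p in Om L, he p * ψ p) + ∫ p in Om L, ke p * ψ p := by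
    rw [← integral_add i2 j2, ← setIntegral_eq_integral_of_forall_compl_eq_zero (s := Om L)]
    · refine integral_congr_ae (ae_of_all _ fun p => ?_)
      simp only [smul_eq_mul]; ring
    · intro p hp
      rw [(test_eq_zero hs hp (0 : ℝ × ℝ)).1, zero_smul]
  rw [e2]; linarith

/-! ### The solution on lines -/

theorem ae_line_x {L : ℝ} {Q : ℝ × ℝ → Prop} (h : ∀ᵐ p ∂(volume.restrict (Om L)), Q p) :
    ∀ᵐ y ∂(volume.restrict (Ioi (0 : ℝ))), ∀ᵐ x ∂(volume.restrict (Ioo 0 L)), Q (x, y) := by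
  rw [volume_restrict_Om] at h
  exact Measure.ae_ae_of_ae_prod
    (Measure.measurePreserving_swap.quasiMeasurePreserving.ae h)

theorem ae_line_y {L : ℝ} {Q : ℝ × ℝ → Prop} (h : ∀ᵐ p ∂(volume.restrict (Om L)), Q p) :
    ∀ᵐ x ∂(volume.restrict (Ioo 0 L)), ∀ᵐ y ∂(volume.restrict (Ioi (0 : ℝ))), Q (x, y) := by
  rw [volume_restrict_Om] at h
  exact Measure.ae_ae_of_ae_prod h

/-- The regularity and the boundary conditions of a solution, expressed on almost all lines, the
relations between its derivatives, and its global square integrability. -/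
structure Remainder.Lines (L ε : ℝ) (aL bL τ : ℝ → ℝ) (S : Remainder) : Prop where
  x_u : ∀ᵐ y ∂(volume.restrict (Ioi (0 : ℝ))), ∃ q,
    LineAC 0 L (fun x => S.u (x, y)) (fun x => -S.vy (x, y)) 0 q
  x_v : ∀ᵐ y ∂(volume.restrict (Ioi (0 : ℝ))),
    LineAC 0 L (fun x => S.v (x, y)) (fun x => S.vx (x, y)) 0 (∫ x in (0 : ℝ)..L, S.vx (x, y))
  x_vy : ∀ᵐ y ∂(volume.restrict (Ioi (0 : ℝ))),
    LineAC 0 L (fun x => S.vy (x, y)) (fun x => S.vxy (x, y)) 0 (τ y)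
  x_uy : ∀ᵐ y ∂(volume.restrict (Ioi (0 : ℝ))), ∃ q,
    LineAC 0 L (fun x => S.uy (x, y)) (fun x => S.uxy (x, y)) 0 q
  x_B : ∀ᵐ y ∂(volume.restrict (Ioi (0 : ℝ))), ∃ p,
    LineAC 0 L (fun x => S.uy (x, y) + ε * S.vx (x, y)) (fun x => S.uxy (x, y) + ε * S.vxx (x, y))
      p (bL y)
  x_P : ∀ᵐ y ∂(volume.restrict (Ioi (0 : ℝ))), ∃ p,
    LineAC 0 L (fun x => S.P (x, y)) (fun x => S.Px (x, y)) p (aL y - 2 * ε * τ y)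
  y_v : ∀ R, 0 < R → ∀ᵐ x ∂(volume.restrict (Ioo 0 L)), ∃ q,
    LineAC 0 R (fun y => S.v (x, y)) (fun y => S.vy (x, y)) 0 q
  y_vy : ∀ R, 0 < R → ∀ᵐ x ∂(volume.restrict (Ioo 0 L)), ∃ q,
    LineAC 0 R (fun y => S.vy (x, y)) (fun y => S.vyy (x, y)) 0 q
  y_vx : ∀ R, 0 < R → ∀ᵐ x ∂(volume.restrict (Ioo 0 L)), ∃ q,
    LineAC 0 R (fun y => S.vx (x, y)) (fun y => S.vxy (x, y)) 0 q
  y_uy : ∀ R, 0 < R → ∀ᵐ x ∂(volume.restrict (Ioo 0 L)), ∃ p q,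
    LineAC 0 R (fun y => S.uy (x, y)) (fun y => S.uyy (x, y)) p q
  y_P : ∀ R, 0 < R → ∀ᵐ x ∂(volume.restrict (Ioo 0 L)), ∃ p q,
    LineAC 0 R (fun y => S.P (x, y)) (fun y => S.Py (x, y)) p q
  rel_x : ∀ᵐ p ∂(volume.restrict (Om L)), S.ux p + S.vy p = 0
  rel_xx : ∀ᵐ p ∂(volume.restrict (Om L)), S.uxx p + S.vxy p = 0
  rel_xy : ∀ᵐ p ∂(volume.restrict (Om L)), S.uxy p + S.vyy p = 0
  u_L2 : MemLp S.u 2 (volume.restrict (Om L))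
  v_L2 : MemLp S.v 2 (volume.restrict (Om L))
  uy_L2 : MemLp S.uy 2 (volume.restrict (Om L))
  vx_L2 : MemLp S.vx 2 (volume.restrict (Om L))
  vy_L2 : MemLp S.vy 2 (volume.restrict (Om L))
  τ_L2 : MemLp τ 2 (volume.restrict (Ioi 0))

theorem tsupport_fderiv_apply_subset' {ψ : ℝ × ℝ → ℝ} {U : Set (ℝ × ℝ)} (hs : tsupport ψ ⊆ U)
    (e : ℝ × ℝ) : tsupport (fun p => fderiv ℝ ψ p e) ⊆ U :=
  (tsupport_fderiv_apply_subset ℝ e).trans hs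

theorem contDiff_fderiv_apply {ψ : ℝ × ℝ → ℝ} (hψ : ContDiff ℝ ∞ ψ) (e : ℝ × ℝ) :
    ContDiff ℝ ∞ (fun p => fderiv ℝ ψ p e) :=
  (hψ.fderiv_right (m := ∞) (by simp)).clm_apply contDiff_const

/-- As limits of test fields, $u$ and $v$ satisfy Green's formulas with test functions that need not
vanish at $x=0$ and $y=0$. By `green_mixed` the derivatives tangential to a side inherit the
vanishing: $u_y,v_y$ at $x=0$ and $u_x,v_x$ at $y=0$, hence also $v_y=-u_x$ there. At $x=L$ the
stress conditions give the end values of $B$ and of $P$, the latter after replacing $u_x$ by $-v_y$.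
-/
theorem Remainder.IsSolution.lines {L ε : ℝ} {us vs f g : ℝ × ℝ → ℝ} {aL bL τ : ℝ → ℝ}
    {S : Remainder} (hL : 0 < L) (H : S.IsSolution L ε us vs f g aL bL)
    (Hτ : HasTrace L S.vy S.vxy τ) : S.Lines L ε aL bL τ := by
  obtain ⟨φ, ϕ, hT, cu, cv, cuy, cvy, cvx⟩ := H.memX.memX0
  have hφ : ∀ n, IsTestFn (φ n) := fun n => by
    obtain ⟨h1, -, ⟨r, a, b, hr, ha, hz⟩, -⟩ := hT n
    exact ⟨h1, r, a, b, hr, ha, fun p hp => (hz p hp).1⟩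
  have hϕ : ∀ n, IsTestFn (ϕ n) := fun n => by
    obtain ⟨-, h1, ⟨r, a, b, hr, ha, hz⟩, -⟩ := hT n
    exact ⟨h1, r, a, b, hr, ha, fun p hp => (hz p hp).2⟩
  have u_L2 : MemLp S.u 2 (volume.restrict (Om L)) :=
    memLp_of_eLpNorm_sub H.jet.ux.1.aestronglyMeasurable (fun n => ((hφ n).memLp 0).1) cu
  have v_L2 : MemLp S.v 2 (volume.restrict (Om L)) :=
    memLp_of_eLpNorm_sub H.jet.vx.1.aestronglyMeasurable (fun n => ((hϕ n).memLp 0).1) cv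
  have uy_L2 : MemLp S.uy 2 (volume.restrict (Om L)) :=
    memLp_of_eLpNorm_sub H.jet.uy.2.1.aestronglyMeasurable (fun n => ((hφ n).memLp (0, 1)).2) cuy
  have vx_L2 := H.memX.vx
  have vy_L2 := H.memX.vy
  have ux_L2 : MemLp S.ux 2 (volume.restrict (Om L)) := by
    refine (memLp_congr_ae ?_).1 vy_L2.neg
    filter_upwards [H.divFree] with p hp
    rw [Pi.neg_apply]; linarith
  -- The norm defining the closure does not contain $u_x$. Its convergence is that of $v_y$, because
  -- both the solution and the test fields are divergence free.
  have cux : Tendsto (fun n => eLpNorm (fun p => S.ux p - fderiv ℝ (φ n) p (1, 0)) 2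
      (volume.restrict (Om L))) atTop (𝓝 0) := by
    refine cvy.congr fun n => ?_
    rw [← eLpNorm_neg]
    refine eLpNorm_congr_ae ?_
    filter_upwards [H.divFree, ae_restrict_mem (measurableSet_Om L)] with p hp hm
    have := (hT n).2.2.2 p hm
    rw [Pi.neg_apply]; linarith
  have iu := (MemLp.locSq u_L2).locInt
  have iv := (MemLp.locSq v_L2).locInt
  have iuy := (MemLp.locSq uy_L2).locInt
  have iux := (MemLp.locSq ux_L2).locInt
  have ivx := (MemLp.locSq vx_L2).locInt
  have ivy := (MemLp.locSq vy_L2).locInt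
  have iP := H.strong.P_half.locSq.locInt
  have iuxx := H.strong.uxx.locInt
  have iuxy := H.strong.uxy.locInt
  have iuyy := H.strong.uyy.locInt
  have ivxx := H.strong.vxx.locInt
  have ivxy := H.strong.vxy.locInt
  have ivyy := H.strong.vyy.locInt
  have iPx := H.strong.Px.locInt
  have iPy := H.strong.Py.locInt
  have rel_xx := H.jet.uxx.ae_add_eq_zero H.jet.vxy iux iuxx ivy ivxy H.divFree
  have wuxy : WeakPartial L (0, 1) S.ux S.uxy :=
    H.jet.ux.mixed H.jet.uy H.jet.uxy iu iux iuy iuxy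
  have wvxy : WeakPartial L (0, 1) S.vx S.vxy :=
    H.jet.vx.mixed H.jet.vy H.jet.vxy iv ivx ivy ivxy
  have rel_xy := wuxy.ae_add_eq_zero H.jet.vyy iux iuxy ivy ivyy H.divFree
  have gux : ∀ {ψ : ℝ × ℝ → ℝ}, ContDiff ℝ ∞ ψ → HasCompactSupport ψ →
      tsupport ψ ⊆ Iio L ×ˢ univ → ∫ p in Om L, greenForm (1, 0) S.u S.ux ψ p = 0 :=
    fun h1 h2 h3 => green_of_approx hφ u_L2 ux_L2 cu cux h1 h2 h3
  have guy : ∀ {ψ : ℝ × ℝ → ℝ}, ContDiff ℝ ∞ ψ → HasCompactSupport ψ →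
      tsupport ψ ⊆ Iio L ×ˢ univ → ∫ p in Om L, greenForm (0, 1) S.u S.uy ψ p = 0 :=
    fun h1 h2 h3 => green_of_approx hφ u_L2 uy_L2 cu cuy h1 h2 h3
  have gvx : ∀ {ψ : ℝ × ℝ → ℝ}, ContDiff ℝ ∞ ψ → HasCompactSupport ψ →
      tsupport ψ ⊆ Iio L ×ˢ univ → ∫ p in Om L, greenForm (1, 0) S.v S.vx ψ p = 0 :=
    fun h1 h2 h3 => green_of_approx hϕ v_L2 vx_L2 cv cvx h1 h2 h3
  have gvy : ∀ {ψ : ℝ × ℝ → ℝ}, ContDiff ℝ ∞ ψ → HasCompactSupport ψ →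
      tsupport ψ ⊆ Iio L ×ˢ univ → ∫ p in Om L, greenForm (0, 1) S.v S.vy ψ p = 0 :=
    fun h1 h2 h3 => green_of_approx hϕ v_L2 vy_L2 cv cvy h1 h2 h3
  have sL : Iio L ×ˢ Ioi (0 : ℝ) ⊆ Iio L ×ˢ univ := prod_mono subset_rfl (subset_univ _)
  have sB : Ioo 0 L ×ˢ (univ : Set ℝ) ⊆ Iio L ×ˢ univ := prod_mono (fun _ h => h.2) subset_rfl
  have nL : ∀ {ψ : ℝ × ℝ → ℝ}, tsupport ψ ⊆ Iio L ×ˢ Ioi 0 →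
      ((0 : ℝ), (0 : ℝ)) ∉ tsupport ψ ∧ (L, (0 : ℝ)) ∉ tsupport ψ := fun hs =>
    ⟨fun h => lt_irrefl (0 : ℝ) (hs h).2, fun h => lt_irrefl (0 : ℝ) (hs h).2⟩
  have nB : ∀ {ψ : ℝ × ℝ → ℝ}, tsupport ψ ⊆ Ioo 0 L ×ˢ univ →
      ((0 : ℝ), (0 : ℝ)) ∉ tsupport ψ ∧ (L, (0 : ℝ)) ∉ tsupport ψ := fun hs =>
    ⟨fun h => lt_irrefl (0 : ℝ) (hs h).1.1, fun h => lt_irrefl L (hs h).1.2⟩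
  have x_vy : ∀ᵐ y ∂(volume.restrict (Ioi (0 : ℝ))),
      LineAC 0 L (fun x => S.vy (x, y)) (fun x => S.vxy (x, y)) 0 (τ y) := by
    have h1 := lineAC_x_of_green hL ivy ivxy fun ψ hψ hψc hs =>
      green_mixed iv ivx ivy ivxy hψ hψc (nL hs).1 (nL hs).2
        (gvx (contDiff_fderiv_apply hψ (0, 1)) (hasCompactSupport_fderiv_apply hψc _)
          ((tsupport_fderiv_apply_subset' hs _).trans sL))
        (gvy (contDiff_fderiv_apply hψ (1, 0)) (hasCompactSupport_fderiv_apply hψc _)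
          ((tsupport_fderiv_apply_subset' hs _).trans sL))
        (wvxy.green_left ivx ivxy hψ hψc hs)
    filter_upwards [h1, Hτ.lineAC hL ivy ivxy] with y hy1 ⟨p, hy2⟩
    rw [← (hy1.unique hy2 hL).2]
    exact hy1
  have y_ux : ∀ R, 0 < R → ∀ᵐ x ∂(volume.restrict (Ioo 0 L)), ∃ q,
      LineAC 0 R (fun y => S.ux (x, y)) (fun y => S.uxy (x, y)) 0 q := by
    intro R hR
    have h1 := lineAC_y_of_green hR iux iuxy fun ψ hψ hψc hs =>
      green_mixed iu iuy iux iuxy hψ hψc (nB hs).1 (nB hs).2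
        (guy (contDiff_fderiv_apply hψ (1, 0)) (hasCompactSupport_fderiv_apply hψc _)
          ((tsupport_fderiv_apply_subset' hs _).trans sB))
        (gux (contDiff_fderiv_apply hψ (0, 1)) (hasCompactSupport_fderiv_apply hψc _)
          ((tsupport_fderiv_apply_subset' hs _).trans sB))
        (H.jet.uxy.green_bottom iuy iuxy hψ hψc hs)
    filter_upwards [h1] with x hx using ⟨_, hx⟩
  have hsubR : ∀ R : ℝ, Ioo 0 R ⊆ Ioi 0 := fun R y hy => hy.1
  refine ⟨?_, ?_, x_vy, ?_, ?_, ?_, ?_, ?_, ?_, ?_, ?_, H.divFree, rel_xx, rel_xy,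
    u_L2, v_L2, uy_L2, vx_L2, vy_L2, ?_⟩
  · have h1 := lineAC_x_of_green hL iu iux fun ψ hψ hψc hs => gux hψ hψc (hs.trans sL)
    filter_upwards [h1, ae_line_x H.divFree] with y hy hd
    refine ⟨_, hy.congr hL.le (ae_of_all _ fun _ => rfl) ?_⟩
    filter_upwards [hd] with x hx
    linarith
  · exact lineAC_x_of_green hL iv ivx fun ψ hψ hψc hs => gvx hψ hψc (hs.trans sL)
  · have h1 := lineAC_x_of_green hL iuy iuxy fun ψ hψ hψc hs =>
      green_mixed iu iux iuy iuxy hψ hψc (nL hs).1 (nL hs).2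
        (gux (contDiff_fderiv_apply hψ (0, 1)) (hasCompactSupport_fderiv_apply hψc _)
          ((tsupport_fderiv_apply_subset' hs _).trans sL))
        (guy (contDiff_fderiv_apply hψ (1, 0)) (hasCompactSupport_fderiv_apply hψc _)
          ((tsupport_fderiv_apply_subset' hs _).trans sL))
        (wuxy.green_left iux iuxy hψ hψc hs)
    filter_upwards [h1] with y hy using ⟨_, hy⟩
  · exact H.stress_tangential.lineAC hL (iuy.add (ivx.const_mul ε)) (iuxy.add (ivxx.const_mul ε))
  · have h1 := H.stress_normal.lineAC hL (iP.sub (iux.const_mul (2 * ε)))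
      (iPx.sub (iuxx.const_mul (2 * ε)))
    filter_upwards [h1, x_vy, ae_line_x H.divFree, ae_line_x rel_xx] with y ⟨p, h1⟩ h2 h3 h4
    have h5 := h1.sub (h2.const_mul (2 * ε)) hL.le
    refine ⟨_, h5.congr hL.le ?_ ?_⟩
    · filter_upwards [h3] with x hx
      linear_combination (2 * ε) * hx
    · filter_upwards [h4] with x hx
      linear_combination (2 * ε) * hx
  · intro R hR
    have h1 := lineAC_y_of_green hR iv ivy fun ψ hψ hψc hs => gvy hψ hψc (hs.trans sB)
    filter_upwards [h1] with x hx using ⟨_, hx⟩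
  · intro R hR
    filter_upwards [y_ux R hR, ae_line_y H.divFree, ae_line_y rel_xy] with x ⟨q, h1⟩ h2 h3
    have h4 := h1.const_mul (-1)
    rw [mul_zero] at h4
    refine ⟨_, h4.congr hR.le ?_ ?_⟩
    · filter_upwards [ae_restrict_of_ae_restrict_of_subset (hsubR R) h2] with y hy
      linarith
    · filter_upwards [ae_restrict_of_ae_restrict_of_subset (hsubR R) h3] with y hy
      linarith
  · intro R hR
    have h1 := lineAC_y_of_green hR ivx ivxy fun ψ hψ hψc hs =>
      green_mixed iv ivy ivx ivxy hψ hψc (nB hs).1 (nB hs).2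
        (gvy (contDiff_fderiv_apply hψ (1, 0)) (hasCompactSupport_fderiv_apply hψc _)
          ((tsupport_fderiv_apply_subset' hs _).trans sB))
        (gvx (contDiff_fderiv_apply hψ (0, 1)) (hasCompactSupport_fderiv_apply hψc _)
          ((tsupport_fderiv_apply_subset' hs _).trans sB))
        (H.jet.vxy.green_bottom ivy ivxy hψ hψc hs)
    filter_upwards [h1] with x hx using ⟨_, hx⟩
  · exact fun R hR => H.jet.uyy.lineAC_y hR iuy iuyy
  · exact fun R hR => H.jet.Py.lineAC_y hR iP iPy
  -- The space $\mathcal X$ provides a square integrable trace of $u_x$. By uniqueness of end values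
  -- it equals $-\tau$.
  · obtain ⟨t, ht, -, ht2⟩ := H.memX.ux_trace
    refine (memLp_congr_ae ?_).1 ht2.neg
    filter_upwards [ht.lineAC hL iux iuxx, x_vy, ae_line_x H.divFree, ae_line_x rel_xx]
      with y ⟨p, h1⟩ h2 h3 h4
    have h5 := (h1.const_mul (-1)).congr hL.le (H₁ := fun x => S.vy (x, y))
      (H₁' := fun x => S.vxy (x, y)) (by filter_upwards [h3] with x hx; linarith)
      (by filter_upwards [h4] with x hx; linarith)
    rw [Pi.neg_apply, ← (h5.unique h2 hL).2]; ring

/-! ### Decay at the corners -/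

theorem tendsto_zero_of_contraction {x g : ℕ → ℝ} (hx : ∀ n, 0 ≤ x n) (hg : Tendsto g atTop (𝓝 0))
    (h : ∀ n, x (n + 1) ≤ 3 / 4 * x n + g n) : Tendsto x atTop (𝓝 0) := by
  rw [Metric.tendsto_atTop]
  intro ε hε
  obtain ⟨N, hN⟩ := (Metric.tendsto_atTop.1 hg) (ε / 8) (by positivity)
  -- Once $g\le\varepsilon/8$, the affine map has the fixed point
  -- $\frac34\cdot\frac\varepsilon2+\frac\varepsilon8=\frac\varepsilon2$.
  have h1 : ∀ k, x (N + k) ≤ (3 / 4) ^ k * x N + ε / 2 := by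
    intro k
    induction k with
    | zero => simp; positivity
    | succ k ih =>
      have h2 := h (N + k)
      have h3 := hN (N + k) (by omega)
      rw [Real.dist_eq, sub_zero] at h3
      have h4 := (abs_lt.1 h3).2
      rw [← add_assoc, pow_succ]
      linarith
  have h5 : Tendsto (fun k : ℕ => (3 / 4 : ℝ) ^ k * x N) atTop (𝓝 0) := by
    have := (tendsto_pow_atTop_nhds_zero_of_lt_one (r := (3 / 4 : ℝ)) (by norm_num)
      (by norm_num)).mul_const (x N)
    simpa using this
  obtain ⟨K, hK⟩ := (Metric.tendsto_atTop.1 h5) (ε / 2) (by positivity)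
  refine ⟨N + K, fun n hn => ?_⟩
  obtain ⟨k, rfl⟩ := Nat.exists_eq_add_of_le (show N ≤ n by omega)
  have h6 := hK k (by omega)
  rw [Real.dist_eq, sub_zero] at h6 ⊢
  rw [abs_of_nonneg (hx _)]
  linarith [h1 k, (abs_lt.1 h6).2]

/-- For functions in `H^{1/2}`, the mean of `h²` over squares shrinking to a corner is of smaller
order than the inverse of the side length. -/
theorem corner_decay {h : ℝ × ℝ → ℝ} {L : ℝ} (hL : 0 < L) {Q : ℕ → Set (ℝ × ℝ)}
    (hQm : ∀ n, MeasurableSet (Q n)) (hQ : ∀ n, Q (n + 1) ⊆ Q n)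
    (hvol : ∀ n, volume (Q n) = ENNReal.ofReal ((L / 2 ^ n) ^ 2))
    (hdist : ∀ n, ∀ p ∈ Q n, ∀ q ∈ Q n, dist p q ≤ L / 2 ^ n)
    (h2 : MemLp h 2 (volume.restrict (Q 0)))
    (hG : ∫⁻ p in Q 0, ∫⁻ q in Q 0, ENNReal.ofReal ((h p - h q) ^ 2 / dist p q ^ 3) < ⊤) :
    Tendsto (fun n : ℕ => 2 ^ n * ∫ p in Q n, h p ^ 2) atTop (𝓝 0) := by
  have hQ0 : ∀ n, Q n ⊆ Q 0 := fun n => by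
    induction n with
    | zero => exact subset_rfl
    | succ n ih => exact (hQ n).trans ih
  set Φ : ℝ × ℝ → ℝ × ℝ → ℝ≥0∞ := fun p q => ENNReal.ofReal ((h p - h q) ^ 2 / dist p q ^ 3)
  set J : ℕ → ℝ≥0∞ := fun n => ∫⁻ p in Q n, ENNReal.ofReal (h p ^ 2)
  set G : ℕ → ℝ≥0∞ := fun n => ∫⁻ p in Q n, ∫⁻ q in Q 0, Φ p q
  have hGlim : Tendsto G atTop (𝓝 0) := by
    have hv : Tendsto ((volume.restrict (Q 0)) ∘ Q) atTop (𝓝 0) := by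
      have e : ∀ n, (volume.restrict (Q 0)) (Q n) = ENNReal.ofReal ((L / 2 ^ n) ^ 2) := fun n => by
        rw [Measure.restrict_apply (hQm n), inter_eq_left.2 (hQ0 n), hvol]
      have : Tendsto (fun n : ℕ => ENNReal.ofReal ((L / 2 ^ n) ^ 2)) atTop (𝓝 (ENNReal.ofReal 0)) := by
        refine ENNReal.tendsto_ofReal ?_
        have h1 : Tendsto (fun n : ℕ => L * (1 / 2 : ℝ) ^ n) atTop (𝓝 (L * 0)) :=
          (tendsto_pow_atTop_nhds_zero_of_lt_one (by norm_num) (by norm_num)).const_mul L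
        have h3 := h1.pow 2
        simp only [mul_zero, ne_eq, OfNat.ofNat_ne_zero, not_false_eq_true, zero_pow] at h3
        refine h3.congr fun n => ?_
        rw [one_div, inv_pow, div_eq_mul_inv]
      rw [ENNReal.ofReal_zero] at this
      exact this.congr fun n => (e n).symm
    have := tendsto_setLIntegral_zero hG.ne hv
    refine this.congr fun n => ?_
    simp only [G]
    rw [Measure.restrict_restrict (hQm n), inter_eq_left.2 (hQ0 n)]
  have hGfin : ∀ n, G n ≠ ⊤ := fun n =>
    ((lintegral_mono_set (hQ0 n)).trans_lt hG).ne
  have hJ : ∀ n, J n = ENNReal.ofReal (∫ p in Q n, h p ^ 2) := fun n => by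
    rw [ofReal_integral_eq_lintegral_ofReal]
    · exact (h2.mono_measure (Measure.restrict_mono (hQ0 n) le_rfl)).integrable_sq
    · exact ae_of_all _ fun _ => sq_nonneg _
  have hJfin : ∀ n, J n ≠ ⊤ := fun n => by rw [hJ]; exact ENNReal.ofReal_ne_top
  -- Average $h(p)^2\le\frac32h(q)^2+3(h(p)-h(q))^2$ over $q$ in the larger square and integrate
  -- over $p$ in the smaller one, which has a quarter of the area. After multiplication by $2^{n+1}$
  -- the factor of the old quantity is $2\cdot\frac14\cdot\frac32=\frac34<1$. The other term is a
  -- piece of the Gagliardo integral over a shrinking set.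
  have step : ∀ n, ENNReal.ofReal ((L / 2 ^ n) ^ 2) * J (n + 1)
      ≤ ENNReal.ofReal (3 / 2) * J n * ENNReal.ofReal ((L / 2 ^ (n + 1)) ^ 2)
        + ENNReal.ofReal (3 * (L / 2 ^ n) ^ 3) * G n := by
    intro n
    set a := L / 2 ^ n with ha
    have ha0 : 0 < a := by positivity
    have pw : ∀ p ∈ Q n, ∀ q ∈ Q n, ENNReal.ofReal (h p ^ 2)
        ≤ ENNReal.ofReal (3 / 2) * ENNReal.ofReal (h q ^ 2) + ENNReal.ofReal (3 * a ^ 3) * Φ p q := by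
      intro p hp q hq
      simp only [Φ]
      rw [← ENNReal.ofReal_mul (by norm_num), ← ENNReal.ofReal_mul (by positivity),
        ← ENNReal.ofReal_add (by positivity) (by positivity)]
      refine ENNReal.ofReal_le_ofReal ?_
      -- The exponent three of the Gagliardo kernel is compensated by the diameter of the square.
      have h3 : (h p - h q) ^ 2 ≤ a ^ 3 * ((h p - h q) ^ 2 / dist p q ^ 3) := by
        rcases eq_or_ne p q with rfl | hne
        · simp
        · have hd : 0 < dist p q := dist_pos.2 hne
          rw [mul_div_assoc', le_div_iff₀ (by positivity), mul_comm]
          exact mul_le_mul_of_nonneg_right (pow_le_pow_left₀ hd.le (hdist n p hp q hq) 3)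
            (sq_nonneg _)
      nlinarith [sq_nonneg (h q - 2 * (h p - h q))]
    have s1 : ∀ p ∈ Q (n + 1), ENNReal.ofReal (a ^ 2) * ENNReal.ofReal (h p ^ 2)
        ≤ ENNReal.ofReal (3 / 2) * J n + ENNReal.ofReal (3 * a ^ 3) * ∫⁻ q in Q 0, Φ p q := by
      intro p hp
      have m1 : AEMeasurable (fun q => ENNReal.ofReal (3 / 2) * ENNReal.ofReal (h q ^ 2))
          (volume.restrict (Q n)) := by
        have := (h2.mono_measure (Measure.restrict_mono (hQ0 n) le_rfl)).1.aemeasurable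
        exact ((this.pow_const 2).ennreal_ofReal).const_mul _
      calc ENNReal.ofReal (a ^ 2) * ENNReal.ofReal (h p ^ 2)
          = ∫⁻ q in Q n, ENNReal.ofReal (h p ^ 2) := by
            rw [setLIntegral_const, hvol, mul_comm]
        _ ≤ ∫⁻ q in Q n, (ENNReal.ofReal (3 / 2) * ENNReal.ofReal (h q ^ 2)
              + ENNReal.ofReal (3 * a ^ 3) * Φ p q) :=
            setLIntegral_mono' (hQm n) fun q hq => pw p (hQ n hp) q hq
        _ = ENNReal.ofReal (3 / 2) * J n + ENNReal.ofReal (3 * a ^ 3) * ∫⁻ q in Q n, Φ p q := by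
            rw [lintegral_add_left' m1, lintegral_const_mul' _ _ ENNReal.ofReal_ne_top,
              lintegral_const_mul' _ _ ENNReal.ofReal_ne_top]
        _ ≤ _ := by gcongr; exact hQ0 n
    calc ENNReal.ofReal (a ^ 2) * J (n + 1)
        = ∫⁻ p in Q (n + 1), ENNReal.ofReal (a ^ 2) * ENNReal.ofReal (h p ^ 2) := by
          rw [lintegral_const_mul' _ _ ENNReal.ofReal_ne_top]
      _ ≤ ∫⁻ p in Q (n + 1), (ENNReal.ofReal (3 / 2) * J n
            + ENNReal.ofReal (3 * a ^ 3) * ∫⁻ q in Q 0, Φ p q) :=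
          setLIntegral_mono' (hQm (n + 1)) s1
      _ = ENNReal.ofReal (3 / 2) * J n * ENNReal.ofReal ((L / 2 ^ (n + 1)) ^ 2)
            + ENNReal.ofReal (3 * a ^ 3) * G (n + 1) := by
          rw [lintegral_add_left measurable_const, setLIntegral_const, hvol,
            lintegral_const_mul' _ _ ENNReal.ofReal_ne_top]
      _ ≤ _ := by gcongr; exact lintegral_mono_set (hQ n)
  set g : ℕ → ℝ := fun n => (G n).toReal
  have hg : Tendsto g atTop (𝓝 0) := by
    have := (ENNReal.tendsto_toReal (show (0 : ℝ≥0∞) ≠ ⊤ by simp)).comp hGlim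
    rw [ENNReal.toReal_zero] at this
    exact this
  set j : ℕ → ℝ := fun n => ∫ p in Q n, h p ^ 2
  have hj0 : ∀ n, 0 ≤ j n := fun n => integral_nonneg fun _ => sq_nonneg _
  refine tendsto_zero_of_contraction (g := fun n => 6 * L * g n)
    (fun n => mul_nonneg (by positivity) (hj0 n)) (by simpa using hg.const_mul (6 * L)) fun n => ?_
  have h3 := step n
  have hGn : G n = ENNReal.ofReal (g n) := (ENNReal.ofReal_toReal (hGfin n)).symm
  have hg0 : 0 ≤ g n := ENNReal.toReal_nonneg
  rw [hJ, hJ, hGn, ← ENNReal.ofReal_mul (by positivity), ← ENNReal.ofReal_mul (by positivity),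
    ← ENNReal.ofReal_mul (mul_nonneg (by norm_num) (hj0 n)), ← ENNReal.ofReal_mul (by positivity),
    ← ENNReal.ofReal_add (mul_nonneg (mul_nonneg (by norm_num) (hj0 n)) (by positivity))
      (by positivity),
    ENNReal.ofReal_le_ofReal_iff (by
      have := hj0 n
      positivity)] at h3
  change _ * j (n + 1) ≤ 3 / 2 * j n * _ + _ at h3
  have hp : (0 : ℝ) < 2 ^ n := by positivity
  set t : ℝ := 2 ^ n with ht
  have e1 : (2 : ℝ) ^ (n + 1) = 2 * t := by rw [pow_succ]; ring
  rw [e1] at h3 ⊢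
  have h4 : (L / t) ^ 2 * (2 * t * j (n + 1)) ≤ (L / t) ^ 2 * (3 / 4 * (t * j n) + 6 * L * g n) := by
    have : (L / t) ^ 2 * (3 / 4 * (t * j n) + 6 * L * g n)
        = 2 * t * (3 / 2 * j n * (L / (2 * t)) ^ 2 + 3 * (L / t) ^ 3 * g n) := by
      field_simp; ring
    rw [this]
    nlinarith
  exact le_of_mul_le_mul_left h4 (by positivity)

/-- The part of `Ω` which lies in squares of side `L / 2 ^ n` at the corners. -/
def Corners (L : ℝ) (n : ℕ) : Set (ℝ × ℝ) :=
  Ioo 0 (L / 2 ^ n) ×ˢ Ioo 0 (L / 2 ^ n) ∪ Ioo (L - L / 2 ^ n) L ×ˢ Ioo 0 (L / 2 ^ n)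

theorem div_two_pow_le {L : ℝ} (hL : 0 < L) (n : ℕ) : L / 2 ^ n ≤ L :=
  div_le_self hL.le (one_le_pow₀ (by norm_num))

theorem Corners_subset {L : ℝ} (hL : 0 < L) (n : ℕ) : Corners L n ⊆ Om L := by
  have := div_two_pow_le hL n
  rintro p (⟨h1, h2⟩ | ⟨h1, h2⟩)
  · exact ⟨⟨h1.1, h1.2.trans_le this⟩, h2.1⟩
  · exact ⟨⟨by linarith [h1.1], h1.2⟩, h2.1⟩

theorem measurableSet_Corners (L : ℝ) (n : ℕ) : MeasurableSet (Corners L n) :=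
  (measurableSet_Ioo.prod measurableSet_Ioo).union (measurableSet_Ioo.prod measurableSet_Ioo)

/-- `h²` is integrable near the corners, with integral of order `o(2⁻ⁿ)` over squares of side
`L / 2 ^ n`. -/
def CornerSmall (L : ℝ) (h : ℝ × ℝ → ℝ) : Prop :=
  (∀ n, MemLp h 2 (volume.restrict (Corners L n))) ∧
    Tendsto (fun n : ℕ => 2 ^ n * ∫ p in Corners L n, h p ^ 2) atTop (𝓝 0)

theorem LocHalfSobolev.cornerSmall {L : ℝ} (hL : 0 < L) {h : ℝ × ℝ → ℝ} (H : LocHalfSobolev L h) :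
    CornerSmall L h := by
  obtain ⟨h2, hG⟩ := H L hL
  have hpos : ∀ n : ℕ, 0 < L / 2 ^ n := fun n => by positivity
  have hs : ∀ n : ℕ, L / 2 ^ (n + 1) ≤ L / 2 ^ n := fun n =>
    div_le_div_of_nonneg_left hL.le (by positivity) (pow_le_pow_right₀ (by norm_num) (by omega))
  have hsq : ∀ c d s : ℝ, ∀ p ∈ Ioo c (c + s) ×ˢ Ioo d (d + s), ∀ q ∈ Ioo c (c + s) ×ˢ Ioo d (d + s),
      dist p q ≤ s := by
    rintro c d s p ⟨hp1, hp2⟩ q ⟨hq1, hq2⟩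
    rw [Prod.dist_eq, Real.dist_eq, Real.dist_eq]
    refine max_le (abs_le.2 ⟨?_, ?_⟩) (abs_le.2 ⟨?_, ?_⟩) <;>
      linarith [hp1.1, hp1.2, hq1.1, hq1.2, hp2.1, hp2.2, hq2.1, hq2.2]
  have hl := corner_decay (h := h) hL (Q := fun n => Ioo 0 (L / 2 ^ n) ×ˢ Ioo 0 (L / 2 ^ n))
    (fun n => measurableSet_Ioo.prod measurableSet_Ioo)
    (fun n => prod_mono (Ioo_subset_Ioo_right (hs n)) (Ioo_subset_Ioo_right (hs n)))
    (fun n => by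
      rw [Measure.volume_eq_prod, Measure.prod_prod, Real.volume_Ioo, sub_zero,
        ← ENNReal.ofReal_mul (hpos n).le, sq])
    (fun n => by simpa using hsq 0 0 (L / 2 ^ n))
    (by simpa using h2) (by simpa using hG)
  have hr := corner_decay (h := h) hL (Q := fun n => Ioo (L - L / 2 ^ n) L ×ˢ Ioo 0 (L / 2 ^ n))
    (fun n => measurableSet_Ioo.prod measurableSet_Ioo)
    (fun n => prod_mono (Ioo_subset_Ioo_left (by linarith [hs n])) (Ioo_subset_Ioo_right (hs n)))
    (fun n => by
      rw [Measure.volume_eq_prod, Measure.prod_prod, Real.volume_Ioo, Real.volume_Ioo, sub_zero,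
        sub_sub_cancel, ← ENNReal.ofReal_mul (hpos n).le, sq])
    (fun n => by simpa using hsq (L - L / 2 ^ n) 0 (L / 2 ^ n))
    (by simpa using h2) (by simpa using hG)
  have hsub : ∀ n, Corners L n ⊆ Ioo 0 L ×ˢ Ioo 0 L := fun n => by
    have := div_two_pow_le hL n
    rintro p (⟨h1, h2⟩ | ⟨h1, h2⟩)
    · exact ⟨⟨h1.1, h1.2.trans_le this⟩, h2.1, h2.2.trans_le this⟩
    · exact ⟨⟨by linarith [h1.1], h1.2⟩, h2.1, h2.2.trans_le this⟩
  have hmem : ∀ n, MemLp h 2 (volume.restrict (Corners L n)) := fun n =>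
    h2.mono_measure (Measure.restrict_mono (hsub n) le_rfl)
  have hint : ∀ n, IntegrableOn (fun p => h p ^ 2) (Corners L n) := fun n => (hmem n).integrable_sq
  refine ⟨hmem, squeeze_zero (fun n => mul_nonneg (by positivity)
    (integral_nonneg fun _ => sq_nonneg _)) (fun n => ?_) (by simpa using hl.add hr)⟩
  rw [← mul_add]
  refine mul_le_mul_of_nonneg_left ?_ (by positivity)
  have i1 := (hint n).mono_set (s := Ioo 0 (L / 2 ^ n) ×ˢ Ioo 0 (L / 2 ^ n)) subset_union_left
  have i2 := (hint n).mono_set (s := Ioo (L - L / 2 ^ n) L ×ˢ Ioo 0 (L / 2 ^ n)) subset_union_right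
  rw [← integral_add_measure i1 i2]
  exact integral_mono_measure (Measure.restrict_union_le _ _) (ae_of_all _ fun _ => sq_nonneg _)
    (Integrable.add_measure i1 i2)

theorem volume_Corners_le {L : ℝ} (hL : 0 < L) (n : ℕ) :
    volume (Corners L n) ≤ ENNReal.ofReal (2 * (L / 2 ^ n) ^ 2) := by
  have hpos : 0 < L / 2 ^ n := by positivity
  refine (measure_union_le _ _).trans (le_of_eq ?_)
  rw [Measure.volume_eq_prod, Measure.prod_prod, Measure.prod_prod, Real.volume_Ioo,
    Real.volume_Ioo, sub_zero, sub_sub_cancel, ← ENNReal.ofReal_mul hpos.le,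
    ← ENNReal.ofReal_add (by positivity) (by positivity)]
  congr 1; ring

/-- Essentially bounded functions. -/
theorem cornerSmall_of_bounded {L : ℝ} (hL : 0 < L) {h : ℝ × ℝ → ℝ}
    (H : MemLp h ⊤ (volume.restrict (Om L))) : CornerSmall L h := by
  obtain ⟨C, hC⟩ : ∃ C : ℝ, ∀ᵐ p ∂(volume.restrict (Om L)), ‖h p‖ ≤ C := by
    refine ⟨(eLpNorm h ⊤ (volume.restrict (Om L))).toReal, ?_⟩
    have := ae_le_eLpNormEssSup (f := h) (μ := volume.restrict (Om L))
    filter_upwards [this] with p hp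
    rw [← eLpNorm_exponent_top] at hp
    rw [← toReal_enorm]
    exact ENNReal.toReal_mono H.2.ne hp
  have hb : ∀ n, ∀ᵐ p ∂(volume.restrict (Corners L n)), ‖h p ^ 2‖ ≤ C ^ 2 := fun n => by
    filter_upwards [ae_restrict_of_ae_restrict_of_subset (Corners_subset hL n) hC] with p hp
    rw [norm_pow]
    exact pow_le_pow_left₀ (norm_nonneg _) hp 2
  have hfin : ∀ n, volume (Corners L n) < ⊤ := fun n =>
    (volume_Corners_le hL n).trans_lt ENNReal.ofReal_lt_top
  have hmem : ∀ n, MemLp h 2 (volume.restrict (Corners L n)) := fun n => by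
    have : IsFiniteMeasure (volume.restrict (Corners L n)) := ⟨by simpa using hfin n⟩
    exact (H.mono_measure (Measure.restrict_mono (Corners_subset hL n) le_rfl)).mono_exponent le_top
  refine ⟨hmem, squeeze_zero (g := fun n => C ^ 2 * (2 * L ^ 2) * (1 / 2) ^ n)
    (fun n => mul_nonneg (by positivity) (integral_nonneg fun _ => sq_nonneg _)) (fun n => ?_) ?_⟩
  · have h1 : ∫ p in Corners L n, h p ^ 2 ≤ C ^ 2 * (2 * (L / 2 ^ n) ^ 2) := by
      refine (le_abs_self _).trans ((norm_setIntegral_le_of_norm_le_const_ae (hfin n) (hb n)).trans ?_)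
      refine mul_le_mul_of_nonneg_left ?_ (sq_nonneg _)
      exact ENNReal.toReal_le_of_le_ofReal (by positivity) (volume_Corners_le hL n)
    calc 2 ^ n * ∫ p in Corners L n, h p ^ 2 ≤ 2 ^ n * (C ^ 2 * (2 * (L / 2 ^ n) ^ 2)) := by gcongr
      _ = C ^ 2 * (2 * L ^ 2) * (1 / 2) ^ n := by
        rw [one_div, inv_pow]; field_simp
  · have := (tendsto_pow_atTop_nhds_zero_of_lt_one (r := (1 / 2 : ℝ)) (by norm_num)
      (by norm_num)).const_mul (C ^ 2 * (2 * L ^ 2))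
    simpa using this

theorem tendsto_shrink {L : ℝ} : Tendsto (fun n : ℕ => L / 2 ^ n) atTop (𝓝 0) := by
  have := (tendsto_pow_atTop_nhds_zero_of_lt_one (r := (1 / 2 : ℝ)) (by norm_num)
    (by norm_num)).const_mul L
  simp only [mul_zero] at this
  refine this.congr fun n => ?_
  rw [one_div, inv_pow, div_eq_mul_inv]

/-- Square integrable functions of the vertical variable. -/
theorem cornerSmall_of_snd {L : ℝ} (hL : 0 < L) {b : ℝ → ℝ}
    (hb : MemLp b 2 (volume.restrict (Ioi 0))) : CornerSmall L (fun p => b p.2) := by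
  have hpos : ∀ n : ℕ, 0 < L / 2 ^ n := fun n => by positivity
  have hi : ∀ n : ℕ, IntegrableOn (fun y => b y ^ 2) (Ioo 0 (L / 2 ^ n)) := fun n =>
    IntegrableOn.mono_set hb.integrable_sq Ioo_subset_Ioi_self
  have hprod : ∀ (n : ℕ) (α : ℝ), 
      IntegrableOn (fun p : ℝ × ℝ => b p.2 ^ 2) (Ioo α (α + L / 2 ^ n) ×ˢ Ioo 0 (L / 2 ^ n)) ∧
      ∫ p in Ioo α (α + L / 2 ^ n) ×ˢ Ioo 0 (L / 2 ^ n), b p.2 ^ 2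
        = L / 2 ^ n * ∫ y in Ioo 0 (L / 2 ^ n), b y ^ 2 := by
    intro n α
    constructor
    · rw [IntegrableOn, Measure.volume_eq_prod, ← Measure.prod_restrict]
      exact (hi n).comp_snd _
    · rw [Measure.volume_eq_prod, ← Measure.prod_restrict]
      rw [integral_fun_snd (fun y => b y ^ 2)]
      simp [measureReal_def, (hpos n).le]
  have e1 : ∀ n : ℕ, Corners L n = Ioo 0 (0 + L / 2 ^ n) ×ˢ Ioo 0 (L / 2 ^ n) ∪
      Ioo (L - L / 2 ^ n) (L - L / 2 ^ n + L / 2 ^ n) ×ˢ Ioo 0 (L / 2 ^ n) := fun n => by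
    simp [Corners]
  refine ⟨fun n => ?_, squeeze_zero (g := fun n : ℕ => 2 * L * ∫ y in Ioo 0 (L / 2 ^ n), b y ^ 2)
    (fun n => mul_nonneg (by positivity) (integral_nonneg fun _ => sq_nonneg _)) (fun n => ?_) ?_⟩
  · rw [memLp_two_iff_integrable_sq, e1]
    · exact (hprod n 0).1.union (hprod n _).1
    · refine AEStronglyMeasurable.mono_measure ?_
        (Measure.restrict_mono (Corners_subset hL n) le_rfl)
      rw [volume_restrict_Om]
      exact hb.1.comp_snd
  · rw [e1]
    have i1 := hprod n 0
    have i2 := hprod n (L - L / 2 ^ n)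
    have : ∫ p in Ioo 0 (0 + L / 2 ^ n) ×ˢ Ioo 0 (L / 2 ^ n) ∪
      Ioo (L - L / 2 ^ n) (L - L / 2 ^ n + L / 2 ^ n) ×ˢ Ioo 0 (L / 2 ^ n), b p.2 ^ 2
        ≤ 2 * (L / 2 ^ n * ∫ y in Ioo 0 (L / 2 ^ n), b y ^ 2) := by
      rw [two_mul]
      nth_rewrite 1 [← i1.2]
      rw [← i2.2, ← integral_add_measure i1.1 i2.1]
      exact integral_mono_measure (Measure.restrict_union_le _ _) (ae_of_all _ fun _ => sq_nonneg _)
        (Integrable.add_measure i1.1 i2.1)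
    calc _ ≤ 2 ^ n * (2 * (L / 2 ^ n * ∫ y in Ioo 0 (L / 2 ^ n), b y ^ 2)) := by gcongr
      _ = _ := by field_simp
  · have hv : Tendsto ((volume.restrict (Ioi (0 : ℝ))) ∘ fun n : ℕ => Ioo 0 (L / 2 ^ n)) atTop
        (𝓝 0) := by
      have : Tendsto (fun n : ℕ => ENNReal.ofReal (L / 2 ^ n)) atTop (𝓝 (ENNReal.ofReal 0)) :=
        ENNReal.tendsto_ofReal tendsto_shrink
      rw [ENNReal.ofReal_zero] at this
      refine this.congr fun n => ?_
      simp only [Function.comp]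
      rw [Measure.restrict_apply measurableSet_Ioo, inter_eq_left.2 Ioo_subset_Ioi_self,
        Real.volume_Ioo, sub_zero]
    have h2 := hb.integrable_sq.tendsto_setIntegral_nhds_zero hv
    have h3 := h2.const_mul (2 * L)
    rw [mul_zero] at h3
    refine h3.congr fun n => ?_
    rw [Measure.restrict_restrict measurableSet_Ioo, inter_eq_left.2 Ioo_subset_Ioi_self]

/-! ### Cut-off functions -/

/-- A cut-off function which vanishes near the corners and for large `y`, with its derivatives. -/
structure IsCornerCutoff (L C : ℝ) (n : ℕ) (η ηx ηy : ℝ × ℝ → ℝ) : Prop where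
  cont : Continuous η
  cont_x : Continuous ηx
  cont_y : Continuous ηy
  deriv_x : ∀ p : ℝ × ℝ, HasDerivAt (fun s => η (s, p.2)) (ηx p) p.1
  deriv_y : ∀ p : ℝ × ℝ, HasDerivAt (fun t => η (p.1, t)) (ηy p) p.2
  nonneg : ∀ p, 0 ≤ η p
  le_one : ∀ p, η p ≤ 1
  bound_x : ∀ p ∈ Om L, |ηx p| ≤ (Corners L n).indicator (fun _ => C * 2 ^ n) p
  bound_y : ∀ p ∈ Om L, |ηy p| ≤ (Corners L n).indicator (fun _ => C * 2 ^ n) p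
    + (Ioi 0 ×ˢ Ici ((n : ℝ) + 1)).indicator (fun _ => C / ((n : ℝ) + 1)) p
  support : ∃ K : Set (ℝ × ℝ), IsCompact K ∧ ((0 : ℝ), (0 : ℝ)) ∉ K ∧ (L, (0 : ℝ)) ∉ K ∧
    ∀ p ∈ OmBar L, p ∉ K → η p = 0 ∧ ηx p = 0 ∧ ηy p = 0

theorem smooth_step_deriv {ξ : ℝ → ℝ} {c d : ℝ} (hξ : ContDiff ℝ ∞ ξ) (h0 : ∀ t, t ≤ c → ξ t = 0)
    (h1 : ∀ t, d ≤ t → ξ t = 1) (h : ∀ t, 0 ≤ ξ t ∧ ξ t ≤ 1) :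
    (∀ t, t ≤ c → deriv ξ t = 0) ∧ (∀ t, d ≤ t → deriv ξ t = 0) ∧ ∃ D, 0 ≤ D ∧ ∀ t, |deriv ξ t| ≤ D := by
  have e0 : ∀ t, t ≤ c → deriv ξ t = 0 := fun t ht =>
    IsLocalMin.deriv_eq_zero (Eventually.of_forall fun s => by rw [h0 t ht]; exact (h s).1)
  have e1 : ∀ t, d ≤ t → deriv ξ t = 0 := fun t ht =>
    IsLocalMax.deriv_eq_zero (Eventually.of_forall fun s => by rw [h1 t ht]; exact (h s).2)
  refine ⟨e0, e1, ?_⟩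
  have hc : Continuous (deriv ξ) := hξ.continuous_deriv (by simp)
  obtain ⟨D, hD⟩ := (isCompact_Icc (a := c) (b := d)).exists_bound_of_continuousOn hc.continuousOn
  refine ⟨max D 0, le_max_right _ _, fun t => ?_⟩
  rcases le_total t c with ht | ht
  · rw [e0 t ht]; simp
  · rcases le_total d t with hd | hd
    · rw [e1 t hd]; simp
    · exact (hD t ⟨ht, hd⟩).trans (le_max_left _ _)

/-- The factor $1-(1-\xi(x2^n/L))(1-\xi(y2^n/L))$ vanishes when both coordinates are at most
$L/2^{n+1}$ and equals one as soon as one of them reaches $L/2^n$. Its gradient thus lives in the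
corner square and has size $2^n$. The right corner has an analogous factor with $L-x$. A third
factor cuts off at $y\sim n+1$ with derivative of size $1/(n+1)$. -/
theorem exists_cornerCutoff {L : ℝ} (hL : 0 < L) :
    ∃ C : ℝ, 0 ≤ C ∧ ∃ η ηx ηy : ℕ → ℝ × ℝ → ℝ, (∀ n, IsCornerCutoff L C n (η n) (ηx n) (ηy n)) ∧
      ∀ p : ℝ × ℝ, 0 < p.2 → ∀ᶠ n in atTop, η n p = 1 := by
  obtain ⟨ξ, hξ, ξ0, ξ1, ξb⟩ := exists_smooth_step (c := 1 / 2) (d := 1) (by norm_num)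
  obtain ⟨σ, hσ, σ0, σ1, σb⟩ := exists_smooth_step (c := 1) (d := 2) (by norm_num)
  obtain ⟨dξ0, dξ1, D, hD0, hD⟩ := smooth_step_deriv hξ ξ0 ξ1 ξb
  obtain ⟨dσ0, dσ1, E, hE0, hE⟩ := smooth_step_deriv hσ σ0 σ1 σb
  have hdξ : ∀ t, HasDerivAt ξ (deriv ξ t) t := fun t =>
    (hξ.differentiable (by simp) t).hasDerivAt
  have hdσ : ∀ t, HasDerivAt σ (deriv σ t) t := fun t =>
    (hσ.differentiable (by simp) t).hasDerivAt
  have cξ := hξ.continuous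
  have cσ := hσ.continuous
  have cdξ : Continuous (deriv ξ) := hξ.continuous_deriv (by simp)
  have cdσ : Continuous (deriv σ) := hσ.continuous_deriv (by simp)
  let k : ℕ → ℝ := fun n => 2 ^ n / L
  have hk : ∀ n, 0 < k n := fun n => by positivity
  let el : ℕ → ℝ × ℝ → ℝ := fun n p => 1 - (1 - ξ (p.1 * k n)) * (1 - ξ (p.2 * k n))
  let er : ℕ → ℝ × ℝ → ℝ := fun n p => 1 - (1 - ξ ((L - p.1) * k n)) * (1 - ξ (p.2 * k n))
  let z : ℕ → ℝ × ℝ → ℝ := fun n p => 1 - σ (p.2 * ((n : ℝ) + 1)⁻¹)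
  have b1 : ∀ t, 0 ≤ 1 - ξ t ∧ 1 - ξ t ≤ 1 := fun t => ⟨by linarith [(ξb t).2], by linarith [(ξb t).1]⟩
  have b2 : ∀ s t, 0 ≤ 1 - (1 - ξ s) * (1 - ξ t) ∧ 1 - (1 - ξ s) * (1 - ξ t) ≤ 1 := fun s t =>
    ⟨by linarith [mul_le_one₀ (b1 s).2 (b1 t).1 (b1 t).2], by linarith [mul_nonneg (b1 s).1 (b1 t).1]⟩
  have bz : ∀ n p, 0 ≤ z n p ∧ z n p ≤ 1 := fun n p =>
    ⟨by simp only [z]; linarith [(σb (p.2 * ((n : ℝ) + 1)⁻¹)).2], by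
      simp only [z]; linarith [(σb (p.2 * ((n : ℝ) + 1)⁻¹)).1]⟩
  have bel : ∀ n p, 0 ≤ el n p ∧ el n p ≤ 1 := fun n p => b2 _ _
  have ber : ∀ n p, 0 ≤ er n p ∧ er n p ≤ 1 := fun n p => b2 _ _
  -- location of the derivatives
  have near : ∀ n (t : ℝ), t * k n < 1 ↔ t < L / 2 ^ n := fun n t => by
    simp only [k]
    rw [← mul_div_assoc, div_lt_one hL, lt_div_iff₀ (by positivity)]
  have prod3 : ∀ a b c D : ℝ, 0 ≤ D → |a| ≤ D → 0 ≤ b → b ≤ 1 → 0 ≤ c → c ≤ 1 → |a * b * c| ≤ D := by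
    intro a b c D hD ha hb hb' hc hc'
    rw [abs_mul, abs_mul, abs_of_nonneg hb, abs_of_nonneg hc]
    calc |a| * b * c ≤ D * 1 * 1 := by gcongr
      _ = D := by ring
  -- Off the corner squares one of the two arguments of $\xi$ is at least one, where $1-\xi$ and
  -- $\xi'$ both vanish.
  have loc : ∀ n, ∀ p ∈ Om L, p ∉ Corners L n → ∀ t, (t = p.1 ∨ t = L - p.1) →
      deriv ξ (t * k n) * (1 - ξ (p.2 * k n)) = 0 ∧ (1 - ξ (t * k n)) * deriv ξ (p.2 * k n) = 0 := by
    intro n p hp hc t ht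
    rcases lt_or_ge (p.2 * k n) 1 with h2 | h2
    · have : 1 ≤ t * k n := by
        by_contra! h
        rw [near] at h h2
        rcases ht with rfl | rfl
        · exact hc (Or.inl ⟨⟨hp.1.1, h⟩, hp.2, h2⟩)
        · exact hc (Or.inr ⟨⟨by linarith, hp.1.2⟩, hp.2, h2⟩)
      rw [dξ1 _ this, ξ1 _ this]; simp
    · rw [dξ1 _ h2, ξ1 _ h2]; simp
  refine ⟨2 * D / L + E, by positivity, fun n p => el n p * er n p * z n p,
    fun n p => (deriv ξ (p.1 * k n) * k n * (1 - ξ (p.2 * k n)) * er n p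
        + el n p * (-(deriv ξ ((L - p.1) * k n) * k n * (1 - ξ (p.2 * k n))))) * z n p,
    fun n p => ((1 - ξ (p.1 * k n)) * (deriv ξ (p.2 * k n) * k n) * er n p
        + el n p * ((1 - ξ ((L - p.1) * k n)) * (deriv ξ (p.2 * k n) * k n))) * z n p
        + el n p * er n p * (-(deriv σ (p.2 * ((n : ℝ) + 1)⁻¹) * ((n : ℝ) + 1)⁻¹)), fun n => ?_, ?_⟩
  · have hb : 2 * (D * k n) ≤ (2 * D / L + E) * 2 ^ n := by
      have : 2 * (D * k n) = 2 * D / L * 2 ^ n := by simp only [k]; ring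
      rw [this]; gcongr; linarith
    have hCn : 0 ≤ (2 * D / L + E) * 2 ^ n := by positivity
    have hdk : ∀ t, |deriv ξ t * k n| ≤ D * k n := fun t => by
      rw [abs_mul, abs_of_pos (hk n)]; exact mul_le_mul_of_nonneg_right (hD t) (hk n).le
    have hDk : 0 ≤ D * k n := mul_nonneg hD0 (hk n).le
    refine ⟨by fun_prop, by fun_prop, by fun_prop, fun p => ?_, fun p => ?_, fun p => ?_, fun p => ?_,
      fun p hp => ?_, fun p hp => ?_, ?_⟩
    · have d1 : HasDerivAt (fun s => el n (s, p.2))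
          (deriv ξ (p.1 * k n) * k n * (1 - ξ (p.2 * k n))) p.1 := by
        have := (((hdξ (p.1 * k n)).comp p.1 ((hasDerivAt_id p.1).mul_const (k n))).const_sub 1).mul_const
          (1 - ξ (p.2 * k n))
        refine (this.const_sub 1).congr_deriv ?_
        simp
      have d2 : HasDerivAt (fun s => er n (s, p.2))
          (-(deriv ξ ((L - p.1) * k n) * k n * (1 - ξ (p.2 * k n)))) p.1 := by
        have := (((hdξ ((L - p.1) * k n)).comp p.1
          (((hasDerivAt_id p.1).const_sub L).mul_const (k n))).const_sub 1).mul_const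
          (1 - ξ (p.2 * k n))
        refine (this.const_sub 1).congr_deriv ?_
        simp
      exact (d1.mul d2).mul_const (z n p)
    · have d0 : HasDerivAt (fun t => 1 - ξ (t * k n)) (-(deriv ξ (p.2 * k n) * k n)) p.2 := by
        have := ((hdξ (p.2 * k n)).comp p.2 ((hasDerivAt_id p.2).mul_const (k n))).const_sub 1
        refine this.congr_deriv ?_
        simp
      have d1 : HasDerivAt (fun t => el n (p.1, t))
          ((1 - ξ (p.1 * k n)) * (deriv ξ (p.2 * k n) * k n)) p.2 := by
        refine ((d0.const_mul (1 - ξ (p.1 * k n))).const_sub 1).congr_deriv ?_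
        simp
      have d2 : HasDerivAt (fun t => er n (p.1, t))
          ((1 - ξ ((L - p.1) * k n)) * (deriv ξ (p.2 * k n) * k n)) p.2 := by
        refine ((d0.const_mul (1 - ξ ((L - p.1) * k n))).const_sub 1).congr_deriv ?_
        simp
      have d3 : HasDerivAt (fun t => z n (p.1, t))
          (-(deriv σ (p.2 * ((n : ℝ) + 1)⁻¹) * ((n : ℝ) + 1)⁻¹)) p.2 := by
        have := ((hdσ (p.2 * ((n : ℝ) + 1)⁻¹)).comp p.2
          ((hasDerivAt_id p.2).mul_const ((n : ℝ) + 1)⁻¹)).const_sub 1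
        refine this.congr_deriv ?_
        simp
      exact (d1.mul d2).mul d3
    · exact mul_nonneg (mul_nonneg (bel n p).1 (ber n p).1) (bz n p).1
    · exact mul_le_one₀ (mul_le_one₀ (bel n p).2 (ber n p).1 (ber n p).2) (bz n p).1 (bz n p).2
    · beta_reduce
      by_cases hc : p ∈ Corners L n
      · rw [indicator_of_mem hc]
        refine le_trans ?_ hb
        have t1 := prod3 _ _ _ _ hDk (hdk (p.1 * k n)) (b1 (p.2 * k n)).1 (b1 (p.2 * k n)).2
          (ber n p).1 (ber n p).2
        have t2 := prod3 _ _ _ _ hDk (hdk ((L - p.1) * k n)) (b1 (p.2 * k n)).1 (b1 (p.2 * k n)).2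
          (bel n p).1 (bel n p).2
        rw [abs_mul, abs_of_nonneg (bz n p).1]
        refine le_trans (mul_le_of_le_one_right (abs_nonneg _) (bz n p).2) ?_
        refine (abs_add_le _ _).trans ?_
        rw [mul_neg, abs_neg, mul_comm (el n p)]
        linarith
      · rw [indicator_of_notMem hc]
        have t1 := (loc n p hp hc p.1 (Or.inl rfl)).1
        have t2 := (loc n p hp hc (L - p.1) (Or.inr rfl)).1
        rw [mul_right_comm (deriv ξ (p.1 * k n)), t1, mul_right_comm (deriv ξ ((L - p.1) * k n)), t2]
        simp
    · beta_reduce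
      refine (abs_add_le _ _).trans (add_le_add ?_ ?_)
      · by_cases hc : p ∈ Corners L n
        · rw [indicator_of_mem hc]
          refine le_trans ?_ hb
          have t1 := prod3 _ _ _ _ hDk (hdk (p.2 * k n)) (b1 (p.1 * k n)).1 (b1 (p.1 * k n)).2
            (ber n p).1 (ber n p).2
          have t2 := prod3 _ _ _ _ hDk (hdk (p.2 * k n)) (b1 ((L - p.1) * k n)).1
            (b1 ((L - p.1) * k n)).2 (bel n p).1 (bel n p).2
          rw [abs_mul, abs_of_nonneg (bz n p).1]
          refine le_trans (mul_le_of_le_one_right (abs_nonneg _) (bz n p).2) ?_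
          refine (abs_add_le _ _).trans ?_
          rw [mul_comm (el n p), mul_comm (1 - ξ (p.1 * k n)), mul_comm (1 - ξ ((L - p.1) * k n))]
          linarith
        · rw [indicator_of_notMem hc]
          have t1 := (loc n p hp hc p.1 (Or.inl rfl)).2
          have t2 := (loc n p hp hc (L - p.1) (Or.inr rfl)).2
          rw [← mul_assoc (1 - ξ (p.1 * k n)), t1, ← mul_assoc (1 - ξ ((L - p.1) * k n)), t2]
          simp
      · rcases lt_or_ge p.2 ((n : ℝ) + 1) with h | h
        · have : p.2 * ((n : ℝ) + 1)⁻¹ ≤ 1 := by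
            rw [← div_eq_mul_inv]; exact (div_le_one (by positivity)).2 h.le
          rw [dσ0 _ this]
          simp only [zero_mul, neg_zero, mul_zero, abs_zero]
          exact indicator_nonneg (fun _ _ => by positivity) _
        · rw [indicator_of_mem (show p ∈ Ioi 0 ×ˢ Ici ((n : ℝ) + 1) from ⟨hp.1.1, h⟩)]
          have hn : (0 : ℝ) ≤ ((n : ℝ) + 1)⁻¹ := by positivity
          have t0 : |deriv σ (p.2 * ((n : ℝ) + 1)⁻¹) * ((n : ℝ) + 1)⁻¹| ≤ E * ((n : ℝ) + 1)⁻¹ := by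
            rw [abs_mul, abs_of_nonneg hn]
            exact mul_le_mul_of_nonneg_right (hE _) hn
          have t1 := prod3 _ _ _ _ (by positivity) t0 (bel n p).1 (bel n p).2 (ber n p).1 (ber n p).2
          rw [mul_neg, abs_neg]
          calc _ = _ := by congr 1; ring
            _ ≤ _ := t1
            _ ≤ _ := by
              rw [div_eq_mul_inv]; gcongr
              have : 0 ≤ 2 * D / L := by positivity
              linarith
    · have hs : 0 < L / 2 ^ n := by positivity
      have half : ∀ t, t < L / 2 ^ n / 2 → t * k n ≤ 1 / 2 := fun t ht => by
        have := mul_le_mul_of_nonneg_right ht.le (hk n).le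
        refine this.trans (le_of_eq ?_)
        simp only [k]; field_simp
      refine ⟨(Icc 0 L ×ˢ Icc 0 (2 * ((n : ℝ) + 1))) \
        (Iio (L / 2 ^ n / 2) ×ˢ Iio (L / 2 ^ n / 2) ∪ Ioi (L - L / 2 ^ n / 2) ×ˢ Iio (L / 2 ^ n / 2)),
        (isCompact_Icc.prod isCompact_Icc).diff
          ((isOpen_Iio.prod isOpen_Iio).union (isOpen_Ioi.prod isOpen_Iio)), ?_, ?_, ?_⟩
      · rintro ⟨-, h⟩
        exact h (Or.inl ⟨by simpa using hs, by simpa using hs⟩)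
      · rintro ⟨-, h⟩
        exact h (Or.inr ⟨by simpa using hs, by simpa using hs⟩)
      · intro p hp hK
        by_cases h2 : p.2 ≤ 2 * ((n : ℝ) + 1)
        · have : p ∈ Iio (L / 2 ^ n / 2) ×ˢ Iio (L / 2 ^ n / 2) ∪
              Ioi (L - L / 2 ^ n / 2) ×ˢ Iio (L / 2 ^ n / 2) := by
            by_contra h
            exact hK ⟨⟨hp.1, hp.2, h2⟩, h⟩
          rcases this with ⟨h3, h4⟩ | ⟨h3, h4⟩
          · have e1 := half _ h3
            have e2 := half _ h4
            have : el n p = 0 := by simp only [el]; rw [ξ0 _ e1, ξ0 _ e2]; norm_num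
            simp only [this, dξ0 _ e1, dξ0 _ e2]
            simp
          · have e1 : (L - p.1) * k n ≤ 1 / 2 := half _ (by simp only [mem_Ioi] at h3; linarith)
            have e2 := half _ h4
            have : er n p = 0 := by simp only [er]; rw [ξ0 _ e1, ξ0 _ e2]; norm_num
            simp only [this, dξ0 _ e1, dξ0 _ e2]
            simp
        · push Not at h2
          have : 2 ≤ p.2 * ((n : ℝ) + 1)⁻¹ := by
            rw [← div_eq_mul_inv, le_div_iff₀ (by positivity)]; exact h2.le
          have hz : z n p = 0 := by simp only [z]; rw [σ1 _ this]; norm_num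
          simp only [hz, dσ1 _ this]
          simp
  · intro p hp
    have e1 : ∀ᶠ n : ℕ in atTop, L / 2 ^ n < p.2 := tendsto_shrink.eventually (gt_mem_nhds hp)
    have e2 : ∀ᶠ n : ℕ in atTop, p.2 ≤ n := by
      obtain ⟨N, hN⟩ := exists_nat_ge p.2
      filter_upwards [eventually_ge_atTop N] with n hn
      exact hN.trans (by exact_mod_cast hn)
    filter_upwards [e1, e2] with n h1 h2
    have e3 : 1 ≤ p.2 * k n := by
      by_contra! h
      rw [near] at h
      linarith
    have e4 : p.2 * ((n : ℝ) + 1)⁻¹ ≤ 1 := by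
      rw [← div_eq_mul_inv]; exact (div_le_one (by positivity)).2 (by linarith)
    simp only [el, er, z]
    rw [ξ1 _ e3, σ0 _ e4]
    norm_num

/-! ### The divergence theorem with inflow of one sign -/

theorem LocInt.mul_cutoff {L : ℝ} {h η : ℝ × ℝ → ℝ} (H : LocInt L h) (hη : Continuous η)
    {K : Set (ℝ × ℝ)} (hK : IsCompact K) (h0 : ((0 : ℝ), (0 : ℝ)) ∉ K) (hL : (L, (0 : ℝ)) ∉ K)
    (hz : ∀ p ∈ Om L, p ∉ K → η p = 0) : IntegrableOn (fun p => η p * h p) (Om L) := by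
  obtain ⟨C, hC⟩ := hK.exists_bound_of_continuousOn hη.continuousOn
  have : IntegrableOn (fun p => η p * h p) (K ∩ Om L) := by
    refine Integrable.bdd_mul (c := C) (H K hK h0 hL) hη.aestronglyMeasurable ?_
    refine (ae_restrict_iff' (hK.measurableSet.inter (measurableSet_Om L))).2
      (ae_of_all _ fun p hp => hC p hp.1)
  refine this.of_forall_sdiff_eq_zero (measurableSet_Om L) fun p hp => ?_
  rw [hz p hp.1 fun h => hp.2 ⟨h, hp.1⟩, zero_mul]

theorem setIntegral_Om {L : ℝ} {F : ℝ × ℝ → ℝ} (hF : IntegrableOn F (Om L)) :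
    ∫ p in Om L, F p = ∫ x in Ioo 0 L, ∫ y in Ioi 0, F (x, y) := by
  rw [IntegrableOn, volume_restrict_Om] at hF
  rw [volume_restrict_Om]
  exact integral_prod _ hF

theorem setIntegral_Om_symm {L : ℝ} {F : ℝ × ℝ → ℝ} (hF : IntegrableOn F (Om L)) :
    ∫ p in Om L, F p = ∫ y in Ioi 0, ∫ x in Ioo 0 L, F (x, y) := by
  rw [IntegrableOn, volume_restrict_Om] at hF
  rw [volume_restrict_Om]
  exact integral_prod_symm _ hF

theorem intervalIntegral_eq_Ioo {a b : ℝ} (h : a ≤ b) (f : ℝ → ℝ) :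
    ∫ x in a..b, f x = ∫ x in Ioo a b, f x := by
  rw [intervalIntegral.integral_of_le h, integral_Ioc_eq_integral_Ioo]

/-- On almost every line the integral of $(\eta X)_x$ is $\eta X$ at $x=L$ minus $\eta X$ at $x=0$,
and the latter is not positive. Because only its sign is used, no integrability of the inflow in $y$
is needed. -/
theorem le_setIntegral_cutoff_x {L C : ℝ} (hL : 0 < L) {n : ℕ} {η ηx ηy X DX : ℝ × ℝ → ℝ}
    {XL : ℝ → ℝ} (hη : IsCornerCutoff L C n η ηx ηy) (iX : LocInt L X) (iDX : LocInt L DX)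
    (hX : ∀ᵐ y ∂(volume.restrict (Ioi (0 : ℝ))), ∃ p, p ≤ 0 ∧
      LineAC 0 L (fun x => X (x, y)) (fun x => DX (x, y)) p (XL y))
    (iXL : IntegrableOn XL (Ioi 0)) :
    ∫ y in Ioi 0, η (L, y) * XL y ≤ ∫ p in Om L, (ηx p * X p + η p * DX p) := by
  obtain ⟨K, hK, h0, hKL, hz⟩ := hη.support
  have hOm : Om L ⊆ OmBar L := prod_mono Ioo_subset_Icc_self Ioi_subset_Ici_self
  have i1 := iX.mul_cutoff hη.cont_x hK h0 hKL fun p hp hp' => (hz p (hOm hp) hp').2.1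
  have i2 := iDX.mul_cutoff hη.cont hK h0 hKL fun p hp hp' => (hz p (hOm hp) hp').1
  have i3 : IntegrableOn (fun p => ηx p * X p + η p * DX p) (Om L) := i1.add i2
  rw [setIntegral_Om_symm i3]
  have i4 := i3
  rw [IntegrableOn, volume_restrict_Om] at i4
  refine integral_mono_ae ?_ i4.integral_prod_right ?_
  · refine Integrable.bdd_mul (c := 1) iXL
      (hη.cont.comp (by fun_prop : Continuous fun y : ℝ => (L, y))).aestronglyMeasurable
      (ae_of_all _ fun y => ?_)
    rw [Real.norm_eq_abs, abs_of_nonneg (hη.nonneg _)]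
    exact hη.le_one _
  · filter_upwards [hX] with y ⟨p, hp, hl⟩
    have hlη : LineAC 0 L (fun x => η (x, y)) (fun x => ηx (x, y)) (η (0, y)) (η (L, y)) := by
      refine LineAC.of_hasDerivAt hL.le ?_ (fun x _ => hη.deriv_x (x, y)) ?_
      · exact (hη.cont.comp (by fun_prop : Continuous fun x : ℝ => (x, y))).continuousOn
      · exact (hη.cont_x.comp (by fun_prop : Continuous fun x : ℝ => (x, y))).intervalIntegrable _ _
    have := (hlη.mul hl hL.le).integral_eq
    rw [intervalIntegral_eq_Ioo hL.le] at this
    rw [this]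
    linarith [mul_nonpos_of_nonneg_of_nonpos (hη.nonneg (0, y)) hp]

/-- On vertical lines both end values vanish: $Y$ at the wall, and $\eta$ at a height $R$ above its
support. -/
theorem setIntegral_cutoff_y {L C : ℝ} {n : ℕ} {η ηx ηy Y DY : ℝ × ℝ → ℝ}
    (hη : IsCornerCutoff L C n η ηx ηy) (iY : LocInt L Y) (iDY : LocInt L DY)
    (hY : ∀ R, 0 < R → ∀ᵐ x ∂(volume.restrict (Ioo 0 L)), ∃ q,
      LineAC 0 R (fun y => Y (x, y)) (fun y => DY (x, y)) 0 q) :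
    ∫ p in Om L, (ηy p * Y p + η p * DY p) = 0 := by
  obtain ⟨K, hK, h0, hKL, hz⟩ := hη.support
  have hOm : Om L ⊆ OmBar L := prod_mono Ioo_subset_Icc_self Ioi_subset_Ici_self
  have i1 := iY.mul_cutoff hη.cont_y hK h0 hKL fun p hp hp' => (hz p (hOm hp) hp').2.2
  have i2 := iDY.mul_cutoff hη.cont hK h0 hKL fun p hp hp' => (hz p (hOm hp) hp').1
  have i3 : IntegrableOn (fun p => ηy p * Y p + η p * DY p) (Om L) := i1.add i2
  rw [setIntegral_Om i3]
  obtain ⟨R', hR'⟩ := (hK.image continuous_snd).bddAbove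
  set R := max R' 0 + 1
  have hR : 0 < R := by positivity
  have hout : ∀ x ∈ Ioo 0 L, ∀ y, R ≤ y → (x, y) ∉ K := fun x _ y hy h => by
    have := (hR' ⟨_, h, rfl⟩).trans (le_max_left _ 0)
    simp only at this
    linarith [lt_add_one (max R' 0)]
  have hmem : ∀ x ∈ Ioo 0 L, ∀ y, R ≤ y → (x, y) ∈ OmBar L := fun x hx y hy =>
    ⟨Ioo_subset_Icc_self hx, hR.le.trans hy⟩
  refine (integral_congr_ae (g := fun _ => (0 : ℝ)) ?_).trans (by simp)
  filter_upwards [hY R hR, ae_restrict_mem measurableSet_Ioo] with x ⟨q, hl⟩ hx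
  have hlη : LineAC 0 R (fun y => η (x, y)) (fun y => ηy (x, y)) (η (x, 0)) (η (x, R)) := by
    refine LineAC.of_hasDerivAt hR.le ?_ (fun y _ => hη.deriv_y (x, y)) ?_
    · exact (hη.cont.comp (by fun_prop : Continuous fun y : ℝ => (x, y))).continuousOn
    · exact (hη.cont_y.comp (by fun_prop : Continuous fun y : ℝ => (x, y))).intervalIntegrable _ _
  have h1 := (hlη.mul hl hR.le).integral_eq
  rw [intervalIntegral_eq_Ioo hR.le, (hz _ (hmem x hx R le_rfl) (hout x hx R le_rfl)).1] at h1
  simp only [mul_zero, zero_mul, sub_zero] at h1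
  refine Eq.trans ?_ h1
  refine setIntegral_eq_of_subset_of_forall_sdiff_eq_zero measurableSet_Ioi Ioo_subset_Ioi_self ?_
  intro y hy
  have hy' : R ≤ y := by
    by_contra! h
    exact hy.2 ⟨hy.1, h⟩
  have h2 := hz _ (hmem x hx y hy') (hout x hx y hy')
  rw [h2.1, h2.2.2]
  ring

/-- `h` is integrable near the corners, with integral of order `o(2⁻ⁿ)` over squares of side
`L / 2 ^ n`. -/
def CornerSmallInt (L : ℝ) (h : ℝ × ℝ → ℝ) : Prop :=
  (∀ n, IntegrableOn h (Corners L n)) ∧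
    Tendsto (fun n : ℕ => 2 ^ n * ∫ p in Corners L n, |h p|) atTop (𝓝 0)

/-- If `X_x + Y_y` is integrable, then its integral is bounded below by the outflow. -/
theorem outflow_le {L : ℝ} (hL : 0 < L) {X DX Y DY : ℝ × ℝ → ℝ} {XL : ℝ → ℝ}
    (iX : LocInt L X) (iDX : LocInt L DX) (iY : LocInt L Y) (iDY : LocInt L DY)
    (hX : ∀ᵐ y ∂(volume.restrict (Ioi (0 : ℝ))), ∃ p, p ≤ 0 ∧
      LineAC 0 L (fun x => X (x, y)) (fun x => DX (x, y)) p (XL y))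
    (hY : ∀ R, 0 < R → ∀ᵐ x ∂(volume.restrict (Ioo 0 L)), ∃ q,
      LineAC 0 R (fun y => Y (x, y)) (fun y => DY (x, y)) 0 q)
    (cX : CornerSmallInt L X) (cY : CornerSmallInt L Y)
    (fY : IntegrableOn Y (Ioo 0 L ×ˢ Ioi 1)) (iXL : IntegrableOn XL (Ioi 0))
    (iZ : IntegrableOn (fun p => DX p + DY p) (Om L)) :
    ∫ y in Ioi 0, XL y ≤ ∫ p in Om L, (DX p + DY p) := by
  obtain ⟨C, hC, η, ηx, ηy, hη, hlim⟩ := exists_cornerCutoff hL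
  have hOm : Om L ⊆ OmBar L := prod_mono Ioo_subset_Icc_self Ioi_subset_Ici_self
  have hI : ∀ n, IntegrableOn (fun p => ηx n p * X p) (Om L) ∧
      IntegrableOn (fun p => η n p * DX p) (Om L) ∧ IntegrableOn (fun p => ηy n p * Y p) (Om L) ∧
      IntegrableOn (fun p => η n p * DY p) (Om L) := fun n => by
    obtain ⟨K, hK, h0, hKL, hz⟩ := (hη n).support
    exact ⟨iX.mul_cutoff (hη n).cont_x hK h0 hKL fun p hp hp' => (hz p (hOm hp) hp').2.1,
      iDX.mul_cutoff (hη n).cont hK h0 hKL fun p hp hp' => (hz p (hOm hp) hp').1,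
      iY.mul_cutoff (hη n).cont_y hK h0 hKL fun p hp hp' => (hz p (hOm hp) hp').2.2,
      iDY.mul_cutoff (hη n).cont hK h0 hKL fun p hp hp' => (hz p (hOm hp) hp').1⟩
  -- The error caused by derivatives of the cut-off consists of the two corner contributions and of
  -- the tail of $Y$. The horizontal derivative of the cut-off has no tail, so $X$ need not be
  -- integrable for large $y$.
  set G : ℕ → ℝ := fun n => C * (2 ^ n * ∫ p in Corners L n, |X p|)
    + C * (2 ^ n * ∫ p in Corners L n, |Y p|)
    + C / ((n : ℝ) + 1) * ∫ p in Ioo 0 L ×ˢ Ioi 1, |Y p|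
  have hG : Tendsto G atTop (𝓝 0) := by
    have h1 : Tendsto (fun n : ℕ => C / ((n : ℝ) + 1)) atTop (𝓝 0) :=
      tendsto_const_nhds.div_atTop (tendsto_natCast_atTop_atTop.atTop_add tendsto_const_nhds)
    simpa using ((cX.2.const_mul C).add (cY.2.const_mul C)).add
      (h1.mul_const (∫ p in Ioo 0 L ×ˢ Ioi 1, |Y p|))
  have key : ∀ n, ∫ y in Ioi 0, η n (L, y) * XL y
      ≤ (∫ p in Om L, η n p * (DX p + DY p)) + G n := fun n => by
    have h1 := le_setIntegral_cutoff_x hL (hη n) iX iDX hX iXL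
    have h2 := setIntegral_cutoff_y (hη n) iY iDY hY
    obtain ⟨i1, i2, i3, i4⟩ := hI n
    rw [integral_add i1 i2] at h1
    rw [integral_add i3 i4] at h2
    have h3 : ∫ p in Om L, η n p * (DX p + DY p)
        = (∫ p in Om L, η n p * DX p) + ∫ p in Om L, η n p * DY p := by
      rw [← integral_add i2 i4]
      simp only [mul_add]
    have sub1 : Corners L n ⊆ Om L := Corners_subset hL n
    have corner : ∀ F : ℝ × ℝ → ℝ, CornerSmallInt L F →
        IntegrableOn (fun p => (Corners L n).indicator (fun _ => C * 2 ^ n) p * |F p|) (Om L) ∧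
        ∫ p in Om L, (Corners L n).indicator (fun _ => C * 2 ^ n) p * |F p|
          = C * (2 ^ n * ∫ p in Corners L n, |F p|) := fun F hF => by
      have e : (fun p => (Corners L n).indicator (fun _ => C * 2 ^ n) p * |F p|)
          = (Corners L n).indicator (fun p => C * 2 ^ n * |F p|) := by
        ext p
        by_cases hp : p ∈ Corners L n <;> simp [hp]
      rw [e]
      constructor
      · exact (IntegrableOn.integrable_indicator ((hF.1 n).abs.const_mul _)
          (measurableSet_Corners L n)).integrableOn
      · rw [setIntegral_indicator (measurableSet_Corners L n), inter_eq_right.2 sub1,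
          integral_const_mul]
        ring
    have far : IntegrableOn (fun p => (Ioi 0 ×ˢ Ici ((n : ℝ) + 1)).indicator
          (fun _ => C / ((n : ℝ) + 1)) p * |Y p|) (Om L) ∧
        ∫ p in Om L, (Ioi 0 ×ˢ Ici ((n : ℝ) + 1)).indicator (fun _ => C / ((n : ℝ) + 1)) p * |Y p|
          ≤ C / ((n : ℝ) + 1) * ∫ p in Ioo 0 L ×ˢ Ioi 1, |Y p| := by
      have hm : MeasurableSet ((Ioi 0 ×ˢ Ici ((n : ℝ) + 1)) : Set (ℝ × ℝ)) :=
        measurableSet_Ioi.prod measurableSet_Ici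
      have e : (fun p => (Ioi 0 ×ˢ Ici ((n : ℝ) + 1)).indicator
          (fun _ => C / ((n : ℝ) + 1)) p * |Y p|)
          = (Ioi 0 ×ˢ Ici ((n : ℝ) + 1)).indicator (fun p => C / ((n : ℝ) + 1) * |Y p|) := by
        ext p
        by_cases hp : p ∈ (Ioi 0 ×ˢ Ici ((n : ℝ) + 1) : Set (ℝ × ℝ)) <;>
          simp only [hp, indicator_of_mem, indicator_of_notMem, not_false_eq_true, zero_mul]
      -- For $n=0$ the set on the left contains points of the line $y=1$, which the set on the right
      -- omits; hence only an inclusion up to null sets.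
      have hs : (Om L ∩ Ioi 0 ×ˢ Ici ((n : ℝ) + 1) : Set (ℝ × ℝ)) ≤ᵐ[volume]
          (Ioo 0 L ×ˢ Ioi 1 : Set (ℝ × ℝ)) := by
        have hn : (0 : ℝ) ≤ n := Nat.cast_nonneg n
        have hae : ∀ᵐ p : ℝ × ℝ, p.2 ≠ 1 := by
          have : volume ((univ : Set ℝ) ×ˢ ({1} : Set ℝ)) = 0 := by
            rw [Measure.volume_eq_prod, Measure.prod_prod]; simp
          refine measure_mono_null ?_ this
          intro p hp
          simp only [mem_ofPred_eq, not_not, mem_compl_iff] at hp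
          exact ⟨mem_univ _, hp⟩
        filter_upwards [hae] with p hp h
        refine ⟨h.1.1, lt_of_le_of_ne ?_ (Ne.symm hp)⟩
        have := h.2.2
        simp only [mem_Ici] at this
        linarith
      have fY' := IntegrableOn.mono_set_ae (fY.abs) hs
      rw [e]
      constructor
      · rw [IntegrableOn, integrable_indicator_iff hm, IntegrableOn, Measure.restrict_restrict hm,
          inter_comm]
        exact fY'.const_mul _
      · rw [setIntegral_indicator hm, integral_const_mul]
        refine mul_le_mul_of_nonneg_left ?_ (by positivity)
        exact setIntegral_mono_set fY.abs (ae_of_all _ fun _ => abs_nonneg _) hs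
    obtain ⟨cx1, cx2⟩ := corner X cX
    obtain ⟨cy1, cy2⟩ := corner Y cY
    have h4 : ∫ p in Om L, ηx n p * X p ≤ C * (2 ^ n * ∫ p in Corners L n, |X p|) := by
      rw [← cx2]
      refine setIntegral_mono_on i1 cx1 (measurableSet_Om L) fun p hp => ?_
      refine (le_abs_self _).trans ?_
      rw [abs_mul]
      exact mul_le_mul_of_nonneg_right ((hη n).bound_x p hp) (abs_nonneg _)
    have h8 : ∫ p in Om L, ηy n p * Y p ≤ C * (2 ^ n * ∫ p in Corners L n, |Y p|)
        + C / ((n : ℝ) + 1) * ∫ p in Ioo 0 L ×ˢ Ioi 1, |Y p| := by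
      refine le_trans ?_ (add_le_add cy2.le far.2)
      rw [← integral_add cy1 far.1]
      refine setIntegral_mono_on i3 (cy1.add far.1) (measurableSet_Om L) fun p hp => ?_
      refine (le_abs_self _).trans ?_
      rw [abs_mul, ← add_mul]
      exact mul_le_mul_of_nonneg_right ((hη n).bound_y p hp) (abs_nonneg _)
    have h7 : ∫ p in Om L, ηy n p * Y p = -∫ p in Om L, η n p * DY p := by linarith
    have : G n = C * (2 ^ n * ∫ p in Corners L n, |X p|)
      + C * (2 ^ n * ∫ p in Corners L n, |Y p|)
      + C / ((n : ℝ) + 1) * ∫ p in Ioo 0 L ×ˢ Ioi 1, |Y p| := rfl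
    rw [h3, this]
    linarith
  have l1 : Tendsto (fun n => ∫ y in Ioi 0, η n (L, y) * XL y) atTop (𝓝 (∫ y in Ioi 0, XL y)) := by
    refine tendsto_integral_of_dominated_convergence (fun y => |XL y|) (fun n => ?_) iXL.abs
      (fun n => ae_of_all _ fun y => ?_) ?_
    · exact ((hη n).cont.comp (by fun_prop : Continuous fun y : ℝ =>
        (L, y))).aestronglyMeasurable.mul iXL.aestronglyMeasurable
    · rw [norm_mul, Real.norm_eq_abs, Real.norm_eq_abs, abs_of_nonneg ((hη n).nonneg _)]
      exact mul_le_of_le_one_left (abs_nonneg _) ((hη n).le_one _)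
    · filter_upwards [ae_restrict_mem measurableSet_Ioi] with y hy
      refine tendsto_const_nhds.congr' ?_
      filter_upwards [hlim (L, y) hy] with n hn
      rw [hn, one_mul]
  have l2 : Tendsto (fun n => ∫ p in Om L, η n p * (DX p + DY p)) atTop
      (𝓝 (∫ p in Om L, (DX p + DY p))) := by
    refine tendsto_integral_of_dominated_convergence (fun p => |DX p + DY p|) (fun n => ?_) iZ.abs
      (fun n => ae_of_all _ fun y => ?_) ?_
    · exact (hη n).cont.aestronglyMeasurable.mul iZ.aestronglyMeasurable
    · rw [norm_mul, Real.norm_eq_abs, Real.norm_eq_abs, abs_of_nonneg ((hη n).nonneg _)]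
      exact mul_le_of_le_one_left (abs_nonneg _) ((hη n).le_one _)
    · filter_upwards [ae_restrict_mem (measurableSet_Om L)] with p hp
      refine tendsto_const_nhds.congr' ?_
      filter_upwards [hlim p hp.2] with n hn
      rw [hn, one_mul]
  have l3 := l2.add hG
  rw [add_zero] at l3
  exact le_of_tendsto_of_tendsto' l1 l3 key

/-! ### Products with bounded coefficients -/

theorem LineAC.cast {α γ : ℝ} {H H' : ℝ → ℝ} {p q p' q' : ℝ} (h : LineAC α γ H H' p q)
    (hp : p = p') (hq : q = q') : LineAC α γ H H' p' q' := hp ▸ hq ▸ h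

theorem Om_subset_OmBar (L : ℝ) : Om L ⊆ OmBar L :=
  prod_mono Ioo_subset_Icc_self Ioi_subset_Ici_self

/-- Continuous and bounded on `[0, L] × [0, ∞)`. -/
def Bdd (L : ℝ) (w : ℝ × ℝ → ℝ) : Prop :=
  ContinuousOn w (OmBar L) ∧ ∃ W, ∀ p ∈ OmBar L, |w p| ≤ W

namespace Bdd

variable {L : ℝ} {w : ℝ × ℝ → ℝ}

theorem aesm (H : Bdd L w) {s : Set (ℝ × ℝ)} (hs : s ⊆ Om L) :
    AEStronglyMeasurable w (volume.restrict s) :=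
  ((H.1.mono (Om_subset_OmBar L)).aestronglyMeasurable (measurableSet_Om L)).mono_measure
    (Measure.restrict_mono hs le_rfl)

theorem ae_le (H : Bdd L w) {s : Set (ℝ × ℝ)} (hs : s ⊆ Om L) :
    ∃ W, 0 ≤ W ∧ ∀ᵐ p ∂(volume.restrict s), ‖w p‖ ≤ W := by
  obtain ⟨W, hW⟩ := H.2
  refine ⟨max W 0, le_max_right _ _, ?_⟩
  have : ∀ᵐ p ∂(volume.restrict (Om L)), ‖w p‖ ≤ max W 0 := by
    filter_upwards [ae_restrict_mem (measurableSet_Om L)] with p hp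
    exact (hW p (Om_subset_OmBar L hp)).trans (le_max_left _ _)
  exact ae_restrict_of_ae_restrict_of_subset hs this

theorem integrableOn_mul (H : Bdd L w) {s : Set (ℝ × ℝ)} (hs : s ⊆ Om L) {h : ℝ × ℝ → ℝ}
    (hh : IntegrableOn h s) : IntegrableOn (fun p => w p * h p) s := by
  obtain ⟨W, -, hW⟩ := H.ae_le hs
  exact Integrable.bdd_mul (c := W) hh (H.aesm hs) hW

theorem memLp_mul (H : Bdd L w) {s : Set (ℝ × ℝ)} (hs : s ⊆ Om L) {h : ℝ × ℝ → ℝ}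
    (hh : MemLp h 2 (volume.restrict s)) : MemLp (fun p => w p * h p) 2 (volume.restrict s) := by
  obtain ⟨W, -, hW⟩ := H.ae_le hs
  refine MemLp.of_le_mul (c := W) hh ((H.aesm hs).mul hh.1) ?_
  filter_upwards [hW] with p hp
  rw [norm_mul]
  exact mul_le_mul_of_nonneg_right hp (norm_nonneg _)

theorem locInt_mul (H : Bdd L w) {h : ℝ × ℝ → ℝ} (hh : LocInt L h) :
    LocInt L (fun p => w p * h p) :=
  fun K hK h0 hL => H.integrableOn_mul inter_subset_right (hh K hK h0 hL)

theorem cornerSmallInt_mul (hL : 0 < L) (H : Bdd L w) {h : ℝ × ℝ → ℝ} (hh : CornerSmallInt L h) :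
    CornerSmallInt L (fun p => w p * h p) := by
  obtain ⟨W, hW0, hW⟩ := H.ae_le (subset_refl (Om L))
  refine ⟨fun n => H.integrableOn_mul (Corners_subset hL n) (hh.1 n),
    squeeze_zero (g := fun n : ℕ => W * (2 ^ n * ∫ p in Corners L n, |h p|))
    (fun n => mul_nonneg (by positivity) (integral_nonneg fun _ => abs_nonneg _)) (fun n => ?_)
    (by simpa using hh.2.const_mul W)⟩
  rw [mul_left_comm]
  refine mul_le_mul_of_nonneg_left ?_ (by positivity)
  rw [← integral_const_mul]
  refine integral_mono_ae (H.integrableOn_mul (Corners_subset hL n) (hh.1 n)).abs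
    ((hh.1 n).abs.const_mul W) ?_
  filter_upwards [ae_restrict_of_ae_restrict_of_subset (Corners_subset hL n) hW] with p hp
  rw [abs_mul]
  exact mul_le_mul_of_nonneg_right hp (abs_nonneg _)

end Bdd

theorem CornerSmall.mul {L : ℝ} {h k : ℝ × ℝ → ℝ} (H : CornerSmall L h) (G : CornerSmall L k) :
    CornerSmallInt L (fun p => h p * k p) := by
  have hi : ∀ n, IntegrableOn (fun p => h p * k p) (Corners L n) := fun n =>
    (H.1 n).integrable_mul (G.1 n)
  refine ⟨hi, squeeze_zero (fun n => mul_nonneg (by positivity)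
    (integral_nonneg fun _ => abs_nonneg _)) (fun n => ?_) (by simpa using H.2.add G.2)⟩
  rw [← mul_add, ← integral_add (H.1 n).integrable_sq (G.1 n).integrable_sq]
  refine mul_le_mul_of_nonneg_left (integral_mono (hi n).abs
    ((H.1 n).integrable_sq.add (G.1 n).integrable_sq) fun p => ?_) (by positivity)
  simp only [abs_mul]
  nlinarith [sq_nonneg (|h p| - |k p|), sq_abs (h p), sq_abs (k p)]

theorem CornerSmallInt.add {L : ℝ} {h k : ℝ × ℝ → ℝ} (H : CornerSmallInt L h)
    (G : CornerSmallInt L k) : CornerSmallInt L (fun p => h p + k p) := by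
  refine ⟨fun n => (H.1 n).add (G.1 n), squeeze_zero (fun n => mul_nonneg (by positivity)
    (integral_nonneg fun _ => abs_nonneg _)) (fun n => ?_) (by simpa using H.2.add G.2)⟩
  rw [← mul_add, ← integral_add (H.1 n).abs (G.1 n).abs]
  exact mul_le_mul_of_nonneg_left (integral_mono ((H.1 n).add (G.1 n)).abs
    ((H.1 n).abs.add (G.1 n).abs) fun p => abs_add_le _ _) (by positivity)

theorem CornerSmallInt.const_mul {L : ℝ} {h : ℝ × ℝ → ℝ} (H : CornerSmallInt L h) (c : ℝ) :
    CornerSmallInt L (fun p => c * h p) := by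
  refine ⟨fun n => (H.1 n).const_mul c, ?_⟩
  have := H.2.const_mul |c|
  rw [mul_zero] at this
  refine this.congr fun n => ?_
  simp only [abs_mul, integral_const_mul]
  ring

theorem CornerSmall.add {L : ℝ} {h k : ℝ × ℝ → ℝ} (H : CornerSmall L h)
    (G : CornerSmall L k) : CornerSmall L (fun p => h p + k p) := by
  refine ⟨fun n => (H.1 n).add (G.1 n), squeeze_zero (fun n => mul_nonneg (by positivity)
    (integral_nonneg fun _ => sq_nonneg _)) (fun n => ?_)
    (by simpa using (H.2.const_mul 2).add (G.2.const_mul 2))⟩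
  have i1 := (H.1 n).integrable_sq
  have i2 := (G.1 n).integrable_sq
  calc 2 ^ n * ∫ p in Corners L n, (h p + k p) ^ 2
      ≤ 2 ^ n * ∫ p in Corners L n, (2 * h p ^ 2 + 2 * k p ^ 2) := by
        refine mul_le_mul_of_nonneg_left (integral_mono ((H.1 n).add (G.1 n)).integrable_sq
          ((i1.const_mul 2).add (i2.const_mul 2)) fun p => ?_) (by positivity)
        nlinarith [sq_nonneg (h p - k p)]
    _ = _ := by
        rw [integral_add (i1.const_mul 2) (i2.const_mul 2), integral_const_mul, integral_const_mul]
        ring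

theorem CornerSmall.const_mul {L : ℝ} {h : ℝ × ℝ → ℝ} (H : CornerSmall L h) (c : ℝ) :
    CornerSmall L (fun p => c * h p) := by
  refine ⟨fun n => (H.1 n).const_mul c, ?_⟩
  have := H.2.const_mul (c ^ 2)
  rw [mul_zero] at this
  refine this.congr fun n => ?_
  simp only [mul_pow, integral_const_mul]
  ring

theorem CornerSmall.sub {L : ℝ} {h k : ℝ × ℝ → ℝ} (H : CornerSmall L h)
    (G : CornerSmall L k) : CornerSmall L (fun p => h p - k p) := by
  simpa [sub_eq_add_neg] using H.add (G.const_mul (-1))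

/-! ### Continuously differentiable coefficients -/

/-- `h` is continuously differentiable on `[0, L] × [0, ∞)` with derivatives `hx`, `hy`. -/
structure IsC1 (L : ℝ) (h hx hy : ℝ × ℝ → ℝ) : Prop where
  cont : ContinuousOn h (OmBar L)
  cont_x : ContinuousOn hx (OmBar L)
  cont_y : ContinuousOn hy (OmBar L)
  dx : ∀ p ∈ Om L, HasDerivAt (fun s => h (s, p.2)) (hx p) p.1
  dy : ∀ p ∈ Om L, HasDerivAt (fun t => h (p.1, t)) (hy p) p.2

theorem continuousOn_line_x {L y : ℝ} {h : ℝ × ℝ → ℝ} (H : ContinuousOn h (OmBar L)) (hy : 0 ≤ y) :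
    ContinuousOn (fun x => h (x, y)) (Icc 0 L) :=
  H.comp (by fun_prop) fun _ hx => ⟨hx, hy⟩

theorem continuousOn_line_y {L x R : ℝ} {h : ℝ × ℝ → ℝ} (H : ContinuousOn h (OmBar L))
    (hx : x ∈ Icc 0 L) : ContinuousOn (fun y => h (x, y)) (Icc 0 R) :=
  H.comp (by fun_prop) fun _ hy => ⟨hx, hy.1⟩

theorem IsC1.line_x {L y : ℝ} {h hx hy : ℝ × ℝ → ℝ} (H : IsC1 L h hx hy) (hL : 0 < L)
    (hy0 : 0 < y) :
    LineAC 0 L (fun x => h (x, y)) (fun x => hx (x, y)) (h (0, y)) (h (L, y)) := by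
  refine LineAC.of_hasDerivAt hL.le (continuousOn_line_x H.cont hy0.le) (fun x hx => H.dx (x, y) ⟨hx, hy0⟩) ?_
  refine ContinuousOn.intervalIntegrable ?_
  rw [uIcc_of_le hL.le]
  exact continuousOn_line_x H.cont_x hy0.le

theorem IsC1.line_y {L x R : ℝ} {h hx hy : ℝ × ℝ → ℝ} (H : IsC1 L h hx hy) (hR : 0 < R)
    (hx0 : x ∈ Ioo 0 L) :
    LineAC 0 R (fun y => h (x, y)) (fun y => hy (x, y)) (h (x, 0)) (h (x, R)) := by
  have hx1 := Ioo_subset_Icc_self hx0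
  refine LineAC.of_hasDerivAt hR.le (continuousOn_line_y H.cont hx1) (fun y hy => H.dy (x, y) ⟨hx0, hy.1⟩) ?_
  refine ContinuousOn.intervalIntegrable ?_
  rw [uIcc_of_le hR.le]
  exact continuousOn_line_y H.cont_y hx1

/-- The derivative of `w h k`, where a prime denotes the derivative. -/
def tri (w w' h h' k k' : ℝ × ℝ → ℝ) (p : ℝ × ℝ) : ℝ :=
  w' p * (h p * k p) + w p * (h' p * k p + h p * k' p)

theorem locInt_tri {L : ℝ} {w w' h h' k k' : ℝ × ℝ → ℝ} (hw : Bdd L w) (hw' : Bdd L w')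
    (hh : LocSqIntegrable L h) (hh' : LocSqIntegrable L h') (hk : LocSqIntegrable L k)
    (hk' : LocSqIntegrable L k') : LocInt L (tri w w' h h' k k') :=
  (hw'.locInt_mul (hh.mul hk)).add (hw.locInt_mul ((hh'.mul hk).add (hh.mul hk')))

/-! ### Square integrability from slices and traces -/

theorem memLp_snd {L : ℝ} {b : ℝ → ℝ} (hb : MemLp b 2 (volume.restrict (Ioi 0))) :
    MemLp (fun p : ℝ × ℝ => b p.2) 2 (volume.restrict (Om L)) := by
  rw [volume_restrict_Om]
  exact hb.comp_snd _

theorem sq_integral_abs_le {L : ℝ} (hL : 0 < L) {h : ℝ → ℝ} (hh : MemLp h 2 (volume.restrict (Ioo 0 L))) :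
    (∫ x in Ioo 0 L, |h x|) ^ 2 ≤ L * ∫ x in Ioo 0 L, h x ^ 2 := by
  have hi : IntervalIntegrable (fun x => |h x|) volume 0 L := by
    rw [intervalIntegrable_iff_integrableOn_Ioo_of_le hL.le]
    exact (hh.integrable (by norm_num)).abs
  have hl : LineAC 0 L (fun s => ∫ x in (0 : ℝ)..s, |h x|) (fun x => |h x|) 0
      (∫ x in (0 : ℝ)..L, |h x|) :=
    ⟨hi, ae_of_all _ fun s => by rw [zero_add], by rw [zero_add]⟩
  have := (hl.sq_le hL.le (by simpa [IntegrableOn] using hh.integrable_sq)).2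
  rw [intervalIntegral_eq_Ioo hL.le] at this
  simpa using this

/-- Integration in `x` maps square integrable functions to square integrable functions. -/
theorem memLp_integral_x {L c : ℝ} (hL : 0 < L) {h : ℝ × ℝ → ℝ}
    (hh : MemLp h 2 (volume.restrict (Ioo 0 L ×ˢ Ioi c))) :
    MemLp (fun y => ∫ x in Ioo 0 L, |h (x, y)|) 2 (volume.restrict (Ioi c)) := by
  have e : (volume : Measure (ℝ × ℝ)).restrict (Ioo 0 L ×ˢ Ioi c)
    = (volume.restrict (Ioo 0 L)).prod (volume.restrict (Ioi c)) := by
    rw [Measure.prod_restrict]; rfl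
  rw [e] at hh
  have hm : AEStronglyMeasurable (fun y => ∫ x in Ioo 0 L, |h (x, y)|) (volume.restrict (Ioi c)) :=
    (hh.1.norm.prod_swap).integral_prod_right'
  rw [memLp_two_iff_integrable_sq hm]
  have hsq := hh.integrable_sq
  refine Integrable.mono' (hsq.integral_prod_right.const_mul L) (hm.pow 2) ?_
  filter_upwards [hsq.prod_left_ae, hh.1.prod_swap.prodMk_left] with y hy hy'
  rw [Real.norm_eq_abs, abs_of_nonneg (sq_nonneg _)]
  exact sq_integral_abs_le hL ((memLp_two_iff_integrable_sq hy').2 hy)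

/-- A function with square integrable derivative in `x` and square integrable trace at `x = L` is
square integrable. -/
theorem memLp_of_lineAC {L c : ℝ} (hL : 0 < L) {h hx : ℝ × ℝ → ℝ} {t : ℝ → ℝ}
    (hm : AEStronglyMeasurable h (volume.restrict (Ioo 0 L ×ˢ Ioi c)))
    (hh : MemLp hx 2 (volume.restrict (Ioo 0 L ×ˢ Ioi c)))
    (ht : MemLp t 2 (volume.restrict (Ioi c)))
    (hl : ∀ᵐ y ∂(volume.restrict (Ioi c)), ∃ p,
      LineAC 0 L (fun x => h (x, y)) (fun x => hx (x, y)) p (t y)) :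
    MemLp h 2 (volume.restrict (Ioo 0 L ×ˢ Ioi c)) := by
  have hG : MemLp (fun y => |t y| + 2 * ∫ x in Ioo 0 L, |hx (x, y)|) 2 (volume.restrict (Ioi c)) :=
    ht.norm.add ((memLp_integral_x hL hh).const_mul 2)
  have e : (volume : Measure (ℝ × ℝ)).restrict (Ioo 0 L ×ˢ Ioi c)
    = (volume.restrict (Ioo 0 L)).prod (volume.restrict (Ioi c)) := by
    rw [Measure.prod_restrict]; rfl
  rw [e] at hm ⊢
  rw [memLp_two_iff_integrable_sq hm]
  have key : ∀ᵐ y ∂(volume.restrict (Ioi c)), ∀ᵐ x ∂(volume.restrict (Ioo 0 L)),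
      h (x, y) ^ 2 ≤ (|t y| + 2 * ∫ x in Ioo 0 L, |hx (x, y)|) ^ 2 := by
    filter_upwards [hl] with y ⟨p, hp⟩
    filter_upwards [hp.eq, ae_restrict_mem measurableSet_Ioo] with x h1 h2
    have hi := (intervalIntegrable_iff_integrableOn_Ioo_of_le hL.le).1 hp.int
    have hb : ∀ s ∈ Icc 0 L, |∫ x in (0 : ℝ)..s, hx (x, y)| ≤ ∫ x in Ioo 0 L, |hx (x, y)| := by
      intro s hs
      rw [intervalIntegral_eq_Ioo hs.1]
      refine (abs_integral_le_integral_abs).trans ?_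
      exact setIntegral_mono_set hi.abs (ae_of_all _ fun _ => abs_nonneg _)
        (Ioo_subset_Ioo_right hs.2).eventuallyLE
    have h3 := hp.fin
    have h4 : h (x, y) = t y - (∫ x in (0 : ℝ)..L, hx (x, y)) + ∫ x in (0 : ℝ)..x, hx (x, y) := by
      rw [h1, h3]; ring
    refine sq_le_sq.2 ?_
    have h5 := hb x (Ioo_subset_Icc_self h2)
    have h6 := hb L ⟨hL.le, le_rfl⟩
    rw [h4]
    refine le_trans ?_ (le_abs_self _)
    calc _ ≤ |t y| + |∫ x in (0 : ℝ)..L, hx (x, y)| + |∫ x in (0 : ℝ)..x, hx (x, y)| :=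
          (abs_add_le _ _).trans (add_le_add_left (abs_sub _ _) _)
      _ ≤ _ := by linarith
  have hm2 := hm.pow 2
  refine (integrable_prod_iff' hm2).2 ⟨?_, ?_⟩
  · filter_upwards [key, hm2.prod_swap.prodMk_left] with y hy hmy
    refine Integrable.mono' (integrable_const ((|t y| + 2 * ∫ x in Ioo 0 L, |hx (x, y)|) ^ 2)) hmy ?_
    filter_upwards [hy] with x hx
    rw [Real.norm_eq_abs, abs_of_nonneg (sq_nonneg _)]
    exact hx
  · refine Integrable.mono' (hG.integrable_sq.const_mul L)
      (hm2.norm.prod_swap.integral_prod_right') ?_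
    filter_upwards [key] with y hy
    rw [Real.norm_eq_abs, abs_of_nonneg (integral_nonneg fun _ => norm_nonneg _)]
    calc _ ≤ ∫ x in Ioo 0 L, (|t y| + 2 * ∫ x in Ioo 0 L, |hx (x, y)|) ^ 2 := by
          refine integral_mono_of_nonneg (ae_of_all _ fun _ => norm_nonneg _)
            (integrable_const _) ?_
          filter_upwards [hy] with x hx
          rw [Real.norm_eq_abs, abs_of_nonneg (sq_nonneg _)]
          exact hx
      _ = _ := by
          rw [integral_const]
          simp [measureReal_def, hL.le]

/-! ### The energy inequality -/

/-- A bounded, non-negative weight with bounded derivatives. -/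
structure IsWeight (L : ℝ) (w wx wy wxx wxy wyy : ℝ × ℝ → ℝ) : Prop where
  c1 : IsC1 L w wx wy
  c1x : IsC1 L wx wxx wxy
  c1y : IsC1 L wy wxy wyy
  bd : Bdd L w
  bd_x : Bdd L wx
  bd_y : Bdd L wy
  bd_xx : Bdd L wxx
  bd_xy : Bdd L wxy
  bd_yy : Bdd L wyy
  nonneg : ∀ p ∈ OmBar L, 0 ≤ w p

theorem LineAC.tri {α γ : ℝ} {w w' h h' k k' : ℝ → ℝ} {p₁ q₁ p₂ q₂ p₃ q₃ : ℝ} (hle : α ≤ γ)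
    (H : LineAC α γ w w' p₁ q₁) (H₂ : LineAC α γ h h' p₂ q₂) (H₃ : LineAC α γ k k' p₃ q₃) :
    LineAC α γ (fun s => w s * (h s * k s))
      (fun s => w' s * (h s * k s) + w s * (h' s * k s + h s * k' s))
      (p₁ * (p₂ * p₃)) (q₁ * (q₂ * q₃)) :=
  H.mul (H₂.mul H₃ hle) hle

/-- A square integrable function with square integrable derivative is absolutely continuous up to
the end point. -/
theorem lineAC_of_contDiffOn {b : ℝ → ℝ} (hb : ContDiffOn ℝ 1 b (Ioi 0))
    (hb' : MemLp (deriv b) 2 (volume.restrict (Ioi 0))) {R : ℝ} (hR : 0 < R) :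
    ∃ p, LineAC 0 R b (deriv b) p (b R) := by
  have hd : ∀ y ∈ Ioi (0 : ℝ), HasDerivAt b (deriv b y) y := fun y hy =>
    ((hb.differentiableOn (by simp)).differentiableAt (Ioi_mem_nhds hy)).hasDerivAt
  have hi : IntervalIntegrable (deriv b) volume 0 R := by
    rw [intervalIntegrable_iff_integrableOn_Ioo_of_le hR.le]
    exact (hb'.mono_measure (Measure.restrict_mono Ioo_subset_Ioi_self le_rfl)).integrable
      (by norm_num)
  have key : ∀ s, 0 < s → s ≤ R → b R - b s = ∫ t in s..R, deriv b t := fun s hs hsR => by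
    symm
    refine intervalIntegral.integral_eq_sub_of_hasDerivAt_of_le hsR
      (fun y hy => (hd y (hs.trans_le hy.1)).continuousAt.continuousWithinAt)
      (fun y hy => hd y (hs.trans hy.1)) (hi.mono_set ?_)
    rw [uIcc_of_le hsR, uIcc_of_le hR.le]
    exact Icc_subset_Icc_left hs.le
  refine ⟨b R - ∫ t in (0 : ℝ)..R, deriv b t, hi, ?_, by ring⟩
  filter_upwards [ae_restrict_mem measurableSet_Ioo] with s hs
  have h1 := key s hs.1 hs.2.le
  have h2 := intervalIntegral.integral_add_adjacent_intervals (a := 0) (b := s) (c := R)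
    (hi.mono_set (by
      rw [uIcc_of_le hs.1.le, uIcc_of_le hR.le]; exact Icc_subset_Icc_right hs.2.le))
    (hi.mono_set (by
      rw [uIcc_of_le hs.2.le, uIcc_of_le hR.le]; exact Icc_subset_Icc_left hs.1.le))
  linarith

/-! ### The energy flux of the multiplier $[-\beta_y,\epsilon\beta_x]$ -/

section Flux

variable (ε : ℝ) (w wx wy wxx wxy wyy : ℝ × ℝ → ℝ) (bL : ℝ → ℝ) (S : Remainder)

/-- The tangential stress. -/
def Remainder.B (p : ℝ × ℝ) : ℝ := S.uy p + ε * S.vx p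

def Remainder.Bx (p : ℝ × ℝ) : ℝ := S.uxy p + ε * S.vxx p

def Remainder.By (p : ℝ × ℝ) : ℝ := S.uyy p + ε * S.vxy p

/-- The horizontal component of the energy flux. -/
def fluxX (p : ℝ × ℝ) : ℝ :=
  w p * (S.uy p * (S.B ε p - bL p.2)) + -(1 / 2) * (w p * (S.B ε p * S.B ε p))
    + -1 * (w p * (S.P p * S.vy p)) + -1 * (wy p * (S.P p * S.v p))
    + -ε * (wx p * (S.v p * S.B ε p))

/-- The summands follow those of `fluxX` in the same order, each in the form produced by
`LineAC.tri`. The function $b_L$ has no $x$-derivative and contributes nothing. -/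
def fluxDX (p : ℝ × ℝ) : ℝ :=
  tri w wx S.uy S.uxy (fun p => S.B ε p - bL p.2) (S.Bx ε) p
    + -(1 / 2) * tri w wx (S.B ε) (S.Bx ε) (S.B ε) (S.Bx ε) p
    + -1 * tri w wx S.P S.Px S.vy S.vxy p + -1 * tri wy wxy S.P S.Px S.v S.vx p
    + -ε * tri wx wxx S.v S.vx (S.B ε) (S.Bx ε) p

/-- The vertical component of the energy flux. -/
def fluxY (p : ℝ × ℝ) : ℝ :=
  w p * (S.P p * S.vx p) + wx p * (S.P p * S.v p) + w p * (S.vy p * (S.B ε p - bL p.2))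
    + -(2 * ε) * (w p * (S.vx p * S.vy p)) + wy p * (S.v p * S.B ε p)
    + -(2 * ε) * (wy p * (S.v p * S.vx p)) + -(2 * ε) * (wx p * (S.v p * S.vy p))

def fluxDY (p : ℝ × ℝ) : ℝ :=
  tri w wy S.P S.Py S.vx S.vxy p + tri wx wxy S.P S.Py S.v S.vy p
    + tri w wy S.vy S.vyy (fun p => S.B ε p - bL p.2) (fun p => S.By ε p - deriv bL p.2) p
    + -(2 * ε) * tri w wy S.vx S.vxy S.vy S.vyy p + tri wy wyy S.v S.vy (S.B ε) (S.By ε) p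
    + -(2 * ε) * tri wy wyy S.v S.vy S.vx S.vxy p
    + -(2 * ε) * tri wx wxy S.v S.vy S.vy S.vyy p

/-- The terms of lower order in the divergence of the energy flux. -/
def fluxLow (p : ℝ × ℝ) : ℝ :=
  wx p * (S.uy p * S.B ε p) + -(1 / 2) * (wx p * (S.B ε p * S.B ε p))
    + -ε * (wxx p * (S.v p * S.B ε p)) + -ε * (wx p * (S.vx p * S.B ε p))
    + 2 * (wy p * (S.vy p * S.B ε p)) + -(4 * ε) * (wy p * (S.vx p * S.vy p))
    + wyy p * (S.v p * S.B ε p) + -(2 * ε) * (wyy p * (S.v p * S.vx p))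
    + -(2 * ε) * (wxy p * (S.v p * S.vy p)) + -(2 * ε) * (wx p * (S.vy p * S.vy p))
    + -1 * (wx p * (S.uy p * bL p.2)) + -1 * (wy p * (S.vy p * bL p.2))
    + -1 * (w p * (S.vy p * deriv bL p.2))

/-- The outflow at `x = L`. -/
def outflow (L : ℝ) (aL τ : ℝ → ℝ) (y : ℝ) : ℝ :=
  -(1 / 2) * (w (L, y) * bL y ^ 2)
    - (aL y - 2 * ε * τ y) * (w (L, y) * τ y + wy (L, y) * ∫ x in Ioo 0 L, S.vx (x, y))
    - ε * (wx (L, y) * ((∫ x in Ioo 0 L, S.vx (x, y)) * bL y))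

end Flux

theorem LocSqIntegrable.bL {L : ℝ} {b : ℝ → ℝ} (hb : MemLp b 2 (volume.restrict (Ioi 0))) :
    LocSqIntegrable L (fun p => b p.2) := MemLp.locSq (memLp_snd hb)

section Energy

variable {L ε : ℝ} {w wx wy wxx wxy wyy us vs f g F1 F2 : ℝ × ℝ → ℝ} {aL bL τ : ℝ → ℝ}
  {S : Remainder}

/-- The flux is designed for this cancellation. After inserting the momentum equations,
$u_{xx}=-v_{xy}$ and $u_{xy}=-v_{yy}$, both the pressure and all second derivatives of the solution
disappear. -/
theorem flux_divergence (hl : S.Lines L ε aL bL τ)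
    (h1 : ∀ᵐ p ∂(volume.restrict (Om L)), S.Px p = F1 p + S.uyy p + ε * S.uxx p)
    (h2 : ∀ᵐ p ∂(volume.restrict (Om L)), S.Py p = ε * (F2 p + S.vyy p + ε * S.vxx p)) :
    ∀ᵐ p ∂(volume.restrict (Om L)),
      fluxDX ε w wx wy wxx wxy bL S p + fluxDY ε w wx wy wxy wyy bL S p
        = -1 * (w p * (S.vy p * F1 p)) + -1 * (wy p * (S.v p * F1 p))
          + ε * (w p * (S.vx p * F2 p)) + ε * (wx p * (S.v p * F2 p))
          + fluxLow ε w wx wy wxx wxy wyy bL S p := by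
  filter_upwards [h1, h2, hl.rel_xx, hl.rel_xy] with p e1 e2 e3 e4
  have e3' : S.uxx p = -S.vxy p := by linarith
  have e4' : S.uxy p = -S.vyy p := by linarith
  simp only [fluxDX, fluxDY, fluxLow, tri, Remainder.B, Remainder.Bx, Remainder.By]
  rw [e1, e2, e3', e4']
  ring

/-- At $x=0$ the functions $v$, $v_y$ and $u_y$ vanish, and $-\frac12wB^2\le0$ is all that remains.
At $x=L$ the factor $B-b_L$ vanishes, which eliminates the unspecified end value of $u_y$; the other
end values are $P=a_L-2\epsilon\tau$, $v_y=\tau$ and $v=\int_0^Lv_x$. -/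
theorem flux_lineX (hL : 0 < L) (hw : IsWeight L w wx wy wxx wxy wyy) (hl : S.Lines L ε aL bL τ) :
    ∀ᵐ y ∂(volume.restrict (Ioi (0 : ℝ))), ∃ p, p ≤ 0 ∧
      LineAC 0 L (fun x => fluxX ε w wx wy bL S (x, y))
        (fun x => fluxDX ε w wx wy wxx wxy bL S (x, y)) p (outflow ε w wx wy bL S L aL τ y) := by
  filter_upwards [hl.x_v, hl.x_vy, hl.x_uy, hl.x_B, hl.x_P, ae_restrict_mem measurableSet_Ioi]
    with y v a ⟨qb, b⟩ ⟨pB, B⟩ ⟨pP, P⟩ hy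
  have lw := hw.c1.line_x hL hy
  have lwx := hw.c1x.line_x hL hy
  have lwy := hw.c1y.line_x hL hy
  have Bβ : LineAC 0 L (fun x => S.B ε (x, y) - bL y) (fun x => S.Bx ε (x, y)) (pB - bL y)
      (bL y - bL y) := by
    have := B.sub (LineAC.const (bL y)) hL.le
    simp only [sub_zero] at this
    exact this
  have t1 := LineAC.tri hL.le lw b Bβ
  have t2 := (LineAC.tri hL.le lw B B).const_mul (-(1 / 2))
  have t3 := (LineAC.tri hL.le lw P a).const_mul (-1)
  have t4 := (LineAC.tri hL.le lwy P v).const_mul (-1)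
  have t5 := (LineAC.tri hL.le lwx v B).const_mul (-ε)
  have t := (((t1.add t2 hL.le).add t3 hL.le).add t4 hL.le).add t5 hL.le
  refine ⟨-(1 / 2) * (w (0, y) * (pB * pB)), ?_, t.cast (by ring) ?_⟩
  · have : 0 ≤ w (0, y) * (pB * pB) :=
      mul_nonneg (hw.nonneg _ ⟨⟨le_rfl, hL.le⟩, mem_Ici.2 (mem_Ioi.1 hy).le⟩) (mul_self_nonneg _)
    linarith
  · rw [intervalIntegral_eq_Ioo hL.le, outflow]
    ring

/-- Every summand of the vertical flux contains $v$, $v_x$ or $v_y$, all of which vanish at the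
wall. The end values of $P$ and $u_y$ are therefore irrelevant. -/
theorem flux_lineY (hw : IsWeight L w wx wy wxx wxy wyy) (hl : S.Lines L ε aL bL τ)
    (hb : ContDiffOn ℝ 1 bL (Ioi 0)) (hb2 : MemLp (deriv bL) 2 (volume.restrict (Ioi 0)))
    (R : ℝ) (hR : 0 < R) : ∀ᵐ x ∂(volume.restrict (Ioo 0 L)), ∃ q,
      LineAC 0 R (fun y => fluxY ε w wx wy bL S (x, y))
        (fun y => fluxDY ε w wx wy wxy wyy bL S (x, y)) 0 q := by
  obtain ⟨pβ, lβ⟩ := lineAC_of_contDiffOn hb hb2 hR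
  filter_upwards [hl.y_v R hR, hl.y_vy R hR, hl.y_vx R hR, hl.y_uy R hR, hl.y_P R hR,
    ae_restrict_mem measurableSet_Ioo] with x ⟨qv, v⟩ ⟨qa, a⟩ ⟨qc, c⟩ ⟨pb, qb, b⟩ ⟨pP, qP, P⟩ hx
  have lw := hw.c1.line_y hR hx
  have lwx := hw.c1x.line_y hR hx
  have lwy := hw.c1y.line_y hR hx
  have B := b.add (c.const_mul ε) hR.le
  have Bβ := B.sub lβ hR.le
  have t1 := LineAC.tri hR.le lw P c
  have t2 := LineAC.tri hR.le lwx P v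
  have t3 := LineAC.tri hR.le lw a Bβ
  have t4 := (LineAC.tri hR.le lw c a).const_mul (-(2 * ε))
  have t5 := LineAC.tri hR.le lwy v B
  have t6 := (LineAC.tri hR.le lwy v c).const_mul (-(2 * ε))
  have t7 := (LineAC.tri hR.le lwx v a).const_mul (-(2 * ε))
  have t := (((((t1.add t2 hR.le).add t3 hR.le).add t4 hR.le).add t5 hR.le).add t6 hR.le).add t7
    hR.le
  exact ⟨_, t.cast (by ring) rfl⟩

theorem flux_locInt (hw : IsWeight L w wx wy wxx wxy wyy) (H : S.IsSolution L ε us vs f g aL bL)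
    (hl : S.Lines L ε aL bL τ) (hb1 : MemLp bL 2 (volume.restrict (Ioi 0)))
    (hb2 : MemLp (deriv bL) 2 (volume.restrict (Ioi 0))) :
    LocInt L (fluxX ε w wx wy bL S) ∧ LocInt L (fluxDX ε w wx wy wxx wxy bL S) ∧
      LocInt L (fluxY ε w wx wy bL S) ∧ LocInt L (fluxDY ε w wx wy wxy wyy bL S) := by
  have v := MemLp.locSq hl.v_L2
  have a := MemLp.locSq hl.vy_L2
  have b := MemLp.locSq hl.uy_L2
  have c := MemLp.locSq hl.vx_L2
  have P := LocHalfSobolev.locSq H.strong.P_half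
  have β := LocSqIntegrable.bL (L := L) hb1
  have β' := LocSqIntegrable.bL (L := L) hb2
  have B : LocSqIntegrable L (S.B ε) := b.add (c.const_mul ε)
  have Bx : LocSqIntegrable L (S.Bx ε) := H.strong.uxy.add (H.strong.vxx.const_mul ε)
  have By : LocSqIntegrable L (S.By ε) := H.strong.uyy.add (H.strong.vxy.const_mul ε)
  have Bβ : LocSqIntegrable L (fun p => S.B ε p - bL p.2) := B.sub β
  have Bβ' : LocSqIntegrable L (fun p => S.By ε p - deriv bL p.2) := By.sub β'
  have ax := H.strong.vxy
  have ay := H.strong.vyy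
  have bx := H.strong.uxy
  have Px := H.strong.Px
  have Py := H.strong.Py
  refine ⟨?_, ?_, ?_, ?_⟩
  · exact ((((hw.bd.locInt_mul (b.mul Bβ)).add ((hw.bd.locInt_mul (B.mul B)).const_mul _)).add
      ((hw.bd.locInt_mul (P.mul a)).const_mul _)).add
      ((hw.bd_y.locInt_mul (P.mul v)).const_mul _)).add
      ((hw.bd_x.locInt_mul (v.mul B)).const_mul _)
  · exact ((((locInt_tri hw.bd hw.bd_x b bx Bβ Bx).add
      ((locInt_tri hw.bd hw.bd_x B Bx B Bx).const_mul _)).add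
      ((locInt_tri hw.bd hw.bd_x P Px a ax).const_mul _)).add
      ((locInt_tri hw.bd_y hw.bd_xy P Px v c).const_mul _)).add
      ((locInt_tri hw.bd_x hw.bd_xx v c B Bx).const_mul _)
  · exact ((((((hw.bd.locInt_mul (P.mul c)).add (hw.bd_x.locInt_mul (P.mul v))).add
      (hw.bd.locInt_mul (a.mul Bβ))).add ((hw.bd.locInt_mul (c.mul a)).const_mul _)).add
      (hw.bd_y.locInt_mul (v.mul B))).add ((hw.bd_y.locInt_mul (v.mul c)).const_mul _)).add
      ((hw.bd_x.locInt_mul (v.mul a)).const_mul _)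
  · exact ((((((locInt_tri hw.bd hw.bd_y P Py c ax).add (locInt_tri hw.bd_x hw.bd_xy P Py v a)).add
      (locInt_tri hw.bd hw.bd_y a ay Bβ Bβ')).add
      ((locInt_tri hw.bd hw.bd_y c ax a ay).const_mul _)).add
      (locInt_tri hw.bd_y hw.bd_yy v a B By)).add
      ((locInt_tri hw.bd_y hw.bd_yy v a c ax).const_mul _)).add
      ((locInt_tri hw.bd_x hw.bd_xy v a a ay).const_mul _)

/-- Apart from the bounded coefficients, each summand is a product of two factors which are of class
$H^{1/2}$ at the corners, bounded ($v$), or square integrable functions of $y$ alone ($b_L$).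
Squares of such factors are $o(2^{-n})$ in mean over the corner squares, hence so are the products.
-/
theorem flux_cornerSmall (hL : 0 < L) (hw : IsWeight L w wx wy wxx wxy wyy)
    (H : S.IsSolution L ε us vs f g aL bL) (hb1 : MemLp bL 2 (volume.restrict (Ioi 0))) :
    CornerSmallInt L (fluxX ε w wx wy bL S) ∧ CornerSmallInt L (fluxY ε w wx wy bL S) := by
  have v := cornerSmall_of_bounded hL H.memX.v_bdd
  have a := LocHalfSobolev.cornerSmall hL H.strong.vy_half
  have b := LocHalfSobolev.cornerSmall hL H.strong.uy_half
  have c := LocHalfSobolev.cornerSmall hL H.strong.vx_half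
  have P := LocHalfSobolev.cornerSmall hL H.strong.P_half
  have β := cornerSmall_of_snd hL hb1
  have B : CornerSmall L (S.B ε) := b.add (c.const_mul ε)
  have Bβ : CornerSmall L (fun p => S.B ε p - bL p.2) := B.sub β
  have m := fun {k : ℝ × ℝ → ℝ} (hk : Bdd L k) {h : ℝ × ℝ → ℝ} (hh : CornerSmallInt L h) =>
    Bdd.cornerSmallInt_mul hL hk hh
  constructor
  · exact ((((m hw.bd (b.mul Bβ)).add ((m hw.bd (B.mul B)).const_mul _)).add
      ((m hw.bd (P.mul a)).const_mul _)).add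
      ((m hw.bd_y (P.mul v)).const_mul _)).add
      ((m hw.bd_x (v.mul B)).const_mul _)
  · exact ((((((m hw.bd (P.mul c)).add (m hw.bd_x (P.mul v))).add
      (m hw.bd (a.mul Bβ))).add ((m hw.bd (c.mul a)).const_mul _)).add
      (m hw.bd_y (v.mul B))).add ((m hw.bd_y (v.mul c)).const_mul _)).add
      ((m hw.bd_x (v.mul a)).const_mul _)

theorem memLp_of_mul_snd {h : ℝ × ℝ → ℝ}
    (hm : AEStronglyMeasurable h (volume.restrict (Om L)))
    (hh : MemLp (fun p => h p * p.2) 2 (volume.restrict (Om L))) :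
    MemLp h 2 (volume.restrict (Ioo 0 L ×ˢ Ioi 1)) := by
  have hs : (Ioo 0 L ×ˢ Ioi 1 : Set (ℝ × ℝ)) ⊆ Om L :=
    prod_mono subset_rfl (Ioi_subset_Ioi zero_le_one)
  refine MemLp.of_le (hh.mono_measure (Measure.restrict_mono hs le_rfl))
    (hm.mono_measure (Measure.restrict_mono hs le_rfl)) ?_
  filter_upwards [ae_restrict_mem (measurableSet_Ioo.prod measurableSet_Ioi)] with p hp
  rw [norm_mul]
  refine le_mul_of_one_le_right (norm_nonneg _) ?_
  rw [Real.norm_eq_abs]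
  exact hp.2.le.trans (le_abs_self _)

/-- The trace of $P$ at $x=L$ is $a_L-2\epsilon\tau$. For $y>1$ the weights in the norm of $\mathcal
X$ make $u_{yy}$ and $u_{xx}$ square integrable, hence also $P_x$ by the equation. Integration in
$x$ from the outflow boundary gives $P$. -/
theorem memLp_P (hL : 0 < L) (H : S.IsSolution L ε us vs f g aL bL)
    (hl : S.Lines L ε aL bL τ) (ha : MemLp aL 2 (volume.restrict (Ioi 0)))
    (hF1 : MemLp F1 2 (volume.restrict (Om L)))
    (h1 : ∀ᵐ p ∂(volume.restrict (Om L)), S.Px p = F1 p + S.uyy p + ε * S.uxx p) :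
    MemLp S.P 2 (volume.restrict (Ioo 0 L ×ˢ Ioi 1)) := by
  have hs : (Ioo 0 L ×ˢ Ioi 1 : Set (ℝ × ℝ)) ⊆ Om L :=
    prod_mono subset_rfl (Ioi_subset_Ioi zero_le_one)
  have hs' : (Ioi 1 : Set ℝ) ⊆ Ioi 0 := Ioi_subset_Ioi zero_le_one
  have huyy := memLp_of_mul_snd H.jet.uyy.2.1.aestronglyMeasurable H.memX.uyy_y
  have huxx := memLp_of_mul_snd H.jet.uxx.2.1.aestronglyMeasurable H.memX.uxx_y
  have hPx : MemLp S.Px 2 (volume.restrict (Ioo 0 L ×ˢ Ioi 1)) := by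
    refine (memLp_congr_ae (ae_restrict_of_ae_restrict_of_subset hs h1)).2 ?_
    exact ((hF1.mono_measure (Measure.restrict_mono hs le_rfl)).add huyy).add (huxx.const_mul ε)
  have ht : MemLp (fun y => aL y - 2 * ε * τ y) 2 (volume.restrict (Ioi 1)) :=
    (ha.sub (hl.τ_L2.const_mul (2 * ε))).mono_measure (Measure.restrict_mono hs' le_rfl)
  exact memLp_of_lineAC hL (H.jet.Px.1.aestronglyMeasurable.mono_measure
    (Measure.restrict_mono hs le_rfl)) hPx ht (ae_restrict_of_ae_restrict_of_subset hs' hl.x_P)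

theorem flux_far (hw : IsWeight L w wx wy wxx wxy wyy) (hl : S.Lines L ε aL bL τ)
    (hb1 : MemLp bL 2 (volume.restrict (Ioi 0)))
    (hP : MemLp S.P 2 (volume.restrict (Ioo 0 L ×ˢ Ioi 1))) :
    IntegrableOn (fluxY ε w wx wy bL S) (Ioo 0 L ×ˢ Ioi 1) := by
  have hs : (Ioo 0 L ×ˢ Ioi 1 : Set (ℝ × ℝ)) ⊆ Om L :=
    prod_mono subset_rfl (Ioi_subset_Ioi zero_le_one)
  have r : ∀ {h : ℝ × ℝ → ℝ}, MemLp h 2 (volume.restrict (Om L)) →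
      MemLp h 2 (volume.restrict (Ioo 0 L ×ˢ Ioi 1)) := fun hh =>
    hh.mono_measure (Measure.restrict_mono hs le_rfl)
  have v := r hl.v_L2
  have a := r hl.vy_L2
  have c := r hl.vx_L2
  have B : MemLp (S.B ε) 2 (volume.restrict (Ioo 0 L ×ˢ Ioi 1)) :=
    r (hl.uy_L2.add (hl.vx_L2.const_mul ε))
  have Bβ : MemLp (fun p => S.B ε p - bL p.2) 2 (volume.restrict (Ioo 0 L ×ˢ Ioi 1)) :=
    B.sub (r (memLp_snd hb1))
  have m := fun {k : ℝ × ℝ → ℝ} (hk : Bdd L k) {h h' : ℝ × ℝ → ℝ}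
    (hh : MemLp h 2 (volume.restrict (Ioo 0 L ×ˢ Ioi 1)))
    (hh' : MemLp h' 2 (volume.restrict (Ioo 0 L ×ˢ Ioi 1))) =>
    hk.integrableOn_mul hs (hh.integrable_mul hh')
  exact ((((((m hw.bd hP c).add (m hw.bd_x hP v)).add
      (m hw.bd a Bβ)).add ((m hw.bd c a).const_mul _)).add
      (m hw.bd_y v B)).add ((m hw.bd_y v c).const_mul _)).add
      ((m hw.bd_x v a).const_mul _)

theorem fluxLow_integrable (hw : IsWeight L w wx wy wxx wxy wyy) (hl : S.Lines L ε aL bL τ)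
    (hb1 : MemLp bL 2 (volume.restrict (Ioi 0)))
    (hb2 : MemLp (deriv bL) 2 (volume.restrict (Ioi 0))) :
    IntegrableOn (fluxLow ε w wx wy wxx wxy wyy bL S) (Om L) := by
  have v := hl.v_L2
  have a := hl.vy_L2
  have b := hl.uy_L2
  have c := hl.vx_L2
  have β := memLp_snd (L := L) hb1
  have β' := memLp_snd (L := L) hb2
  have B : MemLp (S.B ε) 2 (volume.restrict (Om L)) := b.add (c.const_mul ε)
  have m := fun {k : ℝ × ℝ → ℝ} (hk : Bdd L k) {h h' : ℝ × ℝ → ℝ}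
    (hh : MemLp h 2 (volume.restrict (Om L))) (hh' : MemLp h' 2 (volume.restrict (Om L))) =>
    hk.integrableOn_mul subset_rfl (hh.integrable_mul hh')
  exact ((((((((((((m hw.bd_x b B).add ((m hw.bd_x B B).const_mul _)).add
    ((m hw.bd_xx v B).const_mul _)).add ((m hw.bd_x c B).const_mul _)).add
    ((m hw.bd_y a B).const_mul _)).add ((m hw.bd_y c a).const_mul _)).add
    (m hw.bd_yy v B)).add ((m hw.bd_yy v c).const_mul _)).add
    ((m hw.bd_xy v a).const_mul _)).add ((m hw.bd_x a a).const_mul _)).add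
    ((m hw.bd_x b β).const_mul _)).add ((m hw.bd_y a β).const_mul _)).add
    ((m hw.bd a β').const_mul _)

theorem Bdd.memLp_trace {L : ℝ} (hL : 0 < L) {w : ℝ × ℝ → ℝ} (H : Bdd L w) {h : ℝ → ℝ}
    (hh : MemLp h 2 (volume.restrict (Ioi 0))) :
    MemLp (fun y => w (L, y) * h y) 2 (volume.restrict (Ioi 0)) := by
  obtain ⟨W, hW⟩ := H.2
  have hc : ContinuousOn (fun y => w (L, y)) (Ioi 0) :=
    H.1.comp (by fun_prop) fun _ hy => ⟨⟨hL.le, le_rfl⟩, mem_Ici.2 (mem_Ioi.1 hy).le⟩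
  refine MemLp.of_le_mul (c := W) hh
    ((hc.aestronglyMeasurable measurableSet_Ioi).mul hh.1) ?_
  filter_upwards [ae_restrict_mem measurableSet_Ioi] with y hy
  rw [norm_mul]
  exact mul_le_mul_of_nonneg_right
    (hW (L, y) ⟨⟨hL.le, le_rfl⟩, mem_Ici.2 (mem_Ioi.1 hy).le⟩) (norm_nonneg _)

/-- The inner integral is the trace of $v$ at $x=L$, because $v$ vanishes at $x=0$. -/
theorem memLp_vL (hL : 0 < L) (hl : S.Lines L ε aL bL τ) :
    MemLp (fun y => ∫ x in Ioo 0 L, S.vx (x, y)) 2 (volume.restrict (Ioi 0)) := by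
  have h1 := memLp_integral_x (c := 0) hL hl.vx_L2
  refine MemLp.of_le h1 ?_ (ae_of_all _ fun y => ?_)
  · have := hl.vx_L2.1
    rw [volume_restrict_Om] at this
    exact this.prod_swap.integral_prod_right'
  · rw [Real.norm_eq_abs, Real.norm_eq_abs]
    exact abs_integral_le_integral_abs.trans (le_abs_self _)

theorem outflow_integrable (hL : 0 < L) (hw : IsWeight L w wx wy wxx wxy wyy)
    (hl : S.Lines L ε aL bL τ) (ha : MemLp aL 2 (volume.restrict (Ioi 0)))
    (hb1 : MemLp bL 2 (volume.restrict (Ioi 0))) :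
    IntegrableOn (outflow ε w wx wy bL S L aL τ) (Ioi 0) := by
  have vL := memLp_vL hL hl
  have wb := hw.bd.memLp_trace hL hb1
  have wτ := hw.bd.memLp_trace hL hl.τ_L2
  have wv := hw.bd_y.memLp_trace hL vL
  have wv' := hw.bd_x.memLp_trace hL vL
  have t : MemLp (fun y => aL y - 2 * ε * τ y) 2 (volume.restrict (Ioi 0)) :=
    ha.sub (hl.τ_L2.const_mul (2 * ε))
  have i1 := (wb.integrable_mul hb1).const_mul (-(1 / 2))
  have i2 := t.integrable_mul (wτ.add wv)
  have i3 := (wv'.integrable_mul hb1).const_mul ε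
  refine ((i1.sub i2).sub i3).congr (ae_of_all _ fun y => ?_)
  simp only [outflow, Pi.sub_apply, Pi.add_apply, Pi.mul_apply]
  ring

theorem energy_integrable (hw : IsWeight L w wx wy wxx wxy wyy) (hl : S.Lines L ε aL bL τ)
    (hb1 : MemLp bL 2 (volume.restrict (Ioi 0)))
    (hb2 : MemLp (deriv bL) 2 (volume.restrict (Ioi 0)))
    (hF1 : MemLp F1 2 (volume.restrict (Om L))) (hF2 : MemLp F2 2 (volume.restrict (Om L))) :
    IntegrableOn (fun p => -1 * (w p * (S.vy p * F1 p)) + -1 * (wy p * (S.v p * F1 p))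
          + ε * (w p * (S.vx p * F2 p)) + ε * (wx p * (S.v p * F2 p))
          + fluxLow ε w wx wy wxx wxy wyy bL S p) (Om L) := by
  have m := fun {k : ℝ × ℝ → ℝ} (hk : Bdd L k) {h h' : ℝ × ℝ → ℝ}
    (hh : MemLp h 2 (volume.restrict (Om L))) (hh' : MemLp h' 2 (volume.restrict (Om L))) =>
    hk.integrableOn_mul subset_rfl (hh.integrable_mul hh')
  exact (((((m hw.bd hl.vy_L2 hF1).const_mul _).add ((m hw.bd_y hl.v_L2 hF1).const_mul _)).add
      ((m hw.bd hl.vx_L2 hF2).const_mul _)).add ((m hw.bd_x hl.v_L2 hF2).const_mul _)).add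
      (fluxLow_integrable hw hl hb1 hb2)

/-- The energy inequality: the equations are tested with `[-β_y, ε β_x]`, `β = w v`. -/
theorem energy_le (hL : 0 < L) (hw : IsWeight L w wx wy wxx wxy wyy)
    (H : S.IsSolution L ε us vs f g aL bL) (hl : S.Lines L ε aL bL τ)
    (ha : MemLp aL 2 (volume.restrict (Ioi 0))) (hb : ContDiffOn ℝ 1 bL (Ioi 0))
    (hb1 : MemLp bL 2 (volume.restrict (Ioi 0)))
    (hb2 : MemLp (deriv bL) 2 (volume.restrict (Ioi 0)))
    (hF1 : MemLp F1 2 (volume.restrict (Om L))) (hF2 : MemLp F2 2 (volume.restrict (Om L)))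
    (h1 : ∀ᵐ p ∂(volume.restrict (Om L)), S.Px p = F1 p + S.uyy p + ε * S.uxx p)
    (h2 : ∀ᵐ p ∂(volume.restrict (Om L)), S.Py p = ε * (F2 p + S.vyy p + ε * S.vxx p)) :
    ∫ y in Ioi 0, outflow ε w wx wy bL S L aL τ y ≤
      ∫ p in Om L, (-1 * (w p * (S.vy p * F1 p)) + -1 * (wy p * (S.v p * F1 p))
          + ε * (w p * (S.vx p * F2 p)) + ε * (wx p * (S.v p * F2 p))
          + fluxLow ε w wx wy wxx wxy wyy bL S p) := by
  have hdiv := flux_divergence (w := w) (wx := wx) (wy := wy) (wxx := wxx) (wxy := wxy)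
    (wyy := wyy) hl h1 h2
  have hZ := energy_integrable hw hl hb1 hb2 hF1 hF2
  obtain ⟨iX, iDX, iY, iDY⟩ := flux_locInt hw H hl hb1 hb2
  obtain ⟨cX, cY⟩ := flux_cornerSmall hL hw H hb1
  rw [← integral_congr_ae hdiv]
  exact outflow_le hL iX iDX iY iDY (flux_lineX hL hw hl) (flux_lineY hw hl hb hb2) cX cY
    (flux_far hw hl hb1 (memLp_P hL H hl ha hF1 h1)) (outflow_integrable hL hw hl ha hb1)
    (hZ.congr (hdiv.mono fun p hp => hp.symm))

end Energy

/-! ### Inequalities of Poincaré and Hardy -/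

theorem LineAC.restrict {α r γ : ℝ} {H H' : ℝ → ℝ} {p q : ℝ} (h : LineAC α γ H H' p q)
    (h1 : α ≤ r) (h2 : r ≤ γ) :
    LineAC r γ H H' (p + ∫ t in α..r, H' t) q ∧ LineAC α r H H' p (p + ∫ t in α..r, H' t) := by
  have i1 : IntervalIntegrable H' volume α r := h.int.mono_set (by
    rw [uIcc_of_le h1, uIcc_of_le (h1.trans h2)]; exact Icc_subset_Icc_right h2)
  have i2 : IntervalIntegrable H' volume r γ := h.int.mono_set (by
    rw [uIcc_of_le h2, uIcc_of_le (h1.trans h2)]; exact Icc_subset_Icc_left h1)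
  refine ⟨⟨i2, ?_, ?_⟩, i1, ae_restrict_of_ae_restrict_of_subset (Ioo_subset_Ioo_right h2) h.eq, rfl⟩
  · filter_upwards [ae_restrict_of_ae_restrict_of_subset (Ioo_subset_Ioo_left h1) h.eq,
      ae_restrict_mem measurableSet_Ioo] with s hs hm
    have i3 : IntervalIntegrable H' volume r s := i2.mono_set (by
      rw [uIcc_of_le hm.1.le, uIcc_of_le h2]; exact Icc_subset_Icc_right hm.2.le)
    rw [hs, add_assoc, intervalIntegral.integral_add_adjacent_intervals i1 i3]
  · rw [h.fin, add_assoc, intervalIntegral.integral_add_adjacent_intervals i1 i2]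

theorem integrable_sq_slices_x {L : ℝ} {h : ℝ × ℝ → ℝ} (hh : MemLp h 2 (volume.restrict (Om L))) :
    (∀ᵐ y ∂(volume.restrict (Ioi (0 : ℝ))), IntegrableOn (fun x => h (x, y) ^ 2) (Ioo 0 L)) ∧
    IntegrableOn (fun y => ∫ x in Ioo 0 L, h (x, y) ^ 2) (Ioi 0) := by
  have := hh.integrable_sq
  rw [volume_restrict_Om] at this
  exact ⟨this.prod_left_ae, this.integral_prod_right⟩

theorem integrable_sq_slices_y {L : ℝ} {h : ℝ × ℝ → ℝ} (hh : MemLp h 2 (volume.restrict (Om L))) :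
    (∀ᵐ x ∂(volume.restrict (Ioo 0 L)), IntegrableOn (fun y => h (x, y) ^ 2) (Ioi 0)) ∧
    IntegrableOn (fun x => ∫ y in Ioi 0, h (x, y) ^ 2) (Ioo 0 L) := by
  have := hh.integrable_sq
  rw [volume_restrict_Om] at this
  exact ⟨this.prod_right_ae, this.integral_prod_left⟩

theorem poincare_x {L : ℝ} (hL : 0 < L) {h hx : ℝ × ℝ → ℝ}
    (hh : MemLp h 2 (volume.restrict (Om L))) (hhx : MemLp hx 2 (volume.restrict (Om L)))
    (hl : ∀ᵐ y ∂(volume.restrict (Ioi (0 : ℝ))), ∃ q,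
      LineAC 0 L (fun x => h (x, y)) (fun x => hx (x, y)) 0 q) :
    ∫ p in Om L, h p ^ 2 ≤ L ^ 2 * ∫ p in Om L, hx p ^ 2 := by
  rw [setIntegral_Om_symm hh.integrable_sq, setIntegral_Om_symm hhx.integrable_sq,
    ← integral_const_mul]
  refine integral_mono_ae (integrable_sq_slices_x hh).2
    ((integrable_sq_slices_x hhx).2.const_mul _) ?_
  filter_upwards [hl, (integrable_sq_slices_x hh).1, (integrable_sq_slices_x hhx).1]
    with y ⟨q, hq⟩ i1 i2
  have h1 := (hq.sq_le hL.le i2).1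
  calc ∫ x in Ioo 0 L, h (x, y) ^ 2 ≤ ∫ x in Ioo 0 L, L * ∫ x in Ioo 0 L, hx (x, y) ^ 2 := by
        refine integral_mono_ae i1 (integrable_const _) ?_
        filter_upwards [h1, ae_restrict_mem measurableSet_Ioo] with x h2 h3
        refine h2.trans ?_
        rw [sub_zero]
        refine mul_le_mul h3.2.le ?_ (integral_nonneg fun _ => sq_nonneg _) hL.le
        exact setIntegral_mono_set i2 (ae_of_all _ fun _ => sq_nonneg _)
          (Ioo_subset_Ioo_right h3.2.le).eventuallyLE
    _ = _ := by
        rw [integral_const]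
        simp [measureReal_def, hL.le]
        ring

theorem poincare_trace {L : ℝ} (hL : 0 < L) {hx : ℝ × ℝ → ℝ}
    (hhx : MemLp hx 2 (volume.restrict (Om L))) :
    ∫ y in Ioi 0, (∫ x in Ioo 0 L, hx (x, y)) ^ 2 ≤ L * ∫ p in Om L, hx p ^ 2 := by
  rw [setIntegral_Om_symm hhx.integrable_sq, ← integral_const_mul]
  refine integral_mono_of_nonneg (ae_of_all _ fun _ => sq_nonneg _)
    ((integrable_sq_slices_x hhx).2.const_mul _) ?_
  have hm := hhx.1
  rw [volume_restrict_Om] at hm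
  filter_upwards [(integrable_sq_slices_x hhx).1, hm.prod_swap.prodMk_left] with y i2 hm2
  have h1 := sq_integral_abs_le hL ((memLp_two_iff_integrable_sq hm2).2 i2)
  refine le_trans ?_ h1
  refine sq_le_sq.2 ?_
  exact abs_integral_le_integral_abs.trans (le_abs_self _)

/-- Integrate $(h^2/y)'=2h'h/y-(h/y)^2\le2h'^2-\frac12(h/y)^2$ over $(r,R)$, away from the
singularity. The end value at $R$ has the good sign, and the one at $r$ satisfies
$h(r)^2/r\le\int_0^rh'^2$ because $h(0)=0$. -/
theorem hardy_line {r R q : ℝ} (hr : 0 < r) (hrR : r ≤ R) {h h' : ℝ → ℝ} (hl : LineAC 0 R h h' 0 q)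
    (i1 : IntegrableOn (fun y => h y ^ 2) (Ioi 0)) (i2 : IntegrableOn (fun y => h' y ^ 2) (Ioi 0)) :
    ∫ y in Ioo r R, (h y / y) ^ 2 ≤ 4 * ∫ y in Ioi 0, h' y ^ 2 := by
  obtain ⟨l1, l2⟩ := hl.restrict hr.le hrR
  set m := 0 + ∫ t in (0 : ℝ)..r, h' t
  have s1 : Ioo r R ⊆ Ioi 0 := fun y hy => hr.trans hy.1
  have s2 : Ioo 0 r ⊆ Ioi (0 : ℝ) := Ioo_subset_Ioi_self
  have hm : m ^ 2 ≤ r * ∫ t in Ioo 0 r, h' t ^ 2 := by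
    simpa using (l2.sq_le hr.le (i2.mono_set s2)).2
  have linv : LineAC r R (fun y => y⁻¹) (fun y => -(y ^ 2)⁻¹) r⁻¹ R⁻¹ := by
    refine LineAC.of_hasDerivAt hrR ?_ (fun y hy => hasDerivAt_inv (hr.trans hy.1).ne') ?_
    · exact continuousOn_id.inv₀ fun y hy => (hr.trans_le hy.1).ne'
    · refine ContinuousOn.intervalIntegrable ?_
      rw [uIcc_of_le hrR]
      exact ((continuousOn_id.pow 2).inv₀ fun y hy => pow_ne_zero 2 (hr.trans_le hy.1).ne').neg
  have l3 := (l1.mul l1 hrR).mul linv hrR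
  have e := l3.integral_eq
  have hi := (intervalIntegrable_iff_integrableOn_Ioo_of_le hrR).1 l3.int
  rw [intervalIntegral_eq_Ioo hrR] at e
  have i3 : IntegrableOn (fun y => (h y / y) ^ 2) (Ioo r R) := by
    have : IntegrableOn (fun y => (y⁻¹) ^ 2 * h y ^ 2) (Ioo r R) := by
      refine Integrable.bdd_mul (c := (r⁻¹) ^ 2) (i1.mono_set s1) (by fun_prop) ?_
      filter_upwards [ae_restrict_mem measurableSet_Ioo] with y hy
      rw [norm_pow, Real.norm_eq_abs, abs_of_pos (inv_pos.2 (hr.trans hy.1))]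
      exact pow_le_pow_left₀ (inv_pos.2 (hr.trans hy.1)).le
        (inv_anti₀ hr hy.1.le) 2
    refine this.congr (ae_of_all _ fun y => ?_)
    simp only [div_eq_mul_inv]; ring
  have i4 := i2.mono_set s1
  have h4 : ∫ y in Ioo r R, ((h' y * h y + h y * h' y) * y⁻¹ + h y * h y * -(y ^ 2)⁻¹)
      ≤ ∫ y in Ioo r R, (2 * h' y ^ 2 - 1 / 2 * (h y / y) ^ 2) := by
    refine setIntegral_mono_on hi ((i4.const_mul 2).sub (i3.const_mul _)) measurableSet_Ioo ?_
    intro y hy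
    have hy0 : y ≠ 0 := (hr.trans hy.1).ne'
    have : (h' y * h y + h y * h' y) * y⁻¹ + h y * h y * -(y ^ 2)⁻¹
        = 2 * h' y * (h y / y) - (h y / y) ^ 2 := by
      field_simp
      ring
    rw [this]
    nlinarith [sq_nonneg (2 * h' y - h y / y)]
  rw [e, integral_sub (i4.const_mul 2) (i3.const_mul _), integral_const_mul, integral_const_mul] at h4
  have h5 : 0 ≤ q * q * R⁻¹ := mul_nonneg (mul_self_nonneg _) (inv_pos.2 (hr.trans_le hrR)).le
  have h6 : m * m * r⁻¹ ≤ ∫ t in Ioo 0 r, h' t ^ 2 := by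
    rw [← div_eq_mul_inv, div_le_iff₀ hr]
    nlinarith
  have h7 : (∫ t in Ioo 0 r, h' t ^ 2) + ∫ t in Ioo r R, h' t ^ 2 ≤ ∫ y in Ioi 0, h' y ^ 2 := by
    rw [← setIntegral_union (by
      rw [Set.disjoint_left]; exact fun y h1 h2 => absurd h1.2 (not_lt.2 h2.1.le)) measurableSet_Ioo
      (i2.mono_set s2) i4]
    exact setIntegral_mono_set i2 (ae_of_all _ fun _ => sq_nonneg _)
      (union_subset s2 s1).eventuallyLE
  have h8 : 0 ≤ ∫ t in Ioo 0 r, h' t ^ 2 := integral_nonneg fun _ => sq_nonneg _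
  linarith

/-- The bound of `hardy_line` is uniform on the exhaustion by $1/(n+1)<y<n+1$. Integrability of
$(h/y)^2$ is thus a conclusion and not a hypothesis. -/
theorem hardy_y {L : ℝ} {h hy : ℝ × ℝ → ℝ}
    (hh : MemLp h 2 (volume.restrict (Om L))) (hhy : MemLp hy 2 (volume.restrict (Om L)))
    (hl : ∀ R, 0 < R → ∀ᵐ x ∂(volume.restrict (Ioo 0 L)), ∃ q,
      LineAC 0 R (fun y => h (x, y)) (fun y => hy (x, y)) 0 q) :
    IntegrableOn (fun p => (h p / p.2) ^ 2) (Om L) ∧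
      ∫ p in Om L, (h p / p.2) ^ 2 ≤ 4 * ∫ p in Om L, hy p ^ 2 := by
  set φ : ℕ → Set (ℝ × ℝ) := fun n => Ioo 0 L ×ˢ Ioo (1 / ((n : ℝ) + 1)) ((n : ℝ) + 1)
  have hpos : ∀ n : ℕ, (0 : ℝ) < 1 / ((n : ℝ) + 1) := fun n => by positivity
  have hle : ∀ n : ℕ, 1 / ((n : ℝ) + 1) ≤ (n : ℝ) + 1 := fun n => by
    have : (1 : ℝ) ≤ (n : ℝ) + 1 := by linarith [Nat.cast_nonneg (α := ℝ) n]
    exact (div_le_one (by positivity)).2 this |>.trans this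
  have hφm : ∀ n, MeasurableSet (φ n) := fun n => measurableSet_Ioo.prod measurableSet_Ioo
  have hφs : ∀ n, φ n ⊆ Om L := fun n => prod_mono subset_rfl fun y hy => (hpos n).trans hy.1
  have cov : AECover (volume.restrict (Om L)) atTop φ := by
    refine ⟨?_, hφm⟩
    filter_upwards [ae_restrict_mem (measurableSet_Om L)] with p hp
    have t1 : ∀ᶠ n : ℕ in atTop, 1 / ((n : ℝ) + 1) < p.2 :=
      tendsto_one_div_add_atTop_nhds_zero_nat.eventually (gt_mem_nhds hp.2)
    obtain ⟨N, hN⟩ := exists_nat_ge p.2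
    filter_upwards [t1, eventually_ge_atTop N] with n h1 h2
    have : (N : ℝ) ≤ n := by exact_mod_cast h2
    exact ⟨hp.1, h1, by linarith⟩
  have hm : AEStronglyMeasurable (fun p => (h p / p.2) ^ 2) (volume.restrict (Om L)) := by
    have : AEStronglyMeasurable (fun p : ℝ × ℝ => p.2⁻¹) (volume.restrict (Om L)) :=
      (measurable_snd.inv).aestronglyMeasurable
    simp only [div_eq_mul_inv]
    exact (hh.1.mul this).pow 2
  have hi : ∀ n, IntegrableOn (fun p => (h p / p.2) ^ 2) (φ n) := fun n => by
    refine Integrable.mono' (g := fun p => ((n : ℝ) + 1) ^ 2 * h p ^ 2)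
      (IntegrableOn.mono_set (hh.integrable_sq.const_mul _) (hφs n))
      (hm.mono_measure (Measure.restrict_mono (hφs n) le_rfl)) ?_
    filter_upwards [ae_restrict_mem (hφm n)] with p hp
    have h0 : 0 < p.2 := (hpos n).trans hp.2.1
    rw [Real.norm_eq_abs, abs_of_nonneg (sq_nonneg _), div_pow, div_le_iff₀ (by positivity)]
    have h1 : 1 ≤ ((n : ℝ) + 1) * p.2 := by
      have := hp.2.1.le
      rw [div_le_iff₀ (by positivity)] at this
      linarith
    have h2 : 1 ≤ (((n : ℝ) + 1) * p.2) ^ 2 := one_le_pow₀ h1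
    calc h p ^ 2 ≤ (((n : ℝ) + 1) * p.2) ^ 2 * h p ^ 2 := le_mul_of_one_le_left (sq_nonneg _) h2
      _ = _ := by ring
  have hb : ∀ n, ∫ p in φ n, (h p / p.2) ^ 2 ≤ 4 * ∫ p in Om L, hy p ^ 2 := fun n => by
    have e : ∫ p in φ n, (h p / p.2) ^ 2 = ∫ x in Ioo 0 L, ∫ y in Ioo (1 / ((n : ℝ) + 1)) ((n : ℝ) + 1),
        (h (x, y) / y) ^ 2 := setIntegral_prod _ (hi n)
    have hi' := hi n
    simp only [φ] at hi'
    rw [IntegrableOn, Measure.volume_eq_prod, ← Measure.prod_restrict] at hi'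
    rw [e, setIntegral_Om hhy.integrable_sq, ← integral_const_mul]
    refine integral_mono_ae hi'.integral_prod_left ((integrable_sq_slices_y hhy).2.const_mul 4) ?_
    filter_upwards [hl ((n : ℝ) + 1) (by positivity), (integrable_sq_slices_y hhy).1,
      (integrable_sq_slices_y hh).1] with x ⟨q, hq⟩ i1 i2
    exact hardy_line (hpos n) (hle n) hq i2 i1
  have e : ∀ n, ∫ p in φ n, (h p / p.2) ^ 2 ∂(volume.restrict (Om L)) = ∫ p in φ n, (h p / p.2) ^ 2 :=
    fun n => by rw [Measure.restrict_restrict (hφm n), inter_eq_left.2 (hφs n)]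
  have hint : Integrable (fun p => (h p / p.2) ^ 2) (volume.restrict (Om L)) := by
    refine cov.integrable_of_integral_bounded_of_nonneg_ae (4 * ∫ p in Om L, hy p ^ 2) (fun n => ?_)
      (ae_of_all _ fun _ => sq_nonneg _) (Eventually.of_forall fun n => by rw [e]; exact hb n)
    rw [IntegrableOn, Measure.restrict_restrict (hφm n), inter_eq_left.2 (hφs n)]
    exact hi n
  refine ⟨hint, ?_⟩
  exact le_of_tendsto (cov.integral_tendsto_of_countably_generated hint)
    (Eventually.of_forall fun n => by rw [e]; exact hb n)

/-! ### Pointwise bounds -/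

/-- With $s=\theta^{-1}$ one has $2|xy|\le\theta x^2+sy^2\le(1+\nu)G\le2\nu G$. A single bound $G$
for both squares keeps the long sums uniform. -/
theorem young_le {θ s G k κ ν x y : ℝ} (hθ : 0 < θ) (hs : s * θ = 1) (hk : |k| ≤ κ) (hν : 1 ≤ ν)
    (hx : θ * x ^ 2 ≤ G) (hy : s * y ^ 2 ≤ ν * G) : k * (x * y) ≤ κ * (ν * G) := by
  have hs0 : 0 < s := by
    by_contra! h
    nlinarith
  have hG : 0 ≤ G := le_trans (by positivity) hx
  have h1 : 2 * |x * y| ≤ θ * x ^ 2 + s * y ^ 2 := by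
    have h2 : θ * x ^ 2 + s * y ^ 2 - 2 * (|x| * |y|) = s * (θ * |x| - |y|) ^ 2 := by
      have e1 : x ^ 2 = |x| ^ 2 := (sq_abs x).symm
      have e2 : y ^ 2 = |y| ^ 2 := (sq_abs y).symm
      rw [e1, e2]
      linear_combination (-θ * |x| ^ 2 + 2 * |x| * |y|) * hs
    have h3 : 0 ≤ s * (θ * |x| - |y|) ^ 2 := by positivity
    rw [abs_mul]
    linarith
  have h4 : |x * y| ≤ ν * G := by nlinarith
  have h5 : k * (x * y) ≤ |k| * |x * y| := by
    rw [← abs_mul]; exact le_abs_self _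
  exact h5.trans (mul_le_mul hk h4 (abs_nonneg _) ((abs_nonneg _).trans hk))

/-- The quantities which are small, or which are bounded by the data. -/
def majorant (θ s t by' bx a b c h u v z z' β β' : ℝ) : ℝ :=
  θ * (by' ^ 2 + (t * bx) ^ 2 + a ^ 2 + (t * c) ^ 2 + h ^ 2)
    + s * (u ^ 2 + (t * v) ^ 2 + b ^ 2 + z ^ 2 + (t * z') ^ 2 + β ^ 2 + β' ^ 2)

-- The letters stand for $\beta_y,\beta_x$ (`by'`, `bx`), $v_y,u_y,v_x$ (`a`, `b`, `c`), $v/y$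
-- (`h`), $b_L,b_L'$ (`β`, `β'`) and $\sqrt\epsilon$ (`t`). The left side is what remains after the
-- coercive terms have been removed. In each product one factor is bounded by $G$ with coefficient
-- $\theta$ and the other with coefficient $\theta^{-1}$, possibly after using a power of
-- $\sqrt\epsilon$. The term with $w_{yy}v$ is written as $(yw_{yy})(v/y)$, for which the decay of
-- $w_{yy}$ is needed.
set_option maxHeartbeats 1000000 in
theorem low_order_le {θ s t M w wx wy wxx wxy wyy k usx vs vsx vsy d y by' bx a b c h u v β β' : ℝ}
    (hθ : 0 < θ) (hs : s * θ = 1) (hθ1 : θ ≤ 1) (ht : 0 ≤ t) (htθ : t ≤ θ) (hM : 1 ≤ M)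
    (hw : |w| ≤ M) (hwx : |wx| ≤ M) (hwy : |wy| ≤ M) (hwxx : |wxx| ≤ M) (hwxy : |wxy| ≤ M)
    (hk : |k| ≤ M) (hkv : wyy * v = k * h) (husx : |usx| ≤ M) (hvs : |vs| ≤ d * y + M)
    (hvsx : |t * vsx| ≤ M) (hvsy : |vsy| ≤ M) :
    by' * (usx * u + vs * b) - t ^ 2 * (bx * (usx * v + vsx * u + vs * a + vsy * v))
      + (wx * (b * (b + t ^ 2 * c)) + -(1 / 2) * (wx * ((b + t ^ 2 * c) * (b + t ^ 2 * c)))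
        + -t ^ 2 * (wxx * (v * (b + t ^ 2 * c))) + -t ^ 2 * (wx * (c * (b + t ^ 2 * c)))
        + 2 * (wy * (a * (b + t ^ 2 * c))) + -(4 * t ^ 2) * (wy * (c * a))
        + wyy * (v * (b + t ^ 2 * c)) + -(2 * t ^ 2) * (wyy * (v * c))
        + -(2 * t ^ 2) * (wxy * (v * a)) + -(2 * t ^ 2) * (wx * (a * a))
        + -1 * (wx * (b * β)) + -1 * (wy * (a * β)) + -1 * (w * (a * β')))
      ≤ 104 * M ^ 2 * majorant θ s t by' bx a b c h u v (d * y * b) (d * y * a) β β' := by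
  set G := majorant θ s t by' bx a b c h u v (d * y * b) (d * y * a) β β' with hG
  have hs0 : 0 < s := by
    by_contra! h
    nlinarith
  have hs1 : 1 ≤ s := by nlinarith
  have hθs : θ ≤ s := hθ1.trans hs1
  have ht1 : t ≤ 1 := htθ.trans hθ1
  -- This is where $\epsilon\le\theta^2$ enters: a factor $\sqrt\epsilon$ moves a quantity from the
  -- $\theta$ group to the $\theta^{-1}$ group.
  have hst : s * t ^ 2 ≤ θ := by nlinarith [mul_le_mul htθ htθ ht hθ.le]
  have hM0 : 0 ≤ M := by linarith
  have hM2 : M ≤ M ^ 2 := by nlinarith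
  have gθ : θ * (by' ^ 2 + (t * bx) ^ 2 + a ^ 2 + (t * c) ^ 2 + h ^ 2) ≤ G := by
    rw [hG, majorant]
    have : 0 ≤ s * (u ^ 2 + (t * v) ^ 2 + b ^ 2 + (d * y * b) ^ 2 + (t * (d * y * a)) ^ 2 + β ^ 2
      + β' ^ 2) := by positivity
    linarith
  have gs : s * (u ^ 2 + (t * v) ^ 2 + b ^ 2 + (d * y * b) ^ 2 + (t * (d * y * a)) ^ 2 + β ^ 2
      + β' ^ 2) ≤ G := by
    rw [hG, majorant]
    have : 0 ≤ θ * (by' ^ 2 + (t * bx) ^ 2 + a ^ 2 + (t * c) ^ 2 + h ^ 2) := by positivity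
    linarith
  have pθ : ∀ x r : ℝ, 0 ≤ r → x ^ 2 + r = by' ^ 2 + (t * bx) ^ 2 + a ^ 2 + (t * c) ^ 2 + h ^ 2 →
      θ * x ^ 2 ≤ G := fun x r hr e => by
    refine le_trans ?_ gθ
    rw [← e]
    exact mul_le_mul_of_nonneg_left (by linarith) hθ.le
  have ps : ∀ x r : ℝ, 0 ≤ r → x ^ 2 + r = u ^ 2 + (t * v) ^ 2 + b ^ 2 + (d * y * b) ^ 2
      + (t * (d * y * a)) ^ 2 + β ^ 2 + β' ^ 2 → s * x ^ 2 ≤ G := fun x r hr e => by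
    refine le_trans ?_ gs
    rw [← e]
    exact mul_le_mul_of_nonneg_left (by linarith) hs0.le
  have θby := pθ by' ((t * bx) ^ 2 + a ^ 2 + (t * c) ^ 2 + h ^ 2) (by positivity) (by ring)
  have θbx := pθ (t * bx) (by' ^ 2 + a ^ 2 + (t * c) ^ 2 + h ^ 2) (by positivity) (by ring)
  have θa := pθ a (by' ^ 2 + (t * bx) ^ 2 + (t * c) ^ 2 + h ^ 2) (by positivity) (by ring)
  have θc := pθ (t * c) (by' ^ 2 + (t * bx) ^ 2 + a ^ 2 + h ^ 2) (by positivity) (by ring)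
  have θh := pθ h (by' ^ 2 + (t * bx) ^ 2 + a ^ 2 + (t * c) ^ 2) (by positivity) (by ring)
  have su := ps u ((t * v) ^ 2 + b ^ 2 + (d * y * b) ^ 2 + (t * (d * y * a)) ^ 2 + β ^ 2 + β' ^ 2)
    (by positivity) (by ring)
  have sv := ps (t * v) (u ^ 2 + b ^ 2 + (d * y * b) ^ 2 + (t * (d * y * a)) ^ 2 + β ^ 2 + β' ^ 2)
    (by positivity) (by ring)
  have sb := ps b (u ^ 2 + (t * v) ^ 2 + (d * y * b) ^ 2 + (t * (d * y * a)) ^ 2 + β ^ 2 + β' ^ 2)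
    (by positivity) (by ring)
  have sz := ps (d * y * b) (u ^ 2 + (t * v) ^ 2 + b ^ 2 + (t * (d * y * a)) ^ 2 + β ^ 2 + β' ^ 2)
    (by positivity) (by ring)
  have sz' := ps (t * (d * y * a)) (u ^ 2 + (t * v) ^ 2 + b ^ 2 + (d * y * b) ^ 2 + β ^ 2 + β' ^ 2)
    (by positivity) (by ring)
  have sβ := ps β (u ^ 2 + (t * v) ^ 2 + b ^ 2 + (d * y * b) ^ 2 + (t * (d * y * a)) ^ 2 + β' ^ 2)
    (by positivity) (by ring)
  have sβ' := ps β' (u ^ 2 + (t * v) ^ 2 + b ^ 2 + (d * y * b) ^ 2 + (t * (d * y * a)) ^ 2 + β ^ 2)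
    (by positivity) (by ring)
  have up : ∀ x : ℝ, s * x ^ 2 ≤ G → θ * x ^ 2 ≤ G := fun x hx =>
    (mul_le_mul_of_nonneg_right hθs (sq_nonneg x)).trans hx
  have gain : ∀ x : ℝ, θ * x ^ 2 ≤ G → s * (t * x) ^ 2 ≤ G := fun x hx => by
    have := mul_le_mul_of_nonneg_right hst (sq_nonneg x)
    calc s * (t * x) ^ 2 = s * t ^ 2 * x ^ 2 := by ring
      _ ≤ _ := this.trans hx
  have hG0 : 0 ≤ G := le_trans (by positivity) θby
  -- The linear growth of $v_s$ is separated here; the products of $dy$ with $u_y$ and with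
  -- $\sqrt\epsilon v_y$ are entries of the majorant.
  have vsq : vs ^ 2 ≤ 2 * (d * y) ^ 2 + 2 * M ^ 2 := by
    have h1 : vs ^ 2 ≤ (d * y + M) ^ 2 := by
      rw [← sq_abs vs]
      exact pow_le_pow_left₀ (abs_nonneg _) hvs 2
    nlinarith [sq_nonneg (d * y - M)]
  have M21 : 1 ≤ M ^ 2 := one_le_pow₀ hM
  have svb : s * (vs * b) ^ 2 ≤ 4 * M ^ 2 * G := by
    have h1 : s * (vs * b) ^ 2 ≤ 2 * (s * (d * y * b) ^ 2) + 2 * M ^ 2 * (s * b ^ 2) := by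
      have := mul_le_mul_of_nonneg_left vsq (show 0 ≤ s * b ^ 2 by positivity)
      linarith only [this]
    linarith only [h1, sz, mul_le_mul_of_nonneg_left sb (sq_nonneg M),
      mul_le_mul_of_nonneg_right M21 hG0]
  have sva : s * (t * (vs * a)) ^ 2 ≤ 4 * M ^ 2 * G := by
    have h1 : s * (t * (vs * a)) ^ 2
        ≤ 2 * (s * (t * (d * y * a)) ^ 2) + 2 * M ^ 2 * (s * (t * a) ^ 2) := by
      have := mul_le_mul_of_nonneg_left vsq (show 0 ≤ s * (t * a) ^ 2 by positivity)
      linarith only [this]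
    linarith only [h1, sz', mul_le_mul_of_nonneg_left (gain a θa) (sq_nonneg M),
      mul_le_mul_of_nonneg_right M21 hG0]
  -- one instance of Young's inequality for each term
  have Y : ∀ {k x y : ℝ}, |k| ≤ 4 * M → θ * x ^ 2 ≤ G → s * y ^ 2 ≤ G →
      k * (x * y) ≤ 4 * M ^ 2 * G := fun {k x y} h1 h2 h3 => by
    have := young_le (ν := 1) hθ hs h1 le_rfl h2 (by rwa [one_mul])
    rw [one_mul] at this
    exact this.trans (mul_le_mul_of_nonneg_right (by linarith) hG0)
  have Y' : ∀ {k x y : ℝ}, |k| ≤ 1 → θ * x ^ 2 ≤ G → s * y ^ 2 ≤ 4 * M ^ 2 * G →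
      k * (x * y) ≤ 4 * M ^ 2 * G := fun {k x y} h1 h2 h3 => by
    have := young_le (ν := 4 * M ^ 2) hθ hs h1 (by linarith) h2 h3
    rwa [one_mul] at this
  have K : ∀ r q : ℝ, |r| ≤ 4 → |q| ≤ M → |r * q| ≤ 4 * M := fun r q hr hq => by
    rw [abs_mul]; exact mul_le_mul hr hq (abs_nonneg _) (by norm_num)
  have t4 : |t| ≤ 4 := by rw [abs_of_nonneg ht]; linarith
  have T : ∀ r : ℝ, |r| ≤ 4 → |r * t| ≤ 4 := fun r hr => by
    rw [abs_mul, abs_of_nonneg ht]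
    calc |r| * t ≤ 4 * 1 := mul_le_mul hr ht1 ht (by norm_num)
      _ = 4 := by norm_num
  have e1 := Y (K 1 usx (by norm_num) husx) θby su
  have e2 := Y' (k := 1) (by norm_num) θby svb
  have e3 := Y (K (-1) usx (by norm_num) husx) θbx sv
  have e4 := Y (K (-1) (t * vsx) (by norm_num) hvsx) θbx su
  have e5 := Y' (k := -1) (by norm_num) θbx sva
  have e6 := Y (K (-1) vsy (by norm_num) hvsy) θbx sv
  have e7 := Y (K (1 / 2) wx (by norm_num [abs_le]) hwx) (up b sb) sb
  have e8 := Y (K (-(1 / 2) * t) wx (T _ (by norm_num [abs_le])) hwx) θc (gain _ θc)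
  have e9 := Y (K (-1 * t) wxx (T _ (by norm_num)) hwxx) (up _ sv) sb
  have e10 := Y (K (-1 * t * t) wxx (T _ (T _ (by norm_num))) hwxx) θc sv
  have e11 := Y (K (-1 * t) wx (T _ (by norm_num)) hwx) θc sb
  have e12 := Y (K (-1 * t) wx (T _ (by norm_num)) hwx) θc (gain _ θc)
  have e13 := Y (K 2 wy (by norm_num) hwy) θa sb
  have e14 := Y (K (-2) wy (by norm_num) hwy) θc (gain _ θa)
  have e15 := Y (K 1 k (by norm_num) hk) θh sb
  have e16 := Y (K (-1) k (by norm_num) hk) θc (gain _ θh)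
  have e17 := Y (K (-2 * t) wxy (T _ (by norm_num)) hwxy) θa sv
  have e18 := Y (K (-2 * t) wx (T _ (by norm_num)) hwx) θa (gain _ θa)
  have e19 := Y (K (-1) wx (by norm_num) hwx) (up b sb) sβ
  have e20 := Y (K (-1) wy (by norm_num) hwy) θa sβ
  have e21 := Y (K (-1) w (by norm_num) hw) θa sβ'
  have h0 : 0 ≤ 4 * M ^ 2 * G := by positivity
  have key : by' * (usx * u + vs * b) - t ^ 2 * (bx * (usx * v + vsx * u + vs * a + vsy * v))
      + (wx * (b * (b + t ^ 2 * c)) + -(1 / 2) * (wx * ((b + t ^ 2 * c) * (b + t ^ 2 * c)))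
        + -t ^ 2 * (wxx * (v * (b + t ^ 2 * c))) + -t ^ 2 * (wx * (c * (b + t ^ 2 * c)))
        + 2 * (wy * (a * (b + t ^ 2 * c))) + -(4 * t ^ 2) * (wy * (c * a))
        + wyy * (v * (b + t ^ 2 * c)) + -(2 * t ^ 2) * (wyy * (v * c))
        + -(2 * t ^ 2) * (wxy * (v * a)) + -(2 * t ^ 2) * (wx * (a * a))
        + -1 * (wx * (b * β)) + -1 * (wy * (a * β)) + -1 * (w * (a * β')))
      = 1 * usx * (by' * u) + 1 * (by' * (vs * b)) + -1 * usx * (t * bx * (t * v))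
        + -1 * (t * vsx) * (t * bx * u) + -1 * (t * bx * (t * (vs * a)))
        + -1 * vsy * (t * bx * (t * v)) + 1 / 2 * wx * (b * b)
        + -(1 / 2) * t * wx * (t * c * (t * (t * c))) + -1 * t * wxx * (t * v * b)
        + -1 * t * t * wxx * (t * c * (t * v)) + -1 * t * wx * (t * c * b)
        + -1 * t * wx * (t * c * (t * (t * c))) + 2 * wy * (a * b) + -2 * wy * (t * c * (t * a))
        + 1 * k * (h * b) + -1 * k * (t * c * (t * h)) + -2 * t * wxy * (a * (t * v))
        + -2 * t * wx * (a * (t * a)) + -1 * wx * (b * β) + -1 * wy * (a * β)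
        + -1 * w * (a * β') := by
    linear_combination (b + t ^ 2 * c - 2 * t ^ 2 * c) * hkv
  rw [key]
  -- There are $21$ products, each at most $4M^2G$. The constant $104$ leaves room.
  linarith only [e1, e2, e3, e4, e5, e6, e7, e8, e9, e10, e11, e12, e13, e14, e15, e16, e17, e18,
    e19, e20, e21, h0]

/-! ### The background flow and its reciprocal -/

namespace IsC1

variable {L : ℝ} {h hx hy k kx ky : ℝ × ℝ → ℝ}

theorem congr (H : IsC1 L h hx hy) {h' hx' hy' : ℝ × ℝ → ℝ} (e : ∀ p, h' p = h p)
    (ex : ∀ p, hx' p = hx p) (ey : ∀ p, hy' p = hy p) : IsC1 L h' hx' hy' := by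
  rw [funext e, funext ex, funext ey]; exact H

theorem add (H : IsC1 L h hx hy) (K : IsC1 L k kx ky) :
    IsC1 L (fun p => h p + k p) (fun p => hx p + kx p) (fun p => hy p + ky p) :=
  ⟨H.cont.add K.cont, H.cont_x.add K.cont_x, H.cont_y.add K.cont_y,
    fun p hp => (H.dx p hp).add (K.dx p hp), fun p hp => (H.dy p hp).add (K.dy p hp)⟩

theorem const_mul (H : IsC1 L h hx hy) (c : ℝ) :
    IsC1 L (fun p => c * h p) (fun p => c * hx p) (fun p => c * hy p) :=
  ⟨continuousOn_const.mul H.cont, continuousOn_const.mul H.cont_x, continuousOn_const.mul H.cont_y,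
    fun p hp => (H.dx p hp).const_mul c, fun p hp => (H.dy p hp).const_mul c⟩

theorem mul (H : IsC1 L h hx hy) (K : IsC1 L k kx ky) :
    IsC1 L (fun p => h p * k p) (fun p => hx p * k p + h p * kx p)
      (fun p => hy p * k p + h p * ky p) :=
  ⟨H.cont.mul K.cont, (H.cont_x.mul K.cont).add (H.cont.mul K.cont_x),
    (H.cont_y.mul K.cont).add (H.cont.mul K.cont_y),
    fun p hp => (H.dx p hp).mul (K.dx p hp), fun p hp => (H.dy p hp).mul (K.dy p hp)⟩

theorem inv (H : IsC1 L h hx hy) (h0 : ∀ p ∈ OmBar L, h p ≠ 0) :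
    IsC1 L (fun p => (h p)⁻¹) (fun p => -(hx p * (h p)⁻¹ ^ 2)) (fun p => -(hy p * (h p)⁻¹ ^ 2)) := by
  have hc : ContinuousOn (fun p => (h p)⁻¹) (OmBar L) := H.cont.inv₀ h0
  refine ⟨hc, (H.cont_x.mul (hc.pow 2)).neg, (H.cont_y.mul (hc.pow 2)).neg, fun p hp => ?_,
    fun p hp => ?_⟩
  · refine ((H.dx p hp).inv (h0 p (Om_subset_OmBar L hp))).congr_deriv ?_
    simp only [Prod.mk.eta]
    rw [inv_pow, div_eq_mul_inv, neg_mul]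
  · refine ((H.dy p hp).inv (h0 p (Om_subset_OmBar L hp))).congr_deriv ?_
    simp only [Prod.mk.eta]
    rw [inv_pow, div_eq_mul_inv, neg_mul]

theorem dX_eq (H : IsC1 L h hx hy) {p : ℝ × ℝ} (hp : p ∈ Om L) : dX L h p = hx p :=
  ((H.dx p hp).hasDerivWithinAt).derivWithin
    ((uniqueDiffOn_Icc (hp.1.1.trans hp.1.2)) p.1 (Ioo_subset_Icc_self hp.1))

theorem dY_eq (H : IsC1 L h hx hy) {p : ℝ × ℝ} (hp : p ∈ Om L) : dY h p = hy p :=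
  ((H.dy p hp).hasDerivWithinAt).derivWithin
    ((uniqueDiffOn_Ici 0) p.2 (Ioi_subset_Ici_self hp.2))

end IsC1

/-- Regularity and bounds of the background flow. -/
structure IsBackground (L ε m M d : ℝ) (us usx usy usxx usxy usyy vs vsx vsy : ℝ × ℝ → ℝ) :
    Prop where
  c1 : IsC1 L us usx usy
  c1x : IsC1 L usx usxx usxy
  c1y : IsC1 L usy usxy usyy
  c1v : IsC1 L vs vsx vsy
  lower : ∀ p ∈ OmBar L, m ≤ us p
  upper : ∀ p ∈ OmBar L, |us p| ≤ M
  bd_x : ∀ p ∈ OmBar L, |usx p| ≤ M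
  bd_y : ∀ p ∈ OmBar L, (1 + p.2) * |usy p| ≤ M
  bd_xx : ∀ p ∈ OmBar L, |usxx p| ≤ M
  bd_xy : ∀ p ∈ OmBar L, |usxy p| ≤ M
  bd_yy : ∀ p ∈ OmBar L, (1 + p.2) * |usyy p| ≤ M
  bd_v : ∀ p ∈ Om L, |vs p| ≤ d * p.2 + M
  bd_vx : ∀ p ∈ Om L, |√ε * vsx p| ≤ M
  bd_vy : ∀ p ∈ Om L, |vsy p| ≤ M

/-- The first derivative of `1 / h`. -/
def inv1 (h hx : ℝ × ℝ → ℝ) (p : ℝ × ℝ) : ℝ := -(hx p * (h p)⁻¹ ^ 2)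

/-- The second derivative of `1 / h`. -/
def inv2 (h hx hy hxy : ℝ × ℝ → ℝ) (p : ℝ × ℝ) : ℝ :=
  -(hxy p * (h p)⁻¹ ^ 2) + 2 * hx p * hy p * (h p)⁻¹ ^ 3

section Background

variable {L ε m M d : ℝ} {us usx usy usxx usxy usyy vs vsx vsy : ℝ × ℝ → ℝ}

theorem inv1_abs_le {h hx : ℝ × ℝ → ℝ} {p : ℝ × ℝ} {r : ℝ} (h1 : |(h p)⁻¹| ≤ M)
    (h2 : |hx p| ≤ r) : |inv1 h hx p| ≤ r * M ^ 2 := by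
  rw [inv1, abs_neg, abs_mul, abs_pow]
  exact mul_le_mul h2 (pow_le_pow_left₀ (abs_nonneg _) h1 2) (by positivity)
    ((abs_nonneg _).trans h2)

theorem inv2_abs_le {h hx hy hxy : ℝ × ℝ → ℝ} {p : ℝ × ℝ} {r₁ r₂ r₃ : ℝ} (h1 : |(h p)⁻¹| ≤ M)
    (h2 : |hx p| ≤ r₁) (h3 : |hy p| ≤ r₂) (h4 : |hxy p| ≤ r₃) :
    |inv2 h hx hy hxy p| ≤ r₃ * M ^ 2 + 2 * r₁ * r₂ * M ^ 3 := by
  have hr1 := (abs_nonneg _).trans h2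
  have hr2 := (abs_nonneg _).trans h3
  have hr3 := (abs_nonneg _).trans h4
  rw [inv2]
  refine (abs_add_le _ _).trans (add_le_add ?_ ?_)
  · rw [abs_neg, abs_mul, abs_pow]
    exact mul_le_mul h4 (pow_le_pow_left₀ (abs_nonneg _) h1 2) (by positivity) hr3
  · rw [abs_mul, abs_mul, abs_mul, abs_pow, abs_of_pos (two_pos : (0 : ℝ) < 2)]
    gcongr

theorem IsBackground.inv_abs_le (G : IsBackground L ε m M d us usx usy usxx usxy usyy vs vsx vsy)
    (hm : 0 < m) (hmM : m⁻¹ ≤ M) {p : ℝ × ℝ} (hp : p ∈ OmBar L) : |(us p)⁻¹| ≤ M := by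
  have h1 := G.lower p hp
  rw [abs_of_pos (inv_pos.2 (hm.trans_le h1))]
  exact (inv_anti₀ hm h1).trans hmM

theorem abs_le_of_weight {y r h : ℝ} (hy : 0 ≤ y) (H : (1 + y) * |h| ≤ r) :
    |h| ≤ r ∧ y * |h| ≤ r := by
  have := mul_nonneg hy (abs_nonneg h)
  have := abs_nonneg h
  constructor <;> nlinarith

/-- Bounds for the derivatives of `1 / us`. -/
theorem IsBackground.weight_bounds
    (G : IsBackground L ε m M d us usx usy usxx usxy usyy vs vsx vsy)
    (hm : 0 < m) (hmM : m⁻¹ ≤ M) (hM : 1 ≤ M) {p : ℝ × ℝ} (hp : p ∈ OmBar L) :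
    |(us p)⁻¹| ≤ 3 * M ^ 5 ∧ |inv1 us usx p| ≤ 3 * M ^ 5 ∧ |inv1 us usy p| ≤ 3 * M ^ 5 ∧
      |inv2 us usx usx usxx p| ≤ 3 * M ^ 5 ∧ |inv2 us usx usy usxy p| ≤ 3 * M ^ 5 ∧
      |inv2 us usy usy usyy p| ≤ 3 * M ^ 5 ∧ |inv2 us usy usy usyy p * p.2| ≤ 3 * M ^ 5 := by
  have hy : 0 ≤ p.2 := hp.2
  have h0 := G.inv_abs_le hm hmM hp
  have hx := G.bd_x p hp
  obtain ⟨hy1, hy2⟩ := abs_le_of_weight hy (G.bd_y p hp)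
  obtain ⟨hyy1, hyy2⟩ := abs_le_of_weight hy (G.bd_yy p hp)
  have M35 : M ^ 3 ≤ M ^ 5 := pow_le_pow_right₀ hM (by norm_num)
  have M15 : M ≤ M ^ 5 := le_self_pow₀ hM (by norm_num)
  have e1 : M * M ^ 2 ≤ 3 * M ^ 5 := by
    have : M * M ^ 2 = M ^ 3 := by ring
    linarith [pow_pos (zero_lt_one.trans_le hM) 5]
  have e2 : M * M ^ 2 + 2 * M * M * M ^ 3 ≤ 3 * M ^ 5 := by
    have : M * M ^ 2 + 2 * M * M * M ^ 3 = M ^ 3 + 2 * M ^ 5 := by ring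
    linarith
  refine ⟨by linarith, (inv1_abs_le h0 hx).trans e1, (inv1_abs_le h0 hy1).trans e1,
    (inv2_abs_le h0 hx hx (G.bd_xx p hp)).trans e2,
    (inv2_abs_le h0 hx hy1 (G.bd_xy p hp)).trans e2,
    (inv2_abs_le h0 hy1 hy1 hyy1).trans e2, ?_⟩
  -- The weight $y$ is put on $u_{syy}$ in the first summand and on only one of the two factors
  -- $u_{sy}$ in the second.
  have h3 : inv2 us usy usy usyy p * p.2
      = inv2 us usy (fun p => p.2 * usy p) (fun p => p.2 * usyy p) p := by
    simp only [inv2]; ring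
  rw [h3]
  refine (inv2_abs_le h0 hy1 ?_ ?_).trans e2
  · rw [abs_mul, abs_of_nonneg hy]; exact hy2
  · rw [abs_mul, abs_of_nonneg hy]; exact hyy2

theorem IsBackground.weight (G : IsBackground L ε m M d us usx usy usxx usxy usyy vs vsx vsy)
    (hm : 0 < m) (hmM : m⁻¹ ≤ M) (hM : 1 ≤ M) :
    IsWeight L (fun p => (us p)⁻¹) (inv1 us usx) (inv1 us usy) (inv2 us usx usx usxx)
      (inv2 us usx usy usxy) (inv2 us usy usy usyy) := by
  have h0 : ∀ p ∈ OmBar L, us p ≠ 0 := fun p hp => (hm.trans_le (G.lower p hp)).ne'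
  have c1 : IsC1 L (fun p => (us p)⁻¹) (inv1 us usx) (inv1 us usy) := G.c1.inv h0
  have c2 := c1.mul c1
  have c1x : IsC1 L (inv1 us usx) (inv2 us usx usx usxx) (inv2 us usx usy usxy) :=
    ((G.c1x.mul c2).const_mul (-1)).congr (fun p => by simp only [inv1]; ring)
      (fun p => by simp only [inv1, inv2]; ring) (fun p => by simp only [inv1, inv2]; ring)
  have c1y : IsC1 L (inv1 us usy) (inv2 us usx usy usxy) (inv2 us usy usy usyy) :=
    ((G.c1y.mul c2).const_mul (-1)).congr (fun p => by simp only [inv1]; ring)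
      (fun p => by simp only [inv1, inv2]; ring) (fun p => by simp only [inv1, inv2]; ring)
  have B := fun p (hp : p ∈ OmBar L) => G.weight_bounds hm hmM hM hp
  exact ⟨c1, c1x, c1y, ⟨c1.cont, _, fun p hp => (B p hp).1⟩,
    ⟨c1x.cont, _, fun p hp => (B p hp).2.1⟩, ⟨c1y.cont, _, fun p hp => (B p hp).2.2.1⟩,
    ⟨c1x.cont_x, _, fun p hp => (B p hp).2.2.2.1⟩, ⟨c1x.cont_y, _, fun p hp => (B p hp).2.2.2.2.1⟩,
    ⟨c1y.cont_y, _, fun p hp => (B p hp).2.2.2.2.2.1⟩,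
    fun p hp => (inv_pos.2 (hm.trans_le (G.lower p hp))).le⟩

end Background

/-! ### Norms of the solution in terms of `β` -/

section Norms

variable {L ε m M d : ℝ} {us usx usy usxx usxy usyy vs vsx vsy f g : ℝ × ℝ → ℝ}
  {aL bL τ : ℝ → ℝ} {S : Remainder}

/-- The weak `x`-derivative of `β = v / us`. -/
def Remainder.βx (us usx : ℝ × ℝ → ℝ) (S : Remainder) (p : ℝ × ℝ) : ℝ :=
  (us p)⁻¹ * S.vx p + inv1 us usx p * S.v p

/-- The weak `y`-derivative of `β = v / us`. -/
def Remainder.βy (us usy : ℝ × ℝ → ℝ) (S : Remainder) (p : ℝ × ℝ) : ℝ :=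
  (us p)⁻¹ * S.vy p + inv1 us usy p * S.v p

theorem memLp_β (hw : IsWeight L (fun p => (us p)⁻¹) (inv1 us usx) (inv1 us usy) usxx usxy usyy)
    (hl : S.Lines L ε aL bL τ) :
    MemLp (fun p => (us p)⁻¹ * S.v p) 2 (volume.restrict (Om L)) ∧
    MemLp (S.βx us usx) 2 (volume.restrict (Om L)) ∧
    MemLp (S.βy us usy) 2 (volume.restrict (Om L)) :=
  ⟨hw.bd.memLp_mul subset_rfl hl.v_L2,
    (hw.bd.memLp_mul subset_rfl hl.vx_L2).add (hw.bd_x.memLp_mul subset_rfl hl.v_L2),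
    (hw.bd.memLp_mul subset_rfl hl.vy_L2).add (hw.bd_y.memLp_mul subset_rfl hl.v_L2)⟩

theorem line_βx (hL : 0 < L)
    (hw : IsWeight L (fun p => (us p)⁻¹) (inv1 us usx) (inv1 us usy) usxx usxy usyy)
    (hl : S.Lines L ε aL bL τ) : ∀ᵐ y ∂(volume.restrict (Ioi (0 : ℝ))), ∃ q, LineAC 0 L
      (fun x => (us (x, y))⁻¹ * S.v (x, y)) (fun x => S.βx us usx (x, y)) 0 q := by
  filter_upwards [hl.x_v, ae_restrict_mem measurableSet_Ioi] with y hv hy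
  have := (hw.c1.line_x hL hy).mul hv hL.le
  exact ⟨_, (this.cast (mul_zero _) rfl).congr hL.le (ae_of_all _ fun _ => rfl)
    (ae_of_all _ fun x => by simp only [Remainder.βx]; ring)⟩

theorem line_βy
    (hw : IsWeight L (fun p => (us p)⁻¹) (inv1 us usx) (inv1 us usy) usxx usxy usyy)
    (hl : S.Lines L ε aL bL τ) : ∀ R, 0 < R → ∀ᵐ x ∂(volume.restrict (Ioo 0 L)), ∃ q, LineAC 0 R
      (fun y => (us (x, y))⁻¹ * S.v (x, y)) (fun y => S.βy us usy (x, y)) 0 q := fun R hR => by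
  filter_upwards [hl.y_v R hR, ae_restrict_mem measurableSet_Ioo] with x ⟨q, hv⟩ hx
  have := (hw.c1.line_y hR hx).mul hv hR.le
  exact ⟨_, (this.cast (mul_zero _) rfl).congr hR.le (ae_of_all _ fun _ => rfl)
    (ae_of_all _ fun x => by simp only [Remainder.βy]; ring)⟩

/-- Since $\beta$ vanishes at $x=0$ and at the wall, it obeys Poincaré's inequality in $x$ and
Hardy's in $y$. The derivatives of $v$ are recovered from $v_y=u_s\beta_y+(yu_{sy}/u_s)(v/y)$ and
$v_x=u_s\beta_x+(u_{sx}/u_s)v$. In the first identity the factor $y$ is compensated by the decay of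
$u_{sy}$. -/
theorem norm_bounds (hL : 0 < L) (hL1 : L ≤ 1)
    (G : IsBackground L ε m M d us usx usy usxx usxy usyy vs vsx vsy)
    (hm : 0 < m) (hmM : m⁻¹ ≤ M) (hM : 1 ≤ M) (hl : S.Lines L ε aL bL τ) :
    IntegrableOn (fun p => (S.v p / p.2) ^ 2) (Om L) ∧
    ∫ p in Om L, (S.v p / p.2) ^ 2 ≤ 4 * M ^ 2 * ∫ p in Om L, S.βy us usy p ^ 2 ∧
    ∫ p in Om L, S.vy p ^ 2 ≤ 10 * M ^ 6 * ∫ p in Om L, S.βy us usy p ^ 2 ∧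
    ∫ p in Om L, S.v p ^ 2 ≤ L ^ 2 * (M ^ 2 * ∫ p in Om L, S.βx us usx p ^ 2) ∧
    ∫ p in Om L, S.vx p ^ 2 ≤ 4 * M ^ 6 * ∫ p in Om L, S.βx us usx p ^ 2 ∧
    ∫ p in Om L, S.u p ^ 2 ≤ L ^ 2 * ∫ p in Om L, S.vy p ^ 2 := by
  have hw := G.weight hm hmM hM
  obtain ⟨hβ, hβx, hβy⟩ := memLp_β hw hl
  have lx := line_βx hL hw hl
  have ly := line_βy hw hl
  have hP := poincare_x hL hβ hβx lx
  obtain ⟨iH, hH⟩ := hardy_y hβ hβy ly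
  have M0 : 0 < M := by linarith
  have hus : ∀ p ∈ Om L, us p ≠ 0 := fun p hp =>
    (hm.trans_le (G.lower p (Om_subset_OmBar L hp))).ne'
  have husM : ∀ p ∈ Om L, us p ^ 2 ≤ M ^ 2 := fun p hp => by
    rw [← sq_abs]; exact pow_le_pow_left₀ (abs_nonneg _) (G.upper p (Om_subset_OmBar L hp)) 2
  have hwM : ∀ p ∈ Om L, (us p)⁻¹ ^ 2 ≤ M ^ 2 := fun p hp => by
    rw [← sq_abs]
    exact pow_le_pow_left₀ (abs_nonneg _) (G.inv_abs_le hm hmM (Om_subset_OmBar L hp)) 2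
  have e1 : ∀ p ∈ Om L, (S.v p / p.2) ^ 2 ≤ M ^ 2 * ((us p)⁻¹ * S.v p / p.2) ^ 2 := fun p hp => by
    have h1 : S.v p / p.2 = us p * ((us p)⁻¹ * S.v p / p.2) := by
      have := hus p hp
      field_simp
    rw [h1, mul_pow]
    exact mul_le_mul_of_nonneg_right (husM p hp) (sq_nonneg _)
  have i1 : IntegrableOn (fun p => (S.v p / p.2) ^ 2) (Om L) := by
    refine Integrable.mono' (iH.const_mul (M ^ 2)) ?_ ?_
    · have : AEStronglyMeasurable (fun p : ℝ × ℝ => p.2⁻¹) (volume.restrict (Om L)) :=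
        (measurable_snd.inv).aestronglyMeasurable
      simp only [div_eq_mul_inv]
      exact (hl.v_L2.1.mul this).pow 2
    · filter_upwards [ae_restrict_mem (measurableSet_Om L)] with p hp
      rw [Real.norm_eq_abs, abs_of_nonneg (sq_nonneg _)]
      exact e1 p hp
  set Iy := ∫ p in Om L, S.βy us usy p ^ 2
  set Ix := ∫ p in Om L, S.βx us usx p ^ 2
  have hIy : 0 ≤ Iy := integral_nonneg fun _ => sq_nonneg _
  have hIx : 0 ≤ Ix := integral_nonneg fun _ => sq_nonneg _
  have b1 : ∫ p in Om L, (S.v p / p.2) ^ 2 ≤ 4 * M ^ 2 * Iy := by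
    calc _ ≤ ∫ p in Om L, M ^ 2 * ((us p)⁻¹ * S.v p / p.2) ^ 2 :=
          setIntegral_mono_on i1 (iH.const_mul _) (measurableSet_Om L) e1
      _ ≤ _ := by
        rw [integral_const_mul]
        nlinarith [mul_le_mul_of_nonneg_left hH (sq_nonneg M)]
  have M26 : M ^ 2 ≤ M ^ 6 := pow_le_pow_right₀ hM (by norm_num)
  have b2 : ∫ p in Om L, S.vy p ^ 2 ≤ 10 * M ^ 6 * Iy := by
    have i2 := hβy.integrable_sq
    calc _ ≤ ∫ p in Om L, (2 * M ^ 2 * S.βy us usy p ^ 2 + 2 * M ^ 4 * (S.v p / p.2) ^ 2) := by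
          refine setIntegral_mono_on hl.vy_L2.integrable_sq
            ((i2.const_mul _).add (i1.const_mul _)) (measurableSet_Om L) fun p hp => ?_
          have hy : 0 < p.2 := hp.2
          have h1 := hus p hp
          have h2 : S.vy p = us p * S.βy us usy p + (p.2 * usy p * (us p)⁻¹) * (S.v p / p.2) := by
            simp only [Remainder.βy, inv1]
            field_simp
            ring
          have h3 : (p.2 * usy p * (us p)⁻¹) ^ 2 ≤ M ^ 4 := by
            have h4 : (p.2 * usy p) ^ 2 ≤ M ^ 2 := by
              rw [← sq_abs, abs_mul, abs_of_pos hy]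
              exact pow_le_pow_left₀ (by positivity)
                (abs_le_of_weight hy.le (G.bd_y p (Om_subset_OmBar L hp))).2 2
            rw [mul_pow]
            calc _ ≤ M ^ 2 * M ^ 2 := mul_le_mul h4 (hwM p hp) (sq_nonneg _) (sq_nonneg _)
              _ = _ := by ring
          rw [h2]
          have h5 := mul_le_mul_of_nonneg_right (husM p hp) (sq_nonneg (S.βy us usy p))
          have h6 := mul_le_mul_of_nonneg_right h3 (sq_nonneg (S.v p / p.2))
          nlinarith [sq_nonneg (us p * S.βy us usy p - (p.2 * usy p * (us p)⁻¹) * (S.v p / p.2))]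
      _ = 2 * M ^ 2 * Iy + 2 * M ^ 4 * ∫ p in Om L, (S.v p / p.2) ^ 2 := by
          rw [integral_add (i2.const_mul _) (i1.const_mul _), integral_const_mul,
            integral_const_mul]
      _ ≤ _ := by
          have h1 := mul_le_mul_of_nonneg_left b1 (show 0 ≤ 2 * M ^ 4 by positivity)
          have h2 := mul_le_mul_of_nonneg_right M26 hIy
          nlinarith
  have b3 : ∫ p in Om L, S.v p ^ 2 ≤ L ^ 2 * (M ^ 2 * Ix) := by
    calc _ ≤ ∫ p in Om L, M ^ 2 * ((us p)⁻¹ * S.v p) ^ 2 := by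
          refine setIntegral_mono_on hl.v_L2.integrable_sq (hβ.integrable_sq.const_mul _)
            (measurableSet_Om L) fun p hp => ?_
          have h1 : S.v p = us p * ((us p)⁻¹ * S.v p) := by
            have := hus p hp
            field_simp
          conv_lhs => rw [h1, mul_pow]
          exact mul_le_mul_of_nonneg_right (husM p hp) (sq_nonneg _)
      _ ≤ _ := by
          rw [integral_const_mul]
          nlinarith [mul_le_mul_of_nonneg_left hP (sq_nonneg M)]
  refine ⟨i1, b1, b2, b3, ?_, ?_⟩
  · have i2 := hβx.integrable_sq
    have i3 := hl.v_L2.integrable_sq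
    calc _ ≤ ∫ p in Om L, (2 * M ^ 2 * S.βx us usx p ^ 2 + 2 * M ^ 4 * S.v p ^ 2) := by
          refine setIntegral_mono_on hl.vx_L2.integrable_sq
            ((i2.const_mul _).add (i3.const_mul _)) (measurableSet_Om L) fun p hp => ?_
          have h1 := hus p hp
          have h2 : S.vx p = us p * S.βx us usx p + (usx p * (us p)⁻¹) * S.v p := by
            simp only [Remainder.βx, inv1]
            field_simp
            ring
          have h3 : (usx p * (us p)⁻¹) ^ 2 ≤ M ^ 4 := by
            have h4 : usx p ^ 2 ≤ M ^ 2 := by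
              rw [← sq_abs]
              exact pow_le_pow_left₀ (by positivity) (G.bd_x p (Om_subset_OmBar L hp)) 2
            rw [mul_pow]
            calc _ ≤ M ^ 2 * M ^ 2 := mul_le_mul h4 (hwM p hp) (sq_nonneg _) (sq_nonneg _)
              _ = _ := by ring
          rw [h2]
          have h5 := mul_le_mul_of_nonneg_right (husM p hp) (sq_nonneg (S.βx us usx p))
          have h6 := mul_le_mul_of_nonneg_right h3 (sq_nonneg (S.v p))
          nlinarith [sq_nonneg (us p * S.βx us usx p - (usx p * (us p)⁻¹) * S.v p)]
      _ = 2 * M ^ 2 * Ix + 2 * M ^ 4 * ∫ p in Om L, S.v p ^ 2 := by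
          rw [integral_add (i2.const_mul _) (i3.const_mul _), integral_const_mul,
            integral_const_mul]
      _ ≤ _ := by
          have h1 := mul_le_mul_of_nonneg_left b3 (show 0 ≤ 2 * M ^ 4 by positivity)
          have h2 := mul_le_mul_of_nonneg_right M26 hIx
          have h3 : L ^ 2 * (M ^ 6 * Ix) ≤ M ^ 6 * Ix :=
            mul_le_of_le_one_left (by positivity) (pow_le_one₀ hL.le hL1)
          nlinarith
  · have := poincare_x (hx := fun p => -S.vy p) hL hl.u_L2 hl.vy_L2.neg hl.x_u
    simpa only [neg_sq] using this

end Norms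

/-! ### The positivity estimate for a given background flow -/

theorem memLp_mul_of_bound {L W : ℝ} {k h : ℝ × ℝ → ℝ} (hc : ContinuousOn k (OmBar L))
    (hb : ∀ p ∈ Om L, |k p| ≤ W) (hh : MemLp h 2 (volume.restrict (Om L))) :
    MemLp (fun p => k p * h p) 2 (volume.restrict (Om L)) := by
  refine MemLp.of_le_mul (c := W) hh
    (((hc.mono (Om_subset_OmBar L)).aestronglyMeasurable (measurableSet_Om L)).mul hh.1) ?_
  filter_upwards [ae_restrict_mem (measurableSet_Om L)] with p hp
  rw [norm_mul]
  exact mul_le_mul_of_nonneg_right (hb p hp) (norm_nonneg _)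

theorem memLp_mul_of_linear_bound {L d W : ℝ} {k h : ℝ × ℝ → ℝ} (hc : ContinuousOn k (OmBar L))
    (hb : ∀ p ∈ Om L, |k p| ≤ d * p.2 + W) (hh : MemLp h 2 (volume.restrict (Om L)))
    (hh' : MemLp (fun p => h p * p.2) 2 (volume.restrict (Om L))) :
    MemLp (fun p => k p * h p) 2 (volume.restrict (Om L)) := by
  refine MemLp.of_le (g := fun p => d * |h p * p.2| + W * |h p|)
    ((hh'.norm.const_mul d).add (hh.norm.const_mul W))
    (((hc.mono (Om_subset_OmBar L)).aestronglyMeasurable (measurableSet_Om L)).mul hh.1) ?_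
  filter_upwards [ae_restrict_mem (measurableSet_Om L)] with p hp
  have hy : 0 < p.2 := hp.2
  rw [norm_mul, Real.norm_eq_abs, Real.norm_eq_abs, Real.norm_eq_abs]
  refine le_trans ?_ (le_abs_self _)
  rw [abs_mul, abs_of_pos hy]
  have := mul_le_mul_of_nonneg_right (hb p hp) (abs_nonneg (h p))
  linarith

/-- `f` is integrable over `Ω` with integral `I`. -/
def HasInt (L : ℝ) (f : ℝ × ℝ → ℝ) (I : ℝ) : Prop :=
  IntegrableOn f (Om L) ∧ ∫ p in Om L, f p = I

theorem HasInt.add {L I J : ℝ} {f g : ℝ × ℝ → ℝ} (hf : HasInt L f I) (hg : HasInt L g J) :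
    HasInt L (fun p => f p + g p) (I + J) :=
  ⟨hf.1.add hg.1, by rw [integral_add hf.1 hg.1, hf.2, hg.2]⟩

theorem HasInt.const_mul {L I : ℝ} {f : ℝ × ℝ → ℝ} (hf : HasInt L f I) (c : ℝ) :
    HasInt L (fun p => c * f p) (c * I) :=
  ⟨hf.1.const_mul c, by rw [integral_const_mul, hf.2]⟩

theorem MemLp.hasInt {L : ℝ} {f : ℝ × ℝ → ℝ} (hf : MemLp f 2 (volume.restrict (Om L))) :
    HasInt L (fun p => f p ^ 2) (∫ p in Om L, f p ^ 2) := ⟨hf.integrable_sq, rfl⟩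

theorem HasInt.snd {L : ℝ} (hL : 0 < L) {b : ℝ → ℝ} (hb : MemLp b 2 (volume.restrict (Ioi 0))) :
    HasInt L (fun p => b p.2 ^ 2) (L * ∫ y in Ioi 0, b y ^ 2) := by
  refine ⟨(memLp_snd hb).integrable_sq, ?_⟩
  rw [volume_restrict_Om, integral_fun_snd (fun y => b y ^ 2)]
  simp [measureReal_def, hL.le]

/-- The normal stress contributes $2t^2w\tau^2$. Half of $t^2w\tau^2$ is spent on the product with
$a$ and another half on the product with $V$, the trace of $v$; one full copy survives. Writing
$a=tz$ shows why $a_L$ is measured as $a_L/\sqrt\epsilon$. -/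
theorem outflow_pointwise {t M w wx usy τ a b V : ℝ} (ht : 0 < t) (ht1 : t ≤ 1) (hM : 1 ≤ M)
    (hw0 : 0 ≤ w) (hw : w ≤ M) (hwx : |wx| ≤ M ^ 3) (hy : |usy| ≤ M) :
    t ^ 2 * (w * τ ^ 2) - 3 * M ^ 6 * (b ^ 2 + a ^ 2 / t ^ 2 + t ^ 2 * V ^ 2)
      ≤ -(1 / 2) * (w * b ^ 2) - (a - 2 * t ^ 2 * τ) * (w * τ + -(usy * w ^ 2) * V)
        - t ^ 2 * (wx * (V * b)) := by
  obtain ⟨z, rfl⟩ : ∃ z, a = t * z := ⟨a / t, by field_simp⟩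
  have e : (t * z) ^ 2 / t ^ 2 = z ^ 2 := by field_simp
  rw [e]
  have hM0 : 0 < M := by linarith
  have M16 : M ≤ M ^ 6 := le_self_pow₀ hM (by norm_num)
  have M56 : M ^ 5 ≤ M ^ 6 := pow_le_pow_right₀ hM (by norm_num)
  have M61 : 1 ≤ M ^ 6 := one_le_pow₀ hM
  have hw2 : w ^ 2 ≤ M ^ 2 := pow_le_pow_left₀ hw0 hw 2
  have hy2 : usy ^ 2 ≤ M ^ 2 := by rw [← sq_abs]; exact pow_le_pow_left₀ (abs_nonneg _) hy 2
  have hx2 : wx ^ 2 ≤ M ^ 6 := by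
    rw [← sq_abs]
    exact (pow_le_pow_left₀ (abs_nonneg _) hwx 2).trans (by rw [← pow_mul])
  have hyw : usy ^ 2 * w ^ 2 ≤ M ^ 4 :=
    (mul_le_mul hy2 hw2 (sq_nonneg _) (sq_nonneg _)).trans (by rw [← pow_add])
  have hyw5 : w * (usy ^ 2 * w ^ 2) ≤ M ^ 5 :=
    (mul_le_mul hw hyw (by positivity) hM0.le).trans (by rw [← pow_succ'])
  have hyw6 : (usy * w ^ 2) ^ 2 ≤ M ^ 6 := by
    calc (usy * w ^ 2) ^ 2 = w ^ 2 * (usy ^ 2 * w ^ 2) := by ring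
      _ ≤ M ^ 2 * M ^ 4 := mul_le_mul hw2 hyw (by positivity) (by positivity)
      _ = _ := by rw [← pow_add]
  have q1 : w * (t * z * τ) ≤ 1 / 2 * (w * (t ^ 2 * τ ^ 2)) + 1 / 2 * (w * z ^ 2) := by
    nlinarith [mul_nonneg hw0 (sq_nonneg (t * τ - z))]
  have q2 : 2 * t ^ 2 * (w * τ * (usy * w * V))
      ≤ 1 / 2 * (w * (t ^ 2 * τ ^ 2)) + 2 * (t ^ 2 * V ^ 2 * (w * (usy ^ 2 * w ^ 2))) := by
    nlinarith [mul_nonneg hw0 (sq_nonneg (t * τ - 2 * (t * (usy * w * V))))]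
  have q3 : -(t * z * ((usy * w ^ 2) * V))
      ≤ 1 / 2 * z ^ 2 + 1 / 2 * (t ^ 2 * V ^ 2 * (usy * w ^ 2) ^ 2) := by
    nlinarith [sq_nonneg (z + t * ((usy * w ^ 2) * V))]
  have q4 : t ^ 2 * (wx * (V * b)) ≤ 1 / 2 * (t ^ 2 * V ^ 2 * wx ^ 2) + 1 / 2 * (t ^ 2 * b ^ 2) := by
    nlinarith [sq_nonneg (t * (wx * V) - t * b)]
  have tV : 0 ≤ t ^ 2 * V ^ 2 := by positivity
  have r1 := mul_le_mul_of_nonneg_left hyw5 tV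
  have r2 := mul_le_mul_of_nonneg_left hyw6 tV
  have r3 := mul_le_mul_of_nonneg_left hx2 tV
  have r4 := mul_le_mul_of_nonneg_left M56 tV
  have r5 := mul_le_mul_of_nonneg_right hw (sq_nonneg b)
  have r6 := mul_le_mul_of_nonneg_right hw (sq_nonneg z)
  have r7 := mul_le_mul_of_nonneg_right M16 (sq_nonneg b)
  have r8 := mul_le_mul_of_nonneg_right M16 (sq_nonneg z)
  have r9 := mul_le_mul_of_nonneg_right M61 (sq_nonneg z)
  have r10 := mul_le_mul_of_nonneg_right M61 (sq_nonneg b)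
  have r11 : t ^ 2 * b ^ 2 ≤ 1 * b ^ 2 :=
    mul_le_mul_of_nonneg_right (pow_le_one₀ ht.le ht1) (sq_nonneg b)
  have r12 : 0 ≤ M ^ 6 * b ^ 2 := by positivity
  have r13 : 0 ≤ M ^ 6 * z ^ 2 := by positivity
  linarith only [q1, q2, q3, q4, r1, r2, r3, r4, r5, r6, r7, r8, r9, r10, r11, r12, r13]

section Positivity

variable {L ε m M d θ : ℝ} {us usx usy usxx usxy usyy vs vsx vsy f g : ℝ × ℝ → ℝ}
  {aL bL τ : ℝ → ℝ} {S : Remainder}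

/-- Integral of the majorant of the terms of lower order. -/
theorem integral_majorant_le (hL : 0 < L) (hθ : 0 < θ) (hθ1 : θ ≤ 1) (hLθ : L ≤ θ ^ 2) (hε : 0 < ε)
    (G : IsBackground L ε m M d us usx usy usxx usxy usyy vs vsx vsy)
    (hm : 0 < m) (hmM : m⁻¹ ≤ M) (hM : 1 ≤ M) (hl : S.Lines L ε aL bL τ) (hX : S.MemX L)
    (hb1 : MemLp bL 2 (volume.restrict (Ioi 0)))
    (hb2 : MemLp (deriv bL) 2 (volume.restrict (Ioi 0))) :
    ∃ I, HasInt L (fun p => majorant θ θ⁻¹ (√ε) (S.βy us usy p) (S.βx us usx p) (S.vy p) (S.uy p)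
        (S.vx p) (S.v p / p.2) (S.u p) (S.v p) (d * p.2 * S.uy p) (d * p.2 * S.vy p) (bL p.2)
        (deriv bL p.2)) I ∧
      I ≤ 25 * M ^ 6 * θ * (∫ p in Om L, (S.βy us usy p ^ 2 + ε * S.βx us usx p ^ 2))
        + θ⁻¹ * ((∫ p in Om L, S.uy p ^ 2)
          + d ^ 2 * (∫ p in Om L, ((S.uy p * p.2) ^ 2 + ε * (S.vy p * p.2) ^ 2))
          + ((∫ y in Ioi 0, bL y ^ 2) + ∫ y in Ioi 0, deriv bL y ^ 2)) := by
  have hL1 : L ≤ 1 := hLθ.trans (pow_le_one₀ hθ.le hθ1)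
  have t2 : √ε ^ 2 = ε := Real.sq_sqrt hε.le
  obtain ⟨-, hβx, hβy⟩ := memLp_β (G.weight hm hmM hM) hl
  obtain ⟨iH, hH, hA, hV, hC, hU⟩ := norm_bounds hL hL1 G hm hmM hM hl
  have hvyy : MemLp (fun p => S.vy p * p.2) 2 (volume.restrict (Om L)) := by
    refine (memLp_congr_ae ?_).2 hX.ux_y.neg
    filter_upwards [hl.rel_x] with p hp
    simp only [Pi.neg_apply]
    linear_combination p.2 * hp
  have j1 := MemLp.hasInt hβy
  have j2 := MemLp.hasInt hβx
  have j3 := MemLp.hasInt hl.vy_L2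
  have j4 := MemLp.hasInt hl.vx_L2
  have j5 : HasInt L (fun p => (S.v p / p.2) ^ 2) _ := ⟨iH, rfl⟩
  have j6 := MemLp.hasInt hl.u_L2
  have j7 := MemLp.hasInt hl.v_L2
  have j8 := MemLp.hasInt hl.uy_L2
  have j9 := MemLp.hasInt hX.uy_y
  have j10 := MemLp.hasInt hvyy
  have j11 := HasInt.snd hL hb1
  have j12 := HasInt.snd hL hb2
  have J := (((((j1.add (j2.const_mul ε)).add j3).add (j4.const_mul ε)).add j5).const_mul θ).add
    (((((((j6.add (j7.const_mul ε)).add j8).add (j9.const_mul (d ^ 2))).add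
      (j10.const_mul (d ^ 2 * ε))).add j11).add j12).const_mul θ⁻¹)
  have JN := j1.add (j2.const_mul ε)
  have JW := j9.add (j10.const_mul ε)
  rw [JN.2, JW.2]
  refine ⟨_, ⟨J.1.congr (ae_of_all _ fun p => ?_), (integral_congr_ae (ae_of_all _ fun p => ?_)).trans
    J.2⟩, ?_⟩
  · simp only [majorant, mul_pow, t2]; ring
  · simp only [majorant, mul_pow, t2]; ring
  have iy0 : 0 ≤ ∫ p in Om L, S.βy us usy p ^ 2 := integral_nonneg fun _ => sq_nonneg _
  have ix0 : 0 ≤ ∫ p in Om L, S.βx us usx p ^ 2 := integral_nonneg fun _ => sq_nonneg _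
  have b0 : 0 ≤ ∫ y in Ioi 0, bL y ^ 2 := integral_nonneg fun _ => sq_nonneg _
  have b0' : 0 ≤ ∫ y in Ioi 0, deriv bL y ^ 2 := integral_nonneg fun _ => sq_nonneg _
  generalize (∫ p in Om L, S.βy us usy p ^ 2) = Iy at *
  generalize (∫ p in Om L, S.βx us usx p ^ 2) = Ix at *
  generalize (∫ y in Ioi 0, bL y ^ 2) = b at *
  generalize (∫ y in Ioi 0, deriv bL y ^ 2) = b' at *
  generalize (∫ p in Om L, S.vy p ^ 2) = A at *
  generalize (∫ p in Om L, S.vx p ^ 2) = C at *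
  generalize (∫ p in Om L, S.v p ^ 2) = V at *
  generalize (∫ p in Om L, S.u p ^ 2) = U at *
  generalize (∫ p in Om L, (S.v p / p.2) ^ 2) = H at *
  have hs0 : 0 < θ⁻¹ := inv_pos.2 hθ
  have hsθ : θ⁻¹ * θ = 1 := inv_mul_cancel₀ hθ.ne'
  generalize θ⁻¹ = s at *
  have M26 : M ^ 2 ≤ M ^ 6 := pow_le_pow_right₀ hM (by norm_num)
  have M61 : 1 ≤ M ^ 6 := one_le_pow₀ hM
  have sL : s * L ^ 2 ≤ θ := by
    have h1 : L ^ 2 ≤ (θ ^ 2) ^ 2 := pow_le_pow_left₀ hL.le hLθ 2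
    calc s * L ^ 2 ≤ s * (θ ^ 2) ^ 2 := mul_le_mul_of_nonneg_left h1 hs0.le
      _ = θ ^ 3 * (s * θ) := by ring
      _ = θ ^ 3 := by rw [hsθ, mul_one]
      _ ≤ θ := pow_le_of_le_one hθ.le hθ1 (by norm_num)
  have u1 : s * U ≤ θ * (10 * M ^ 6 * Iy) := by
    calc s * U ≤ s * (L ^ 2 * (10 * M ^ 6 * Iy)) :=
          mul_le_mul_of_nonneg_left (hU.trans (mul_le_mul_of_nonneg_left hA (sq_nonneg L))) hs0.le
      _ = s * L ^ 2 * (10 * M ^ 6 * Iy) := by ring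
      _ ≤ _ := mul_le_mul_of_nonneg_right sL (by positivity)
  have u2 : s * (ε * V) ≤ θ * (M ^ 6 * (ε * Ix)) := by
    calc s * (ε * V) ≤ s * (ε * (L ^ 2 * (M ^ 2 * Ix))) :=
          mul_le_mul_of_nonneg_left (mul_le_mul_of_nonneg_left hV hε.le) hs0.le
      _ = s * L ^ 2 * (M ^ 2 * (ε * Ix)) := by ring
      _ ≤ θ * (M ^ 6 * (ε * Ix)) := by gcongr
  have u3 : θ * A ≤ θ * (10 * M ^ 6 * Iy) := mul_le_mul_of_nonneg_left hA hθ.le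
  have u4 : θ * (ε * C) ≤ θ * (4 * M ^ 6 * (ε * Ix)) := by
    refine mul_le_mul_of_nonneg_left ?_ hθ.le
    calc ε * C ≤ ε * (4 * M ^ 6 * Ix) := mul_le_mul_of_nonneg_left hC hε.le
      _ = _ := by ring
  have u5 : θ * H ≤ θ * (4 * M ^ 6 * Iy) := by
    refine mul_le_mul_of_nonneg_left (hH.trans ?_) hθ.le
    gcongr
  have u6 : θ * Iy ≤ θ * (M ^ 6 * Iy) :=
    mul_le_mul_of_nonneg_left (le_mul_of_one_le_left iy0 M61) hθ.le
  have u7 : θ * (ε * Ix) ≤ θ * (M ^ 6 * (ε * Ix)) :=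
    mul_le_mul_of_nonneg_left (le_mul_of_one_le_left (by positivity) M61) hθ.le
  have u8 : s * (L * b) ≤ s * b :=
    mul_le_mul_of_nonneg_left (mul_le_of_le_one_left b0 hL1) hs0.le
  have u9 : s * (L * b') ≤ s * b' :=
    mul_le_mul_of_nonneg_left (mul_le_of_le_one_left b0' hL1) hs0.le
  have u10 : 0 ≤ θ * (M ^ 6 * (ε * Ix)) := by positivity
  -- The coefficients of $\|\beta_y\|^2$ add up to $10+10+4+1=25$. Those of $\epsilon\|\beta_x\|^2$
  -- add up to $6$, and `u10` fills the difference.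
  linarith only [u1, u2, u3, u4, u5, u6, u7, u8, u9, u10]

end Positivity

/-! ### Absorption of the terms of lower order -/

section Positivity

variable {L ε m M d θ : ℝ} {us usx usy usxx usxy usyy vs vsx vsy f g : ℝ × ℝ → ℝ}
  {aL bL τ : ℝ → ℝ} {S : Remainder}

/-- The identities $u_s^2\beta_y=u_sv_y-u_{sy}v$ and $u_s^2\beta_x=u_sv_x-u_{sx}v$ extract
$-u_s^2(\beta_y^2+\epsilon\beta_x^2)$ from convection, and $u_s\ge m$. The rest is `low_order_le`
with $3M^5$, the bound for the derivatives of $1/u_s$, in place of $M$; hence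
$936M^{10}=104(3M^5)^2$. -/
theorem young_integrand_le (hθ : 0 < θ) (hθ1 : θ ≤ 1) (hε : 0 < ε) (hεθ : ε ≤ θ ^ 2)
    (G : IsBackground L ε m M d us usx usy usxx usxy usyy vs vsx vsy)
    (hm : 0 < m) (hmM : m⁻¹ ≤ M) (hM : 1 ≤ M) {p : ℝ × ℝ} (hp : p ∈ Om L) :
    -1 * ((us p)⁻¹ * (S.vy p * (f p - (-(us p * S.vy p) + usx p * S.u p + vs p * S.uy p
        + usy p * S.v p))))
      + -1 * (inv1 us usy p * (S.v p * (f p - (-(us p * S.vy p) + usx p * S.u p + vs p * S.uy p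
        + usy p * S.v p))))
      + ε * ((us p)⁻¹ * (S.vx p * (g p - (us p * S.vx p + vsx p * S.u p + vs p * S.vy p
        + vsy p * S.v p))))
      + ε * (inv1 us usx p * (S.v p * (g p - (us p * S.vx p + vsx p * S.u p + vs p * S.vy p
        + vsy p * S.v p))))
      + fluxLow ε (fun p => (us p)⁻¹) (inv1 us usx) (inv1 us usy) (inv2 us usx usx usxx)
        (inv2 us usx usy usxy) (inv2 us usy usy usyy) bL S p
    ≤ (-(f p * S.βy us usy p) + ε * (g p * S.βx us usx p))
      + -m ^ 2 * (S.βy us usy p ^ 2 + ε * S.βx us usx p ^ 2)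
      + 936 * M ^ 10 * majorant θ θ⁻¹ (√ε) (S.βy us usy p) (S.βx us usx p) (S.vy p) (S.uy p)
        (S.vx p) (S.v p / p.2) (S.u p) (S.v p) (d * p.2 * S.uy p) (d * p.2 * S.vy p) (bL p.2)
        (deriv bL p.2) := by
  have hpb := Om_subset_OmBar L hp
  have hy : 0 < p.2 := hp.2
  have ht2 : √ε ^ 2 = ε := Real.sq_sqrt hε.le
  have htθ : √ε ≤ θ := by
    rw [← Real.sqrt_sq hθ.le]; exact Real.sqrt_le_sqrt hεθ
  obtain ⟨w0, w1, w2, w3, w4, -, w6⟩ := G.weight_bounds hm hmM hM hpb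
  have M15 : M ≤ M ^ 5 := le_self_pow₀ hM (by norm_num)
  have M51 : 1 ≤ M ^ 5 := one_le_pow₀ hM
  have hMN : M ≤ 3 * M ^ 5 := by linarith
  have key := low_order_le (w := (us p)⁻¹) (wx := inv1 us usx p) (wy := inv1 us usy p)
    (wxx := inv2 us usx usx usxx p) (wxy := inv2 us usx usy usxy p)
    (wyy := inv2 us usy usy usyy p) (k := inv2 us usy usy usyy p * p.2) (by' := S.βy us usy p) (bx := S.βx us usx p) (a := S.vy p)
    (b := S.uy p) (c := S.vx p) (h := S.v p / p.2) (u := S.u p) (v := S.v p) (β := bL p.2)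
    (β' := deriv bL p.2) (d := d) (y := p.2) (s := θ⁻¹) (t := √ε) (vs := vs p) (usx := usx p)
    (vsx := vsx p) (vsy := vsy p)
    hθ (inv_mul_cancel₀ hθ.ne') hθ1 (Real.sqrt_nonneg ε) htθ (show 1 ≤ 3 * M ^ 5 by linarith)
    w0 w1 w2 w3 w4 w6 (by field_simp) ((G.bd_x p hpb).trans hMN)
    ((G.bd_v p hp).trans (by linarith)) ((G.bd_vx p hp).trans hMN) ((G.bd_vy p hp).trans hMN)
  rw [ht2] at key
  have hus := G.lower p hpb
  have hus0 : us p ≠ 0 := (hm.trans_le hus).ne'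
  have e1 : us p ^ 2 * S.βy us usy p = us p * S.vy p - usy p * S.v p := by
    simp only [Remainder.βy, inv1]; field_simp; ring
  have e2 : us p ^ 2 * S.βx us usx p = us p * S.vx p - usx p * S.v p := by
    simp only [Remainder.βx, inv1]; field_simp; ring
  have hm2 : m ^ 2 ≤ us p ^ 2 := pow_le_pow_left₀ hm.le hus 2
  have h3 : m ^ 2 * (S.βy us usy p ^ 2 + ε * S.βx us usx p ^ 2)
      ≤ us p ^ 2 * (S.βy us usy p ^ 2 + ε * S.βx us usx p ^ 2) :=
    mul_le_mul_of_nonneg_right hm2 (by positivity)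
  have e3 : (us p)⁻¹ * S.vy p + inv1 us usy p * S.v p = S.βy us usy p := rfl
  have e4 : (us p)⁻¹ * S.vx p + inv1 us usx p * S.v p = S.βx us usx p := rfl
  have e5 : 936 * M ^ 10 = 104 * (3 * M ^ 5) ^ 2 := by ring
  rw [e5]
  simp only [fluxLow, Remainder.B]
  generalize 104 * (3 * M ^ 5) ^ 2 * majorant θ θ⁻¹ (√ε) (S.βy us usy p) (S.βx us usx p) (S.vy p)
    (S.uy p) (S.vx p) (S.v p / p.2) (S.u p) (S.v p) (d * p.2 * S.uy p) (d * p.2 * S.vy p) (bL p.2)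
    (deriv bL p.2) = Q at *
  generalize S.βy us usy p = Y at *
  generalize S.βx us usx p = Z at *
  refine le_trans (le_of_eq ?_) (add_le_add_right (a := -(f p * Y) + ε * (g p * Z)
    + -(us p ^ 2 * (Y ^ 2 + ε * Z ^ 2))) key |>.trans ?_)
  · linear_combination (-(f p) - us p * S.vy p + usx p * S.u p + vs p * S.uy p + usy p * S.v p) * e3
      + ε * (g p - (us p * S.vx p + vsx p * S.u p + vs p * S.vy p + vsy p * S.v p)) * e4
      + Y * e1 + ε * Z * e2
  · linarith

/-- The positivity estimate, with constants which depend only on the bounds of the background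
flow. -/
theorem positivity_of_background (hm : 0 < m) (hmM : m⁻¹ ≤ M) (hM : 1 ≤ M) :
    ∃ θ κ C : ℝ, 0 < θ ∧ θ ≤ 1 ∧ 0 < κ ∧ 0 < C ∧
      ∀ {L ε d : ℝ} {us usx usy usxx usxy usyy vs vsx vsy f g : ℝ × ℝ → ℝ}
        {aL bL τ : ℝ → ℝ} {S : Remainder}, 0 < L → L ≤ θ ^ 2 → 0 < ε → ε ≤ θ ^ 2 →
        IsBackground L ε m M d us usx usy usxx usxy usyy vs vsx vsy →
        MemLp f 2 (volume.restrict (Om L)) → MemLp g 2 (volume.restrict (Om L)) →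
        MemLp aL 2 (volume.restrict (Ioi 0)) →
        ContDiffOn ℝ 1 bL (Ioi 0) → MemLp bL 2 (volume.restrict (Ioi 0)) →
        MemLp (deriv bL) 2 (volume.restrict (Ioi 0)) →
        S.IsSolution L ε us vs f g aL bL → S.Lines L ε aL bL τ →
        IntegrableOn (fun y => ε * τ y ^ 2 / us (L, y)) (Ioi 0) ∧
        κ * ((∫ p in Om L, (S.βy us usy p ^ 2 + ε * S.βx us usx p ^ 2))
            + ∫ y in Ioi 0, ε * τ y ^ 2 / us (L, y))
          ≤ C * ((∫ p in Om L, S.uy p ^ 2)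
              + d ^ 2 * (∫ p in Om L, ((S.uy p * p.2) ^ 2 + ε * (S.vy p * p.2) ^ 2))
              + ∫ y in Ioi 0, (bL y ^ 2 + deriv bL y ^ 2 + aL y ^ 2 / ε))
            + ∫ p in Om L, (-(f p * S.βy us usy p) + ε * (g p * S.βx us usx p)) := by
  have M0 : 0 < M := by linarith
  -- This is the total coefficient of $\theta(\|\beta_y\|^2+\epsilon\|\beta_x\|^2)$ on the right:
  -- the first part comes from the majorant, the second from the trace of $v$ at $x=L$. The choice
  -- of $\theta$ makes $Q\theta\le m^2/2$, so that half of the coercive term remains.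
  set Q := 936 * M ^ 10 * (25 * M ^ 6) + 12 * M ^ 12 with hQ
  have hQ0 : 0 < Q := by positivity
  refine ⟨min 1 (m ^ 2 / (2 * Q)), min 1 (m ^ 2 / 2),
    936 * M ^ 10 * (min 1 (m ^ 2 / (2 * Q)))⁻¹ + 3 * M ^ 6, by positivity, min_le_left _ _,
    by positivity, by positivity, ?_⟩
  have hθ0 : 0 < min 1 (m ^ 2 / (2 * Q)) := by positivity
  have hθ1 : min 1 (m ^ 2 / (2 * Q)) ≤ 1 := min_le_left _ _
  have hθQ : Q * min 1 (m ^ 2 / (2 * Q)) ≤ m ^ 2 / 2 := by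
    calc _ ≤ Q * (m ^ 2 / (2 * Q)) := mul_le_mul_of_nonneg_left (min_le_right _ _) hQ0.le
      _ = _ := by field_simp
  generalize min 1 (m ^ 2 / (2 * Q)) = θ at *
  intro L ε d us usx usy usxx usxy usyy vs vsx vsy f g aL bL τ S hL hLθ hε hεθ G hf hg ha hb hb1 hb2
    H hl
  have hL1 : L ≤ 1 := hLθ.trans (pow_le_one₀ hθ0.le hθ1)
  have hw := G.weight hm hmM hM
  obtain ⟨-, hβx, hβy⟩ := memLp_β hw hl
  have bu : ∀ {k : ℝ × ℝ → ℝ}, (∀ p ∈ OmBar L, |k p| ≤ M) → ∀ p ∈ Om L, |k p| ≤ M := fun h p hp =>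
    h p (Om_subset_OmBar L hp)
  have husy : ∀ p ∈ OmBar L, |usy p| ≤ M := fun p hp => (abs_le_of_weight hp.2 (G.bd_y p hp)).1
  have hvyy : MemLp (fun p => S.vy p * p.2) 2 (volume.restrict (Om L)) := by
    refine (memLp_congr_ae ?_).2 H.memX.ux_y.neg
    filter_upwards [hl.rel_x] with p hp
    simp only [Pi.neg_apply]
    linear_combination p.2 * hp
  -- This bound degenerates with $\epsilon$, but it serves only to show that the forcing is square
  -- integrable, not to estimate it.
  have hvsx : ∀ p ∈ Om L, |vsx p| ≤ (√ε)⁻¹ * M := fun p hp => by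
    have := G.bd_vx p hp
    have ht : 0 < √ε := Real.sqrt_pos.2 hε
    rw [abs_mul, abs_of_pos ht] at this
    rw [inv_mul_eq_div, le_div_iff₀ ht]
    linarith
  set F1 : ℝ × ℝ → ℝ := fun p => f p - (-(us p * S.vy p) + usx p * S.u p + vs p * S.uy p
        + usy p * S.v p) with hF1d
  set F2 : ℝ × ℝ → ℝ := fun p => g p - (us p * S.vx p + vsx p * S.u p + vs p * S.vy p
        + vsy p * S.v p) with hF2d
  have hF1 : MemLp F1 2 (volume.restrict (Om L)) :=
    hf.sub (((((memLp_mul_of_bound G.c1.cont (bu G.upper) hl.vy_L2).neg).add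
      (memLp_mul_of_bound G.c1.cont_x (bu G.bd_x) hl.u_L2)).add
      (memLp_mul_of_linear_bound G.c1v.cont G.bd_v hl.uy_L2 H.memX.uy_y)).add
      (memLp_mul_of_bound G.c1.cont_y (bu husy) hl.v_L2))
  have hF2 : MemLp F2 2 (volume.restrict (Om L)) :=
    hg.sub ((((memLp_mul_of_bound G.c1.cont (bu G.upper) hl.vx_L2).add
      (memLp_mul_of_bound G.c1v.cont_x hvsx hl.u_L2)).add
      (memLp_mul_of_linear_bound G.c1v.cont G.bd_v hl.vy_L2 hvyy)).add
      (memLp_mul_of_bound G.c1v.cont_y G.bd_vy hl.v_L2))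
  have h1 : ∀ᵐ p ∂(volume.restrict (Om L)), S.Px p = F1 p + S.uyy p + ε * S.uxx p := by
    filter_upwards [H.momentum_x, hl.rel_x, ae_restrict_mem (measurableSet_Om L)] with p e1 e2 hp
    rw [G.c1.dX_eq hp, G.c1.dY_eq hp] at e1
    simp only [hF1d]
    linear_combination e1 - us p * e2
  have h2 : ∀ᵐ p ∂(volume.restrict (Om L)), S.Py p = ε * (F2 p + S.vyy p + ε * S.vxx p) := by
    filter_upwards [H.momentum_y, ae_restrict_mem (measurableSet_Om L)] with p e1 hp
    rw [G.c1v.dX_eq hp, G.c1v.dY_eq hp] at e1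
    simp only [hF2d]
    have e2 : S.Py p = ε * (S.Py p / ε) := by field_simp
    rw [e2]
    linear_combination ε * e1
  have energy := energy_le hL hw H hl ha hb hb1 hb2 hF1 hF2 h1 h2
  have henergy_int := energy_integrable hw hl hb1 hb2 hF1 hF2
  obtain ⟨I, hI, hIle⟩ := integral_majorant_le hL hθ0 hθ1 hLθ hε G hm hmM hM hl H.memX hb1 hb2
  obtain ⟨-, -, -, -, hC, -⟩ := norm_bounds hL hL1 G hm hmM hM hl
  have jR : HasInt L (fun p => -(f p * S.βy us usy p) + ε * (g p * S.βx us usx p)) _ :=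
    ⟨((hf.integrable_mul hβy).neg).add ((hg.integrable_mul hβx).const_mul ε), rfl⟩
  have jN : HasInt L (fun p => S.βy us usy p ^ 2 + ε * S.βx us usx p ^ 2) _ :=
    ⟨hβy.integrable_sq.add (hβx.integrable_sq.const_mul ε), rfl⟩
  have J := (jR.add (jN.const_mul (-m ^ 2))).add (hI.const_mul (936 * M ^ 10))
  have upper := setIntegral_mono_on henergy_int J.1 (measurableSet_Om L) fun p hp =>
    young_integrand_le hθ0 hθ1 hε hεθ G hm hmM hM hp
  rw [J.2] at upper
  -- the boundary terms
  have hwτ := hw.bd.memLp_trace hL hl.τ_L2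
  have iτ : IntegrableOn (fun y => ε * τ y ^ 2 / us (L, y)) (Ioi 0) := by
    refine ((hwτ.integrable_mul hl.τ_L2).const_mul ε).congr (ae_of_all _ fun y => ?_)
    simp only [Pi.mul_apply, div_eq_mul_inv]
    ring
  have hV := memLp_vL hL hl
  have iD : IntegrableOn (fun y => bL y ^ 2 + deriv bL y ^ 2 + aL y ^ 2 / ε) (Ioi 0) := by
    simp only [div_eq_mul_inv]
    exact (hb1.integrable_sq.add hb2.integrable_sq).add (ha.integrable_sq.mul_const _)
  have iV := hV.integrable_sq.const_mul ε
  have lower : (∫ y in Ioi 0, ε * τ y ^ 2 / us (L, y)) - 3 * M ^ 6 *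
      ((∫ y in Ioi 0, (bL y ^ 2 + deriv bL y ^ 2 + aL y ^ 2 / ε))
        + ∫ y in Ioi 0, ε * (∫ x in Ioo 0 L, S.vx (x, y)) ^ 2)
      ≤ ∫ y in Ioi 0, outflow ε (fun p => (us p)⁻¹) (inv1 us usx) (inv1 us usy) bL S L aL τ y := by
    have iDV : IntegrableOn (fun y => 3 * M ^ 6 * ((bL y ^ 2 + deriv bL y ^ 2 + aL y ^ 2 / ε)
        + ε * (∫ x in Ioo 0 L, S.vx (x, y)) ^ 2)) (Ioi 0) := (iD.add iV).const_mul _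
    rw [← integral_add iD iV, ← integral_const_mul, ← integral_sub iτ iDV]
    refine setIntegral_mono_on (iτ.sub iDV)
      (outflow_integrable hL hw hl ha hb1) measurableSet_Ioi fun y hy => ?_
    have hp : ((L, y) : ℝ × ℝ) ∈ OmBar L := ⟨⟨hL.le, le_rfl⟩, mem_Ici.2 (mem_Ioi.1 hy).le⟩
    have hw0 := hw.nonneg _ hp
    have hwM := G.inv_abs_le hm hmM hp
    have hwx := (inv1_abs_le hwM (G.bd_x _ hp)).trans_eq (by ring : M * M ^ 2 = M ^ 3)
    have ht1 : √ε ≤ 1 := Real.sqrt_le_one.2 (hεθ.trans (pow_le_one₀ hθ0.le hθ1))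
    have := outflow_pointwise (τ := τ y) (a := aL y) (b := bL y)
      (V := ∫ x in Ioo 0 L, S.vx (x, y)) (Real.sqrt_pos.2 hε) ht1 hM hw0
      ((le_abs_self _).trans hwM) hwx (husy _ hp)
    rw [Real.sq_sqrt hε.le] at this
    refine le_trans ?_ this
    have h3 : 0 ≤ M ^ 6 * deriv bL y ^ 2 := by positivity
    rw [div_eq_mul_inv (ε * τ y ^ 2)]
    linarith
  have hvL := poincare_trace hL hl.vx_L2
  rw [integral_const_mul] at lower
  refine ⟨iτ, ?_⟩
  have hNx : ε * ∫ p in Om L, S.βx us usx p ^ 2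
      ≤ ∫ p in Om L, (S.βy us usy p ^ 2 + ε * S.βx us usx p ^ 2) := by
    rw [integral_add hβy.integrable_sq (hβx.integrable_sq.const_mul ε), integral_const_mul]
    exact le_add_of_nonneg_left (integral_nonneg fun _ => sq_nonneg _)
  have hD : (∫ y in Ioi 0, bL y ^ 2) + ∫ y in Ioi 0, deriv bL y ^ 2
      ≤ ∫ y in Ioi 0, (bL y ^ 2 + deriv bL y ^ 2 + aL y ^ 2 / ε) := by
    rw [← integral_add hb1.integrable_sq hb2.integrable_sq]
    exact integral_mono (hb1.integrable_sq.add hb2.integrable_sq) iD fun y =>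
      le_add_of_nonneg_right (by positivity)
  have t0 : 0 ≤ ∫ y in Ioi 0, ε * τ y ^ 2 / us (L, y) := by
    refine setIntegral_nonneg measurableSet_Ioi fun y hy => ?_
    have hp : ((L, y) : ℝ × ℝ) ∈ OmBar L := ⟨⟨hL.le, le_rfl⟩, mem_Ici.2 (mem_Ioi.1 hy).le⟩
    have := hm.trans_le (G.lower _ hp)
    positivity
  have ub0 : 0 ≤ ∫ p in Om L, S.uy p ^ 2 := integral_nonneg fun _ => sq_nonneg _
  have W0 : 0 ≤ ∫ p in Om L, ((S.uy p * p.2) ^ 2 + ε * (S.vy p * p.2) ^ 2) :=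
    integral_nonneg fun _ => by positivity
  have X0 : 0 ≤ ∫ p in Om L, S.βx us usx p ^ 2 := integral_nonneg fun _ => sq_nonneg _
  have C0 : 0 ≤ ∫ p in Om L, S.vx p ^ 2 := integral_nonneg fun _ => sq_nonneg _
  have chain := lower.trans (energy.trans upper)
  generalize (∫ p in Om L, (S.βy us usy p ^ 2 + ε * S.βx us usx p ^ 2)) = N at *
  generalize (∫ p in Om L, S.βx us usx p ^ 2) = X at *
  generalize (∫ p in Om L, S.vx p ^ 2) = C at *
  generalize (∫ y in Ioi 0, ε * τ y ^ 2 / us (L, y)) = T at *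
  generalize (∫ y in Ioi 0, (∫ x in Ioo 0 L, S.vx (x, y)) ^ 2) = V at *
  generalize (∫ y in Ioi 0, (bL y ^ 2 + deriv bL y ^ 2 + aL y ^ 2 / ε)) = D at *
  generalize (∫ p in Om L, S.uy p ^ 2) = U at *
  generalize (∫ p in Om L, ((S.uy p * p.2) ^ 2 + ε * (S.vy p * p.2) ^ 2)) = W at *
  generalize (∫ p in Om L, (-(f p * S.βy us usy p) + ε * (g p * S.βx us usx p))) = R at *
  have hN0 : 0 ≤ N := le_trans (by positivity) hNx
  -- The trace of $v$ at $x=L$ costs $\int v_x^2$ with a factor $L\le\theta$, so it can be absorbed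
  -- too.
  have v1 : ε * V ≤ θ * (4 * M ^ 6 * N) := by
    have a1 : ε * V ≤ ε * (L * (4 * M ^ 6 * X)) := by gcongr; exact hvL.trans (by gcongr)
    have a2 : ε * (L * (4 * M ^ 6 * X)) = L * (4 * M ^ 6 * (ε * X)) := by ring
    have a3 : L ≤ θ := hLθ.trans (pow_le_of_le_one hθ0.le hθ1 (by norm_num))
    rw [a2] at a1
    refine a1.trans ?_
    gcongr
  have v2 := mul_le_mul_of_nonneg_left v1 (show 0 ≤ 3 * M ^ 6 by positivity)
  have v3 := mul_le_mul_of_nonneg_left (hIle.trans (add_le_add_right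
    (mul_le_mul_of_nonneg_left (add_le_add_right hD _) (inv_pos.2 hθ0).le) _))
    (show 0 ≤ 936 * M ^ 10 by positivity)
  have v4 := mul_le_mul_of_nonneg_right hθQ hN0
  have e1 : Q * θ * N = 936 * M ^ 10 * (25 * M ^ 6 * θ * N) + 3 * M ^ 6 * (θ * (4 * M ^ 6 * N)) := by
    rw [hQ]; ring
  rw [e1] at v4
  have v5 : min 1 (m ^ 2 / 2) * (N + T) ≤ m ^ 2 / 2 * N + T := by
    have a1 := mul_le_mul_of_nonneg_right (min_le_right 1 (m ^ 2 / 2)) hN0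
    have a2 := mul_le_mul_of_nonneg_right (min_le_left 1 (m ^ 2 / 2)) t0
    linarith
  have v6 : 0 ≤ 3 * M ^ 6 * U := by positivity
  have v7 : 0 ≤ 3 * M ^ 6 * (d ^ 2 * W) := by positivity
  refine v5.trans ?_
  linarith only [chain, v2, v3, v4, v6, v7]

end Positivity

/-! ### Smooth functions on the closed half strip -/

section Calculus

variable {L : ℝ} {h : ℝ × ℝ → ℝ}

theorem uniqueDiffOn_OmBar (hL : 0 < L) : UniqueDiffOn ℝ (OmBar L) :=
  (uniqueDiffOn_Icc hL).prod (uniqueDiffOn_Ici 0)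

theorem OmBar_mem_nhds {p : ℝ × ℝ} (hp : p ∈ Om L) : OmBar L ∈ 𝓝 p :=
  mem_of_superset ((isOpen_Ioo.prod isOpen_Ioi).mem_nhds hp) (Om_subset_OmBar L)

theorem hasDerivWithinAt_x (H : Smooth L h) {p : ℝ × ℝ} (hp : p ∈ OmBar L) :
    HasDerivWithinAt (fun s => h (s, p.2)) (fderivWithin ℝ h (OmBar L) p (1, 0)) (Icc 0 L) p.1 := by
  have h1 := (H.differentiableOn (by simp) p hp).hasFDerivWithinAt
  have h2 : HasDerivWithinAt (fun s : ℝ => (s, p.2)) ((1, 0) : ℝ × ℝ) (Icc 0 L) p.1 :=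
    (hasDerivWithinAt_id _ _).prodMk (hasDerivWithinAt_const _ _ _)
  exact h1.comp_hasDerivWithinAt_of_eq p.1 h2 (fun s hs => ⟨hs, hp.2⟩) rfl

theorem hasDerivWithinAt_y (H : Smooth L h) {p : ℝ × ℝ} (hp : p ∈ OmBar L) :
    HasDerivWithinAt (fun t => h (p.1, t)) (fderivWithin ℝ h (OmBar L) p (0, 1)) (Ici 0) p.2 := by
  have h1 := (H.differentiableOn (by simp) p hp).hasFDerivWithinAt
  have h2 : HasDerivWithinAt (fun t : ℝ => (p.1, t)) ((0, 1) : ℝ × ℝ) (Ici 0) p.2 :=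
    (hasDerivWithinAt_const _ _ _).prodMk (hasDerivWithinAt_id _ _)
  exact h1.comp_hasDerivWithinAt_of_eq p.2 h2 (fun t ht => ⟨hp.1, ht⟩) rfl

theorem dX_eq_fderivWithin (hL : 0 < L) (H : Smooth L h) {p : ℝ × ℝ} (hp : p ∈ OmBar L) :
    dX L h p = fderivWithin ℝ h (OmBar L) p (1, 0) :=
  (hasDerivWithinAt_x H hp).derivWithin (uniqueDiffOn_Icc hL _ hp.1)

theorem dY_eq_fderivWithin (H : Smooth L h) {p : ℝ × ℝ} (hp : p ∈ OmBar L) :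
    dY h p = fderivWithin ℝ h (OmBar L) p (0, 1) :=
  (hasDerivWithinAt_y H hp).derivWithin (uniqueDiffOn_Ici 0 _ hp.2)

theorem Smooth.fderivWithin_apply (hL : 0 < L) (H : Smooth L h) (e : ℝ × ℝ) :
    Smooth L (fun p => fderivWithin ℝ h (OmBar L) p e) :=
  (ContDiffOn.fderivWithin (m := ∞) (n := ∞) H (uniqueDiffOn_OmBar hL) (by simp)).clm_apply
    contDiffOn_const

theorem Smooth.dX (hL : 0 < L) (H : Smooth L h) : Smooth L (dX L h) :=
  (H.fderivWithin_apply hL (1, 0)).congr fun _ hp => dX_eq_fderivWithin hL H hp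

theorem Smooth.dY (hL : 0 < L) (H : Smooth L h) : Smooth L (dY h) :=
  (H.fderivWithin_apply hL (0, 1)).congr fun _ hp => dY_eq_fderivWithin H hp

theorem Smooth.isC1 (hL : 0 < L) (H : Smooth L h) : IsC1 L h (BoundaryLayer.dX L h)
    (BoundaryLayer.dY h) := by
  refine ⟨H.continuousOn, (H.dX hL).continuousOn, (H.dY hL).continuousOn, fun p hp => ?_,
    fun p hp => ?_⟩
  · rw [dX_eq_fderivWithin hL H (Om_subset_OmBar L hp)]
    exact (hasDerivWithinAt_x H (Om_subset_OmBar L hp)).hasDerivAt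
      (Icc_mem_nhds hp.1.1 hp.1.2)
  · rw [dY_eq_fderivWithin H (Om_subset_OmBar L hp)]
    exact (hasDerivWithinAt_y H (Om_subset_OmBar L hp)).hasDerivAt (Ici_mem_nhds hp.2)

/-- Near an interior point the one-sided derivatives are ordinary ones, and the second derivative is
symmetric. -/
theorem dY_dX_eq (hL : 0 < L) (H : Smooth L h) {p : ℝ × ℝ} (hp : p ∈ Om L) :
    dY (dX L h) p = dX L (dY h) p := by
  have hpb := Om_subset_OmBar L hp
  have key : ∀ e : ℝ × ℝ, fderivWithin ℝ (fun q => fderivWithin ℝ h (OmBar L) q e) (OmBar L) p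
      = (fderiv ℝ (fderiv ℝ h) p).flip e := by
    intro e
    have e1 : (fun q => fderivWithin ℝ h (OmBar L) q e) =ᶠ[𝓝 p] fun q => fderiv ℝ h q e := by
      filter_upwards [(isOpen_Ioo.prod isOpen_Ioi).mem_nhds hp] with q hq
      rw [fderivWithin_of_mem_nhds (OmBar_mem_nhds hq)]
    rw [fderivWithin_of_mem_nhds (OmBar_mem_nhds hp), e1.fderiv_eq]
    have h1 : ContDiffAt ℝ 1 (fderiv ℝ h) p :=
      (H.contDiffAt (OmBar_mem_nhds hp)).fderiv_right (by norm_cast)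
    have h2 := ((h1.differentiableAt (by simp)).hasFDerivAt.clm_apply (hasFDerivAt_const e p)).fderiv
    rw [h2]
    ext <;> simp
  have sym : IsSymmSndFDerivAt ℝ h p :=
    (H.contDiffAt (OmBar_mem_nhds hp)).isSymmSndFDerivAt (by
      rw [minSmoothness_of_isRCLikeNormedField]
      exact WithTop.coe_le_coe.2 (le_top : (2 : ℕ∞) ≤ ⊤))
  have e1 : fderivWithin ℝ (dX L h) (OmBar L) p
      = fderivWithin ℝ (fun q => fderivWithin ℝ h (OmBar L) q (1, 0)) (OmBar L) p :=
    fderivWithin_congr (fun q hq => dX_eq_fderivWithin hL H hq) (dX_eq_fderivWithin hL H hpb)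
  have e2 : fderivWithin ℝ (dY h) (OmBar L) p
      = fderivWithin ℝ (fun q => fderivWithin ℝ h (OmBar L) q (0, 1)) (OmBar L) p :=
    fderivWithin_congr (fun q hq => dY_eq_fderivWithin H hq) (dY_eq_fderivWithin H hpb)
  rw [dY_eq_fderivWithin (H.dX hL) hpb, dX_eq_fderivWithin hL (H.dY hL) hpb, e1, e2, key, key]
  exact sym.eq (0, 1) (1, 0)

theorem abs_le_OmBar {W : ℝ} (hL : 0 < L) (hc : ContinuousOn h (OmBar L))
    (hb : ∀ p ∈ Om L, |h p| ≤ W) : ∀ p ∈ OmBar L, |h p| ≤ W := by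
  have hcl : closure (Om L) = OmBar L := by
    rw [Om, closure_prod_eq, closure_Ioo hL.ne, closure_Ioi, OmBar]
  intro p hp
  rw [← hcl] at hp hc
  exact closure_minimal (s := h '' Om L) (t := {r | |r| ≤ W}) (by rintro _ ⟨q, hq, rfl⟩; exact hb q hq)
    (isClosed_le continuous_abs continuous_const) (hc.image_closure ⟨p, hp, rfl⟩)

/-- A function which vanishes at the wall and whose normal derivative decays quadratically is
bounded. -/
theorem abs_le_of_dy_decay {hx hy : ℝ × ℝ → ℝ} {W : ℝ} (hL : 0 < L) (H : IsC1 L h hx hy)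
    (h0 : ∀ x ∈ Ioo 0 L, h (x, 0) = 0) (hW : ∀ p ∈ Om L, (1 + p.2) ^ 2 * |hy p| ≤ W) :
    ∀ p ∈ OmBar L, |h p| ≤ W := by
  refine abs_le_OmBar hL H.cont fun p hp => ?_
  have hpb := Om_subset_OmBar L hp
  have hW0 : 0 ≤ W := le_trans (by positivity) (hW p hp)
  have hp2 : 0 < p.2 := hp.2
  have hyb : ∀ y ∈ Icc 0 p.2, (1 + y) ^ 2 * |hy (p.1, y)| ≤ W := by
    have hc : ContinuousOn (fun q : ℝ × ℝ => (1 + q.2) ^ 2 * hy q) (OmBar L) :=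
      ContinuousOn.mul (by fun_prop) H.cont_y
    intro y hy
    have := abs_le_OmBar hL hc (W := W) (fun q hq => by
      rw [abs_mul, abs_of_nonneg (by positivity)]; exact hW q hq) (p.1, y) ⟨hpb.1, hy.1⟩
    rwa [abs_mul, abs_of_nonneg (by positivity)] at this
  have hd : ∀ y ∈ Ico 0 p.2, HasDerivWithinAt (fun t => h (p.1, t)) (hy (p.1, y)) (Ici y) y := by
    intro y hy1
    rcases hy1.1.eq_or_lt with rfl | hy0
    -- `IsC1` gives derivatives in the open domain only. At the wall the one-sided derivative is the
    -- limit of the derivatives above it.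
    · refine hasDerivWithinAt_Ici_of_tendsto_deriv (s := Ioo 0 p.2) ?_ ?_ (Ioo_mem_nhdsGT hp2) ?_
      · exact fun t ht => (H.dy (p.1, t) ⟨hp.1, ht.1⟩).differentiableAt.differentiableWithinAt
      · exact ((continuousOn_line_y (R := p.2) H.cont hpb.1) 0 ⟨le_rfl, hp2.le⟩).mono
          Ioo_subset_Icc_self
      · have h1 := ((continuousOn_line_y (R := p.2) H.cont_y hpb.1) 0 ⟨le_rfl, hp2.le⟩).mono
          (Ioo_subset_Icc_self)
        rw [ContinuousWithinAt, nhdsWithin_Ioo_eq_nhdsGT hp2] at h1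
        refine h1.congr' ?_
        filter_upwards [self_mem_nhdsWithin] with t ht
        exact (H.dy (p.1, t) ⟨hp.1, ht⟩).deriv.symm
    · exact (H.dy (p.1, y) ⟨hp.1, hy0⟩).hasDerivWithinAt
  -- The comparison function is the primitive of the bound $W(1+y)^{-2}$; it vanishes at the wall
  -- and stays below $W$.
  have hB : ∀ y ∈ Icc 0 p.2, HasDerivAt (fun t : ℝ => W * (1 - (1 + t)⁻¹)) (W * (1 + y)⁻¹ ^ 2) y := by
    intro y hy
    have h1 : (1 + y) ≠ 0 := by linarith [hy.1]
    refine ((((hasDerivAt_id y).const_add 1).inv h1).const_sub 1 |>.const_mul W).congr_deriv ?_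
    rw [id, neg_div, neg_neg, inv_pow, one_div]
  have := image_norm_le_of_norm_deriv_right_le_deriv_boundary' (continuousOn_line_y H.cont hpb.1)
    hd (B := fun t => W * (1 - (1 + t)⁻¹)) (B' := fun y => W * (1 + y)⁻¹ ^ 2)
    (by simp [h0 p.1 hp.1]) (fun y hy => (hB y hy).continuousAt.continuousWithinAt)
    (fun y hy => (hB y (Ico_subset_Icc_self hy)).hasDerivWithinAt) (fun y hy => by
      have h1 := hyb y (Ico_subset_Icc_self hy)
      have h2 : 0 < 1 + y := by linarith [hy.1]
      rw [Real.norm_eq_abs, inv_pow, ← div_eq_mul_inv, le_div_iff₀ (by positivity)]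
      linarith) ⟨hp2.le, le_rfl⟩
  refine this.trans ?_
  have h2 : 0 < (1 + p.2)⁻¹ := by positivity
  have h3 : 0 ≤ W * (1 + p.2)⁻¹ := by positivity
  linarith

/-- The primitive of `h` in the normal direction. -/
theorem isC1_primitive {k kx ky hx hy : ℝ × ℝ → ℝ} (hL : 0 < L) (H : IsC1 L h hx hy)
    (K : IsC1 L k kx ky) (h0 : ∀ x ∈ Ioo 0 L, k (x, 0) = 0) {W : ℝ} (hb : ∀ p ∈ Om L, |hx p| ≤ W)
    (hk : ∀ p ∈ Om L, hx p + ky p = 0) :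
    IsC1 L (fun p => ∫ s in (0 : ℝ)..p.2, h (p.1, s)) (fun p => -k p) h := by
  -- Clamping the arguments extends $h$ to a continuous function on the plane, to which the facts on
  -- parametric primitives apply.
  set e : ℝ → ℝ → ℝ := fun x s => h ((projIcc 0 L hL.le x : ℝ), max s 0) with he
  have hec : Continuous (Function.uncurry e) := by
    have : ContinuousOn h (OmBar L) := H.cont
    exact this.comp_continuous (by fun_prop) fun p => ⟨(projIcc 0 L hL.le p.1).2, mem_Ici.2 (le_max_right p.2 0)⟩
  have hev : ∀ x ∈ Icc 0 L, ∀ s, 0 ≤ s → e x s = h (x, s) := fun x hx s hs => by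
    simp only [he, projIcc_of_mem hL.le hx, max_eq_left hs]
  have hint : ∀ p ∈ OmBar L, ∫ s in (0 : ℝ)..p.2, h (p.1, s) = ∫ s in (0 : ℝ)..p.2, e p.1 s := by
    intro p hp
    refine intervalIntegral.integral_congr fun s hs => ?_
    rw [uIcc_of_le hp.2] at hs
    exact (hev p.1 hp.1 s hs.1).symm
  refine ⟨?_, K.cont.neg, H.cont, fun p hp => ?_, fun p hp => ?_⟩
  · refine ContinuousOn.congr (f := fun p : ℝ × ℝ => ∫ s in (0 : ℝ)..p.2, e p.1 s) ?_ hint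
    exact (intervalIntegral.continuous_parametric_primitive_of_continuous (a₀ := 0)
      hec).continuousOn
  · have hp2 : 0 < p.2 := hp.2
    have hcx : ∀ x ∈ Ioo 0 L, ∀ k : ℝ × ℝ → ℝ, ContinuousOn k (OmBar L) →
        IntervalIntegrable (fun s => k (x, s)) volume 0 p.2 := fun x hx k hk => by
      refine ContinuousOn.intervalIntegrable ?_
      rw [uIcc_of_le hp2.le]
      exact continuousOn_line_y hk (Ioo_subset_Icc_self hx)
    have h1 := (intervalIntegral.hasDerivAt_integral_of_dominated_loc_of_deriv_le (𝕜 := ℝ)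
      (μ := volume) (a := 0) (b := p.2) (F := fun x s => h (x, s)) (F' := fun x s => hx (x, s))
      (x₀ := p.1) (s := Ioo 0 L) (bound := fun _ => W) (Ioo_mem_nhds hp.1.1 hp.1.2) ?_
      (hcx _ hp.1 h H.cont) (hcx _ hp.1 hx H.cont_x).def'.aestronglyMeasurable ?_ (by simp) ?_).2
    · refine h1.congr_deriv ?_
      have h2 := (K.line_y hp2 hp.1)
      -- By the divergence condition $\partial_x\int_0^yh=\int_0^yh_x=-\int_0^yk_y=-k$, as $k$
      -- vanishes at the wall.
      have h3 : ∫ s in (0 : ℝ)..p.2, ky (p.1, s) = k (p.1, p.2) - k (p.1, 0) :=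
        intervalIntegral.integral_eq_sub_of_hasDerivAt_of_le hp2.le
          (continuousOn_line_y K.cont (Ioo_subset_Icc_self hp.1))
          (fun s hs => K.dy (p.1, s) ⟨hp.1, hs.1⟩) (hcx _ hp.1 ky K.cont_y)
      rw [h0 p.1 hp.1, sub_zero] at h3
      rw [← h3, ← intervalIntegral.integral_neg]
      refine intervalIntegral.integral_congr_ae (ae_of_all _ fun s hs => ?_)
      rw [uIoc_of_le hp2.le] at hs
      linarith [hk (p.1, s) ⟨hp.1, hs.1⟩]
    · filter_upwards [Ioo_mem_nhds hp.1.1 hp.1.2] with x hx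
      exact (hcx _ hx h H.cont).def'.aestronglyMeasurable
    · refine ae_of_all _ fun s hs x hx => ?_
      rw [uIoc_of_le hp2.le] at hs
      exact hb (x, s) ⟨hx, hs.1⟩
    · refine ae_of_all _ fun s hs x hx => ?_
      rw [uIoc_of_le hp2.le] at hs
      exact H.dx (x, s) ⟨hx, hs.1⟩
  · have hp2 : 0 < p.2 := hp.2
    have hx := Ioo_subset_Icc_self hp.1
    have h1 : HasDerivAt (fun t => ∫ s in (0 : ℝ)..t, e p.1 s) (e p.1 p.2) p.2 :=
      intervalIntegral.integral_hasDerivAt_right ((show Continuous (e p.1) from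
        hec.comp (by fun_prop : Continuous fun s => (p.1, s))).intervalIntegrable _ _)
        (Continuous.stronglyMeasurableAtFilter (hec.comp (by fun_prop : Continuous fun s => (p.1, s)))
          _ _) (hec.comp (by fun_prop : Continuous fun s => (p.1, s))).continuousAt
    rw [hev p.1 hx p.2 hp2.le] at h1
    refine h1.congr_of_eventuallyEq ?_
    filter_upwards [Ioi_mem_nhds hp2] with t ht
    exact hint (p.1, t) ⟨hx, (mem_Ioi.1 ht).le⟩

end Calculus

/-! ### Functions with bounded derivatives -/

/-- `h` is `C¹` on `[0, L] × [0, ∞)`, and bounded by `W` together with its derivatives. -/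
def BddC1 (L W : ℝ) (h : ℝ × ℝ → ℝ) : Prop :=
  ∃ hx hy, IsC1 L h hx hy ∧ ∀ p ∈ OmBar L, |h p| ≤ W ∧ |hx p| ≤ W ∧ |hy p| ≤ W

/-- `h` is `C²` on `[0, L] × [0, ∞)`, and bounded by `W` together with its derivatives, where the
normal derivatives carry the weight `1 + y`. -/
def BddC2 (L W : ℝ) (h : ℝ × ℝ → ℝ) : Prop :=
  ∃ hx hy hxx hxy hyy, IsC1 L h hx hy ∧ IsC1 L hx hxx hxy ∧ IsC1 L hy hxy hyy ∧
    ∀ p ∈ OmBar L, |h p| ≤ W ∧ |hx p| ≤ W ∧ (1 + p.2) * |hy p| ≤ W ∧ |hxx p| ≤ W ∧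
      |hxy p| ≤ W ∧ (1 + p.2) * |hyy p| ≤ W

section Bounded

variable {L W V t : ℝ} {h k : ℝ × ℝ → ℝ}

theorem abs_mul_add_mul_le {a b c d W V : ℝ} (ha : |a| ≤ W) (hb : |b| ≤ V) (hc : |c| ≤ W)
    (hd : |d| ≤ V) : |a * b + c * d| ≤ 2 * (W * V) := by
  have h1 := (abs_nonneg a).trans ha
  refine (abs_add_le _ _).trans ?_
  rw [abs_mul, abs_mul, two_mul]
  exact add_le_add (mul_le_mul ha hb (abs_nonneg _) h1) (mul_le_mul hc hd (abs_nonneg _) h1)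

theorem BddC2.add (H : BddC2 L W h) (K : BddC2 L V k) : BddC2 L (W + V) (fun p => h p + k p) := by
  obtain ⟨hx, hy, hxx, hxy, hyy, c, cx, cy, hb⟩ := H
  obtain ⟨kx, ky, kxx, kxy, kyy, d, dx, dy, kb⟩ := K
  refine ⟨_, _, _, _, _, c.add d, cx.add dx, cy.add dy, fun p hp => ?_⟩
  obtain ⟨h1, h2, h3, h4, h5, h6⟩ := hb p hp
  obtain ⟨k1, k2, k3, k4, k5, k6⟩ := kb p hp
  have hr : 0 ≤ 1 + p.2 := by linarith [mem_Ici.1 hp.2]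
  refine ⟨(abs_add_le _ _).trans (add_le_add h1 k1), (abs_add_le _ _).trans (add_le_add h2 k2), ?_,
    (abs_add_le _ _).trans (add_le_add h4 k4), (abs_add_le _ _).trans (add_le_add h5 k5), ?_⟩
  · refine (mul_le_mul_of_nonneg_left (abs_add_le _ _) hr).trans ?_
    rw [mul_add]; exact add_le_add h3 k3
  · refine (mul_le_mul_of_nonneg_left (abs_add_le _ _) hr).trans ?_
    rw [mul_add]; exact add_le_add h6 k6

theorem BddC2.const_mul (H : BddC2 L W h) {c : ℝ} (hc0 : 0 ≤ c) (hc : c ≤ 1) :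
    BddC2 L W (fun p => c * h p) := by
  obtain ⟨hx, hy, hxx, hxy, hyy, d, dx, dy, hb⟩ := H
  refine ⟨_, _, _, _, _, d.const_mul c, dx.const_mul c, dy.const_mul c, fun p hp => ?_⟩
  obtain ⟨h1, h2, h3, h4, h5, h6⟩ := hb p hp
  have hr : 0 ≤ 1 + p.2 := by linarith [mem_Ici.1 hp.2]
  have key : ∀ a : ℝ, |c * a| ≤ |a| := fun a => by
    rw [abs_mul, abs_of_nonneg hc0]; exact mul_le_of_le_one_left (abs_nonneg a) hc
  exact ⟨(key _).trans h1, (key _).trans h2, (mul_le_mul_of_nonneg_left (key _) hr).trans h3,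
    (key _).trans h4, (key _).trans h5, (mul_le_mul_of_nonneg_left (key _) hr).trans h6⟩

theorem BddC2.mul (H : BddC2 L W h) (K : BddC2 L V k) :
    BddC2 L (4 * (W * V)) (fun p => h p * k p) := by
  obtain ⟨hx, hy, hxx, hxy, hyy, c, cx, cy, hb⟩ := H
  obtain ⟨kx, ky, kxx, kxy, kyy, d, dx, dy, kb⟩ := K
  refine ⟨_, _, fun p => hxx p * k p + hx p * kx p + (hx p * kx p + h p * kxx p),
    fun p => hxy p * k p + hy p * kx p + (hx p * ky p + h p * kxy p), _, c.mul d, ?_,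
    (cy.mul d).add (c.mul dy), fun p hp => ?_⟩
  · exact ((cx.mul d).add (c.mul dx)).congr (fun p => rfl) (fun p => rfl) (fun p => by ring)
  obtain ⟨h1, h2, h3, h4, h5, h6⟩ := hb p hp
  obtain ⟨k1, k2, k3, k4, k5, k6⟩ := kb p hp
  have hp2 := mem_Ici.1 hp.2
  have hr : 0 ≤ 1 + p.2 := by linarith
  have h3' := (abs_le_of_weight hp2 h3).1
  have k3' := (abs_le_of_weight hp2 k3).1
  have WV : 0 ≤ W * V := mul_nonneg ((abs_nonneg _).trans h1) ((abs_nonneg _).trans k1)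
  have e : ∀ a : ℝ, (1 + p.2) * |a| = |(1 + p.2) * a| := fun a => by
    rw [abs_mul, abs_of_nonneg hr]
  rw [e] at h3 h6 k3 k6
  simp only [e]
  have four : ∀ a b : ℝ, |a| ≤ 2 * (W * V) → |b| ≤ 2 * (W * V) → |a + b| ≤ 4 * (W * V) :=
    fun a b ha hb => (abs_add_le _ _).trans (by linarith)
  refine ⟨?_, ?_, ?_, four _ _ (abs_mul_add_mul_le h4 k1 h2 k2) (abs_mul_add_mul_le h2 k2 h1 k4),
    four _ _ (abs_mul_add_mul_le h5 k1 h3' k2) (abs_mul_add_mul_le h2 k3' h1 k5), ?_⟩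
  · rw [abs_mul]
    have := mul_le_mul h1 k1 (abs_nonneg _) ((abs_nonneg _).trans h1)
    linarith
  · exact (abs_mul_add_mul_le h2 k1 h1 k2).trans (by linarith)
  · have := abs_mul_add_mul_le h3 k1 h1 k3
    rw [show (1 + p.2) * (hy p * k p + h p * ky p)
      = (1 + p.2) * hy p * k p + h p * ((1 + p.2) * ky p) by ring]
    linarith
  · have := four _ _ (abs_mul_add_mul_le h6 k1 h3' k3) (abs_mul_add_mul_le h3' k3 h1 k6)
    refine le_trans (le_of_eq ?_) this
    congr 1
    ring

theorem BddC2.bddC1 (H : BddC2 L W h) : BddC1 L W h := by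
  obtain ⟨hx, hy, _, _, _, c, _, _, hb⟩ := H
  exact ⟨hx, hy, c, fun p hp => ⟨(hb p hp).1, (hb p hp).2.1,
    (abs_le_of_weight hp.2 (hb p hp).2.2.1).1⟩⟩

theorem BddC1.add (H : BddC1 L W h) (K : BddC1 L V k) : BddC1 L (W + V) (fun p => h p + k p) := by
  obtain ⟨hx, hy, c, hb⟩ := H
  obtain ⟨kx, ky, d, kb⟩ := K
  exact ⟨_, _, c.add d, fun p hp => ⟨(abs_add_le _ _).trans (add_le_add (hb p hp).1 (kb p hp).1),
    (abs_add_le _ _).trans (add_le_add (hb p hp).2.1 (kb p hp).2.1),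
    (abs_add_le _ _).trans (add_le_add (hb p hp).2.2 (kb p hp).2.2)⟩⟩

theorem BddC1.const_mul (H : BddC1 L W h) {c : ℝ} (hc0 : 0 ≤ c) (hc : c ≤ 1) :
    BddC1 L W (fun p => c * h p) := by
  obtain ⟨hx, hy, d, hb⟩ := H
  have key : ∀ a : ℝ, |c * a| ≤ |a| := fun a => by
    rw [abs_mul, abs_of_nonneg hc0]; exact mul_le_of_le_one_left (abs_nonneg a) hc
  exact ⟨_, _, d.const_mul c, fun p hp => ⟨(key _).trans (hb p hp).1, (key _).trans (hb p hp).2.1,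
    (key _).trans (hb p hp).2.2⟩⟩

theorem BddC1.mul (H : BddC1 L W h) (K : BddC1 L V k) :
    BddC1 L (2 * (W * V)) (fun p => h p * k p) := by
  obtain ⟨hx, hy, c, hb⟩ := H
  obtain ⟨kx, ky, d, kb⟩ := K
  refine ⟨_, _, c.mul d, fun p hp => ?_⟩
  obtain ⟨h1, h2, h3⟩ := hb p hp
  obtain ⟨k1, k2, k3⟩ := kb p hp
  have WV : 0 ≤ W * V := mul_nonneg ((abs_nonneg _).trans h1) ((abs_nonneg _).trans k1)
  refine ⟨?_, abs_mul_add_mul_le h2 k1 h1 k2, abs_mul_add_mul_le h3 k1 h1 k3⟩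
  rw [abs_mul]
  have := mul_le_mul h1 k1 (abs_nonneg _) ((abs_nonneg _).trans h1)
  linarith

theorem mapsTo_scale (ht : 0 ≤ t) :
    MapsTo (fun p : ℝ × ℝ => (p.1, t * p.2)) (OmBar L) (OmBar L) := fun _ hp =>
  ⟨hp.1, mul_nonneg ht hp.2⟩

theorem IsC1.scale {hx hy : ℝ × ℝ → ℝ} (H : IsC1 L h hx hy) (ht : 0 < t) :
    IsC1 L (fun p => h (p.1, t * p.2)) (fun p => hx (p.1, t * p.2))
      (fun p => t * hy (p.1, t * p.2)) := by
  have hc : ∀ k : ℝ × ℝ → ℝ, ContinuousOn k (OmBar L) →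
      ContinuousOn (fun p : ℝ × ℝ => k (p.1, t * p.2)) (OmBar L) := fun k hk =>
    hk.comp (by fun_prop) (mapsTo_scale ht.le)
  refine ⟨hc h H.cont, hc hx H.cont_x, continuousOn_const.mul (hc hy H.cont_y), fun p hp => ?_,
    fun p hp => ?_⟩
  · exact H.dx (p.1, t * p.2) ⟨hp.1, mul_pos ht hp.2⟩
  · have h1 := H.dy (p.1, t * p.2) ⟨hp.1, mul_pos ht hp.2⟩
    have h2 : HasDerivAt (fun s : ℝ => t * s) t p.2 := by
      simpa using (hasDerivAt_id p.2).const_mul t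
    exact (HasDerivAt.comp p.2 h1 h2).congr_deriv (mul_comm _ _)

/-- Every normal derivative of a function of $(x,ty)$ carries a factor $t$, and $(1+y)t\le1+ty$ for
$t\le1$. The weighted bounds of the Euler layers therefore hold in the variable $y$ uniformly in
$\epsilon$. -/
theorem BddC2.scale (H : BddC2 L W h) (ht : 0 < t) (ht1 : t ≤ 1) :
    BddC2 L W (fun p => h (p.1, t * p.2)) := by
  obtain ⟨hx, hy, hxx, hxy, hyy, c, cx, cy, hb⟩ := H
  refine ⟨_, _, _, fun p => t * hxy (p.1, t * p.2), _, c.scale ht, cx.scale ht,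
    (cy.scale ht).const_mul t, fun p hp => ?_⟩
  obtain ⟨h1, h2, h3, h4, h5, h6⟩ := hb _ (mapsTo_scale ht.le hp)
  have hp2 : 0 ≤ p.2 := hp.2
  have key : ∀ a : ℝ, (1 + p.2) * |t * a| ≤ (1 + t * p.2) * |a| := fun a => by
    rw [abs_mul, abs_of_pos ht, ← mul_assoc]
    exact mul_le_mul_of_nonneg_right (by nlinarith) (abs_nonneg a)
  have key' : ∀ a : ℝ, |t * a| ≤ |a| := fun a => by
    rw [abs_mul, abs_of_pos ht]; exact mul_le_of_le_one_left (abs_nonneg a) ht1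
  refine ⟨h1, h2, (key _).trans h3, h4, (key' _).trans h5, (key _).trans ?_⟩
  exact (mul_le_mul_of_nonneg_left (key' _) (by positivity)).trans h6

/-- A function of `t y` whose derivatives vanish for large arguments. -/
theorem BddC2.comp_snd {φ φ' φ'' : ℝ → ℝ} {X : ℝ} (h1 : ∀ s, HasDerivAt φ (φ' s) s)
    (h2 : ∀ s, HasDerivAt φ' (φ'' s) s) (hc : Continuous φ'')
    (hX : ∀ s, 0 ≤ s → |φ s| ≤ X ∧ |φ' s| ≤ X ∧ |φ'' s| ≤ X)
    (h0 : ∀ s, 2 < s → φ' s = 0 ∧ φ'' s = 0) (ht : 0 < t) (ht1 : t ≤ 1) :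
    BddC2 L (3 * X) (fun p => φ (t * p.2)) := by
  have c1 : Continuous φ := continuous_iff_continuousAt.2 fun s => (h1 s).continuousAt
  have c2 : Continuous φ' := continuous_iff_continuousAt.2 fun s => (h2 s).continuousAt
  have cc : ∀ κ : ℝ → ℝ, Continuous κ → ContinuousOn (fun p : ℝ × ℝ => κ p.2) (OmBar L) :=
    fun κ hκ => (hκ.comp continuous_snd).continuousOn
  have C : ∀ κ κ' : ℝ → ℝ, Continuous κ → Continuous κ' → (∀ s, HasDerivAt κ (κ' s) s) →
      IsC1 L (fun p => κ (t * p.2)) (fun _ => 0) (fun p => t * κ' (t * p.2)) := fun κ κ' hκ hκ' hd =>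
    IsC1.scale (h := fun p => κ p.2) (hx := fun _ => 0) (hy := fun p => κ' p.2)
      ⟨cc κ hκ, continuousOn_const, cc κ' hκ', fun p _ => hasDerivAt_const p.1 (κ p.2),
        fun p _ => hd p.2⟩ ht
  have X0 : 0 ≤ X := (abs_nonneg _).trans (hX 0 le_rfl).1
  have C0 : IsC1 L (fun _ => 0) (fun _ => 0) (fun _ => 0) :=
    ⟨continuousOn_const, continuousOn_const, continuousOn_const, fun _ _ => hasDerivAt_const _ _,
      fun _ _ => hasDerivAt_const _ _⟩
  have Cy := (C φ' φ'' c2 hc h2).const_mul t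
  simp only [mul_zero] at Cy
  refine ⟨_, _, fun _ => 0, fun _ => 0, _, C φ φ' c1 c2 h1, C0, Cy, fun p hp => ?_⟩
  have hp2 : 0 ≤ p.2 := hp.2
  obtain ⟨b1, b2, b3⟩ := hX (t * p.2) (by positivity)
  -- Where the derivatives do not vanish, $ty\le2$ and hence $(1+y)t\le3$.
  have key : ∀ a : ℝ, |a| ≤ X → (2 < t * p.2 → a = 0) → (1 + p.2) * |t * a| ≤ 3 * X := by
    intro a ha ha0
    rcases le_or_gt (t * p.2) 2 with h | h
    · rw [abs_mul, abs_of_pos ht, ← mul_assoc]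
      exact mul_le_mul (by linarith) ha (abs_nonneg _) (by norm_num)
    · rw [ha0 h]; simpa using X0
  simp only [abs_zero]
  have X3 : 0 ≤ 3 * X := by positivity
  refine ⟨by linarith, X3, key _ b2 fun h => (h0 _ h).1, X3, X3, key _ ?_ fun h => ?_⟩
  · rw [abs_mul, abs_of_pos ht]
    exact (mul_le_of_le_one_left (abs_nonneg _) ht1).trans b3
  · rw [(h0 _ h).2, mul_zero]

theorem IsCutoff.exists_bound {χ : ℝ → ℝ} (H : IsCutoff χ) :
    ∃ X : ℝ, 0 < X ∧ (∀ j ≤ 3, ∀ s, 0 ≤ s → |iteratedDeriv j χ s| ≤ X) ∧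
      ∀ j s, 2 < s → iteratedDeriv j χ s = 0 := by
  have h0 : ∀ j s, 2 < s → iteratedDeriv j χ s = 0 := fun j s hs => by
    have : χ =ᶠ[𝓝 s] fun _ => 0 := by
      filter_upwards [Ioi_mem_nhds hs] with r hr using H.2.2 r (mem_Ioi.1 hr).le
    rw [this.iteratedDeriv_eq]
    simp
  have hb : ∀ j, ∃ X, ∀ s ∈ Icc (0 : ℝ) 2, ‖iteratedDeriv j χ s‖ ≤ X := fun j =>
    isCompact_Icc.exists_bound_of_continuousOn
      (H.1.continuous_iteratedDeriv j (by exact_mod_cast le_top)).continuousOn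
  choose X hX using hb
  have X0 : ∀ j, 0 ≤ X j := fun j => (norm_nonneg _).trans (hX j 0 (by simp))
  refine ⟨X 0 + X 1 + X 2 + X 3 + 1, by linarith [X0 0, X0 1, X0 2, X0 3], fun j hj s hs => ?_, h0⟩
  have hle : X j ≤ X 0 + X 1 + X 2 + X 3 + 1 := by
    interval_cases j <;> linarith [X0 0, X0 1, X0 2, X0 3]
  rcases le_or_gt s 2 with h | h
  · exact (hX j s ⟨hs, h⟩).trans hle
  · rw [h0 j s h, abs_zero]; exact (X0 j).trans hle

theorem IsCutoff.bddC2 {χ : ℝ → ℝ} (H : IsCutoff χ) {X : ℝ}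
    (hX : ∀ j ≤ 3, ∀ s, 0 ≤ s → |iteratedDeriv j χ s| ≤ X)
    (h0 : ∀ j s, 2 < s → iteratedDeriv j χ s = 0) {j : ℕ} (hj : j ≤ 1) (ht : 0 < t) (ht1 : t ≤ 1) :
    BddC2 L (3 * X) (fun p => iteratedDeriv j χ (t * p.2)) := by
  have hd : ∀ i s, HasDerivAt (iteratedDeriv i χ) (iteratedDeriv (i + 1) χ s) s := fun i s => by
    rw [iteratedDeriv_succ]
    exact (H.1.differentiable_iteratedDeriv i (by exact_mod_cast ENat.natCast_lt_top i) s).hasDerivAt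
  exact BddC2.comp_snd (hd j) (hd (j + 1))
    (H.1.continuous_iteratedDeriv _ (by exact_mod_cast le_top))
    (fun s hs => ⟨hX j (by omega) s hs, hX (j + 1) (by omega) s hs, hX (j + 2) (by omega) s hs⟩)
    (fun s hs => ⟨h0 _ s hs, h0 _ s hs⟩) ht ht1

/-- The bound of $h$ itself is separate from the weighted ones because $u_e^0$ does not decay. -/
theorem Smooth.bddC2 (hL : 0 < L) (H : Smooth L h) (hb : ∀ p ∈ OmBar L, |h p| ≤ W)
    (hW : WeightedBound L W 1 h) : BddC2 L W h := by
  refine ⟨_, _, BoundaryLayer.dX L (BoundaryLayer.dX L h), _, _, H.isC1 hL, ?_, (H.dY hL).isC1 hL, fun p hp => ?_⟩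
  · have := (H.dX hL).isC1 hL
    refine ⟨this.cont, this.cont_x, ((H.dY hL).dX hL).continuousOn, this.dx, fun p hp => ?_⟩
    rw [← dY_dX_eq hL H hp]
    exact this.dy p hp
  · have w0 : ∀ i j, 1 ≤ i + j → i + j ≤ 3 → |((BoundaryLayer.dX L)^[i] (BoundaryLayer.dY^[j] h)) p| ≤ W :=
      fun i j h1 h2 => by simpa using hW i j 0 h1 h2 (by norm_num) p hp
    have w1 : ∀ i j, 1 ≤ i + j → i + j ≤ 3 →
        (1 + p.2) * |((BoundaryLayer.dX L)^[i] (BoundaryLayer.dY^[j] h)) p| ≤ W :=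
      fun i j h1 h2 => by simpa using hW i j 1 h1 h2 (by norm_num) p hp
    exact ⟨hb p hp, w0 1 0 (by norm_num) (by norm_num), w1 0 1 (by norm_num) (by norm_num),
      w0 2 0 (by norm_num) (by norm_num), w0 1 1 (by norm_num) (by norm_num),
      w1 0 2 (by norm_num) (by norm_num)⟩

theorem WeightedBound.mono_order (H : WeightedBound L W 0 h) : WeightedBound L W 1 h :=
  fun i j k _ h2 h3 => H i j k (Nat.zero_le _) h2 h3

theorem WeightedBound.abs_le (H : WeightedBound L W 0 h) : ∀ p ∈ OmBar L, |h p| ≤ W :=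
  fun p hp => by simpa using H 0 0 0 le_rfl (by norm_num) (by norm_num) p hp

theorem Smooth.bddC2_of_weight (hL : 0 < L) (H : Smooth L h) (hW : WeightedBound L W 0 h) :
    BddC2 L W h := H.bddC2 hL hW.abs_le hW.mono_order

end Bounded

/-! ### The first Prandtl corrector -/

section Corrector

variable {L W : ℝ} {u v : ℝ × ℝ → ℝ}

/-- The normal component of a divergence free field with decaying tangential component. -/
theorem isC1_of_divFree (hL : 0 < L) (hu : Smooth L u) (hv : Smooth L v)
    (hdiv : ∀ p ∈ Om L, dX L u p + dY v p = 0) :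
    IsC1 L v (dX L v) (fun p => -dX L u p) ∧
      IsC1 L (dX L v) (dX L (dX L v)) (fun p => -dX L (dX L u) p) := by
  have h1 := hv.isC1 hL
  have hv1 := (hv.dX hL).isC1 hL
  refine ⟨⟨h1.cont, h1.cont_x, (hu.dX hL).continuousOn.neg, h1.dx, fun p hp => ?_⟩,
    ⟨hv1.cont, hv1.cont_x, ((hu.dX hL).dX hL).continuousOn.neg, hv1.dx, fun p hp => ?_⟩⟩
  · exact (h1.dy p hp).congr_deriv (by linarith [hdiv p hp])
  · refine (hv1.dy p hp).congr_deriv ?_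
    rw [dY_dX_eq hL hv hp]
    have e : (fun s => dY v (s, p.2)) =ᶠ[𝓝 p.1] fun s => -dX L u (s, p.2) := by
      filter_upwards [Ioo_mem_nhds hp.1.1 hp.1.2] with s hs
      linarith [hdiv (s, p.2) ⟨hs, hp.2⟩]
    have h3 := ((hv.dY hL).isC1 hL).dx p hp
    have h4 := (((hu.dX hL).isC1 hL).dx p hp).neg.congr_of_eventuallyEq e
    exact h3.unique h4

/-- The normal component carries no bound of its own. It vanishes at the wall and $v_y=-u_x$ decays
quadratically, so it is bounded by the integral of that decay. The same argument applies to $v_x$,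
whose normal derivative is $-u_{xx}$. -/
theorem bddC1_of_divFree (hL : 0 < L) (hu : Smooth L u) (hv : Smooth L v)
    (hdiv : ∀ p ∈ Om L, dX L u p + dY v p = 0) (h0 : ∀ x ∈ Icc 0 L, v (x, 0) = 0)
    (hW : WeightedBound L W 0 u) :
    IsC1 L v (dX L v) (fun p => -dX L u p) ∧
      ∀ p ∈ OmBar L, |v p| ≤ W ∧ |dX L v p| ≤ W ∧ |-dX L u p| ≤ W := by
  obtain ⟨c1, c2⟩ := isC1_of_divFree hL hu hv hdiv
  refine ⟨c1, fun p hp => ⟨?_, ?_, ?_⟩⟩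
  · refine abs_le_of_dy_decay hL c1 (fun x hx => h0 x (Ioo_subset_Icc_self hx)) (fun q hq => ?_) p hp
    rw [abs_neg]
    exact hW 1 0 2 (by norm_num) (by norm_num) (by norm_num) q (Om_subset_OmBar L hq)
  · refine abs_le_of_dy_decay hL c2 (fun x hx => ?_) (fun q hq => ?_) p hp
    · rw [dX, derivWithin_congr (f := fun _ => 0) (fun s hs => h0 s hs)
        (h0 x (Ioo_subset_Icc_self hx)), derivWithin_fun_const]
      rfl
    · rw [abs_neg]
      exact hW 2 0 2 (by norm_num) (by norm_num) (by norm_num) q (Om_subset_OmBar L hq)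
  · rw [abs_neg]
    simpa using hW 1 0 0 (by norm_num) (by norm_num) (by norm_num) p hp

/-- The primitive has derivatives $-v$ and $u$. One order of regularity of $v$, together with
$v_y=-u_x$, thus gives two orders for the primitive. It occurs in the term that keeps the cut-off
corrector divergence free. -/
theorem bddC2_primitive (hL : 0 < L) (hu : Smooth L u) (hv : Smooth L v)
    (hdiv : ∀ p ∈ Om L, dX L u p + dY v p = 0) (h0 : ∀ x ∈ Icc 0 L, v (x, 0) = 0)
    (hW : WeightedBound L W 0 u) : BddC2 L W (fun p => ∫ s in (0 : ℝ)..p.2, u (p.1, s)) := by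
  obtain ⟨c, hb⟩ := bddC1_of_divFree hL hu hv hdiv h0 hW
  have hu1 := hu.isC1 hL
  have C := isC1_primitive hL hu1 (hv.isC1 hL) (fun x hx => h0 x (Ioo_subset_Icc_self hx)) (W := W)
    (fun p hp => by simpa using (hb p (Om_subset_OmBar L hp)).2.2) hdiv
  have c' := c.const_mul (-1)
  refine ⟨_, _, fun p => -dX L v p, dX L u, dY u, C, c'.congr (fun p => by ring) (fun p => by ring)
    (fun p => by ring), hu1, fun p hp => ?_⟩
  obtain ⟨b1, b2, b3⟩ := hb p hp
  simp only [abs_neg] at b1 b2 b3 ⊢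
  refine ⟨?_, b1, ?_, b2, b3, ?_⟩
  · refine abs_le_of_dy_decay hL C (fun x _ => by simp) (fun q hq => ?_) p hp
    exact hW 0 0 2 (by norm_num) (by norm_num) (by norm_num) q (Om_subset_OmBar L hq)
  · simpa using hW 0 0 1 (by norm_num) (by norm_num) (by norm_num) p hp
  · simpa using hW 0 1 1 (by norm_num) (by norm_num) (by norm_num) p hp

end Corrector

/-! ### The approximate solution as a background flow -/

section Background

variable {L W : ℝ} {h : ℝ × ℝ → ℝ}

theorem abs_sub_wall_le (H : Smooth L h) (hb : ∀ p ∈ OmBar L, |dY h p| ≤ W)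
    {x y : ℝ} (hx : x ∈ Icc 0 L) (hy : 0 ≤ y) : |h (x, y) - h (x, 0)| ≤ W * y := by
  have h1 : ∀ t ∈ Ici (0 : ℝ), HasDerivWithinAt (fun t => h (x, t)) (dY h (x, t)) (Ici 0) t :=
    fun t ht => by
      rw [dY_eq_fderivWithin H ⟨hx, ht⟩]
      exact hasDerivWithinAt_y H (p := (x, t)) ⟨hx, ht⟩
  have := Convex.norm_image_sub_le_of_norm_hasDerivWithin_le h1 (C := W)
    (fun t ht => hb (x, t) ⟨hx, ht⟩) (convex_Ici 0) (mem_Ici.2 le_rfl) (mem_Ici.2 hy)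
  simpa [abs_of_nonneg hy] using this

theorem abs_sub_inflow_le (hL : 0 < L) (H : Smooth L h) (hb : ∀ p ∈ OmBar L, |dX L h p| ≤ W)
    {x y : ℝ} (hx : x ∈ Icc 0 L) (hy : 0 ≤ y) : |h (x, y) - h (0, y)| ≤ W * x := by
  have h1 : ∀ s ∈ Icc 0 L, HasDerivWithinAt (fun s => h (s, y)) (dX L h (s, y)) (Icc 0 L) s :=
    fun s hs => by
      rw [dX_eq_fderivWithin hL H (show (s, y) ∈ OmBar L from ⟨hs, hy⟩)]
      exact hasDerivWithinAt_x H (p := (s, y)) ⟨hs, hy⟩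
  have := Convex.norm_image_sub_le_of_norm_hasDerivWithin_le h1 (C := W)
    (fun s hs => hb (s, y) ⟨hs, hy⟩) (convex_Icc 0 L) ⟨le_rfl, hL.le⟩ hx
  simpa [abs_of_nonneg hx.1] using this

variable {ε ub c₀ M X : ℝ} {χ : ℝ → ℝ} {A : Layers}

theorem IsLayers.dX_ue0_le (H : IsLayers L ε ub c₀ M A) {p : ℝ × ℝ} (hp : p ∈ OmBar L) :
    |dX L A.ue0 p| ≤ M := by
  simpa using H.euler.bound_u 1 0 0 (by norm_num) (by norm_num) (by norm_num) p hp

theorem IsLayers.dY_ue0_le (H : IsLayers L ε ub c₀ M A) {p : ℝ × ℝ} (hp : p ∈ OmBar L) :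
    |dY A.ue0 p| ≤ M := by
  simpa using H.euler.bound_u 0 1 0 (by norm_num) (by norm_num) (by norm_num) p hp

theorem IsLayers.dX_up0_le (H : IsLayers L ε ub c₀ M A) {p : ℝ × ℝ} (hp : p ∈ OmBar L) :
    |dX L A.up0 p| ≤ M := by
  simpa using H.prandtl.bound_u 1 0 0 (by norm_num) (by norm_num) (by norm_num) p hp

theorem IsLayers.bddC2_ue0 (H : IsLayers L ε ub c₀ M A) (hL : 0 < L) (hc : 0 < c₀) :
    BddC2 L M A.ue0 :=
  H.euler.smooth_u.bddC2 hL (fun p hp => abs_le.2 ⟨by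
    linarith [H.euler.lower p hp, H.euler.upper p hp], H.euler.upper p hp⟩) H.euler.bound_u

theorem IsLayers.bddC2_up1Cut (H : IsLayers L ε ub c₀ M A) (hL : 0 < L) (hε : 0 < ε) (hε1 : ε ≤ 1)
    (hχ : IsCutoff χ) (hX : ∀ j ≤ 3, ∀ s, 0 ≤ s → |iteratedDeriv j χ s| ≤ X)
    (h0 : ∀ j s, 2 < s → iteratedDeriv j χ s = 0) : BddC2 L (24 * (X * M)) (A.up1Cut χ ε) := by
  have ht := Real.sqrt_pos.2 hε
  have ht1 : √ε ≤ 1 := Real.sqrt_le_one.2 hε1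
  have P := H.prandtlCorrector
  have c0 := hχ.bddC2 (L := L) hX h0 (j := 0) (by norm_num) ht ht1
  have c1 := (hχ.bddC2 (L := L) hX h0 (j := 1) le_rfl ht ht1).const_mul ht.le ht1
  simp only [iteratedDeriv_zero] at c0
  simp only [iteratedDeriv_one] at c1
  have := (c0.mul (P.smooth_u.bddC2_of_weight hL P.bound_u)).add
    (c1.mul (bddC2_primitive hL P.smooth_u P.smooth_v P.divFree P.wall_v P.bound_u))
  have e : 4 * (3 * X * M) + 4 * (3 * X * M) = 24 * (X * M) := by ring
  rwa [e] at this

theorem IsLayers.bddC2_us (H : IsLayers L ε ub c₀ M A) (hc : 0 < c₀) (hL : 0 < L) (hε : 0 < ε)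
    (hε1 : ε ≤ 1) (hχ : IsCutoff χ) (hX : ∀ j ≤ 3, ∀ s, 0 ≤ s → |iteratedDeriv j χ s| ≤ X)
    (h0 : ∀ j s, 2 < s → iteratedDeriv j χ s = 0) :
    BddC2 L (M + M + M + 24 * (X * M)) (A.us χ ε) := by
  have ht := Real.sqrt_pos.2 hε
  have ht1 : √ε ≤ 1 := Real.sqrt_le_one.2 hε1
  exact ((((H.bddC2_ue0 hL hc).scale ht ht1).add
    (H.prandtl.smooth_u.bddC2_of_weight hL H.prandtl.bound_u)).add
    (((H.eulerCorrector.smooth_u.bddC2_of_weight hL H.eulerCorrector.bound_u).scale ht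
      ht1).const_mul ht.le ht1)).add
    ((H.bddC2_up1Cut hL hε hε1 hχ hX h0).const_mul ht.le ht1)

/-- For $y\le4M/c_0$ compare $u_e^0+u_p^0$ with its inflow value $u_e^0(0,0)+u_p^0(0,y)\ge c_0$: two
shifts by at most $L$ in $x$ and one by $\sqrt\epsilon y$ in $Y$ cost $c_0/16$ each. For larger $y$
the decay of $u_p^0$ gives $|u_p^0|\le c_0/4$, while $u_e^0\ge c_0$. The correctors of order
$\sqrt\epsilon$ cost a further $c_0/16$. -/
theorem IsLayers.us_lower (H : IsLayers L ε ub c₀ M A) (hc : 0 < c₀) (hL : 0 < L) (hε : 0 < ε)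
    (hε1 : ε ≤ 1) (hχ : IsCutoff χ) (hX : ∀ j ≤ 3, ∀ s, 0 ≤ s → |iteratedDeriv j χ s| ≤ X)
    (h0 : ∀ j s, 2 < s → iteratedDeriv j χ s = 0) (h1 : M * L ≤ c₀ / 16)
    (h2 : √ε * (M * (4 * M / c₀)) ≤ c₀ / 16) (h3 : √ε * (M + 24 * (X * M)) ≤ c₀ / 16)
    {p : ℝ × ℝ} (hp : p ∈ OmBar L) : c₀ / 2 ≤ A.us χ ε p := by
  have ht := Real.sqrt_pos.2 hε
  have hp2 : 0 ≤ p.2 := hp.2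
  have hq : (p.1, √ε * p.2) ∈ OmBar L := mapsTo_scale ht.le hp
  obtain ⟨_, _, _, _, _, _, _, _, hcut⟩ := H.bddC2_up1Cut hL hε hε1 hχ hX h0
  have a1 := (abs_le.1 (hcut p hp).1).1
  have a2 := (abs_le.1 (H.eulerCorrector.bound_u.abs_le _ hq)).1
  have a3 := mul_le_mul_of_nonneg_left a1 ht.le
  have a4 := mul_le_mul_of_nonneg_left a2 ht.le
  have hM : c₀ ≤ M := (H.euler.lower p hp).trans (H.euler.upper p hp)
  have hM0 : 0 < M := hc.trans_le hM
  have main : 3 * c₀ / 4 ≤ A.ue0 (p.1, √ε * p.2) + A.up0 p := by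
    rcases le_total p.2 (4 * M / c₀) with hy | hy
    · have b1 := (abs_le.1 (abs_sub_wall_le H.euler.smooth_u (fun _ => H.dY_ue0_le) hp.1
        (mul_nonneg ht.le hp2))).1
      have b2 := (abs_le.1 (abs_sub_inflow_le hL H.euler.smooth_u (fun _ => H.dX_ue0_le) hp.1
        (le_refl (0 : ℝ)))).1
      have b3 := (abs_le.1 (abs_sub_inflow_le hL H.prandtl.smooth_u (fun _ => H.dX_up0_le) hp.1
        hp2)).1
      have b4 := H.prandtl.inflow p.2 hp2
      have b5 : M * p.1 ≤ M * L := mul_le_mul_of_nonneg_left hp.1.2 hM0.le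
      have b6 : M * (√ε * p.2) ≤ √ε * (M * (4 * M / c₀)) := by
        rw [mul_left_comm]; gcongr
      simp only [Prod.mk.eta] at b3
      linarith
    · have b1 := H.euler.lower _ hq
      have b2 : (1 + p.2) * |A.up0 p| ≤ M := by
        simpa using H.prandtl.bound_u 0 0 1 (by norm_num) (by norm_num) (by norm_num) p hp
      have b3 := (abs_le_of_weight hp2 b2).2
      have b4 := mul_le_mul_of_nonneg_right hy (abs_nonneg (A.up0 p))
      have b5 : 4 * M / c₀ * |A.up0 p| ≤ 4 * M / c₀ * (c₀ / 4) := by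
        have : 4 * M / c₀ * (c₀ / 4) = M := by field_simp
        linarith
      have b6 := le_of_mul_le_mul_left b5 (by positivity)
      linarith [neg_abs_le (A.up0 p)]
  simp only [Layers.us]
  linarith

/-- Only $v_e^0(x,\sqrt\epsilon y)/\sqrt\epsilon$ is singular. It is at most $\delta y$ by
hypothesis and at most $My$ because $v_e^0$ vanishes at the wall. A normal derivative cancels the
factor $1/\sqrt\epsilon$, whereas an $x$-derivative does not, whence the weight $\sqrt\epsilon$ in
its bound. -/
theorem IsLayers.vs_bounds (H : IsLayers L ε ub c₀ M A) (hL : 0 < L) (hε : 0 < ε) (hε1 : ε ≤ 1)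
    (hχ : IsCutoff χ) (hX : ∀ j ≤ 3, ∀ s, 0 ≤ s → |iteratedDeriv j χ s| ≤ X)
    (h0 : ∀ j s, 2 < s → iteratedDeriv j χ s = 0) {δ : ℝ}
    (hδ : ∀ p ∈ Om L, |A.ve0 p| ≤ δ * p.2) :
    ∃ vsx vsy, IsC1 L (A.vs χ ε) vsx vsy ∧ ∀ p ∈ Om L,
      |A.vs χ ε p| ≤ min δ M * p.2 + (3 * M + 6 * (X * M)) ∧
      |√ε * vsx p| ≤ 3 * M + 6 * (X * M) ∧ |vsy p| ≤ 3 * M + 6 * (X * M) := by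
  have ht := Real.sqrt_pos.2 hε
  have ht1 : √ε ≤ 1 := Real.sqrt_le_one.2 hε1
  have P := H.prandtlCorrector
  have E := H.eulerCorrector
  have c0 := (hχ.bddC2 (L := L) hX h0 (j := 0) (by norm_num) ht ht1).bddC1
  simp only [iteratedDeriv_zero] at c0
  have hvp1 : BddC1 L M A.vp1 :=
    ⟨_, _, bddC1_of_divFree hL P.smooth_u P.smooth_v P.divFree P.wall_v P.bound_u⟩
  obtain ⟨kx, ky, ck, hk⟩ := ((H.prandtl.smooth_v.bddC2_of_weight hL H.prandtl.bound_v).bddC1.add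
    ((E.smooth_v.bddC2_of_weight hL E.bound_v).scale ht ht1).bddC1).add
    ((c0.mul hvp1).const_mul ht.le ht1)
  have ce := ((H.euler.smooth_v.isC1 hL).scale ht).const_mul (√ε)⁻¹
  refine ⟨_, _, (ce.add ck).congr (fun p => ?_) (fun _ => rfl) (fun _ => rfl), fun p hp => ?_⟩
  · simp only [Layers.vs, Layers.vp1Cut]; ring
  have hpb := Om_subset_OmBar L hp
  have hp2 : 0 < p.2 := hp.2
  obtain ⟨k1, k2, k3⟩ := hk p hpb
  have hq : (p.1, √ε * p.2) ∈ OmBar L := mapsTo_scale ht.le hpb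
  have hW : M + M + 2 * (3 * X * M) = 2 * M + 6 * (X * M) := by ring
  have dX_le : |dX L A.ve0 (p.1, √ε * p.2)| ≤ M := by
    simpa using H.euler.bound_v 1 0 0 (by norm_num) (by norm_num) (by norm_num) _ hq
  have dY_le : ∀ q ∈ OmBar L, |dY A.ve0 q| ≤ M := fun q hq => by
    simpa using H.euler.bound_v 0 1 0 (by norm_num) (by norm_num) (by norm_num) _ hq
  have M0 : 0 ≤ M := (abs_nonneg _).trans dX_le
  rw [hW] at k1 k2 k3
  refine ⟨?_, ?_, ?_⟩
  · have e : A.vs χ ε p = (√ε)⁻¹ * A.ve0 (p.1, √ε * p.2) + (A.vp0 p + A.ve1 (p.1, √ε * p.2)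
        + √ε * (χ (√ε * p.2) * A.vp1 p)) := by
      simp only [Layers.vs, Layers.vp1Cut]; ring
    have b1 := hδ (p.1, √ε * p.2) ⟨hp.1, mul_pos ht hp.2⟩
    have b2 := abs_sub_wall_le H.euler.smooth_v dY_le hpb.1 (mul_pos ht hp2).le
    rw [H.euler.wall p.1 hpb.1, sub_zero] at b2
    have b3 : |(√ε)⁻¹ * A.ve0 (p.1, √ε * p.2)| ≤ min δ M * p.2 := by
      rw [abs_mul, abs_of_pos (inv_pos.2 ht), inv_mul_le_iff₀ ht, mul_left_comm]
      rcases min_choice δ M with h | h <;> rw [h] <;> assumption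
    rw [e]
    refine (abs_add_le _ _).trans ?_
    linarith
  · have e : √ε * ((√ε)⁻¹ * dX L A.ve0 (p.1, √ε * p.2) + kx p)
        = dX L A.ve0 (p.1, √ε * p.2) + √ε * kx p := by field_simp
    rw [e]
    refine (abs_add_le _ _).trans ?_
    have : |√ε * kx p| ≤ |kx p| := by
      rw [abs_mul, abs_of_pos ht]; exact mul_le_of_le_one_left (abs_nonneg _) ht1
    linarith
  · have e : (√ε)⁻¹ * (√ε * dY A.ve0 (p.1, √ε * p.2)) + ky p
        = dY A.ve0 (p.1, √ε * p.2) + ky p := by field_simp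
    rw [e]
    refine (abs_add_le _ _).trans ?_
    linarith [dY_le _ hq]

/-- The approximate solution is a background flow, with bounds which depend only on `c₀`, `M`
and `χ`. -/
theorem exists_isBackground (hχ : IsCutoff χ) (hc : 0 < c₀) (hM : 0 < M) :
    ∃ θ M₁ : ℝ, 0 < θ ∧ θ ≤ 1 ∧ 1 ≤ M₁ ∧ (c₀ / 2)⁻¹ ≤ M₁ ∧
      ∀ {L ε ub δ : ℝ} {A : Layers}, 0 < L → L ≤ θ ^ 2 → 0 < ε → ε ≤ θ ^ 2 →
        IsLayers L ε ub c₀ M A → (∀ p ∈ Om L, |A.ve0 p| ≤ δ * p.2) →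
        ∃ usx usy usxx usxy usyy vsx vsy, IsBackground L ε (c₀ / 2) M₁ (min δ M) (A.us χ ε)
          usx usy usxx usxy usyy (A.vs χ ε) vsx vsy := by
  obtain ⟨X, hX0, hX, h0⟩ := hχ.exists_bound
  -- The three summands are the quantities that `us_lower` requires to be small after multiplication
  -- by $L$ or $\sqrt\epsilon$. Both factors are at most $\theta$, and $\theta D\le c_0/16$.
  set D := M + M * (4 * M / c₀) + (M + 24 * (X * M)) with hD
  have hD0 : 0 < D := by positivity
  refine ⟨min 1 (c₀ / (16 * D)), 1 + (c₀ / 2)⁻¹ + (3 * M + 24 * (X * M)), by positivity,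
    min_le_left _ _, ?_, ?_, fun {L ε ub δ A} hL hLθ hε hεθ H hδ => ?_⟩
  · have : 0 < (c₀ / 2)⁻¹ := by positivity
    have : 0 < X * M := by positivity
    linarith
  · have : 0 < X * M := by positivity
    linarith
  have hθ1 : min 1 (c₀ / (16 * D)) ≤ 1 := min_le_left _ _
  have hθD : min 1 (c₀ / (16 * D)) * D ≤ c₀ / 16 := by
    calc _ ≤ c₀ / (16 * D) * D := mul_le_mul_of_nonneg_right (min_le_right _ _) hD0.le
      _ = c₀ / 16 := by field_simp
  have hθ0 : 0 < min 1 (c₀ / (16 * D)) := by positivity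
  generalize min 1 (c₀ / (16 * D)) = θ at *
  have hL' : L ≤ θ := hLθ.trans (pow_le_of_le_one hθ0.le hθ1 (by norm_num))
  have hε1 : ε ≤ 1 := hεθ.trans (pow_le_one₀ hθ0.le hθ1)
  have htθ : √ε ≤ θ := by
    rw [← Real.sqrt_sq hθ0.le]; exact Real.sqrt_le_sqrt hεθ
  have hMN : 0 < M * (4 * M / c₀) := by positivity
  have hXM : 0 < X * M := by positivity
  have small : ∀ s q, 0 ≤ q → s ≤ θ → q ≤ D → s * q ≤ c₀ / 16 := fun s q hq hs hqD =>
    ((mul_le_mul_of_nonneg_right hs hq).trans (mul_le_mul_of_nonneg_left hqD hθ0.le)).trans hθD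
  obtain ⟨usx, usy, usxx, usxy, usyy, c, cx, cy, hb⟩ := H.bddC2_us hc hL hε hε1 hχ hX h0
  obtain ⟨vsx, vsy, cv, hv⟩ := H.vs_bounds hL hε hε1 hχ hX h0 hδ
  have i0 : 0 < (c₀ / 2)⁻¹ := by positivity
  have hle : M + M + M + 24 * (X * M) ≤ 1 + (c₀ / 2)⁻¹ + (3 * M + 24 * (X * M)) := by linarith
  have hle' : 3 * M + 6 * (X * M) ≤ 1 + (c₀ / 2)⁻¹ + (3 * M + 24 * (X * M)) := by linarith
  refine ⟨usx, usy, usxx, usxy, usyy, vsx, vsy, c, cx, cy, cv, fun p hp => ?_,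
    fun p hp => (hb p hp).1.trans hle, fun p hp => (hb p hp).2.1.trans hle,
    fun p hp => (hb p hp).2.2.1.trans hle, fun p hp => (hb p hp).2.2.2.1.trans hle,
    fun p hp => (hb p hp).2.2.2.2.1.trans hle, fun p hp => (hb p hp).2.2.2.2.2.trans hle,
    fun p hp => (hv p hp).1.trans (by linarith), fun p hp => (hv p hp).2.1.trans hle',
    fun p hp => (hv p hp).2.2.trans hle'⟩
  refine H.us_lower hc hL hε hε1 hχ hX h0 ?_ (small _ _ hMN.le htθ (by linarith))
    (small _ _ (by positivity) htθ (by linarith)) hp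
  rw [mul_comm]
  exact small _ _ hM.le hL' (by linarith)

end Background

/-! ### Weak derivatives from lines -/

section Weak

variable {L : ℝ} {h hx hy ψ : ℝ × ℝ → ℝ}

theorem MemLp.locallyIntegrableOn_Om (H : MemLp h 2 (volume.restrict (Om L))) :
    LocallyIntegrableOn h (Om L) :=
  locallyIntegrableOn_of_locallyIntegrable_restrict (H.locallyIntegrable (by norm_num))

theorem LineAC.of_test_x (hψ : ContDiff ℝ ∞ ψ) {a b : ℝ} (hab : a ≤ b) (y : ℝ) :
    LineAC a b (fun x => ψ (x, y)) (fun x => fderiv ℝ ψ (x, y) (1, 0)) (ψ (a, y)) (ψ (b, y)) := by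
  refine LineAC.of_hasDerivAt hab (hψ.continuous.comp (by fun_prop)).continuousOn
    (fun x _ => ?_) (Continuous.intervalIntegrable
      ((continuous_fderiv_apply hψ (1, 0)).comp (by fun_prop : Continuous fun x : ℝ => (x, y))) _ _)
  exact (hψ.differentiable (by simp) (x, y)).hasFDerivAt.comp_hasDerivAt x
    ((hasDerivAt_id x).prodMk (hasDerivAt_const x y))

theorem LineAC.of_test_y (hψ : ContDiff ℝ ∞ ψ) {a b : ℝ} (hab : a ≤ b) (x : ℝ) :
    LineAC a b (fun y => ψ (x, y)) (fun y => fderiv ℝ ψ (x, y) (0, 1)) (ψ (x, a)) (ψ (x, b)) := by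
  refine LineAC.of_hasDerivAt hab (hψ.continuous.comp (by fun_prop)).continuousOn
    (fun y _ => ?_) (Continuous.intervalIntegrable
      ((continuous_fderiv_apply hψ (0, 1)).comp (by fun_prop : Continuous fun y : ℝ => (x, y))) _ _)
  exact (hψ.differentiable (by simp) (x, y)).hasFDerivAt.comp_hasDerivAt y
    ((hasDerivAt_const y x).prodMk (hasDerivAt_id y))

theorem integrableOn_green_test {k : ℝ × ℝ → ℝ} (hh : MemLp h 2 (volume.restrict (Om L)))
    (hk : MemLp k 2 (volume.restrict (Om L))) (hψ : ContDiff ℝ ∞ ψ) (hc : HasCompactSupport ψ)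
    (e : ℝ × ℝ) : IntegrableOn (fun p => h p * fderiv ℝ ψ p e) (Om L) ∧
      IntegrableOn (fun p => k p * ψ p) (Om L) :=
  ⟨hh.integrable_mul (((continuous_fderiv_apply hψ e).memLp_of_hasCompactSupport (p := 2)
    (hasCompactSupport_fderiv_apply hc e)).restrict _),
    hk.integrable_mul ((hψ.continuous.memLp_of_hasCompactSupport (p := 2) hc).restrict _)⟩

/-- This is the way back from lines to weak derivatives, used for $\beta$: integrate by parts on
almost every line and apply Fubini's theorem. -/
theorem weakPartial_x_of_lines (hL : 0 < L) (hh : MemLp h 2 (volume.restrict (Om L)))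
    (hhx : MemLp hx 2 (volume.restrict (Om L)))
    (H : ∀ᵐ y ∂(volume.restrict (Ioi (0 : ℝ))), ∃ q,
      LineAC 0 L (fun x => h (x, y)) (fun x => hx (x, y)) 0 q) : WeakPartial L (1, 0) h hx := by
  refine ⟨MemLp.locallyIntegrableOn_Om hh, MemLp.locallyIntegrableOn_Om hhx,
    fun ψ hψ hc hs => ?_⟩
  obtain ⟨i1, i2⟩ := integrableOn_green_test hh hhx hψ hc (1, 0)
  have i3 : IntegrableOn (fun p => h p * fderiv ℝ ψ p (1, 0) + hx p * ψ p) (Om L) := i1.add i2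
  rw [← add_eq_zero_iff_eq_neg, ← integral_add i1 i2, setIntegral_Om_symm i3]
  refine (integral_congr_ae (g := fun _ => (0 : ℝ)) ?_).trans (by simp)
  filter_upwards [H] with y ⟨q, hl⟩
  have hz : ψ (L, y) = 0 := image_eq_zero_of_notMem_tsupport fun hm => lt_irrefl _ (hs hm).1.2
  have key := (hl.mul (LineAC.of_test_x hψ hL.le y) hL.le).integral_eq
  rw [hz, mul_zero, zero_mul, sub_zero, intervalIntegral_eq_Ioo hL.le] at key
  refine Eq.trans ?_ key
  exact integral_congr_ae (ae_of_all _ fun x => by ring)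

theorem weakPartial_y_of_lines (hh : MemLp h 2 (volume.restrict (Om L)))
    (hhy : MemLp hy 2 (volume.restrict (Om L)))
    (H : ∀ R, 0 < R → ∀ᵐ x ∂(volume.restrict (Ioo 0 L)), ∃ q,
      LineAC 0 R (fun y => h (x, y)) (fun y => hy (x, y)) 0 q) : WeakPartial L (0, 1) h hy := by
  refine ⟨MemLp.locallyIntegrableOn_Om hh, MemLp.locallyIntegrableOn_Om hhy,
    fun ψ hψ hc hs => ?_⟩
  obtain ⟨i1, i2⟩ := integrableOn_green_test hh hhy hψ hc (0, 1)
  obtain ⟨R', hR'⟩ := (hc.isCompact.image continuous_snd).bddAbove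
  set R := max R' 0 + 1 with hRdef
  have hR : 0 < R := by positivity
  have hout : ∀ x y, R ≤ y → (x, y) ∉ tsupport ψ := fun x y hy hm => by
    have := (hR' ⟨_, hm, rfl⟩).trans (le_max_left _ 0)
    simp only at this
    linarith
  have i3 : IntegrableOn (fun p => h p * fderiv ℝ ψ p (0, 1) + hy p * ψ p) (Om L) := i1.add i2
  rw [← add_eq_zero_iff_eq_neg, ← integral_add i1 i2, setIntegral_Om i3]
  refine (integral_congr_ae (g := fun _ => (0 : ℝ)) ?_).trans (by simp)
  filter_upwards [H R hR] with x ⟨q, hl⟩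
  have hz : ψ (x, R) = 0 := image_eq_zero_of_notMem_tsupport (hout x R le_rfl)
  have key := (hl.mul (LineAC.of_test_y hψ hR.le x) hR.le).integral_eq
  rw [hz, mul_zero, zero_mul, sub_zero, intervalIntegral_eq_Ioo hR.le] at key
  refine Eq.trans ?_ key
  refine setIntegral_eq_of_subset_of_forall_sdiff_eq_zero measurableSet_Ioi Ioo_subset_Ioi_self
    (fun y hy => ?_) |>.trans (setIntegral_congr_fun measurableSet_Ioo fun y _ => ?_)
  · have hm := hout x y (not_lt.1 fun h => hy.2 ⟨hy.1, h⟩)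
    have h2 : fderiv ℝ ψ (x, y) (0, 1) = 0 := by
      rw [image_eq_zero_of_notMem_tsupport fun h => hm (tsupport_fderiv_subset ℝ h)]; rfl
    simp only [image_eq_zero_of_notMem_tsupport hm, h2, mul_zero, add_zero]
  · ring

end Weak

/-! ### Return from $\beta$ to $\nabla v$ -/

/-- The estimate for a given background flow, with the norm of `∇v` included. -/
theorem estimates_of_background {m M : ℝ} (hm : 0 < m) (hmM : m⁻¹ ≤ M) (hM : 1 ≤ M) :
    ∃ θ C K : ℝ, 0 < θ ∧ 0 < C ∧ 0 < K ∧
      ∀ {L ε d : ℝ} {us usx usy usxx usxy usyy vs vsx vsy f g : ℝ × ℝ → ℝ}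
        {aL bL τ : ℝ → ℝ} {S : Remainder}, 0 < L → L ≤ θ ^ 2 → 0 < ε → ε ≤ θ ^ 2 →
        IsBackground L ε m M d us usx usy usxx usxy usyy vs vsx vsy →
        MemLp f 2 (volume.restrict (Om L)) → MemLp g 2 (volume.restrict (Om L)) →
        MemLp aL 2 (volume.restrict (Ioi 0)) →
        ContDiffOn ℝ 1 bL (Ioi 0) → MemLp bL 2 (volume.restrict (Ioi 0)) →
        MemLp (deriv bL) 2 (volume.restrict (Ioi 0)) →
        S.IsSolution L ε us vs f g aL bL → HasTrace L S.vy S.vxy τ →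
        ∃ βx βy : ℝ × ℝ → ℝ,
          WeakPartial L (1, 0) (fun p => S.v p / us p) βx ∧
          WeakPartial L (0, 1) (fun p => S.v p / us p) βy ∧
          MemLp βx 2 (volume.restrict (Om L)) ∧ MemLp βy 2 (volume.restrict (Om L)) ∧
          IntegrableOn (fun y => ε * τ y ^ 2 / us (L, y)) (Ioi 0) ∧
          (∫ p in Om L, (βy p ^ 2 + ε * βx p ^ 2))
              + ∫ y in Ioi 0, ε * τ y ^ 2 / us (L, y)
            ≤ C * ((∫ p in Om L, S.uy p ^ 2)
                + d ^ 2 * (∫ p in Om L, ((S.uy p * p.2) ^ 2 + ε * (S.vy p * p.2) ^ 2))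
                + ∫ y in Ioi 0, (bL y ^ 2 + deriv bL y ^ 2 + aL y ^ 2 / ε))
              + K * ∫ p in Om L, (-(f p * βy p) + ε * (g p * βx p)) ∧
          (∫ p in Om L, (S.vy p ^ 2 + ε * S.vx p ^ 2))
            ≤ C * ((∫ p in Om L, S.uy p ^ 2)
                + d ^ 2 * (∫ p in Om L, ((S.uy p * p.2) ^ 2 + ε * (S.vy p * p.2) ^ 2))
                + ∫ y in Ioi 0, (bL y ^ 2 + deriv bL y ^ 2 + aL y ^ 2 / ε))
              + K * ∫ p in Om L, (-(f p * βy p) + ε * (g p * βx p)) := by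
  obtain ⟨θ, κ, C, hθ, hθ1, hκ, hC, main⟩ := positivity_of_background hm hmM hM
  have hF1 : 1 ≤ 10 * M ^ 6 := by linarith [one_le_pow₀ (n := 6) hM]
  -- The remainder $\mathcal R_2$ has no sign, so the constants in front of the norms and of
  -- $\mathcal R_2$ cannot be enlarged separately. The whole inequality is multiplied by
  -- $10M^6\ge1$, the constant by which $\beta$ controls $\nabla v$; one right-hand side then serves
  -- both estimates.
  refine ⟨θ, 10 * M ^ 6 * (κ⁻¹ * C), 10 * M ^ 6 * κ⁻¹, hθ, by positivity, by positivity, ?_⟩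
  intro L ε d us usx usy usxx usxy usyy vs vsx vsy f g aL bL τ S hL hLθ hε hεθ G hf hg ha hb hb1
    hb2 H Hτ
  have hl := H.lines hL Hτ
  have hw := G.weight hm hmM hM
  obtain ⟨hβ, hβx, hβy⟩ := memLp_β hw hl
  obtain ⟨iτ, hmain⟩ := main hL hLθ hε hεθ G hf hg ha hb hb1 hb2 H hl
  obtain ⟨-, -, n1, -, n2, -⟩ := norm_bounds hL (hLθ.trans (pow_le_one₀ hθ.le hθ1)) G hm hmM hM hl
  have ediv : (fun p => S.v p / us p) = fun p => (us p)⁻¹ * S.v p :=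
    funext fun p => div_eq_inv_mul _ _
  have hT : 0 ≤ ∫ y in Ioi 0, ε * τ y ^ 2 / us (L, y) := by
    refine setIntegral_nonneg measurableSet_Ioi fun y hy => ?_
    have hp : ((L, y) : ℝ × ℝ) ∈ OmBar L := ⟨⟨hL.le, le_rfl⟩, mem_Ici.2 (mem_Ioi.1 hy).le⟩
    have := hm.trans_le (G.lower _ hp)
    positivity
  have hN : (∫ p in Om L, (S.vy p ^ 2 + ε * S.vx p ^ 2))
      ≤ 10 * M ^ 6 * ∫ p in Om L, (S.βy us usy p ^ 2 + ε * S.βx us usx p ^ 2) := by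
    rw [integral_add hl.vy_L2.integrable_sq (hl.vx_L2.integrable_sq.const_mul ε),
      integral_add hβy.integrable_sq (hβx.integrable_sq.const_mul ε), integral_const_mul,
      integral_const_mul]
    have x0 : 0 ≤ ∫ p in Om L, S.βx us usx p ^ 2 := integral_nonneg fun _ => sq_nonneg _
    have := mul_le_mul_of_nonneg_left n2 hε.le
    have h2 : 0 ≤ 6 * (M ^ 6 * (ε * ∫ p in Om L, S.βx us usx p ^ 2)) := by positivity
    linarith
  have hN0 : 0 ≤ ∫ p in Om L, (S.βy us usy p ^ 2 + ε * S.βx us usx p ^ 2) :=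
    integral_nonneg fun _ => by positivity
  refine ⟨S.βx us usx, S.βy us usy, ?_, ?_, hβx, hβy, iτ, ?_⟩
  · rw [ediv]; exact weakPartial_x_of_lines hL hβ hβx (line_βx hL hw hl)
  · rw [ediv]; exact weakPartial_y_of_lines hβ hβy (line_βy hw hl)
  generalize (∫ p in Om L, (S.βy us usy p ^ 2 + ε * S.βx us usx p ^ 2)) = N at *
  generalize (∫ y in Ioi 0, ε * τ y ^ 2 / us (L, y)) = T at *
  generalize (∫ p in Om L, (-(f p * S.βy us usy p) + ε * (g p * S.βx us usx p))) = R at *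
  generalize ((∫ p in Om L, S.uy p ^ 2)
    + d ^ 2 * (∫ p in Om L, ((S.uy p * p.2) ^ 2 + ε * (S.vy p * p.2) ^ 2))
    + ∫ y in Ioi 0, (bL y ^ 2 + deriv bL y ^ 2 + aL y ^ 2 / ε)) = Q at *
  have h1 : N + T ≤ κ⁻¹ * (C * Q + R) := by
    rw [← div_eq_inv_mul, le_div_iff₀ hκ, mul_comm]; exact hmain
  have h2 := mul_le_mul_of_nonneg_left h1 (zero_le_one.trans hF1)
  have e : 10 * M ^ 6 * (κ⁻¹ * (C * Q + R)) = 10 * M ^ 6 * (κ⁻¹ * C) * Q + 10 * M ^ 6 * κ⁻¹ * R := by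
    ring
  rw [e] at h2
  refine ⟨(le_mul_of_one_le_left (add_nonneg hN0 hT) hF1).trans h2, (hN.trans ?_).trans h2⟩
  exact mul_le_mul_of_nonneg_left (le_add_of_nonneg_right hT) (zero_le_one.trans hF1)

end BoundaryLayer

end

/-! ### The positivity estimate for the approximate solution -/

theorem mainTheorem5 (χ : ℝ → ℝ) (hχ : IsCutoff χ) (c₀ M : ℝ) (hc₀ : 0 < c₀) :
    ∃ L₀ ε₀ C K : ℝ, 0 < L₀ ∧ 0 < ε₀ ∧ 0 < C ∧ 0 < K ∧
      ∀ (L ε ub : ℝ) (A : Layers), 0 < L → L < L₀ → 0 < ε → ε < ε₀ →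
        IsLayers L ε ub c₀ M A →
      ∀ δ : ℝ, (∀ p ∈ Om L, |A.ve0 p| ≤ δ * p.2) →
      ∀ (f g : ℝ × ℝ → ℝ) (aL bL : ℝ → ℝ),
        MemLp f 2 (volume.restrict (Om L)) → MemLp g 2 (volume.restrict (Om L)) →
        MemLp aL 2 (volume.restrict (Ioi 0)) →
        ContDiffOn ℝ 1 bL (Ioi 0) → MemLp bL 2 (volume.restrict (Ioi 0)) →
        MemLp (deriv bL) 2 (volume.restrict (Ioi 0)) →
      ∀ S : Remainder, S.IsSolution L ε (A.us χ ε) (A.vs χ ε) f g aL bL →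
      ∀ τ : ℝ → ℝ, HasTrace L S.vy S.vxy τ →
      ∃ βx βy : ℝ × ℝ → ℝ,
        WeakPartial L (1, 0) (fun p => S.v p / A.us χ ε p) βx ∧
        WeakPartial L (0, 1) (fun p => S.v p / A.us χ ε p) βy ∧
        MemLp βx 2 (volume.restrict (Om L)) ∧ MemLp βy 2 (volume.restrict (Om L)) ∧
        IntegrableOn (fun y => ε * τ y ^ 2 / A.us χ ε (L, y)) (Ioi 0) ∧
        (∫ p in Om L, (βy p ^ 2 + ε * βx p ^ 2))
            + ∫ y in Ioi 0, ε * τ y ^ 2 / A.us χ ε (L, y)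
          ≤ C * ((∫ p in Om L, S.uy p ^ 2)
              + δ * (∫ p in Om L, ((S.uy p * p.2) ^ 2 + ε * (S.vy p * p.2) ^ 2))
              + ∫ y in Ioi 0, (bL y ^ 2 + deriv bL y ^ 2 + aL y ^ 2 / ε))
            + K * ∫ p in Om L, (-(f p * βy p) + ε * (g p * βx p)) ∧
        (∫ p in Om L, (S.vy p ^ 2 + ε * S.vx p ^ 2))
          ≤ C * ((∫ p in Om L, S.uy p ^ 2)
              + δ * (∫ p in Om L, ((S.uy p * p.2) ^ 2 + ε * (S.vy p * p.2) ^ 2))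
              + ∫ y in Ioi 0, (bL y ^ 2 + deriv bL y ^ 2 + aL y ^ 2 / ε))
            + K * ∫ p in Om L, (-(f p * βy p) + ε * (g p * βx p)) := by
  rcases le_or_gt M 0 with hM | hM
  -- No layers exist for $M\le0$, since $0<c_0\le u_e^0\le M$.
  · refine ⟨1, 1, 1, 1, one_pos, one_pos, one_pos, one_pos, fun L ε ub A hL _ _ _ H => ?_⟩
    have h0 : ((0 : ℝ), (0 : ℝ)) ∈ OmBar L := ⟨⟨le_rfl, hL.le⟩, mem_Ici.2 le_rfl⟩
    linarith [H.euler.lower _ h0, H.euler.upper _ h0]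
  obtain ⟨θ₁, M₁, hθ₁, -, hM₁, hcM, layers⟩ := exists_isBackground hχ hc₀ hM
  obtain ⟨θ₂, C, K, hθ₂, hC, hK, main⟩ := estimates_of_background (half_pos hc₀) hcM hM₁
  -- The estimate is available with $d^2$, $d=\min(\delta,M)$. As $d^2\le M\delta$, the factor $1+M$
  -- turns it into one that is linear in $\delta$, without any upper bound on $\delta$.
  refine ⟨min (θ₁ ^ 2) (θ₂ ^ 2), min (θ₁ ^ 2) (θ₂ ^ 2), C * (1 + M), K, by positivity,
    by positivity, by positivity, hK, ?_⟩
  intro L ε ub A hL hLθ hε hεθ H δ hδ f g aL bL hf hg ha hb hb1 hb2 S HS τ Hτ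
  obtain ⟨hL1, hL2⟩ := le_min_iff.1 hLθ.le
  obtain ⟨hε1, hε2⟩ := le_min_iff.1 hεθ.le
  obtain ⟨usx, usy, usxx, usxy, usyy, vsx, vsy, G⟩ := layers hL hL1 hε hε1 H hδ
  obtain ⟨βx, βy, wx, wy, mx, my, iτ, h1, h2⟩ :=
    main hL hL2 hε hε2 G hf hg ha hb hb1 hb2 HS Hτ
  have hδ0 : 0 ≤ δ := by
    have := (abs_nonneg _).trans (hδ (L / 2, 1) ⟨⟨by positivity, by linarith⟩, mem_Ioi.2 one_pos⟩)
    simpa using this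
  have hd : min δ M ^ 2 ≤ M * δ := by
    rw [sq]
    exact mul_le_mul (min_le_right _ _) (min_le_left _ _) (le_min hδ0 hM.le) hM.le
  have hU : 0 ≤ ∫ p in Om L, S.uy p ^ 2 := integral_nonneg fun _ => sq_nonneg _
  have hW : 0 ≤ ∫ p in Om L, ((S.uy p * p.2) ^ 2 + ε * (S.vy p * p.2) ^ 2) :=
    integral_nonneg fun _ => by positivity
  have hD : 0 ≤ ∫ y in Ioi 0, (bL y ^ 2 + deriv bL y ^ 2 + aL y ^ 2 / ε) :=
    integral_nonneg fun _ => by positivity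
  have key : C * ((∫ p in Om L, S.uy p ^ 2)
        + min δ M ^ 2 * (∫ p in Om L, ((S.uy p * p.2) ^ 2 + ε * (S.vy p * p.2) ^ 2))
        + ∫ y in Ioi 0, (bL y ^ 2 + deriv bL y ^ 2 + aL y ^ 2 / ε))
      ≤ C * (1 + M) * ((∫ p in Om L, S.uy p ^ 2)
        + δ * (∫ p in Om L, ((S.uy p * p.2) ^ 2 + ε * (S.vy p * p.2) ^ 2))
        + ∫ y in Ioi 0, (bL y ^ 2 + deriv bL y ^ 2 + aL y ^ 2 / ε)) := by
    rw [mul_assoc]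
    refine mul_le_mul_of_nonneg_left ?_ hC.le
    have a1 := mul_le_mul_of_nonneg_right hd hW
    have a2 := mul_nonneg hM.le hU
    have a3 := mul_nonneg hM.le hD
    have a4 := mul_nonneg hδ0 hW
    linarith
  exact ⟨βx, βy, wx, wy, mx, my, iτ, h1.trans (add_le_add_left key _),
    h2.trans (add_le_add_left key _)⟩
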